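/- **Setting.** A spin graph is a finite or countable simple graph, all of whose vertices have finite degree, with a spin from a countable alphabet $S$ at each vertex. A substitution rule $Sub=(\Gamma,\Gamma',V_0,\varphi)$ consists of finite spin graphs $\Gamma\neq\emptyset$ and $\Gamma'$, a set $V_0\subset V(\Gamma)$ and a map $\varphi:V_0\to V(\Gamma')$. If $\psi$ is an isomorphism of $\Gamma$ onto a (not necessarily induced) spin subgraph of a spin graph $\alpha$, then $T(Sub,\psi)\alpha$ arises from the disjoint union of $\alpha$ and $\Gamma'$ by deleting the links of $\psi(\Gamma)$, deleting the vertices of $\psi(V(\Gamma)\setminus V_0)$ with all their links, and identifying $\psi(v)$ with $\varphi(v)$ for $v\in V_0$ (spins on $\Gamma'$ are those of $\Gamma'$; double links count once). This transformation touches the vertices of $\psi(\Gamma)$. A graph grammar is a finite set of rules $Sub_i$ with rates $\lambda_i>0$. Assume that it is local (every $\Gamma_i$ is connected) and locally bounded (for all sufficiently large $n$ the class of spin graphs with all degrees $\le n$ is invariant under all substitutions), and let $R\ge 1$ be an integer such that any two vertices of the same $\Gamma_i$ have distance at most $R$ in $\Gamma_i$. For a finite spin graph $\beta$ let $\xi_\beta$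 be the continuous time Markov chain started from $\beta$ in which every possible transformation $T(Sub_i,\psi)$ is carried out with rate $\lambda_i$. For a spin graph $\alpha$ with graph distance $\rho$, let $O_N(o)$ be the induced spin subgraph on the vertices at distance at most $N$ from $o$, and for a set $D$ of vertices let $\partial D=\{v\notin D:\rho(v,D)\le R\}$. The clusters of a set $E$ of vertices are the connected components of $E$ when any two vertices at distance at most $R$ are considered as linked. (For $R=1$ these are the usual external boundary and the usual connected components.) **Theorem.** For every sufficiently large $n$ there is $t_0>0$ such that for every connected spin graph $\alpha$ with all degrees at most $n$ there is a random process $\alpha(t)$, $t\ge 0$, of finite or countable spin graphs with degrees at most $n$, together with the random set of the vertices touched so far, with the following properties. 1. (Dynamics.) $\alpha(0)=\alpha$ and no vertex is touched at time $0$. Almost surely the trajectory is, locally at every vertex, right continuous with left limits, and at every time $\alpha(t)$ (with the set of touched vertices) either equals its local left limit $\alpha(t-)$ or arises from it by a single substitution. 2. (Thermodynamic limit.) For every vertex $o$ of $\alpha$, every $t\ge 0$, every finite set $W$ of vertex names and every event that depends only on what happens at the vertices in $W$ (presence, spin, links, being touched) during $[0,t]$, the probability of the event for $\xi_{O_N(o)}$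 converges, as $N\to\infty$, to its probability for the process $\alpha(\cdot)$. (A vertex of $\alpha$ has its own name; a created vertex is named after one of the vertices replaced at its creation, with an index, so that names determine from which vertex of $\alpha$ it descends.) 3. (Cluster property.) Let $0\le t<t_0$ and let $E_t$ be the set of the vertices of $\alpha$ touched during $[0,t]$. Almost surely all clusters of $E_t$ are finite. For distinct finite sets $D_1,\dots,D_k$ of vertices and measurable sets $U_1,\dots,U_k$ of trajectories on $[0,t]$, $$P\bigl(\text{for all } i:\ D_i \text{ is a cluster of } E_t \text{ and } \alpha|_{D_i\cup\partial D_i}\in U_i\bigr)=P\bigl(D_1,\dots,D_k\text{ are clusters of }E_t\bigr)\prod_{i=1}^k\mu_{D_i}(U_i),$$ where $\alpha|_{A}$ is the trajectory of the induced spin subgraph (with touched marks) on the vertices in $A$ and those descending from $A$, and $\mu_D$ is the law on $[0,t]$ of $\xi_\beta$, $\beta$ the induced spin subgraph of $\alpha$ on $D\cup\partial D$, conditioned on all vertices of $D$ and no vertex of $\partial D$ being touched. The constant $t_0$ depends on the grammar with its rates, on $n$ and on $R$, but not on $\alpha$. -/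

import Mathlib

open Set Filter Topology MeasureTheory

/-- A spin graph whose vertices carry names from a type `W`: `spin v = none` says that `v` is not
a vertex. Links join distinct vertices, at most one link for each pair. -/
structure SpinGraph (S W : Type) where
  spin : W → Option S
  graph : SimpleGraph W
  spin_ne_none : ∀ u v, graph.Adj u v → spin u ≠ none

namespace SpinGraph

variable {S W : Type}

/-- The set of vertices. -/
def verts (α : SpinGraph S W) : Set W := {v | α.spin v ≠ none}

/-- Non-empty, and every two vertices are joined by a path. -/
def IsConnected (α : SpinGraph S W) : Prop :=
  α.verts.Nonempty ∧ ∀ u ∈ α.verts, ∀ v ∈ α.verts, α.graph.Reachable u v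

/-- Every vertex has degree at most `n`. -/
def DegreeLE (α : SpinGraph S W) (n : ℕ) : Prop :=
  ∀ v, (α.graph.neighborSet v).encard ≤ n

open scoped Classical in
/-- The regular (that is, induced) spin subgraph with vertex set `verts ∩ A`. -/
noncomputable def restrict (α : SpinGraph S W) (A : Set W) : SpinGraph S W where
  spin v := if v ∈ A then α.spin v else none
  graph :=
    { Adj := fun u v => α.graph.Adj u v ∧ u ∈ A ∧ v ∈ A
      symm := ⟨fun _ _ h => ⟨h.1.symm, h.2.2, h.2.1⟩⟩
      loopless := ⟨fun _ h => h.1.ne rfl⟩ }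
  spin_ne_none u v h := by
    rw [if_pos h.2.1]
    exact α.spin_ne_none u v h.1

/-- The `N`-neighbourhood of the vertex `o`. -/
noncomputable def nbhd (α : SpinGraph S W) (o : W) (N : ℕ) : SpinGraph S W :=
  α.restrict {v | α.graph.edist o v ≤ N}

/-- Two different vertices are linked if their distance in `α` is at most `R`;
for `R = 1` these are the links of `α`. -/
noncomputable def rangeGraph (α : SpinGraph S W) (R : ℕ) : SimpleGraph W where
  Adj u v := u ≠ v ∧ α.graph.edist u v ≤ R
  symm := ⟨fun u v h => ⟨h.1.symm, by rw [SimpleGraph.edist_comm]; exact h.2⟩⟩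
  loopless := ⟨fun _ h => h.1 rfl⟩

/-- The external `R`-boundary: the vertices outside `D` at distance at most `R` from `D`. -/
def boundary (α : SpinGraph S W) (R : ℕ) (D : Set W) : Set W :=
  {v | v ∉ D ∧ ∃ u ∈ D, α.graph.edist u v ≤ R}

/-- `D` is a cluster (connected component) of the vertex set `E`, connectedness being understood
in the graph `α.rangeGraph R`. -/
def IsCluster (α : SpinGraph S W) (R : ℕ) (E D : Set W) : Prop :=
  ((α.rangeGraph R).induce D).Connected ∧ D ⊆ E ∧ Disjoint (α.boundary R D) E

end SpinGraph

/-- Names of vertices during the evolution. A vertex `v` of the initial graph has the name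
`(v, [])`; a vertex that is created later gets the name `(v, k :: l)`, where `(v, l)` is the name
of one of the vertices that were replaced at its creation. -/
abbrev Label : Type := ℕ × List ℕ

/-- The `k`-th name available for vertices created at `b`. -/
def Label.child (b : Label) (k : ℕ) : Label := (b.1, k :: b.2)

/-- All names that descend from the initial vertices in `A`. -/
def labelsOver (A : Set ℕ) : Set Label := {l | l.1 ∈ A}

namespace SpinGraph

variable {S : Type}

open scoped Classical in
/-- A spin graph on (a subset of) `ℕ`, as initial state of the evolution. -/
noncomputable def embed (α : SpinGraph S ℕ) : SpinGraph S Label where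
  spin l := if l.2 = [] then α.spin l.1 else none
  graph :=
    { Adj := fun l m => l.2 = [] ∧ m.2 = [] ∧ α.graph.Adj l.1 m.1
      symm := ⟨fun _ _ h => ⟨h.2.1, h.1, h.2.2.symm⟩⟩
      loopless := ⟨fun _ h => h.2.2.ne rfl⟩ }
  spin_ne_none l m h := by
    rw [if_pos h.1]
    exact α.spin_ne_none l.1 m.1 h.2.2

/-- For every name `b`, only finitely many of the names reserved for vertices created at `b` are
in use. Finite graphs and the graphs `α.embed` have this property. -/
def HasRoom (γ : SpinGraph S Label) : Prop :=
  ∀ b : Label, {k : ℕ | γ.spin (b.child k) ≠ none}.Finite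

/-- The first index from which on all names reserved for vertices created at `b` are free. -/
noncomputable def firstFree (γ : SpinGraph S Label) (b : Label) : ℕ :=
  sInf {K : ℕ | ∀ j, K ≤ j → γ.spin (b.child j) = none}

end SpinGraph

/-- A substitution rule `(Γ, Γ', V₀, φ)`: `lhs`, `lhsSpin` are the non-empty spin graph `Γ`,
`rhs`, `rhsSpin` the possibly empty spin graph `Γ'`; `V₀` is the set of those `x` for which
`glue x` is `some y`, and then `φ x = y`. -/
structure Rule (S : Type) where
  size : ℕ
  lhs : SimpleGraph (Fin (size + 1))
  lhsSpin : Fin (size + 1) → S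
  newSize : ℕ
  rhs : SimpleGraph (Fin newSize)
  rhsSpin : Fin newSize → S
  glue : Fin (size + 1) → Option (Fin newSize)

namespace Rule

variable {S : Type} (ρ : Rule S)

/-- `ψ` is an isomorphism of `Γ` onto a (not necessarily regular) spin subgraph of `γ`. -/
def IsMatch (γ : SpinGraph S Label) (ψ : Fin (ρ.size + 1) → Label) : Prop :=
  Function.Injective ψ ∧ (∀ x, γ.spin (ψ x) = some (ρ.lhsSpin x)) ∧
    ∀ x y, ρ.lhs.Adj x y → γ.graph.Adj (ψ x) (ψ y)

open scoped Classical in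
/-- The name of the vertex `y` of `Γ'` after the substitution: it keeps the name of a vertex that
is identified with it, if there is one; otherwise it is a new vertex and gets a free name. -/
noncomputable def place (γ : SpinGraph S Label) (ψ : Fin (ρ.size + 1) → Label)
    (y : Fin ρ.newSize) : Label :=
  if h : ∃ x, ρ.glue x = some y then ψ h.choose
  else (ψ 0).child (γ.firstFree (ψ 0) + y)

open scoped Classical in
/-- What becomes of an old vertex: `none` if it is deleted, else its new name. Only the vertices
of `ψ(Γ)` can be deleted or renamed (the latter if `φ` identifies several of them). -/
noncomputable def collapse (γ : SpinGraph S Label) (ψ : Fin (ρ.size + 1) → Label)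
    (u : Label) : Option Label :=
  if h : ∃ x, ψ x = u then (ρ.glue h.choose).map (ρ.place γ ψ) else some u

open scoped Classical in
/-- The transformation `T(Sub, ψ)`: the links of `ψ(Γ)` are deleted, the vertices of `ψ(Γ)`
outside `ψ(V₀)` are deleted with all their links, each remaining vertex `ψ x` is identified with
`φ x`, and the spins on `Γ'` are those of `Γ'`. Multiple links count as one, loops are dropped. -/
noncomputable def apply (γ : SpinGraph S Label) (ψ : Fin (ρ.size + 1) → Label) :
    SpinGraph S Label where
  spin w :=
    if h : ∃ y, ρ.place γ ψ y = w then some (ρ.rhsSpin h.choose)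
    else if ∃ x, ψ x = w then none
    else γ.spin w
  graph := SimpleGraph.fromRel fun w z =>
    (∃ y y', ρ.rhs.Adj y y' ∧ ρ.place γ ψ y = w ∧ ρ.place γ ψ y' = z) ∨
    ∃ u v, γ.graph.Adj u v ∧ (¬ ∃ x x', ρ.lhs.Adj x x' ∧ ψ x = u ∧ ψ x' = v) ∧
      ρ.collapse γ ψ u = some w ∧ ρ.collapse γ ψ v = some z
  spin_ne_none := by
    have key : ∀ u w, γ.spin u ≠ none → ρ.collapse γ ψ u = some w →
        (if h : ∃ y, ρ.place γ ψ y = w then some (ρ.rhsSpin h.choose)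
          else if ∃ x, ψ x = w then none else γ.spin w) ≠ none := by
      intro u w hu hc
      by_cases hy : ∃ y, ρ.place γ ψ y = w
      · rw [dif_pos hy]; simp
      · rw [dif_neg hy]
        unfold collapse at hc
        split_ifs at hc with hx
        · obtain ⟨y, -, hy'⟩ := Option.map_eq_some_iff.1 hc
          exact absurd ⟨y, hy'⟩ hy
        · obtain rfl : u = w := Option.some.inj hc
          rw [if_neg hx]
          exact hu
    intro w z h
    rw [SimpleGraph.fromRel_adj] at h
    rcases h.2 with (⟨y, y', -, hw, -⟩ | ⟨u, v, huv, -, hw, -⟩) |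
        (⟨y, y', -, -, hw⟩ | ⟨u, v, huv, -, -, hw⟩)
    · rw [dif_pos ⟨y, hw⟩]; simp
    · exact key u w (γ.spin_ne_none u v huv) hw
    · rw [dif_pos ⟨y', hw⟩]; simp
    · exact key v w (γ.spin_ne_none v u huv.symm) hw

end Rule

/-- A finite set of substitution rules with positive rates. -/
structure Grammar (S : Type) where
  numRules : ℕ
  rule : Fin numRules → Rule S
  rate : Fin numRules → ℝ
  rate_pos : ∀ i, 0 < rate i

/-- A spin graph together with the set of the vertices that have been touched so far. -/
@[ext]
structure Marked (S : Type) where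
  graph : SpinGraph S Label
  touched : Set Label

namespace Marked

variable {S : Type}

/-- The initial state: `α`, with no vertex touched. -/
noncomputable def init (α : SpinGraph S ℕ) : Marked S := ⟨α.embed, ∅⟩

/-- The part of the state on the names descending from the initial vertices in `A`. -/
noncomputable def restrict (x : Marked S) (A : Set ℕ) : Marked S :=
  ⟨x.graph.restrict (labelsOver A), x.touched ∩ labelsOver A⟩

/-- The touched vertices of the initial graph. -/
def touchedSet (x : Marked S) : Set ℕ := {v | ((v, []) : Label) ∈ x.touched}

/-- The two states look the same at `l`: same spin (or absence), same neighbours, same mark. -/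
def SameAt (l : Label) (x y : Marked S) : Prop :=
  x.graph.spin l = y.graph.spin l ∧
    x.graph.graph.neighborSet l = y.graph.graph.neighborSet l ∧ (l ∈ x.touched ↔ l ∈ y.touched)

/-- The events that can be observed at the names in `W`: spins, links to any other vertex, marks. -/
@[reducible] def starSigma (W : Set Label) : MeasurableSpace (Marked S) :=
  MeasurableSpace.generateFrom
    ({A | ∃ l ∈ W, ∃ a : Option S, A = {x | x.graph.spin l = a}} ∪
      {A | ∃ l ∈ W, ∃ m : Label, A = {x | x.graph.graph.Adj l m}} ∪
      {A | ∃ l ∈ W, A = {x | l ∈ x.touched}})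

instance : MeasurableSpace (Marked S) := starSigma univ

/-- The events about a trajectory that can be observed at the names in `W` during `[0, t]`. -/
@[reducible] def pathSigma (W : Set Label) (t : ℝ) : MeasurableSpace (ℝ → Marked S) :=
  ⨆ s ∈ Icc (0 : ℝ) t, (starSigma W).comap fun x => x s

end Marked

namespace Grammar

variable {S : Type} (G : Grammar S)

/-- All left hand sides `Γ` are connected. -/
def IsLocal : Prop := ∀ i, (G.rule i).lhs.Connected

/-- The vertices of each left hand side `Γ` have mutual distances at most `R` in `Γ`. -/
def RangeLE (R : ℕ) : Prop := ∀ i x y, (G.rule i).lhs.dist x y ≤ R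

/-- For all sufficiently large `n` the (finite and countable) spin graphs with degrees at most `n`
are invariant with respect to all substitutions. -/
def LocallyBounded : Prop :=
  ∃ n₀ : ℕ, ∀ n, n₀ ≤ n → ∀ i (γ : SpinGraph S Label) ψ, γ.HasRoom → γ.DegreeLE n →
    (G.rule i).IsMatch γ ψ → ((G.rule i).apply γ ψ).DegreeLE n

/-- A substitution together with the place where it is to be carried out. -/
abbrev Move : Type := Σ i : Fin G.numRules, (Fin ((G.rule i).size + 1) → Label)

/-- The move is possible in the state `x`. -/
def CanMove (m : G.Move) (x : Marked S) : Prop := (G.rule m.1).IsMatch x.graph m.2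

/-- The state after the move: the vertices of `ψ(Γ)` are touched. -/
noncomputable def step (m : G.Move) (x : Marked S) : Marked S :=
  ⟨(G.rule m.1).apply x.graph m.2, x.touched ∪ range m.2⟩

/-- The total rate of all transformations that are possible in a finite graph. -/
noncomputable def totalRate (x : Marked S) : ℝ :=
  ∑ i, G.rate i * ({ψ | (G.rule i).IsMatch x.graph ψ}.ncard : ℝ)

/-- The state after the first `j` of the moves `w`. -/
noncomputable def after (x : Marked S) {k : ℕ} (w : Fin k → G.Move) (j : ℕ) : Marked S :=
  ((List.ofFn w).take j).foldl (fun y m => G.step m y) x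

/-- The moves `w` can be carried out one after the other. -/
def Admissible (x : Marked S) {k : ℕ} (w : Fin k → G.Move) : Prop :=
  ∀ j : Fin k, G.CanMove (w j) (G.after x w j)

/-- The trajectory with the moves `w` at the times `τ 0 < τ 1 < …`. -/
noncomputable def pathOf (x : Marked S) {k : ℕ} (w : Fin k → G.Move) (τ : Fin k → ℝ) :
    ℝ → Marked S :=
  fun s => G.after x w {j | τ j ≤ s}.ncard

/-- The density of the event that the jumps on `[0, t]` are the moves `w` at the times `τ`: the
product of the rates of the moves and of the probabilities `exp (-q Δ)` of no jump during a time
interval of length `Δ` in a state of total rate `q`. -/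
noncomputable def pathDensity (x : Marked S) (t : ℝ) {k : ℕ} (w : Fin k → G.Move)
    (τ : Fin k → ℝ) : ENNReal :=
  let T : Fin (k + 2) → ℝ := Fin.cons 0 (Fin.snoc τ t : Fin (k + 1) → ℝ)
  ENNReal.ofReal ((∏ j, G.rate (w j).1) *
    Real.exp (-∑ j : Fin (k + 1), G.totalRate (G.after x w j) * (T j.succ - T j.castSucc)))

open scoped Classical in
/-- The law, on the time interval `[0, t]`, of the (minimal) continuous time Markov chain that
starts from the finite graph `x` and in which each possible transformation is carried out with its
rate. -/
noncomputable def chainLaw (x : Marked S) (t : ℝ) : Measure (ℝ → Marked S) :=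
  Measure.sum fun w : (Σ k : ℕ, (Fin k → G.Move)) =>
    if G.Admissible x w.2 then
      ((volume.restrict {τ : Fin w.1 → ℝ | StrictMono τ ∧ ∀ j, τ j ∈ Ioo 0 t}).withDensity
        (G.pathDensity x t w.2)).map (G.pathOf x w.2)
    else 0

/-- The trajectory evolves by substitutions: at every vertex it is right continuous with left
limits, and the state at time `s` equals the left limit at `s` or arises from it by one
substitution. -/
def IsTrajectory (x : ℝ → Marked S) : Prop :=
  (∀ s, 0 ≤ s → ∀ l, ∀ᶠ s' in 𝓝[>] s, Marked.SameAt l (x s') (x s)) ∧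
  ∀ s, 0 < s → ∃ y, (∀ l, ∀ᶠ s' in 𝓝[<] s, Marked.SameAt l (x s') y) ∧
    (x s = y ∨ ∃ m, G.CanMove m y ∧ x s = G.step m y)

/-- The measure `μ_D` of the cluster `D`: the law on `[0, t]` of the chain that starts from the
regular subgraph on `D ∪ ∂D`, under the condition that all vertices of `D` are touched and no
vertex of `∂D` is touched. -/
noncomputable def clusterLaw (α : SpinGraph S ℕ) (R : ℕ) (t : ℝ) (D : Set ℕ) :
    Measure (ℝ → Marked S) :=
  ProbabilityTheory.cond (G.chainLaw (Marked.init (α.restrict (D ∪ α.boundary R D))) t)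
    {x | D ⊆ (x t).touchedSet ∧ Disjoint (α.boundary R D) (x t).touchedSet}

/-- The process `X` is a random trajectory of countable spin graphs with degrees at most `n`,
starting from `α`. -/
structure IsDynamics (n : ℕ) (α : SpinGraph S ℕ) {Ω : Type} [MeasurableSpace Ω] (P : Measure Ω)
    (X : ℝ → Ω → Marked S) : Prop where
  prob : IsProbabilityMeasure P
  measurable : ∀ s, 0 ≤ s → Measurable (X s)
  start : ∀ᵐ ω ∂P, X 0 ω = Marked.init α
  trajectory : ∀ᵐ ω ∂P, G.IsTrajectory fun s => X s ω
  degree : ∀ᵐ ω ∂P, ∀ s, 0 ≤ s → (X s ω).graph.DegreeLE n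

/-- `X` is the limit of the Markov chains that start from the neighbourhoods `O_N(o)`: on every
time interval `[0, t]` the probability of every event that can be observed at finitely many names
converges. -/
def IsThermodynamicLimit (α : SpinGraph S ℕ) (o : ℕ) {Ω : Type} [MeasurableSpace Ω]
    (P : Measure Ω) (X : ℝ → Ω → Marked S) : Prop :=
  ∀ t, 0 ≤ t → ∀ W : Finset Label, ∀ A : Set (ℝ → Marked S),
    MeasurableSet[Marked.pathSigma (W : Set Label) t] A →
    Tendsto (fun N : ℕ => G.chainLaw (Marked.init (α.nbhd o N)) t A) atTop
      (𝓝 (P {ω | (fun s => X s ω) ∈ A}))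

/-- The cluster property on `[0, t]`: almost surely all clusters of the set of touched vertices
are finite, and given that `D 0, …, D (k - 1)` are among the clusters, the trajectories on them
are independent and have the laws `μ_{D i}`. -/
def ClusterProperty (α : SpinGraph S ℕ) (R : ℕ) (t : ℝ) {Ω : Type} [MeasurableSpace Ω]
    (P : Measure Ω) (X : ℝ → Ω → Marked S) : Prop :=
  (∀ᵐ ω ∂P, ∀ D, α.IsCluster R (X t ω).touchedSet D → D.Finite) ∧
  ∀ (k : ℕ) (D : Fin k → Finset ℕ), Function.Injective D →
    ∀ U : Fin k → Set (ℝ → Marked S), (∀ i, MeasurableSet[Marked.pathSigma univ t] (U i)) →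
      P {ω | ∀ i, α.IsCluster R (X t ω).touchedSet (D i) ∧
          (fun s => (X s ω).restrict ((D i : Set ℕ) ∪ α.boundary R (D i))) ∈ U i} =
        P {ω | ∀ i, α.IsCluster R (X t ω).touchedSet (D i)} *
          ∏ i, G.clusterLaw α R t (D i) (U i)

end Grammar

/-! The proof is a graphical construction. Every conceivable move, that is, a rule together with the
names of the vertices it acts on, gets an independent Poisson clock with the rate of the rule, and a
move is carried out whenever its clock rings while the move is possible. For a finite graph this
reproduces the chain: the indicator of a run is a sum over tuples of rings, and the Mecke formula
turns its expectation into the iterated integrals, with factors exp (-q Δ), by which the law of the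
chain is defined (`JumpSystem.law_runEvent`, `Grammar.chainLaw_init`). All finite subgraphs are
driven by the same clocks, so that their evolutions can be compared trajectory by trajectory.

The names of the theorem are reused after deletions, which makes it impossible to say in advance to
which part of the graph a name will belong. The construction therefore runs with canonical names
that are never reused (`CState`), and the actual names are carried along as a function of them.
Renaming is a bijection between the possible moves, so the law of the trajectory is not affected
(`Grammar.jumpInt_canonical`).

The quantitative input is that, with degrees at most n and connected left hand sides of diameter at
most R, each vertex is touched at a bounded rate. Comparing with θ ^ Y, where Y counts the vertices
of a set F that are still untouched, one sees that all of F is touched during a time interval of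
length h with probability at most κ ^ |F|, where κ is as small as desired if h is small
(`Grammar.exists_law_touch_le`). Since the number of paths of length k from a vertex grows only
geometrically in k, long touched paths are unlikely.

Convergence: during one time slab a discrepancy between two evolutions can reach a given region only
along a path of touched vertices (`Grammar.agree_stateAt`). Hence evolutions in large finite sets
agree on a fixed finite set with high probability at the end of the slab if they did so on a larger
one at its beginning. The argument is iterated over the slabs by means of the Markov property at
their end points (`Grammar.exists_disagree_le`). Borel-Cantelli yields an exhaustion along which the
evolutions stabilize locally (`Grammar.exists_stable`); their limit is the process, and local
probabilities converge to those of the limit (`Grammar.tendsto_law_state`).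

Clusters: if D is touched and no vertex of its R-boundary is, then no move that meets D can leave D,
because a left hand side has diameter at most R. The moves split into those that meet one of the
sets D i and the remaining ones; these families have disjoint sets of clocks, and the probability
factorizes (`Grammar.law_isolated`). The factor of D does not depend on the surroundings, so it can
be computed in the graph on D and its boundary, which identifies it with the conditional law μ_D up
to normalization (`Grammar.law_clusterEvent`). The factorization passes to the limit. An infinite
cluster would contain arbitrarily long touched paths in the graph of pairs at distance at most R,
whose degrees are at most (n + 1) ^ R; this has probability zero as soon as (n + 1) ^ R κ ≤ 1 / 2
(`Grammar.ae_finite_clusters`). -/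

/-! ### Deterministic runs of a jump system driven by clocks -/

/-- A jump system: in the state `z` the finitely many moves `en z` are enabled, and `step c z` is the
state after the move `c`. -/
structure JumpSystem (σ C : Type) where
  en : σ → Finset C
  step : C → σ → σ

namespace JumpSystem

variable {σ σ' C : Type} (J : JumpSystem σ C) (J' : JumpSystem σ' C)

/-- `l` lists the moves, with their times, that are carried out during `(a, b]` from the state `z`
if a move `c` is carried out whenever its clock, with the ring times `T c`, rings while it is
enabled. -/
def IsRun (T : C → Set ℝ) : σ → ℝ → List (C × ℝ) → ℝ → Prop
  | z, a, [], b => a ≤ b ∧ ∀ c ∈ J.en z, ∀ s ∈ T c, ¬ (a < s ∧ s ≤ b)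
  | z, a, e :: l, b => e.1 ∈ J.en z ∧ e.2 ∈ T e.1 ∧ a < e.2 ∧ e.2 ≤ b ∧
      (∀ c ∈ J.en z, ∀ s ∈ T c, ¬ (a < s ∧ s < e.2)) ∧ IsRun T (J.step e.1 z) e.2 l b

/-- The state after all moves of the list. -/
def final : σ → List (C × ℝ) → σ
  | z, [] => z
  | z, e :: l => final (J.step e.1 z) l

/-- The state at time `s`. -/
noncomputable def stateAt : σ → List (C × ℝ) → ℝ → σ
  | z, [], _ => z
  | z, e :: l, s => if e.2 ≤ s then stateAt (J.step e.1 z) l s else z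

/-- The state immediately before time `s`. -/
noncomputable def stateBefore : σ → List (C × ℝ) → ℝ → σ
  | z, [], _ => z
  | z, e :: l, s => if e.2 < s then stateBefore (J.step e.1 z) l s else z

/-- No two different clocks ring at the same time. -/
def NoSim (T : C → Set ℝ) : Prop := ∀ c c' s, s ∈ T c → s ∈ T c' → c = c'

variable {J J'} {T T' : C → Set ℝ} {z : σ} {a b : ℝ} {l l' : List (C × ℝ)}

theorem IsRun.time_mem : ∀ {l : List (C × ℝ)} {z : σ} {a : ℝ}, J.IsRun T z a l b →
    ∀ e ∈ l, a < e.2 ∧ e.2 ≤ b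
  | [], _, _, _, _, he => by simp at he
  | e₀ :: l, z, a, h, e, he => by
    obtain ⟨-, -, h1, h2, -, h3⟩ := h
    rcases List.mem_cons.1 he with rfl | he
    · exact ⟨h1, h2⟩
    · have := h3.time_mem e he
      exact ⟨h1.trans this.1, this.2⟩

theorem IsRun.congr (hT : ∀ c s, a < s → s ≤ b → (s ∈ T c ↔ s ∈ T' c))
    (h : J.IsRun T z a l b) : J.IsRun T' z a l b := by
  induction l generalizing z a with
  | nil => exact ⟨h.1, fun c hc s hs hab => h.2 c hc s ((hT c s hab.1 hab.2).2 hs) hab⟩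
  | cons e l ih =>
    obtain ⟨h1, h2, h3, h4, h5, h6⟩ := h
    exact ⟨h1, (hT _ _ h3 h4).1 h2, h3, h4,
      fun c hc s hs hab => h5 c hc s ((hT c s hab.1 (hab.2.le.trans h4)).2 hs) hab,
      ih (fun c s hs hs' => hT c s (h3.trans hs) hs') h6⟩

/-- The next move is the one whose clock rings first among the enabled ones, and without
simultaneous rings there is only one such clock. -/
theorem IsRun.unique (hT : NoSim T) (h : J.IsRun T z a l b) (h' : J.IsRun T z a l' b) :
    l = l' := by
  induction l generalizing z a l' with
  | nil =>
    cases l' with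
    | nil => rfl
    | cons e' l' => exact absurd ⟨h'.2.2.1, h'.2.2.2.1⟩ (h.2 _ h'.1 _ h'.2.1)
  | cons e l ih =>
    cases l' with
    | nil => exact absurd ⟨h.2.2.1, h.2.2.2.1⟩ (h'.2 _ h.1 _ h.2.1)
    | cons e' l' =>
      obtain ⟨h1, h2, h3, h4, h5, h6⟩ := h
      obtain ⟨k1, k2, k3, k4, k5, k6⟩ := h'
      have ht : e.2 = e'.2 := by
        rcases lt_trichotomy e.2 e'.2 with hlt | heq | hlt
        · exact absurd ⟨h3, hlt⟩ (k5 _ h1 _ h2)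
        · exact heq
        · exact absurd ⟨k3, hlt⟩ (h5 _ k1 _ k2)
      have he : e = e' := Prod.ext (hT _ _ _ h2 (ht ▸ k2)) ht
      subst he
      rw [ih h6 k6]

theorem IsRun.extend_left {a' : ℝ} (ha : a' ≤ a) (hv : ∀ c ∈ J.en z, ∀ s ∈ T c, ¬ (a' < s ∧ s ≤ a))
    (h : J.IsRun T z a l b) : J.IsRun T z a' l b := by
  cases l with
  | nil =>
    refine ⟨ha.trans h.1, fun c hc s hs hab => ?_⟩
    rcases le_or_gt s a with hsa | hsa
    · exact hv c hc s hs ⟨hab.1, hsa⟩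
    · exact h.2 c hc s hs ⟨hsa, hab.2⟩
  | cons e l =>
    obtain ⟨h1, h2, h3, h4, h5, h6⟩ := h
    refine ⟨h1, h2, ha.trans_lt h3, h4, fun c hc s hs hab => ?_, h6⟩
    rcases le_or_gt s a with hsa | hsa
    · exact hv c hc s hs ⟨hab.1, hsa⟩
    · exact h5 c hc s hs ⟨hsa, hab.2⟩

theorem IsRun.split {c : ℝ} (h : J.IsRun T z a l b) (hac : a ≤ c) (hcb : c ≤ b) :
    ∃ l₁ l₂, l = l₁ ++ l₂ ∧ J.IsRun T z a l₁ c ∧ J.IsRun T (J.final z l₁) c l₂ b := by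
  induction l generalizing z a with
  | nil =>
    exact ⟨[], [], rfl, ⟨hac, fun c' hc' s hs hab => h.2 c' hc' s hs ⟨hab.1, hab.2.trans hcb⟩⟩,
      ⟨hcb, fun c' hc' s hs hab => h.2 c' hc' s hs ⟨hac.trans_lt hab.1, hab.2⟩⟩⟩
  | cons e l ih =>
    obtain ⟨h1, h2, h3, h4, h5, h6⟩ := h
    rcases le_or_gt e.2 c with hec | hec
    · obtain ⟨l₁, l₂, rfl, k1, k2⟩ := ih h6 hec
      exact ⟨e :: l₁, l₂, rfl, ⟨h1, h2, h3, hec, h5, k1⟩, k2⟩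
    · exact ⟨[], e :: l, rfl,
        ⟨hac, fun c' hc' s hs hab => h5 c' hc' s hs ⟨hab.1, hab.2.trans_lt hec⟩⟩,
        ⟨h1, h2, hec, h4, fun c' hc' s hs hab => h5 c' hc' s hs ⟨hac.trans_lt hab.1, hab.2⟩, h6⟩⟩

theorem stateAt_of_forall_lt {s : ℝ} (h : ∀ e ∈ l, s < e.2) : J.stateAt z l s = z := by
  cases l with
  | nil => rfl
  | cons e l => simp [stateAt, h e (by simp)]

theorem stateAt_append_of_le {s : ℝ} (h : ∀ e ∈ l, e.2 ≤ s) :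
    J.stateAt z (l ++ l') s = J.stateAt (J.final z l) l' s := by
  induction l generalizing z with
  | nil => rfl
  | cons e l ih =>
    rw [List.cons_append, stateAt, if_pos (h e (by simp)), ih fun e' he' => h e' (by simp [he'])]
    rfl

theorem stateAt_append_of_lt {s : ℝ} (h : ∀ e ∈ l', s < e.2) :
    J.stateAt z (l ++ l') s = J.stateAt z l s := by
  induction l generalizing z with
  | nil => exact stateAt_of_forall_lt h
  | cons e l ih => rw [List.cons_append, stateAt, stateAt, ih]

theorem stateAt_eq_final {s : ℝ} (h : ∀ e ∈ l, e.2 ≤ s) : J.stateAt z l s = J.final z l := by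
  have := stateAt_append_of_le (J := J) (z := z) (l' := []) h
  simpa [stateAt] using this

theorem IsRun.stateAt_end (h : J.IsRun T z a l b) : J.stateAt z l b = J.final z l :=
  stateAt_eq_final fun e he => (h.time_mem e he).2

theorem IsRun.stateAt_start (h : J.IsRun T z a l b) : J.stateAt z l a = z :=
  stateAt_of_forall_lt fun e he => (h.time_mem e he).1

/-- The state of a run at time `s` is the final state of a run up to time `s`. -/
theorem IsRun.exists_stateAt {s : ℝ} (h : J.IsRun T z a l b) (has : a ≤ s) (hsb : s ≤ b) :
    ∃ l', J.IsRun T z a l' s ∧ J.stateAt z l s = J.final z l' := by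
  obtain ⟨l₁, l₂, rfl, h1, h2⟩ := h.split has hsb
  exact ⟨l₁, h1, by rw [stateAt_append_of_lt fun e he => (h2.time_mem e he).1, h1.stateAt_end]⟩

theorem eventually_stateAt_right (z : σ) (l : List (C × ℝ)) (s : ℝ) :
    ∀ᶠ s' in 𝓝[>] s, J.stateAt z l s' = J.stateAt z l s := by
  induction l generalizing z with
  | nil => exact Eventually.of_forall fun _ => rfl
  | cons e l ih =>
    rcases le_or_gt e.2 s with h | h
    · filter_upwards [ih (J.step e.1 z), self_mem_nhdsWithin] with s' hs' hlt
      rw [stateAt, stateAt, if_pos h, if_pos (h.trans (mem_Ioi.1 hlt).le), hs']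
    · filter_upwards [Ioo_mem_nhdsGT h] with s' hs'
      rw [stateAt, stateAt, if_neg h.not_ge, if_neg hs'.2.not_ge]

theorem eventually_stateAt_left (z : σ) (l : List (C × ℝ)) (s : ℝ) :
    ∀ᶠ s' in 𝓝[<] s, J.stateAt z l s' = J.stateBefore z l s := by
  induction l generalizing z with
  | nil => exact Eventually.of_forall fun _ => rfl
  | cons e l ih =>
    rcases lt_or_ge e.2 s with h | h
    · filter_upwards [ih (J.step e.1 z), Ioo_mem_nhdsLT h] with s' hs' hlt
      rw [stateAt, stateBefore, if_pos h, if_pos hlt.1.le, hs']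
    · filter_upwards [self_mem_nhdsWithin] with s' hs'
      rw [stateAt, stateBefore, if_neg h.not_gt, if_neg ((mem_Iio.1 hs').trans_le h).not_ge]

/-- At the time `s` a run either stands still or makes a move whose clock rings. -/
theorem IsRun.stateAt_cases {s : ℝ} (h : J.IsRun T z a l b) (has : a < s)
    (hsb : s ≤ b) :
    (J.stateAt z l s = J.stateBefore z l s ∧ ∀ c ∈ J.en (J.stateBefore z l s), s ∉ T c) ∨
    ∃ c ∈ J.en (J.stateBefore z l s), s ∈ T c ∧
      J.stateAt z l s = J.step c (J.stateBefore z l s) := by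
  induction l generalizing z a with
  | nil => exact Or.inl ⟨rfl, fun c hc hs => h.2 c hc s hs ⟨has, hsb⟩⟩
  | cons e l ih =>
    obtain ⟨h1, h2, h3, h4, h5, h6⟩ := h
    rcases lt_trichotomy e.2 s with hlt | heq | hlt
    · have := ih h6 hlt
      simpa only [stateAt, stateBefore, if_pos hlt, if_pos hlt.le] using this
    · right
      subst heq
      refine ⟨e.1, by simpa [stateBefore] using h1, h2, ?_⟩
      simp only [stateAt, stateBefore, lt_irrefl, le_refl, if_true, if_false]
      exact stateAt_of_forall_lt fun e' he' => (h6.time_mem e' he').1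
    · left
      simp only [stateAt, stateBefore, if_neg hlt.not_gt, if_neg hlt.not_ge]
      exact ⟨trivial, fun c hc hs => h5 c hc s hs ⟨has, hlt⟩⟩

theorem IsRun.final_induction {P : σ → Prop} (hP : ∀ z, ∀ c ∈ J.en z, P z → P (J.step c z))
    (hz : P z) (h : J.IsRun T z a l b) : P (J.final z l) := by
  induction l generalizing z a with
  | nil => exact hz
  | cons e l ih => exact ih (hP _ _ h.1 hz) h.2.2.2.2.2

open scoped Classical in
/-- If the visible moves happen in both systems and the invisible ones do not affect the second
system, then a run of the first system induces a run of the second one. -/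
theorem IsRun.sim (hT : NoSim T) {Rel : σ → σ' → Prop} {vis ok : C → Prop}
    (h1 : ∀ z z' c, Rel z z' → c ∈ J.en z → ok c → vis c →
      c ∈ J'.en z' ∧ Rel (J.step c z) (J'.step c z'))
    (h2 : ∀ z z' c, Rel z z' → c ∈ J.en z → ok c → ¬ vis c → Rel (J.step c z) z')
    (h3 : ∀ z z' c s, Rel z z' → c ∈ J'.en z' → s ∈ T' c → c ∈ J.en z ∧ s ∈ T c ∧ vis c)
    (h4 : ∀ c s, vis c → s ∈ T c → s ∈ T' c) {z' : σ'} (hz : Rel z z')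
    (h : J.IsRun T z a l b) (hok : ∀ e ∈ l, ok e.1) :
    J'.IsRun T' z' a (l.filter fun e => vis e.1) b ∧
      ∀ s, Rel (J.stateAt z l s) (J'.stateAt z' (l.filter fun e => vis e.1) s) := by
  induction l generalizing z z' a with
  | nil =>
    refine ⟨⟨h.1, fun c hc s hs hab => ?_⟩, fun s => hz⟩
    obtain ⟨k1, k2, -⟩ := h3 _ _ _ _ hz hc hs
    exact h.2 c k1 s k2 hab
  | cons e l ih =>
    obtain ⟨e1, e2, e3, e4, e5, e6⟩ := h
    have hoke := hok e (by simp)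
    have hokl : ∀ e' ∈ l, ok e'.1 := fun e' he' => hok e' (by simp [he'])
    have hvoid : ∀ c ∈ J'.en z', ∀ s ∈ T' c, ¬ (a < s ∧ s < e.2) := fun c hc s hs hab => by
      obtain ⟨k1, k2, -⟩ := h3 _ _ _ _ hz hc hs
      exact e5 c k1 s k2 hab
    by_cases hv : vis e.1
    · obtain ⟨k1, k2⟩ := h1 _ _ _ hz e1 hoke hv
      obtain ⟨r1, r2⟩ := ih k2 e6 hokl
      have hf : (e :: l).filter (fun e => vis e.1) = e :: l.filter fun e => vis e.1 := by
        simp [hv]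
      rw [hf]
      refine ⟨⟨k1, h4 _ _ hv e2, e3, e4, hvoid, r1⟩, fun s => ?_⟩
      rw [stateAt, stateAt]
      split_ifs
      · exact r2 s
      · exact hz
    · have hr := h2 _ _ _ hz e1 hoke hv
      obtain ⟨r1, r2⟩ := ih hr e6 hokl
      have hf : (e :: l).filter (fun e => vis e.1) = l.filter fun e => vis e.1 := by
        simp [hv]
      rw [hf]
      refine ⟨r1.extend_left e3.le fun c hc s hs hab => ?_, fun s => ?_⟩
      · obtain ⟨k1, k2, k3⟩ := h3 _ _ _ _ hz hc hs
        -- The second system hears only visible clocks. One of them ringing at the very time of the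
        -- invisible move would, by `hT`, be the clock of that move.
        rcases hab.2.lt_or_eq with hlt | rfl
        · exact e5 c k1 s k2 ⟨hab.1, hlt⟩
        · exact hv (hT _ _ _ k2 e2 ▸ k3)
      · rw [stateAt]
        split_ifs with hs
        · exact r2 s
        · have : ∀ e' ∈ l.filter (fun e => vis e.1), s < e'.2 := fun e' he' =>
            (not_le.1 hs).trans (r1.time_mem e' he').1
          rw [stateAt_of_forall_lt this]
          exact hz

end JumpSystem

/-! ### Finite Poisson point processes on the line -/

section PoissonPoints

/-- A finite list of points on the line. -/
abbrev PointList : Type := Σ n : ℕ, (Fin n → ℝ)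

namespace PointList

/-- The `l`-th point, or `0` if there is no such point. -/
noncomputable def val (x : PointList) (l : ℕ) : ℝ := if h : l < x.1 then x.2 ⟨l, h⟩ else 0

theorem measurable_of_forall {β : Type*} [MeasurableSpace β] {f : PointList → β}
    (h : ∀ n, Measurable fun u : Fin n → ℝ => f ⟨n, u⟩) : Measurable f := by
  intro s hs
  refine MeasurableSpace.measurableSet_iInf.2 fun n => ?_
  exact h n hs

theorem measurable_mk (n : ℕ) : Measurable fun u : Fin n → ℝ => (⟨n, u⟩ : PointList) := by
  intro s hs
  exact MeasurableSpace.measurableSet_iInf.1 hs n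

theorem measurable_val (l : ℕ) : Measurable fun x : PointList => x.val l := by
  refine measurable_of_forall fun n => ?_
  by_cases h : l < n
  · simp only [val, h, dif_pos]; exact measurable_pi_apply (X := fun _ : Fin n => ℝ) ⟨l, h⟩
  · simp only [val, h, dif_neg, not_false_eq_true]; fun_prop

theorem measurable_card : Measurable fun x : PointList => x.1 :=
  measurable_of_forall fun _ => measurable_const

/-- The weight `exp (-m) / n!`. -/
noncomputable def weight (m : ℝ) (n : ℕ) : ENNReal := ENNReal.ofReal (Real.exp (-m) / n.factorial)

/-- The factor n + 1 is the number of positions at which a point can be inserted into a list of n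
points; this is the combinatorial core of the Mecke formula. -/
theorem weight_succ (m : ℝ) (n : ℕ) : weight m (n + 1) * (n + 1 : ℕ) = weight m n := by
  rw [weight, weight, ← ENNReal.ofReal_natCast, ← ENNReal.ofReal_mul (by positivity)]
  congr 1
  rw [Nat.factorial_succ]
  push_cast
  field_simp

theorem tsum_weight (m : ℝ) {x : ℝ} (hx : 0 ≤ x) :
    ∑' n, weight m n * ENNReal.ofReal x ^ n = ENNReal.ofReal (Real.exp (x - m)) := by
  have h1 : ∀ n, weight m n * ENNReal.ofReal x ^ n =
      ENNReal.ofReal (Real.exp (-m) * (x ^ n / n.factorial)) := fun n => by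
    rw [weight, ← ENNReal.ofReal_pow hx, ← ENNReal.ofReal_mul (by positivity)]
    congr 1
    ring
  have h2 : HasSum (fun n : ℕ => Real.exp (-m) * (x ^ n / n.factorial)) (Real.exp (x - m)) := by
    have := (NormedSpace.expSeries_div_hasSum_exp x).mul_left (Real.exp (-m))
    rw [← Real.exp_eq_exp_ℝ, ← Real.exp_add] at this
    rw [sub_eq_neg_add]
    exact this
  simp_rw [h1]
  rw [← ENNReal.ofReal_tsum_of_nonneg (fun n => by positivity) h2.summable, h2.tsum_eq]

/-- The law of a Poisson point process with the finite intensity measure `μ`. -/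
noncomputable def poisson (μ : Measure ℝ) : Measure PointList :=
  Measure.sum fun n => weight (μ.real univ) n •
    (Measure.pi fun _ : Fin n => μ).map fun u => (⟨n, u⟩ : PointList)

theorem lintegral_poisson (μ : Measure ℝ) {f : PointList → ENNReal} (hf : Measurable f) :
    ∫⁻ x, f x ∂poisson μ =
      ∑' n, weight (μ.real univ) n * ∫⁻ u, f ⟨n, u⟩ ∂Measure.pi fun _ : Fin n => μ := by
  rw [poisson, lintegral_sum_measure]
  congr 1
  ext n
  rw [lintegral_smul_measure, lintegral_map hf (measurable_mk n), smul_eq_mul]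

variable (μ : Measure ℝ) [IsFiniteMeasure μ]

/-- Given n points, the weight of the event is the n-th power of the mass of the complement of V,
and the exponential series sums up. The case of an empty V shows that the total mass is one. -/
theorem poisson_forall_notMem {V : Set ℝ} (hV : MeasurableSet V) :
    poisson μ {x | ∀ l : Fin x.1, x.2 l ∉ V} = ENNReal.ofReal (Real.exp (-μ.real V)) := by
  have hm : MeasurableSet {x : PointList | ∀ l : Fin x.1, x.2 l ∉ V} := by
    refine measurableSet_setOfPred.2 (measurable_of_forall fun n => ?_)
    exact measurableSet_setOfPred.1 (by
      have : {u : Fin n → ℝ | ∀ l, u l ∉ V} = ⋂ l, {u | u l ∈ Vᶜ} := by ext; simp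
      rw [this]
      exact MeasurableSet.iInter fun l => measurable_pi_apply l hV.compl)
  have h1 : ∀ n, ∫⁻ u, ({x : PointList | ∀ l : Fin x.1, x.2 l ∉ V}.indicator 1 : _ → ENNReal) ⟨n, u⟩
      ∂Measure.pi (fun _ : Fin n => μ) = ENNReal.ofReal (μ.real Vᶜ) ^ n := fun n => by
    have h2 : (fun u : Fin n → ℝ =>
        ({x : PointList | ∀ l : Fin x.1, x.2 l ∉ V}.indicator 1 : _ → ENNReal) ⟨n, u⟩) =
        (univ.pi fun _ : Fin n => Vᶜ).indicator 1 := by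
      ext u
      have : (u ∈ univ.pi fun _ : Fin n => Vᶜ) ↔ ∀ l, u l ∉ V := by simp [Set.mem_pi]
      simp only [Set.indicator, mem_ofPred_eq, Pi.one_apply]
      by_cases h : ∀ l, u l ∉ V
      · rw [if_pos h, if_pos (this.2 h)]
      · rw [if_neg h, if_neg (mt this.1 h)]
    rw [h2, lintegral_indicator_one (MeasurableSet.univ_pi fun _ => hV.compl), Measure.pi_pi]
    simp [Measure.real]
  rw [← lintegral_indicator_one hm, lintegral_poisson μ (measurable_one.indicator hm)]
  simp_rw [h1]
  rw [tsum_weight _ (by positivity), measureReal_compl hV]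
  congr 2
  ring

instance isProbabilityMeasure_poisson : IsProbabilityMeasure (poisson μ) := ⟨by
  have := poisson_forall_notMem μ (V := ∅) MeasurableSet.empty
  simpa using this⟩

/-- Mecke formula. In the usual version the right hand side contains the configuration with an
additional point at v; the hypothesis `hinv` says that f v does not see this point. Each of the n +
1 summands on lists of n + 1 points gives, by Fubini, the same integral over v and the remaining n
points. -/
theorem lintegral_poisson_sum {f : ℝ → PointList → ENNReal} (hf : Measurable (Function.uncurry f))
    (hinv : ∀ v n (l : Fin (n + 1)) (u : Fin n → ℝ), f v ⟨n + 1, l.insertNth v u⟩ = f v ⟨n, u⟩) :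
    ∫⁻ x, ∑' l, (if l < x.1 then f (x.val l) x else 0) ∂poisson μ =
      ∫⁻ v, ∫⁻ x, f v x ∂poisson μ ∂μ := by
  have hm : Measurable fun x : PointList => ∑' l, (if l < x.1 then f (x.val l) x else 0) := by
    refine Measurable.tsum fun l => Measurable.ite ?_ ?_ measurable_const
    · exact measurable_card (measurableSet_Ioi (a := l))
    · exact hf.comp ((measurable_val l).prodMk measurable_id)
  have hfn : ∀ n, Measurable fun p : ℝ × (Fin n → ℝ) => f p.1 ⟨n, p.2⟩ := fun n =>
    hf.comp (measurable_fst.prodMk ((measurable_mk n).comp measurable_snd))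
  have hfin : ∀ n (u : Fin n → ℝ), ∑' l, (if l < n then f (val ⟨n, u⟩ l) ⟨n, u⟩ else 0) =
      ∑ l : Fin n, f (u l) ⟨n, u⟩ := fun n u => by
    rw [tsum_eq_sum (s := Finset.range n) (fun l hl => by simp at hl; simp [hl]),
      Finset.sum_range]
    refine Finset.sum_congr rfl fun l _ => ?_
    simp [val]
  have hterm : ∀ n (l : Fin (n + 1)),
      ∫⁻ u, f (u l) ⟨n + 1, u⟩ ∂Measure.pi (fun _ : Fin (n + 1) => μ) =
        ∫⁻ v, ∫⁻ u, f v ⟨n, u⟩ ∂Measure.pi (fun _ : Fin n => μ) ∂μ := fun n l => by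
    have hmp := (measurePreserving_piFinSuccAbove (fun _ : Fin (n + 1) => μ) l).symm
    rw [← hmp.lintegral_comp_emb (MeasurableEquiv.measurableEmbedding _), lintegral_prod]
    · refine lintegral_congr fun v => lintegral_congr fun u => ?_
      rw [MeasurableEquiv.piFinSuccAbove_symm_apply]
      simp only [Fin.insertNthEquiv, Equiv.coe_fn_mk, Fin.insertNth_apply_same]
      exact hinv v n l u
    · refine Measurable.aemeasurable ?_
      have : (fun a : ℝ × (Fin n → ℝ) => f (((MeasurableEquiv.piFinSuccAbove (fun _ => ℝ) l).symm a) l)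
          ⟨n + 1, (MeasurableEquiv.piFinSuccAbove (fun _ => ℝ) l).symm a⟩) = fun a => f a.1 ⟨n, a.2⟩ := by
        ext a
        rw [MeasurableEquiv.piFinSuccAbove_symm_apply]
        simp only [Fin.insertNthEquiv, Equiv.coe_fn_mk, Fin.insertNth_apply_same]
        exact hinv _ n l _
      exact this ▸ hfn n
  have hfu : ∀ n, Measurable fun v => ∫⁻ u, f v ⟨n, u⟩ ∂Measure.pi (fun _ : Fin n => μ) := fun n =>
    (hfn n).lintegral_prod_right'
  have hR : ∫⁻ v, ∫⁻ x, f v x ∂poisson μ ∂μ = ∑' n, weight (μ.real univ) n *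
      ∫⁻ v, ∫⁻ u, f v ⟨n, u⟩ ∂Measure.pi (fun _ : Fin n => μ) ∂μ := by
    have : ∀ v, ∫⁻ x, f v x ∂poisson μ = ∑' n, weight (μ.real univ) n *
        ∫⁻ u, f v ⟨n, u⟩ ∂Measure.pi (fun _ : Fin n => μ) := fun v =>
      lintegral_poisson μ (hf.comp (measurable_const.prodMk measurable_id))
    simp_rw [this]
    rw [lintegral_tsum fun n => ((hfu n).const_mul _).aemeasurable]
    exact tsum_congr fun n => lintegral_const_mul _ (hfu n)
  -- The empty list contributes nothing; shifting the index by one makes `weight_succ` applicable.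
  rw [hR, lintegral_poisson μ hm, tsum_eq_zero_add' ENNReal.summable]
  simp_rw [hfin]
  simp only [Finset.univ_eq_empty, Finset.sum_empty, lintegral_zero, mul_zero, zero_add]
  refine tsum_congr fun n => ?_
  rw [lintegral_finsetSum]
  · simp_rw [hterm]
    rw [Finset.sum_const, Finset.card_univ, Fintype.card_fin, nsmul_eq_mul, ← mul_assoc,
      weight_succ]
  · intro l _
    exact hf.comp ((measurable_pi_apply l).prodMk (measurable_mk (n + 1)))

/-- For a measure without atoms the diagonals are null sets of the product measure, by Fubini in one
of the two coinciding coordinates. -/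
theorem poisson_not_injective [NullSingletonClass μ] :
    poisson μ {x | ¬ Function.Injective x.2} = 0 := by
  have hset : {x : PointList | ¬ Function.Injective x.2} =
      {x | ∃ n, x.1 = n ∧ ∃ i j, i < n ∧ j < n ∧ i ≠ j ∧ x.val i = x.val j} := by
    ext x
    simp only [mem_ofPred_eq, Function.Injective, not_forall]
    constructor
    · rintro ⟨i, j, hij, hne⟩
      exact ⟨x.1, rfl, i, j, i.2, j.2, fun h => hne (Fin.ext h), by simpa [val] using hij⟩
    · rintro ⟨n, rfl, i, j, hi, hj, hne, h⟩
      refine ⟨⟨i, hi⟩, ⟨j, hj⟩, by simpa [val, hi, hj] using h, fun h => hne (by simpa using h)⟩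
  have hm : MeasurableSet {x : PointList | ¬ Function.Injective x.2} := by
    rw [hset]
    have : {x : PointList | ∃ n, x.1 = n ∧ ∃ i j, i < n ∧ j < n ∧ i ≠ j ∧ x.val i = x.val j} =
        ⋃ n, ⋃ i, ⋃ j, {x | x.1 = n} ∩ ({x | i < n ∧ j < n ∧ i ≠ j} ∩ {x | x.val i = x.val j}) := by
      ext x
      simp only [mem_ofPred_eq, mem_iUnion, mem_inter_iff]
      constructor
      · rintro ⟨n, h1, i, j, h2, h3, h4, h5⟩
        exact ⟨n, i, j, h1, ⟨h2, h3, h4⟩, h5⟩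
      · rintro ⟨n, i, j, h1, ⟨h2, h3, h4⟩, h5⟩
        exact ⟨n, h1, i, j, h2, h3, h4, h5⟩
    rw [this]
    refine MeasurableSet.iUnion fun n => MeasurableSet.iUnion fun i => MeasurableSet.iUnion fun j =>
      (measurable_card (measurableSet_singleton n)).inter (MeasurableSet.inter ?_ ?_)
    · exact MeasurableSet.const _
    · exact measurableSet_eq_fun (measurable_val i) (measurable_val j)
  rw [← lintegral_indicator_one hm, lintegral_poisson μ (measurable_one.indicator hm)]
  refine ENNReal.tsum_eq_zero.2 fun n => ?_
  have : ∫⁻ u, ({x : PointList | ¬ Function.Injective x.2}.indicator 1 : _ → ENNReal) ⟨n, u⟩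
      ∂Measure.pi (fun _ : Fin n => μ) = 0 := by
    have h2 : (fun u : Fin n → ℝ =>
        ({x : PointList | ¬ Function.Injective x.2}.indicator 1 : _ → ENNReal) ⟨n, u⟩) =
        {u : Fin n → ℝ | ¬ Function.Injective u}.indicator 1 := by
      ext u
      simp only [Set.indicator, mem_ofPred_eq, Pi.one_apply]
    rw [h2]
    refine le_antisymm ((lintegral_indicator_one_le _).trans ?_) (zero_le)
    have hsub : {u : Fin n → ℝ | ¬ Function.Injective u} ⊆
        ⋃ i, ⋃ j, {u | i ≠ j ∧ u i = u j} := by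
      intro u hu
      simp only [mem_ofPred_eq, Function.Injective, not_forall] at hu
      obtain ⟨i, j, h, hne⟩ := hu
      exact mem_iUnion.2 ⟨i, mem_iUnion.2 ⟨j, hne, h⟩⟩
    refine (measure_mono hsub).trans (le_of_eq ?_)
    refine measure_iUnion_null fun i => measure_iUnion_null fun j => ?_
    by_cases hij : i = j
    · simp [hij]
    cases n with
    | zero => exact i.elim0
    | succ n =>
      have hmp := measurePreserving_piFinSuccAbove (fun _ : Fin (n + 1) => μ) i
      obtain ⟨k, hk⟩ := Fin.exists_succAbove_eq (Ne.symm hij)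
      have hS : MeasurableSet {p : ℝ × (Fin n → ℝ) | p.1 = p.2 k} :=
        measurableSet_eq_fun measurable_fst ((measurable_pi_apply k).comp measurable_snd)
      have heq : {u : Fin (n + 1) → ℝ | i ≠ j ∧ u i = u j} =
          (MeasurableEquiv.piFinSuccAbove (fun _ => ℝ) i) ⁻¹' {p | p.1 = p.2 k} := by
        ext u
        simp only [mem_ofPred_eq, ne_eq, hij, not_false_eq_true, true_and, mem_preimage,
          MeasurableEquiv.piFinSuccAbove_apply, Fin.insertNthEquiv_symm_apply, Fin.removeNth, hk]
      rw [heq, hmp.measure_preimage hS.nullMeasurableSet, Measure.prod_apply_symm hS]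
      refine (lintegral_congr fun y => ?_).trans lintegral_zero
      have : (fun x : ℝ => (x, y)) ⁻¹' {p : ℝ × (Fin n → ℝ) | p.1 = p.2 k} = {y k} := by
        ext; simp
      rw [this, measure_singleton]
  simp [this]

end PointList

end PoissonPoints

/-! ### Independent Poisson clocks: Mecke formula and void probabilities -/

section Clocks

open PointList
open scoped NNReal

/-- For each clock and each time slab a list of points. -/
abbrev ClockSpace (C : Type) : Type := C × ℕ → PointList

namespace ClockSpace

variable {C : Type}

/-- The `p`-th time slab of length `h`. -/
def slab (h : ℝ) (p : ℕ) : Set ℝ := Ioc (p * h) ((p + 1) * h)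

/-- The times at which the clock `c` rings. -/
def rings (h : ℝ) (ω : ClockSpace C) (c : C) : Set ℝ :=
  {s | ∃ p, ∃ l < (ω (c, p)).1, (ω (c, p)).val l = s ∧ s ∈ slab h p}

open scoped Classical in
/-- The sum of a function over the rings of the clock `c` in the first `P` slabs. -/
noncomputable def ringSum (h : ℝ) (P : ℕ) (c : C) (ω : ClockSpace C) (g : ℝ → ENNReal) : ENNReal :=
  ∑ p ∈ Finset.range P, ∑' l, if l < (ω (c, p)).1 ∧ (ω (c, p)).val l ∈ slab h p
    then g ((ω (c, p)).val l) else 0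

/-- The intensity of the rings of the clock `i.1` in the slab `i.2`. -/
noncomputable def intensity (lam : C → ℝ≥0) (h : ℝ) (i : C × ℕ) : Measure ℝ :=
  lam i.1 • volume.restrict (slab h i.2)

instance (lam : C → ℝ≥0) (h : ℝ) (i : C × ℕ) : IsFiniteMeasure (intensity lam h i) := by
  have : IsFiniteMeasure (volume.restrict (slab h i.2)) := ⟨by simp [slab]⟩
  unfold intensity
  infer_instance

instance (lam : C → ℝ≥0) (h : ℝ) (i : C × ℕ) : NullSingletonClass (intensity lam h i) := ⟨fun x => by
  simp [intensity]⟩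

/-- Independent Poisson clocks with rates `lam`. -/
noncomputable def law (lam : C → ℝ≥0) (h : ℝ) : Measure (ClockSpace C) :=
  Measure.infinitePi fun i => poisson (intensity lam h i)

instance (lam : C → ℝ≥0) (h : ℝ) : IsProbabilityMeasure (law lam h) := by
  unfold law; infer_instance

/-- Resampling a single coordinate independently of the others leaves a product measure invariant.
In this way formulas for a single Poisson process apply to one coordinate of the clock space. -/
theorem lintegral_update {ι : Type*} {X : ι → Type*} [∀ i, MeasurableSpace (X i)] [DecidableEq ι]
    (μ : ∀ i, Measure (X i)) [∀ i, IsProbabilityMeasure (μ i)] (i : ι)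
    {F : (∀ i, X i) → ENNReal} (hF : Measurable F) :
    ∫⁻ ω, F ω ∂Measure.infinitePi μ =
      ∫⁻ ω, ∫⁻ x, F (Function.update ω i x) ∂μ i ∂Measure.infinitePi μ := by
  have hu : Measurable fun q : (∀ i, X i) × X i => Function.update q.1 i q.2 := by
    refine measurable_pi_iff.2 fun j => ?_
    by_cases hj : j = i
    · subst hj; simpa using measurable_snd
    · simp only [Function.update_of_ne hj]
      exact (measurable_pi_apply j).comp measurable_fst
  have hmap : ((Measure.infinitePi μ).prod (μ i)).map (fun q => Function.update q.1 i q.2) =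
      Measure.infinitePi μ := by
    refine Measure.eq_infinitePi μ fun s t ht => ?_
    rw [Measure.map_apply hu (MeasurableSet.pi s.countable_toSet fun i _ => ht i)]
    by_cases hi : i ∈ s
    · have : (fun q : (∀ i, X i) × X i => Function.update q.1 i q.2) ⁻¹' (s : Set ι).pi t =
          (((s.erase i : Finset ι) : Set ι).pi t) ×ˢ (t i) := by
        ext q
        simp only [mem_preimage, Set.mem_pi, Finset.mem_coe, mem_prod, Finset.mem_erase]
        constructor
        · intro hq
          refine ⟨fun j hj => ?_, by simpa using hq i hi⟩
          simpa [Function.update_of_ne hj.1] using hq j hj.2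
        · rintro ⟨h1, h2⟩ j hj
          by_cases hji : j = i
          · subst hji; simpa using h2
          · simpa [Function.update_of_ne hji] using h1 j ⟨hji, hj⟩
      rw [this, Measure.prod_prod, Measure.infinitePi_pi _ fun i _ => ht i, mul_comm,
        Finset.mul_prod_erase s (fun j => μ j (t j)) hi]
    · have : (fun q : (∀ i, X i) × X i => Function.update q.1 i q.2) ⁻¹' (s : Set ι).pi t =
          ((s : Set ι).pi t) ×ˢ univ := by
        ext q
        simp only [mem_preimage, Set.mem_pi, Finset.mem_coe, mem_prod, mem_univ, and_true]
        refine forall₂_congr fun j hj => ?_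
        rw [Function.update_of_ne (ne_of_mem_of_not_mem hj hi)]
      rw [this, Measure.prod_prod, Measure.infinitePi_pi _ fun i _ => ht i, measure_univ, mul_one]
  conv_lhs => rw [← hmap]
  rw [lintegral_map hF hu]
  exact lintegral_prod _ (hF.comp hu).aemeasurable

theorem measurable_coord (i : C × ℕ) : Measurable fun ω : ClockSpace C => ω i :=
  measurable_pi_apply i

theorem measurableSet_slab (h : ℝ) (p : ℕ) : MeasurableSet (slab h p) := measurableSet_Ioc

theorem measurable_ringSum {Θ : Type*} [MeasurableSpace Θ] (h : ℝ) (P : ℕ) (c : C)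
    {w : Θ → ClockSpace C} {F : Θ → ℝ → ENNReal} (hw : Measurable w)
    (hF : Measurable (Function.uncurry F)) : Measurable fun θ => ringSum h P c (w θ) (F θ) := by
  refine Finset.measurable_sum _ fun p _ => Measurable.tsum fun l => ?_
  have h1 : Measurable fun θ => w θ (c, p) := (measurable_coord (c, p)).comp hw
  have h2 : Measurable fun θ => (w θ (c, p)).val l := (measurable_val l).comp h1
  refine Measurable.ite ?_ (hF.comp (measurable_id.prodMk h2)) measurable_const
  exact ((measurable_card.comp h1) (measurableSet_Ioi (a := l))).inter (h2 (measurableSet_slab h p))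

open scoped Classical in
-- An additional ring at v is invisible to every test function that vanishes at v. This expresses,
-- without mentioning configurations, that a functional does not see the ring at v; compare the
-- hypothesis `hinv` of `lintegral_ringSum`.
theorem ringSum_update_insertNth (h : ℝ) (P : ℕ) (c c' : C) (p n : ℕ) (l : Fin (n + 1)) (v : ℝ)
    (u : Fin n → ℝ) (ω : ClockSpace C) {g : ℝ → ENNReal} (hg : g v = 0) :
    ringSum h P c' (Function.update ω (c, p) ⟨n + 1, l.insertNth v u⟩) g =
      ringSum h P c' (Function.update ω (c, p) ⟨n, u⟩) g := by
  unfold ringSum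
  refine Finset.sum_congr rfl fun p' _ => ?_
  by_cases hp : (c', p') = (c, p)
  · have key : ∀ m (w : Fin m → ℝ), (∑' l, if l < m ∧ val ⟨m, w⟩ l ∈ slab h p' then
        g (val ⟨m, w⟩ l) else 0) = ∑ l : Fin m, (slab h p').indicator g (w l) := fun m w => by
      rw [tsum_eq_sum (s := Finset.range m) (fun l hl => by simp at hl; simp [hl]),
        Finset.sum_range]
      refine Finset.sum_congr rfl fun l _ => ?_
      simp [val, Set.indicator]
    rw [hp, Function.update_self, Function.update_self]
    refine (key _ _).trans (Eq.trans ?_ (key _ _).symm)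
    rw [Fin.sum_univ_succAbove _ l, Fin.insertNth_apply_same]
    simp [Set.indicator, hg]
  · rw [Function.update_of_ne hp, Function.update_of_ne hp]

theorem ringSum_nonpos (h : ℝ) (P : ℕ) (c : C) (ω : ClockSpace C) (g : ℝ → ENNReal) :
    ringSum h P c ω g = 0 ↔ ∀ p < P, ∀ l < (ω (c, p)).1, (ω (c, p)).val l ∈ slab h p →
      g ((ω (c, p)).val l) = 0 := by
  simp only [ringSum, Finset.sum_eq_zero_iff, Finset.mem_range, ENNReal.tsum_eq_zero,
    ite_eq_right_iff, and_imp]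

theorem lintegral_Ioc_slab {h : ℝ} (hh : 0 ≤ h) (P : ℕ) (F : ℝ → ENNReal) :
    ∑ p ∈ Finset.range P, ∫⁻ v in slab h p, F v = ∫⁻ v in Ioc 0 (P * h), F v := by
  induction P with
  | zero => simp
  | succ P ih =>
    rw [Finset.sum_range_succ, ih, slab, ← lintegral_union measurableSet_Ioc]
    · congr 2
      push_cast
      exact Ioc_union_Ioc_eq_Ioc (by positivity) (by nlinarith)
    · exact disjoint_left.2 fun x hx hx' => hx'.1.not_ge hx.2

theorem lintegral_intensity (lam : C → ℝ≥0) (h : ℝ) (i : C × ℕ) (F : ℝ → ENNReal) :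
    ∫⁻ v, F v ∂intensity lam h i = lam i.1 * ∫⁻ v in slab h i.2, F v := by
  rw [intensity, lintegral_smul_measure, ENNReal.smul_def, smul_eq_mul]

/-- The Mecke formula: the sum over the rings of a clock becomes an integral. -/
theorem lintegral_ringSum (lam : C → ℝ≥0) {h : ℝ} (hh : 0 ≤ h) (P : ℕ) (c : C)
    {f : ℝ → ClockSpace C → ENNReal} (hf : Measurable (Function.uncurry f))
    (hinv : ∀ v ω ω', (∀ c' (g : ℝ → ENNReal), g v = 0 →
      ringSum h P c' ω' g = ringSum h P c' ω g) → f v ω' = f v ω) :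
    ∫⁻ ω, ringSum h P c ω (fun v => f v ω) ∂law lam h =
      lam c * ∫⁻ v in Ioc 0 (P * h), ∫⁻ ω, f v ω ∂law lam h := by
  classical
  have hterm : ∀ p, ∫⁻ ω, (∑' l, if l < (ω (c, p)).1 ∧ (ω (c, p)).val l ∈ slab h p
      then f ((ω (c, p)).val l) ω else 0) ∂law lam h =
      lam c * ∫⁻ v in slab h p, ∫⁻ ω, f v ω ∂law lam h := fun p => by
    have hm : Measurable fun ω : ClockSpace C => ∑' l, if l < (ω (c, p)).1 ∧
        (ω (c, p)).val l ∈ slab h p then f ((ω (c, p)).val l) ω else 0 := by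
      refine Measurable.tsum fun l => ?_
      have h1 : Measurable fun ω : ClockSpace C => ω (c, p) := measurable_coord (c, p)
      have h2 : Measurable fun ω : ClockSpace C => (ω (c, p)).val l := (measurable_val l).comp h1
      refine Measurable.ite ?_ (hf.comp (h2.prodMk measurable_id)) measurable_const
      exact ((measurable_card.comp h1) (measurableSet_Ioi (a := l))).inter
        (h2 (measurableSet_slab h p))
    have hupd : Measurable fun q : ClockSpace C × PointList => Function.update q.1 (c, p) q.2 := by
      refine measurable_pi_iff.2 fun j => ?_
      by_cases hj : j = (c, p)
      · subst hj; simpa using measurable_snd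
      · simp only [Function.update_of_ne hj]
        exact (measurable_pi_apply j).comp measurable_fst
    -- Given all other coordinates, the sum runs over the points of the single Poisson process with
    -- index (c, p), and the Mecke formula for one process applies.
    rw [law, lintegral_update _ (c, p) hm]
    have hin : ∀ ω : ClockSpace C, ∫⁻ x, (∑' l, if l < (Function.update ω (c, p) x (c, p)).1 ∧
        (Function.update ω (c, p) x (c, p)).val l ∈ slab h p then
        f ((Function.update ω (c, p) x (c, p)).val l) (Function.update ω (c, p) x) else 0)
        ∂poisson (intensity lam h (c, p)) =
        ∫⁻ v, ∫⁻ x, (if v ∈ slab h p then f v (Function.update ω (c, p) x) else 0)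
          ∂poisson (intensity lam h (c, p)) ∂intensity lam h (c, p) := fun ω => by
      have := lintegral_poisson_sum (intensity lam h (c, p))
        (f := fun v x => if v ∈ slab h p then f v (Function.update ω (c, p) x) else 0) ?_ ?_
      · rw [← this]
        refine lintegral_congr fun x => tsum_congr fun l => ?_
        rw [Function.update_self]
        by_cases h1 : l < x.1 <;> simp [h1]
      · refine Measurable.ite (measurable_fst (measurableSet_slab h p)) ?_ measurable_const
        exact hf.comp (measurable_fst.prodMk
          (hupd.comp (measurable_const.prodMk measurable_snd)))
      · intro v n l u
        by_cases hv : v ∈ slab h p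
        · simp only [hv, if_true]
          exact hinv _ _ _ fun c' g hg => ringSum_update_insertNth h P c c' p n l v u ω hg
        · simp [hv]
    simp_rw [hin]
    have hjm : Measurable fun q : (ClockSpace C × ℝ) × PointList =>
        (if q.1.2 ∈ slab h p then f q.1.2 (Function.update q.1.1 (c, p) q.2) else 0) := by
      refine Measurable.ite ((measurable_snd.comp measurable_fst) (measurableSet_slab h p)) ?_
        measurable_const
      exact hf.comp ((measurable_snd.comp measurable_fst).prodMk
        (hupd.comp ((measurable_fst.comp measurable_fst).prodMk measurable_snd)))
    rw [lintegral_lintegral_swap (hjm.lintegral_prod_right').aemeasurable]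
    rw [lintegral_intensity]
    congr 1
    refine setLIntegral_congr_fun (measurableSet_slab h p) fun v hv => ?_
    simp only [hv, if_true]
    exact (lintegral_update _ (c, p) (hf.comp (measurable_const.prodMk measurable_id))).symm
  unfold ringSum
  rw [lintegral_finsetSum]
  · simp_rw [hterm]
    rw [← Finset.mul_sum, lintegral_Ioc_slab hh]
  · intro p _
    refine Measurable.tsum fun l => ?_
    have h1 : Measurable fun ω : ClockSpace C => ω (c, p) := measurable_coord (c, p)
    have h2 : Measurable fun ω : ClockSpace C => (ω (c, p)).val l := (measurable_val l).comp h1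
    refine Measurable.ite ?_ (hf.comp (h2.prodMk measurable_id)) measurable_const
    exact ((measurable_card.comp h1) (measurableSet_Ioi (a := l))).inter
      (h2 (measurableSet_slab h p))

/-- The probability that no clock rings in a given region. -/
theorem law_void (lam : C → ℝ≥0) {h : ℝ} (hh : 0 ≤ h) (P : ℕ) (F : Finset C) {V : C → Set ℝ}
    (hV : ∀ c, MeasurableSet (V c)) (hVF : ∀ c, c ∉ F → V c = ∅)
    (hVP : ∀ c, V c ⊆ Ioc 0 (P * h)) :
    law lam h {ω | ∀ c, ringSum h P c ω ((V c).indicator 1) = 0} =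
      ENNReal.ofReal (Real.exp (-∑ c ∈ F, lam c * volume.real (V c))) := by
  -- Clocks outside of `F` have an empty forbidden region, so that only finitely many coordinates
  -- are constrained and the event is a finite box.
  have hset : {ω : ClockSpace C | ∀ c, ringSum h P c ω ((V c).indicator 1) = 0} =
      ((F ×ˢ Finset.range P : Finset (C × ℕ)) : Set (C × ℕ)).pi
        fun i => {x : PointList | ∀ l : Fin x.1, x.2 l ∉ slab h i.2 ∩ V i.1} := by
    ext ω
    simp only [mem_ofPred_eq, ringSum_nonpos, Set.mem_pi, Finset.mem_coe, Finset.mem_product,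
      Finset.mem_range, Prod.forall, and_imp]
    constructor
    · rintro h1 c p hc hp l ⟨h2, h3⟩
      have := h1 c p hp l l.2 (by simpa [val] using h2)
      simp [val, h3] at this
    · intro h1 c p hp l hl h2
      by_cases hc : c ∈ F
      · have := h1 c p hc hp ⟨l, hl⟩
        simp only [val, hl, dif_pos] at h2 ⊢
        simp only [mem_inter_iff, h2, true_and] at this
        simp [this]
      · simp [hVF c hc]
  have hm : ∀ V : Set ℝ, MeasurableSet V →
      MeasurableSet {x : PointList | ∀ l : Fin x.1, x.2 l ∉ V} := fun V hV => by
    refine measurableSet_setOfPred.2 (measurable_of_forall fun n => ?_)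
    exact measurableSet_setOfPred.1 (by
      have : {u : Fin n → ℝ | ∀ l, u l ∉ V} = ⋂ l, {u | u l ∈ Vᶜ} := by ext; simp
      rw [this]
      exact MeasurableSet.iInter fun l => measurable_pi_apply l hV.compl)
  rw [hset, law, Measure.infinitePi_pi _ fun i _ => hm _ ((measurableSet_slab h i.2).inter (hV i.1))]
  have hone : ∀ i : C × ℕ, poisson (intensity lam h i)
      {x : PointList | ∀ l : Fin x.1, x.2 l ∉ slab h i.2 ∩ V i.1} =
      ENNReal.ofReal (Real.exp (-(lam i.1 * volume.real (slab h i.2 ∩ V i.1)))) := fun i => by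
    rw [poisson_forall_notMem _ ((measurableSet_slab h i.2).inter (hV i.1))]
    congr 3
    simp only [intensity, Measure.real, Measure.smul_apply]
    rw [Measure.restrict_apply ((measurableSet_slab h i.2).inter (hV i.1)), inter_right_comm,
      inter_self, ENNReal.smul_def, smul_eq_mul, ENNReal.toReal_mul]
    rfl
  simp_rw [hone]
  rw [← ENNReal.ofReal_prod_of_nonneg fun _ _ => by positivity, ← Real.exp_sum,
    Finset.sum_neg_distrib, Finset.sum_product]
  congr 3
  refine Finset.sum_congr rfl fun c _ => ?_
  dsimp only
  rw [← Finset.mul_sum]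
  congr 1
  have hfin : ∀ p, volume (slab h p ∩ V c) ≠ ⊤ := fun p =>
    ((measure_mono inter_subset_left).trans_lt (by simp [slab])).ne
  have := lintegral_Ioc_slab hh P ((V c).indicator 1)
  simp only [lintegral_indicator_one (hV c), Measure.restrict_apply (hV c)] at this
  rw [inter_eq_self_of_subset_left (hVP c)] at this
  simp only [Measure.real]
  rw [← ENNReal.toReal_sum fun p _ => hfin p, ← this]
  simp_rw [inter_comm]

end ClockSpace

end Clocks

/-! ### Almost sure properties and independence of the clocks -/

section Clocks

open PointList
open scoped NNReal

namespace ClockSpace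

variable {C : Type}

/-- No two rings coincide. -/
def Good (h : ℝ) (ω : ClockSpace C) : Prop :=
  JumpSystem.NoSim (rings h ω) ∧ ∀ c P s, ringSum h P c ω (indicator {s} 1) ≤ 1

/-- Given the list at j, its finitely many points form a null set for the intensity of the process
at i, which therefore avoids them. -/
theorem law_common_point (lam : C → ℝ≥0) (h : ℝ) {i j : C × ℕ} (hij : i ≠ j) :
    law lam h {ω | ∃ l < (ω i).1, ∃ l' < (ω j).1, (ω i).val l = (ω j).val l'} = 0 := by
  classical
  have hm : MeasurableSet {ω : ClockSpace C | ∃ l < (ω i).1, ∃ l' < (ω j).1,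
      (ω i).val l = (ω j).val l'} := by
    have : {ω : ClockSpace C | ∃ l < (ω i).1, ∃ l' < (ω j).1, (ω i).val l = (ω j).val l'} =
        ⋃ l, ⋃ l', {ω | l < (ω i).1} ∩ ({ω | l' < (ω j).1} ∩ {ω | (ω i).val l = (ω j).val l'}) := by
      ext ω
      simp only [mem_ofPred_eq, mem_iUnion, mem_inter_iff]
      constructor
      · rintro ⟨l, h1, l', h2, h3⟩
        exact ⟨l, l', h1, h2, h3⟩
      · rintro ⟨l, l', h1, h2, h3⟩
        exact ⟨l, h1, l', h2, h3⟩
    rw [this]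
    refine MeasurableSet.iUnion fun l => MeasurableSet.iUnion fun l' => ?_
    refine ((measurable_card.comp (measurable_coord i)) (measurableSet_Ioi (a := l))).inter
      (((measurable_card.comp (measurable_coord j)) (measurableSet_Ioi (a := l'))).inter ?_)
    exact measurableSet_eq_fun ((measurable_val l).comp (measurable_coord i))
      ((measurable_val l').comp (measurable_coord j))
  rw [← lintegral_indicator_one hm, law, lintegral_update _ i (measurable_one.indicator hm)]
  refine (lintegral_congr fun ω => ?_).trans lintegral_zero
  set W : Set ℝ := (fun l' => (ω j).val l') '' {l' | l' < (ω j).1} with hW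
  have hWf : W.Finite := (Set.finite_lt_nat _).image _
  have h0 : poisson (intensity lam h i) {x | ∀ l : Fin x.1, x.2 l ∉ W} = 1 := by
    rw [poisson_forall_notMem _ hWf.measurableSet]
    have : (intensity lam h i).real W = 0 := by
      simp [Measure.real, hWf.measure_zero]
    simp [this]
  have hWm : MeasurableSet {x : PointList | ∀ l : Fin x.1, x.2 l ∉ W} := by
    refine measurableSet_setOfPred.2 (measurable_of_forall fun n => ?_)
    exact measurableSet_setOfPred.1 (by
      have : {u : Fin n → ℝ | ∀ l, u l ∉ W} = ⋂ l, {u | u l ∈ Wᶜ} := by ext; simp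
      rw [this]
      exact MeasurableSet.iInter fun l => measurable_pi_apply l hWf.measurableSet.compl)
  have hae : ∀ᵐ x ∂poisson (intensity lam h i), x ∈ {x : PointList | ∀ l : Fin x.1, x.2 l ∉ W} := by
    rw [ae_iff]
    exact (prob_compl_eq_zero_iff hWm).2 h0
  refine (lintegral_congr_ae ?_).trans lintegral_zero
  filter_upwards [hae] with x hx
  rw [indicator_of_notMem]
  rintro ⟨l, hl, l', hl', h2⟩
  rw [Function.update_self] at hl h2
  rw [Function.update_of_ne hij.symm] at hl' h2
  refine hx ⟨l, hl⟩ ⟨l', hl', ?_⟩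
  simpa [val, hl] using h2.symm

theorem ae_good [Countable C] (lam : C → ℝ≥0) {h : ℝ} : ∀ᵐ ω ∂law lam h, Good h ω := by
  have h1 : ∀ᵐ ω ∂law lam h, ∀ i, Function.Injective (ω i).2 := by
    refine ae_all_iff.2 fun i => ?_
    have := (Measure.infinitePi_map_eval (fun i => poisson (intensity lam h i)) i)
    have h2 := poisson_not_injective (intensity lam h i)
    rw [← this] at h2
    exact ae_of_ae_map (f := fun ω : ClockSpace C => ω i) (measurable_coord i).aemeasurable
      (p := fun x : PointList => Function.Injective x.2) (ae_iff.2 h2)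
  have h2 : ∀ᵐ ω ∂law lam h, ∀ i j, i ≠ j →
      ¬ ∃ l < (ω i).1, ∃ l' < (ω j).1, (ω i).val l = (ω j).val l' := by
    refine ae_all_iff.2 fun i => ae_all_iff.2 fun j => ?_
    by_cases hij : i = j
    · exact Eventually.of_forall fun _ h => absurd hij h
    · have := law_common_point lam h hij
      filter_upwards [measure_eq_zero_iff_ae_notMem.1 this] with ω hω _ using hω
  filter_upwards [h1, h2] with ω hω1 hω2
  constructor
  · rintro c c' s ⟨p, l, hl, rfl, -⟩ ⟨p', l', hl', h3, -⟩
    by_contra hne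
    exact hω2 (c, p) (c', p') (by simp [hne]) ⟨l, hl, l', hl', h3.symm⟩
  · intro c P s
    by_cases hz : ringSum h P c ω (indicator {s} 1) = 0
    · rw [hz]; exact zero_le_one
    rw [ringSum_nonpos] at hz
    push Not at hz
    obtain ⟨p, hp, l, hl, hs, hne⟩ := hz
    have hvs : (ω (c, p)).val l = s := by
      by_contra hne'
      exact hne (by simp [hne'])
    unfold ringSum
    rw [Finset.sum_eq_single p, tsum_eq_single l]
    · split_ifs
      · exact indicator_le_self' (by simp) _
      · exact zero_le_one
    · intro l' hl'
      split_ifs with hc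
      · refine indicator_of_notMem (fun hmem => hl' ?_) _
        have heq : (ω (c, p)).val l' = (ω (c, p)).val l := (mem_singleton_iff.1 hmem).trans hvs.symm
        have := @hω1 (c, p) ⟨l', hc.1⟩ ⟨l, hl⟩ (by simpa [val, hc.1, hl] using heq)
        simpa using this
      · rfl
    · intro p' _ hpp
      refine ENNReal.tsum_eq_zero.2 fun l' => ?_
      split_ifs with hc
      · refine indicator_of_notMem (fun hmem => ?_) _
        exact hω2 (c, p') (c, p) (by simp [hpp]) ⟨l', hc.1, l, hl,
          (mem_singleton_iff.1 hmem).trans hvs.symm⟩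
      · rfl
    · intro h'
      exact absurd (Finset.mem_range.2 hp) h'

theorem mem_slab_le_iff {h : ℝ} (hh : 0 < h) {p P : ℕ} {v : ℝ} (hv : v ∈ slab h p) :
    v ≤ P * h ↔ p < P := by
  constructor
  · intro h1
    have : (p : ℝ) < P := lt_of_mul_lt_mul_right (hv.1.trans_le h1) hh.le
    exact_mod_cast this
  · intro h1
    refine hv.2.trans (mul_le_mul_of_nonneg_right ?_ hh.le)
    exact_mod_cast h1

theorem ringSum_eq_zero_iff {h : ℝ} (hh : 0 < h) (P : ℕ) (c : C) (ω : ClockSpace C)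
    (g : ℝ → ENNReal) : ringSum h P c ω g = 0 ↔ ∀ v ∈ rings h ω c, v ≤ P * h → g v = 0 := by
  rw [ringSum_nonpos]
  constructor
  · rintro h1 v ⟨p, l, hl, rfl, hs⟩ hv
    exact h1 p ((mem_slab_le_iff hh hs).1 hv) l hl hs
  · intro h1 p hp l hl hs
    exact h1 _ ⟨p, l, hl, rfl, hs⟩ ((mem_slab_le_iff hh hs).2 hp)

theorem ringSum_const_mul (h : ℝ) (P : ℕ) (c : C) (ω : ClockSpace C) (a : ENNReal)
    (g : ℝ → ENNReal) : ringSum h P c ω (fun v => a * g v) = a * ringSum h P c ω g := by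
  unfold ringSum
  rw [Finset.mul_sum]
  refine Finset.sum_congr rfl fun p _ => ?_
  rw [← ENNReal.tsum_mul_left]
  refine tsum_congr fun l => ?_
  split_ifs <;> simp

theorem ringSum_congr {h : ℝ} (hh : 0 < h) (P : ℕ) (c : C) (ω : ClockSpace C)
    {g g' : ℝ → ENNReal} (hg : ∀ v ∈ rings h ω c, v ≤ P * h → g v = g' v) :
    ringSum h P c ω g = ringSum h P c ω g' := by
  unfold ringSum
  refine Finset.sum_congr rfl fun p hp => tsum_congr fun l => ?_
  split_ifs with h1
  · exact hg _ ⟨p, l, h1.1, rfl, h1.2⟩ ((mem_slab_le_iff hh h1.2).2 (Finset.mem_range.1 hp))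
  · rfl

/-- The second clause of `Good` guarantees that a ring is listed only once; otherwise g s would be
counted several times. -/
theorem Good.ringSum_single {h : ℝ} (hh : 0 < h) {P : ℕ} {c : C} {ω : ClockSpace C}
    (hω : Good h ω) {g : ℝ → ENNReal} {s : ℝ} (hs : s ∈ rings h ω c) (hsP : s ≤ P * h)
    (hg : ∀ v ∈ rings h ω c, v ≤ P * h → v ≠ s → g v = 0) : ringSum h P c ω g = g s := by
  rw [ringSum_congr hh P c ω (g' := fun v => g s * indicator {s} 1 v), ringSum_const_mul,
    le_antisymm (hω.2 c P s) ?_, mul_one]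
  · obtain ⟨p, l, hl, h1, h2⟩ := hs
    have hp : p < P := (mem_slab_le_iff hh h2).1 hsP
    unfold ringSum
    refine le_trans ?_ (Finset.single_le_sum (fun _ _ => zero_le) (Finset.mem_range.2 hp))
    refine le_trans ?_ (ENNReal.le_tsum l)
    simp [hl, h1, h2]
  · intro v hv hvP
    by_cases hvs : v = s
    · simp [hvs]
    · simp [hvs, hg v hv hvP hvs]

open scoped Classical in
/-- Only the points with index in `K` are kept. -/
noncomputable def silence (K : Set (C × ℕ)) (ω : ClockSpace C) : ClockSpace C :=
  fun i => if i ∈ K then ω i else ⟨0, Fin.elim0⟩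

theorem measurable_silence (K : Set (C × ℕ)) : Measurable (silence K) := by
  refine measurable_pi_iff.2 fun i => ?_
  by_cases hi : i ∈ K
  · simpa [silence, hi] using measurable_coord i
  · simp [silence, hi]

theorem mem_rings_silence {h : ℝ} {K : Set (C × ℕ)} {ω : ClockSpace C} {c : C} {s : ℝ} :
    s ∈ rings h (silence K ω) c ↔
      ∃ p, (c, p) ∈ K ∧ ∃ l < (ω (c, p)).1, (ω (c, p)).val l = s ∧ s ∈ slab h p := by
  constructor
  · rintro ⟨p, l, hl, h1, h2⟩
    by_cases hK : (c, p) ∈ K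
    · simp only [silence, hK, if_true] at hl h1
      exact ⟨p, hK, l, hl, h1, h2⟩
    · simp [silence, hK] at hl
  · rintro ⟨p, hK, l, hl, h1, h2⟩
    exact ⟨p, l, by simpa [silence, hK] using hl, by simpa [silence, hK] using h1, h2⟩

theorem silence_silence (K K' : Set (C × ℕ)) (ω : ClockSpace C) :
    silence K (silence K' ω) = silence (K ∩ K') ω := by
  ext1 i
  by_cases hi : i ∈ K <;> by_cases hi' : i ∈ K' <;> simp [silence, hi, hi']

/-- The event `E` depends only on the points with index in `K`. -/
def DependsOn (K : Set (C × ℕ)) (E : Set (ClockSpace C)) : Prop := ∀ ω, silence K ω ∈ E ↔ ω ∈ E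

theorem DependsOn.mono {K K' : Set (C × ℕ)} (hK : K ⊆ K') {E : Set (ClockSpace C)}
    (h : DependsOn K E) : DependsOn K' E := fun ω => by
  rw [← h, ← h ω, silence_silence, inter_eq_self_of_subset_left hK]

theorem DependsOn.preimage_silence (K : Set (C × ℕ)) (E : Set (ClockSpace C)) :
    DependsOn K (silence K ⁻¹' E) := fun ω => by
  rw [mem_preimage, mem_preimage, silence_silence, inter_self]

/-- An event that depends only on the points with index in K is its own preimage under `silence K`,
hence measurable with respect to the coordinates in K; disjoint blocks of coordinates are
independent. -/
theorem law_inter (lam : C → ℝ≥0) (h : ℝ) {K K' : Set (C × ℕ)} (hKK : Disjoint K K')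
    {E E' : Set (ClockSpace C)} (hE : MeasurableSet E) (hE' : MeasurableSet E')
    (hK : DependsOn K E) (hK' : DependsOn K' E') :
    law lam h (E ∩ E') = law lam h E * law lam h E' := by
  have hind : ProbabilityTheory.iIndep
      (fun i : C × ℕ => MeasurableSpace.comap (fun ω : ClockSpace C => ω i) inferInstance)
      (law lam h) :=
    (ProbabilityTheory.iIndepFun_infinitePi (X := fun _ x => x)
      (P := fun i => poisson (intensity lam h i)) fun _ => measurable_id).iIndep
  have h1 := ProbabilityTheory.indep_iSup_of_disjoint
    (fun i => (measurable_coord i).comap_le) hind hKK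
  have key : ∀ (K : Set (C × ℕ)) (E : Set (ClockSpace C)), MeasurableSet E → DependsOn K E →
      MeasurableSet[⨆ i ∈ K, MeasurableSpace.comap (fun ω : ClockSpace C => ω i) inferInstance]
        E := by
    intro K E hE hK
    have h2 : E = silence K ⁻¹' E := by ext ω; exact (hK ω).symm
    rw [h2]
    refine MeasurableSet.preimage hE ?_
    refine (@measurable_pi_iff _ _ _ (_) _ _).2 fun i => ?_
    by_cases hi : i ∈ K
    · have : (fun ω : ClockSpace C => silence K ω i) = fun ω => ω i := by
        ext1 ω; simp [silence, hi]
      rw [this]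
      exact Measurable.mono (comap_measurable _) (le_iSup₂_of_le i hi le_rfl) le_rfl
    · have : (fun ω : ClockSpace C => silence K ω i) = fun ω => ⟨0, Fin.elim0⟩ := by
        ext1 ω; simp [silence, hi]
      rw [this]
      exact measurable_const
  exact (ProbabilityTheory.Indep_iff _ _ _).1 h1 E E' (key K E hE hK) (key K' E' hE' hK')

theorem law_iInter (lam : C → ℝ≥0) (h : ℝ) {ι : Type*} (s : Finset ι) {K : ι → Set (C × ℕ)}
    (hKK : ∀ i ∈ s, ∀ j ∈ s, i ≠ j → Disjoint (K i) (K j)) {E : ι → Set (ClockSpace C)}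
    (hE : ∀ i, MeasurableSet (E i)) (hK : ∀ i, DependsOn (K i) (E i)) :
    law lam h (⋂ i ∈ s, E i) = ∏ i ∈ s, law lam h (E i) := by
  classical
  induction s using Finset.induction_on with
  | empty => simp
  | insert i s hi ih =>
    rw [Finset.prod_insert hi, ← ih fun j hj k hk => hKK j (by simp [hj]) k (by simp [hk]),
      Finset.set_biInter_insert]
    refine law_inter lam h (K := K i) (K' := ⋃ j ∈ s, K j) ?_ (hE i)
      (Finset.measurableSet_biInter _ fun j _ => hE j) (hK i) ?_
    · rw [disjoint_iUnion₂_right]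
      exact fun j hj => hKK i (by simp) j (by simp [hj]) fun h => hi (h ▸ hj)
    · intro ω
      simp only [mem_iInter]
      refine forall₂_congr fun j hj => ?_
      exact (hK j).mono (subset_biUnion_of_mem (u := fun j => K j) hj) ω

theorem Good.silence {h : ℝ} {ω : ClockSpace C} (hω : Good h ω) (K : Set (C × ℕ)) :
    Good h (silence K ω) := by
  constructor
  · intro c c' s hs hs'
    obtain ⟨p, -, hs⟩ := mem_rings_silence.1 hs
    obtain ⟨p', -, hs'⟩ := mem_rings_silence.1 hs'
    exact hω.1 c c' s ⟨p, hs⟩ ⟨p', hs'⟩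
  · intro c P s
    refine le_trans ?_ (hω.2 c P s)
    refine Finset.sum_le_sum fun p _ => ENNReal.tsum_le_tsum fun l => ?_
    by_cases hK : (c, p) ∈ K
    · have : ClockSpace.silence K ω (c, p) = ω (c, p) := by simp [ClockSpace.silence, hK]
      rw [this]
    · simp [ClockSpace.silence, hK]

end ClockSpace

end Clocks

/-! ### The law of a run as a sum of iterated integrals -/

namespace JumpSystem

open ClockSpace
open scoped NNReal

variable {σ C O : Type} (J : JumpSystem σ C) (obs : σ → O) (lam : C → ℝ≥0)

/-- The path that stays in `x` until time `τ` and follows `p` afterwards. -/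
noncomputable def glue (x : O) (τ : ℝ) (p : ℝ → O) : ℝ → O := fun s => if τ ≤ s then p s else x

/-- The observed trajectory of a list of moves. -/
noncomputable def path (z : σ) (l : List (C × ℝ)) : ℝ → O := fun s => obs (J.stateAt z l s)

/-- The total rate of the enabled moves. -/
noncomputable def totalRate (z : σ) : ℝ := ∑ c ∈ J.en z, (lam c : ℝ)

theorem path_cons (z : σ) (e : C × ℝ) (l : List (C × ℝ)) :
    J.path obs z (e :: l) = glue (obs z) e.2 (J.path obs (J.step e.1 z) l) := by
  ext1 s
  simp only [path, glue, stateAt]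
  split_ifs <;> rfl

theorem totalRate_nonneg (z : σ) : 0 ≤ J.totalRate lam z :=
  Finset.sum_nonneg fun _ _ => NNReal.coe_nonneg _

theorem measurable_glue [MeasurableSpace O] (x : O) : Measurable fun q : ℝ × (ℝ → O) => glue x q.1 q.2 := by
  refine measurable_pi_iff.2 fun s => ?_
  exact Measurable.ite (measurable_fst measurableSet_Iic)
    ((measurable_pi_apply s).comp measurable_snd) measurable_const

/-- The integral of `G` over the trajectories with exactly `k` jumps during `(a, b]`. -/
noncomputable def jumpInt : ℕ → σ → ℝ → ℝ → ((ℝ → O) → ENNReal) → ENNReal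
  | 0, z, a, b, G => ENNReal.ofReal (Real.exp (-(J.totalRate lam z * (b - a)))) * G fun _ => obs z
  | k + 1, z, a, b, G => ∑ c ∈ J.en z, lam c * ∫⁻ v in Ioc a b,
      ENNReal.ofReal (Real.exp (-(J.totalRate lam z * (v - a)))) *
        jumpInt k (J.step c z) v b fun p => G (glue (obs z) v p)

/-- The parameter space is arbitrary because the induction enlarges it: the time of the first jump
becomes a parameter of the integral over the later ones. -/
theorem measurable_jumpInt [MeasurableSpace O] (k : ℕ) (b : ℝ) {Θ : Type} [MeasurableSpace Θ] (z : σ) {a : Θ → ℝ}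
    {G : Θ → (ℝ → O) → ENNReal} (ha : Measurable a) (hG : Measurable (Function.uncurry G)) :
    Measurable fun θ => J.jumpInt obs lam k z (a θ) b (G θ) := by
  induction k generalizing Θ z with
  | zero =>
    simp only [jumpInt]
    refine Measurable.mul ?_ (hG.comp (measurable_id.prodMk measurable_const))
    fun_prop
  | succ k ih =>
    simp only [jumpInt]
    refine Finset.measurable_fun_sum _ fun c _ => Measurable.const_mul ?_ _
    simp_rw [← lintegral_indicator measurableSet_Ioc]
    refine Measurable.lintegral_prod_right' (f := fun q : Θ × ℝ => (Ioc (a q.1) b).indicator (fun v =>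
      ENNReal.ofReal (Real.exp (-(J.totalRate lam z * (v - a q.1)))) *
        J.jumpInt obs lam k (J.step c z) v b fun p => G q.1 (glue (obs z) v p)) q.2) ?_
    simp only [Set.indicator]
    refine Measurable.ite ?_ (Measurable.mul (by fun_prop) ?_) measurable_const
    · exact (measurableSet_lt (ha.comp measurable_fst) measurable_snd).inter
        (measurable_snd measurableSet_Iic)
    · refine ih (J.step c z) (Θ := Θ × ℝ) (a := fun q => q.2)
        (G := fun q p => G q.1 (glue (obs z) q.2 p)) measurable_snd ?_
      refine hG.comp ((measurable_fst.comp measurable_fst).prodMk ?_)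
      exact (measurable_glue (obs z)).comp ((measurable_snd.comp measurable_fst).prodMk measurable_snd)

/-- No clock rings in the region `V`. -/
def Void (h : ℝ) (P : ℕ) (V : C → Set ℝ) (ω : ClockSpace C) : Prop :=
  ∀ c, ringSum h P c ω ((V c).indicator 1) = 0

/-- The region `V`, enlarged by the time interval `I` for the enabled clocks. -/
def addVoid (V : C → Set ℝ) (z : σ) (I : Set ℝ) : C → Set ℝ := fun c => V c ∪ {s | c ∈ J.en z ∧ s ∈ I}

open scoped Classical in
/-- The sum of `G` over the runs with exactly `k` moves during `(a, b]`, provided that no clock rings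
in `V`. -/
noncomputable def runSum (h : ℝ) (P : ℕ) : ℕ → (C → Set ℝ) → σ → ℝ → ℝ → ((ℝ → O) → ENNReal) →
    ClockSpace C → ENNReal
  | 0, V, z, a, b, G, ω => if Void h P (J.addVoid V z (Ioc a b)) ω then G fun _ => obs z else 0
  | k + 1, V, z, a, b, G, ω => ∑ c ∈ J.en z, ringSum h P c ω fun v => if v ∈ Ioc a b then
      runSum h P k (J.addVoid V z (Ioo a v)) (J.step c z) v b (fun p => G (glue (obs z) v p)) ω else 0

variable {h : ℝ} {P : ℕ}

theorem measurable_void [Countable C] {Θ : Type} [MeasurableSpace Θ] {V : Θ → C → Set ℝ}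
    {w : Θ → ClockSpace C} (hw : Measurable w)
    (hV : ∀ c, MeasurableSet {q : Θ × ℝ | q.2 ∈ V q.1 c}) :
    MeasurableSet {θ | Void h P (V θ) (w θ)} := by
  have : {θ | Void h P (V θ) (w θ)} =
      ⋂ c, {θ | ringSum h P c (w θ) ((V θ c).indicator 1) = 0} := by ext; simp [Void]
  rw [this]
  refine MeasurableSet.iInter fun c => ?_
  exact (measurable_ringSum h P c hw (F := fun θ => (V θ c).indicator 1)
    (measurable_one.indicator (hV c))) (measurableSet_singleton 0)

theorem measurable_runSum [Countable C] [MeasurableSpace O] (k : ℕ) (b : ℝ) {Θ : Type} [MeasurableSpace Θ]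
    (z : σ) {V : Θ → C → Set ℝ} {a : Θ → ℝ} {G : Θ → (ℝ → O) → ENNReal} {w : Θ → ClockSpace C}
    (hw : Measurable w) (hV : ∀ c, MeasurableSet {q : Θ × ℝ | q.2 ∈ V q.1 c}) (ha : Measurable a)
    (hG : Measurable (Function.uncurry G)) :
    Measurable fun θ => J.runSum obs h P k (V θ) z (a θ) b (G θ) (w θ) := by
  induction k generalizing Θ z with
  | zero =>
    simp only [runSum]
    refine Measurable.ite (measurable_void hw fun c => ?_)
      (hG.comp (measurable_id.prodMk measurable_const)) measurable_const
    refine (hV c).union ?_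
    refine (MeasurableSet.const (c ∈ J.en z)).inter ?_
    exact (measurableSet_lt (ha.comp measurable_fst) measurable_snd).inter
        (measurable_snd measurableSet_Iic)
  | succ k ih =>
    simp only [runSum]
    refine Finset.measurable_fun_sum _ fun c _ => measurable_ringSum h P c hw ?_
    refine Measurable.ite ?_ ?_ measurable_const
    · exact (measurableSet_lt (ha.comp measurable_fst) measurable_snd).inter
        (measurable_snd measurableSet_Iic)
    · refine ih (J.step c z) (Θ := Θ × ℝ) (V := fun q => J.addVoid (V q.1) z (Ioo (a q.1) q.2))
        (a := fun q => q.2) (G := fun q p => G q.1 (glue (obs z) q.2 p)) (w := fun q => w q.1)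
        (hw.comp measurable_fst) (fun c' => ?_) measurable_snd ?_
      · refine MeasurableSet.union ?_ ?_
        · exact ((measurable_fst.comp measurable_fst).prodMk measurable_snd) (hV c')
        · refine (MeasurableSet.const (c' ∈ J.en z)).inter ?_
          exact (measurableSet_lt (ha.comp (measurable_fst.comp measurable_fst)) measurable_snd).inter
            (measurableSet_lt measurable_snd (measurable_snd.comp measurable_fst))
      · refine hG.comp ((measurable_fst.comp measurable_fst).prodMk ?_)
        exact (measurable_glue (obs z)).comp
          ((measurable_snd.comp measurable_fst).prodMk measurable_snd)

/-- The sum refers only to rings after a and to the forbidden region, so a ring at v ≤ a outside of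
that region has no influence. This is the hypothesis under which the Mecke formula can be applied to
the first ring. -/
theorem runSum_congr (k : ℕ) {V : C → Set ℝ} {z : σ} {a b v : ℝ} {G : (ℝ → O) → ENNReal}
    {ω ω' : ClockSpace C}
    (hω : ∀ c' (g : ℝ → ENNReal), g v = 0 → ringSum h P c' ω' g = ringSum h P c' ω g)
    (hV : ∀ c, v ∉ V c) (hv : v ≤ a) :
    J.runSum obs h P k V z a b G ω' = J.runSum obs h P k V z a b G ω := by
  have hadd : ∀ I : Set ℝ, v ∉ I → ∀ c, v ∉ J.addVoid V z I c := fun I hI c hc =>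
    hc.elim (hV c) fun h => hI h.2
  induction k generalizing V z a G with
  | zero =>
    have : Void h P (J.addVoid V z (Ioc a b)) ω' ↔ Void h P (J.addVoid V z (Ioc a b)) ω := by
      refine forall_congr' fun c => ?_
      rw [hω]
      exact indicator_of_notMem (hadd _ (fun hm => hm.1.not_ge hv) c) _
    by_cases hvoid : Void h P (J.addVoid V z (Ioc a b)) ω
    · simp only [runSum, if_pos hvoid, if_pos (this.2 hvoid)]
    · simp only [runSum, if_neg hvoid, if_neg (mt this.1 hvoid)]
  | succ k ih =>
    simp only [runSum]
    refine Finset.sum_congr rfl fun c _ => ?_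
    rw [hω _ _ (if_neg fun hm => hm.1.not_ge hv)]
    congr 1
    ext1 v'
    by_cases hv' : v' ∈ Ioc a b
    · rw [if_pos hv', if_pos hv']
      have hn : ∀ c, v ∉ J.addVoid V z (Ioo a v') c := hadd _ fun hm => hm.1.not_ge hv
      refine ih hn (hv.trans hv'.1.le) fun I hI c hc => ?_
      exact hc.elim (hn c) fun h => hI h.2
    · rw [if_neg hv', if_neg hv']

/-- The old forbidden region lies in the past of a and is disjoint from the new piece, so the
volumes add up and the void probability acquires exactly the factor of an exponential holding time.
-/
theorem measureReal_addVoid {V : C → Set ℝ} {F : Finset C} [DecidableEq C] (z : σ) {a v : ℝ}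
    (hVF : ∀ c, c ∉ F → V c = ∅) (hVa : ∀ c, V c ⊆ Ioc 0 a) {I : Set ℝ}
    (hI : I ⊆ Ioc a v) (hIm : MeasurableSet I) (hIv : volume.real I = v - a) :
    ∑ c ∈ F ∪ J.en z, lam c * volume.real (J.addVoid V z I c) =
      ∑ c ∈ F, lam c * volume.real (V c) + J.totalRate lam z * (v - a) := by
  have h1 : ∀ c, volume.real (J.addVoid V z I c) =
      volume.real (V c) + if c ∈ J.en z then v - a else 0 := fun c => by
    by_cases hc : c ∈ J.en z
    · have : J.addVoid V z I c = V c ∪ I := by simp [addVoid, hc]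
      rw [this, measureReal_union (disjoint_left.2 fun s hs hs' => (hI hs').1.not_ge (hVa c hs).2) hIm
        ((measure_mono (hVa c)).trans_lt (by simp)).ne ((measure_mono hI).trans_lt (by simp)).ne,
        hIv, if_pos hc]
    · have : J.addVoid V z I c = V c := by simp [addVoid, hc]
      rw [this, if_neg hc, add_zero]
  simp_rw [h1, mul_add]
  rw [Finset.sum_add_distrib]
  congr 1
  · refine (Finset.sum_subset Finset.subset_union_left fun c _ hc => ?_).symm
    simp [hVF c hc]
  · rw [totalRate, Finset.sum_mul]
    simp only [mul_ite, mul_zero]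
    rw [← Finset.sum_filter]
    congr 1
    ext c
    simp +contextual

/-- The expected sum over the runs with `k` moves. -/
theorem lintegral_runSum [Countable C] [MeasurableSpace O] (hh : 0 ≤ h) (k : ℕ) (z : σ) {a b : ℝ} (ha : 0 ≤ a)
    (hab : a ≤ b) (hb : b ≤ P * h) {V : C → Set ℝ} {F : Finset C} {G : (ℝ → O) → ENNReal}
    (hG : Measurable G) (hV : ∀ c, MeasurableSet (V c)) (hVF : ∀ c, c ∉ F → V c = ∅)
    (hVa : ∀ c, V c ⊆ Ioc 0 a) :
    ∫⁻ ω, J.runSum obs h P k V z a b G ω ∂law lam h =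
      ENNReal.ofReal (Real.exp (-∑ c ∈ F, lam c * volume.real (V c))) *
        J.jumpInt obs lam k z a b G := by
  classical
  induction k generalizing z a V F G with
  | zero =>
    have hVm : ∀ c, MeasurableSet (J.addVoid V z (Ioc a b) c) := fun c =>
      (hV c).union ((MeasurableSet.const (c ∈ J.en z)).inter measurableSet_Ioc)
    have hm : MeasurableSet {ω : ClockSpace C | Void h P (J.addVoid V z (Ioc a b)) ω} :=
      measurable_void measurable_id fun c => measurable_snd (hVm c)
    have h1 : ∀ ω, J.runSum obs h P 0 V z a b G ω =
        {ω | Void h P (J.addVoid V z (Ioc a b)) ω}.indicator (fun _ => G fun _ => obs z) ω :=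
      fun ω => rfl
    simp_rw [h1]
    rw [lintegral_indicator hm, setLIntegral_const]
    have h2 := law_void lam hh P (F ∪ J.en z) hVm (fun c hc => ?_) (fun c => ?_)
    · unfold Void
      rw [h2, measureReal_addVoid J lam z hVF hVa (Subset.refl _) measurableSet_Ioc
        (by simp [hab]), neg_add, Real.exp_add, ENNReal.ofReal_mul (by positivity), jumpInt]
      ring
    · simp only [Finset.mem_union, not_or] at hc
      simp [addVoid, hVF c hc.1, hc.2]
    · refine union_subset ((hVa c).trans (Ioc_subset_Ioc_right (hab.trans hb))) fun s hs => ?_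
      exact ⟨ha.trans_lt hs.2.1, hs.2.2.trans hb⟩
  | succ k ih =>
    simp only [runSum, jumpInt]
    have hfm : ∀ c, Measurable (Function.uncurry fun (v : ℝ) (ω : ClockSpace C) =>
        if v ∈ Ioc a b then J.runSum obs h P k (J.addVoid V z (Ioo a v)) (J.step c z) v b
          (fun p => G (glue (obs z) v p)) ω else 0) := fun c => by
      refine Measurable.ite (measurable_fst measurableSet_Ioc) ?_ measurable_const
      refine J.measurable_runSum obs k b (Θ := ℝ × ClockSpace C) (J.step c z)
        (V := fun q => J.addVoid V z (Ioo a q.1)) (a := fun q => q.1)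
        (G := fun q p => G (glue (obs z) q.1 p)) (w := fun q => q.2) measurable_snd (fun c' => ?_)
        measurable_fst ?_
      · refine MeasurableSet.union (measurable_snd (hV c')) ?_
        refine (MeasurableSet.const (c' ∈ J.en z)).inter ?_
        exact (measurable_snd measurableSet_Ioi).inter
          (measurableSet_lt measurable_snd (measurable_fst.comp measurable_fst))
      · exact hG.comp ((measurable_glue (obs z)).comp
          ((measurable_fst.comp measurable_fst).prodMk measurable_snd))
    rw [lintegral_finsetSum]
    · rw [Finset.mul_sum]
      refine Finset.sum_congr rfl fun c _ => ?_
      -- The Mecke formula replaces the first ring by an integral over its time v. The requirement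
      -- that no enabled clock rings before v is added to the forbidden region and is paid for only
      -- at the end of the recursion.
      rw [lintegral_ringSum lam hh P c (hfm c)]
      · rw [← mul_assoc, mul_comm (ENNReal.ofReal _), mul_assoc]
        congr 1
        rw [← lintegral_const_mul' _ _ ENNReal.ofReal_ne_top,
          ← lintegral_indicator measurableSet_Ioc, ← lintegral_indicator measurableSet_Ioc]
        refine lintegral_congr fun v => ?_
        by_cases hv : v ∈ Ioc a b
        · have hv' : v ∈ Ioc 0 (P * h) := ⟨ha.trans_lt hv.1, hv.2.trans hb⟩
          rw [indicator_of_mem hv', indicator_of_mem hv]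
          simp only [hv, if_true]
          rw [ih (J.step c z) (ha.trans hv.1.le) hv.2 (V := J.addVoid V z (Ioo a v)) (F := F ∪ J.en z)
            (G := fun p => G (glue (obs z) v p))
            (hG.comp ((measurable_glue (obs z)).comp (measurable_const.prodMk measurable_id)))
            (fun c' => (hV c').union ((MeasurableSet.const (c' ∈ J.en z)).inter measurableSet_Ioo))
            (fun c' hc' => ?_) (fun c' => ?_),
            measureReal_addVoid J lam z hVF hVa Ioo_subset_Ioc_self measurableSet_Ioo
              (by simp [hv.1.le]), neg_add, Real.exp_add, ENNReal.ofReal_mul (by positivity)]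
          · ring
          · simp only [Finset.mem_union, not_or] at hc'
            simp [addVoid, hVF c' hc'.1, hc'.2]
          · refine union_subset ((hVa c').trans (Ioc_subset_Ioc_right hv.1.le)) fun s hs => ?_
            exact ⟨ha.trans_lt hs.2.1, hs.2.2.le⟩
        · rw [indicator_of_notMem hv]
          refine indicator_apply_eq_zero.2 fun _ => ?_
          simp only [if_neg hv, lintegral_zero]
      -- The region added for the first holding time is the open interval from a to v; since it does
      -- not contain v, the ring at v itself is not forbidden.
      · intro v ω ω' hωω
        by_cases hv : v ∈ Ioc a b
        · simp only [hv, if_true]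
          refine J.runSum_congr obs k hωω (fun c' hc' => ?_) le_rfl
          rcases hc' with hc' | hc'
          · exact hv.1.not_ge (hVa c' hc').2
          · exact lt_irrefl _ hc'.2.2
        · simp [hv]
    · intro c _
      exact measurable_ringSum h P c measurable_id ((hfm c).comp measurable_swap)

theorem void_iff (hh : 0 < h) {V : C → Set ℝ} {ω : ClockSpace C} :
    Void h P V ω ↔ ∀ c, ∀ s ∈ rings h ω c, s ≤ P * h → s ∉ V c := by
  refine forall_congr' fun c => ?_
  rw [ringSum_eq_zero_iff hh]
  simp

/-- All conditions that no enabled clock rings in between are stored in the forbidden region. A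
tuple of rings that survives the final test is therefore a run. -/
theorem exists_run_of_runSum_ne_zero (hh : 0 < h) (k : ℕ) {V : C → Set ℝ} {z : σ} {a b : ℝ}
    (hab : a ≤ b) (hb : b ≤ P * h) {G : (ℝ → O) → ENNReal} {ω : ClockSpace C}
    (hne : J.runSum obs h P k V z a b G ω ≠ 0) :
    Void h P V ω ∧ ∃ l, l.length = k ∧ J.IsRun (rings h ω) z a l b := by
  induction k generalizing V z a G with
  | zero =>
    simp only [runSum, ne_eq, ite_eq_right_iff, not_forall] at hne
    obtain ⟨hv, -⟩ := hne
    rw [void_iff hh] at hv ⊢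
    refine ⟨fun c s hs hsP hm => hv c s hs hsP (Or.inl hm), [], rfl, hab, fun c hc s hs hm => ?_⟩
    exact hv c s hs (hm.2.trans hb) (Or.inr ⟨hc, hm⟩)
  | succ k ih =>
    simp only [runSum] at hne
    obtain ⟨c, hc, hne⟩ := Finset.exists_ne_zero_of_sum_ne_zero hne
    rw [ne_eq, ringSum_eq_zero_iff hh] at hne
    push Not at hne
    obtain ⟨v, hv, -, hne⟩ := hne
    by_cases hvab : v ∈ Ioc a b
    · rw [if_pos hvab] at hne
      obtain ⟨hvoid, l, hl, hr⟩ := ih hvab.2 hne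
      rw [void_iff hh] at hvoid ⊢
      refine ⟨fun c s hs hsP hm => hvoid c s hs hsP (Or.inl hm), (c, v) :: l, by simp [hl],
        hc, hv, hvab.1, hvab.2, fun c' hc' s hs hm => ?_, hr⟩
      exact hvoid c' s hs ((hm.2.le.trans hvab.2).trans hb) (Or.inr ⟨hc', hm⟩)
    · rw [if_neg hvab] at hne
      exact absurd rfl hne

/-- Among all tuples of rings only the one of the actual run contributes, and `Good` ensures that it
is counted once. -/
theorem runSum_eq (hh : 0 < h) {V : C → Set ℝ} {z : σ} {a b : ℝ}
    (hb : b ≤ P * h) {G : (ℝ → O) → ENNReal} {ω : ClockSpace C} (hω : Good h ω)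
    {l : List (C × ℝ)} (hl : J.IsRun (rings h ω) z a l b) (hV : Void h P V ω) :
    J.runSum obs h P l.length V z a b G ω = G (J.path obs z l) := by
  induction l generalizing V z a G with
  | nil =>
    have : Void h P (J.addVoid V z (Ioc a b)) ω := by
      rw [void_iff hh] at hV ⊢
      rintro c s hs hsP (hm | hm)
      · exact hV c s hs hsP hm
      · exact hl.2 c hm.1 s hs hm.2
    simp only [List.length_nil, runSum, this, if_true]
    rfl
  | cons e l ih =>
    obtain ⟨h1, h2, h3, h4, h5, h6⟩ := hl
    -- Choosing an earlier ring is impossible because no enabled clock rings before `e.2`; choosing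
    -- a later one would leave the ring at `e.2` in the forbidden region.
    have hkey : ∀ c ∈ J.en z, ∀ v ∈ rings h ω c, v ∈ Ioc a b →
        J.runSum obs h P l.length (J.addVoid V z (Ioo a v)) (J.step c z) v b
          (fun p => G (glue (obs z) v p)) ω ≠ 0 → v = e.2 := by
      intro c hc v hv hvab hne
      have hvoid := (J.exists_run_of_runSum_ne_zero obs hh _ hvab.2 hb hne).1
      rw [void_iff hh] at hvoid
      rcases lt_trichotomy v e.2 with hlt | heq | hlt
      · exact absurd ⟨hvab.1, hlt⟩ (h5 c hc v hv)
      · exact heq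
      · exact absurd (Or.inr ⟨h1, h3, hlt⟩) (hvoid e.1 e.2 h2 (h4.trans hb))
    simp only [List.length_cons, runSum]
    rw [Finset.sum_eq_single_of_mem e.1 h1]
    · rw [hω.ringSum_single hh h2 (h4.trans hb)]
      · rw [if_pos ⟨h3, h4⟩, ih h6, path_cons]
        rw [void_iff hh] at hV ⊢
        rintro c s hs hsP (hm | hm)
        · exact hV c s hs hsP hm
        · exact h5 c hm.1 s hs hm.2
      · intro v hv _ hne
        split_ifs with hvab
        · by_contra h0
          exact hne (hkey _ h1 v hv hvab h0)
        · rfl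
    · intro c hc hce
      rw [ringSum_eq_zero_iff hh]
      intro v hv _
      split_ifs with hvab
      · by_contra h0
        have := hkey c hc v hv hvab h0
        subst this
        exact hce (hω.1 _ _ _ hv h2)
      · rfl

/-- The event that a run exists and that its trajectory belongs to `A`. -/
def runEvent (h : ℝ) (z : σ) (a b : ℝ) (A : Set (ℝ → O)) : Set (ClockSpace C) :=
  {ω | ∃ l, J.IsRun (rings h ω) z a l b ∧ J.path obs z l ∈ A}

open scoped Classical in
-- The run is unique, so only the term whose index is the length of the run can be nonzero.
theorem tsum_runSum (hh : 0 < h) {z : σ} {a b : ℝ} (hab : a ≤ b) (hb : b ≤ P * h)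
    (A : Set (ℝ → O)) {ω : ClockSpace C} (hω : Good h ω) :
    ∑' k, J.runSum obs h P k (fun _ => ∅) z a b (A.indicator 1) ω =
      if ω ∈ J.runEvent obs h z a b A then 1 else 0 := by
  have hV : Void h P (fun _ : C => (∅ : Set ℝ)) ω := by
    rw [void_iff hh]; simp
  by_cases hex : ∃ l, J.IsRun (rings h ω) z a l b
  · obtain ⟨l, hl⟩ := hex
    rw [tsum_eq_single l.length, J.runSum_eq obs hh hb hω hl hV]
    · by_cases hA : J.path obs z l ∈ A
      · rw [indicator_of_mem hA, if_pos ⟨l, hl, hA⟩]; rfl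
      · rw [indicator_of_notMem hA, if_neg]
        rintro ⟨l', hl', hA'⟩
        exact hA (hl'.unique hω.1 hl ▸ hA')
    · intro k hk
      by_contra hne
      obtain ⟨-, l', hlen, hl'⟩ := J.exists_run_of_runSum_ne_zero obs hh k hab hb hne
      exact hk (by rw [← hlen, hl'.unique hω.1 hl])
  · rw [if_neg fun ⟨l, hl, _⟩ => hex ⟨l, hl⟩]
    refine ENNReal.tsum_eq_zero.2 fun k => ?_
    by_contra hne
    obtain ⟨-, l', -, hl'⟩ := J.exists_run_of_runSum_ne_zero obs hh k hab hb hne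
    exact hex ⟨l', hl'⟩

/-- Up to clocks with coinciding rings, the event of a run is measurable. -/
theorem exists_measurableSet_runEvent [Countable C] [MeasurableSpace O] (hh : 0 < h) (z : σ) {a b : ℝ}
    (hab : a ≤ b) {A : Set (ℝ → O)} (hA : MeasurableSet A) :
    ∃ E, MeasurableSet E ∧ ∀ ω, Good h ω → (ω ∈ E ↔ ω ∈ J.runEvent obs h z a b A) := by
  classical
  obtain ⟨P, hP⟩ := exists_nat_ge (b / h)
  rw [div_le_iff₀ hh] at hP
  -- For good clocks the sum is the indicator of the event, and it is measurable as a function of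
  -- all clocks.
  refine ⟨{ω | ∑' k, J.runSum obs h P k (fun _ => ∅) z a b (A.indicator 1) ω = 1}, ?_, fun ω hω => ?_⟩
  · have : Measurable fun ω => ∑' k, J.runSum obs h P k (fun _ => ∅) z a b (A.indicator 1) ω :=
      Measurable.tsum fun k => J.measurable_runSum obs k b (Θ := ClockSpace C) z
        (V := fun _ _ => ∅) (a := fun _ => a) (G := fun _ => A.indicator 1) (w := id) measurable_id
        (fun c => by simp) measurable_const
        ((measurable_one.indicator hA).comp measurable_snd)
    exact this (measurableSet_singleton 1)
  · rw [mem_ofPred_eq, J.tsum_runSum obs hh hab hP A hω]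
    simp

/-- The law of the run. -/
theorem law_runEvent [Countable C] [MeasurableSpace O] (hh : 0 < h) (z : σ) {a b : ℝ} (ha : 0 ≤ a)
    (hab : a ≤ b) {A : Set (ℝ → O)} (hA : MeasurableSet A) :
    law lam h (J.runEvent obs h z a b A) = ∑' k, J.jumpInt obs lam k z a b (A.indicator 1) := by
  classical
  obtain ⟨P, hP⟩ := exists_nat_ge (b / h)
  rw [div_le_iff₀ hh] at hP
  obtain ⟨E, hE, hE'⟩ := J.exists_measurableSet_runEvent obs hh z hab hA
  have h1 : law lam h (J.runEvent obs h z a b A) = law lam h E := by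
    refine measure_congr ?_
    filter_upwards [ae_good lam (h := h)] with ω hω
    exact propext (hE' ω hω).symm
  have hm : ∀ k, Measurable fun ω => J.runSum obs h P k (fun _ => ∅) z a b (A.indicator 1) ω :=
    fun k => J.measurable_runSum obs k b (Θ := ClockSpace C) z
        (V := fun _ _ => ∅) (a := fun _ => a) (G := fun _ => A.indicator 1) (w := id) measurable_id
        (fun c => by simp) measurable_const
        ((measurable_one.indicator hA).comp measurable_snd)
  have h2 : ∀ k, J.jumpInt obs lam k z a b (A.indicator 1) =
      ∫⁻ ω, J.runSum obs h P k (fun _ => ∅) z a b (A.indicator 1) ω ∂law lam h := fun k => by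
    rw [J.lintegral_runSum obs lam hh.le k z ha hab hP (F := ∅) (measurable_one.indicator hA)]
    · simp
    · simp
    · simp
    · simp
  simp_rw [h2]
  rw [h1, ← lintegral_tsum fun k => (hm k).aemeasurable, ← lintegral_indicator_one hE]
  refine lintegral_congr_ae ?_
  filter_upwards [ae_good lam (h := h)] with ω hω
  rw [J.tsum_runSum obs hh hab hP A hω]
  by_cases hω' : ω ∈ E
  · rw [indicator_of_mem hω', if_pos ((hE' ω hω).1 hω')]; rfl
  · rw [indicator_of_notMem hω', if_neg (mt (hE' ω hω).2 hω')]

end JumpSystem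

/-! ### Non-explosion, and a bound for the probability of touching many vertices -/

namespace JumpSystem

open ClockSpace
open scoped NNReal

/-- The integrand, with its factor q + B, is the derivative of minus an exponential. In
probabilistic terms, exp (B (b - a)) solves the equation obtained by conditioning on the first jump
when each jump multiplies the future expectation by (q + B) / q; both comparison arguments below
rest on this. -/
theorem exp_add_integral (q B : ℝ) {a b : ℝ} :
    Real.exp (-(q * (b - a))) + (q + B) * ∫ x in a..b, Real.exp (-(q * (x - a)) + B * (b - x)) =
      Real.exp (B * (b - a)) := by
  rw [← intervalIntegral.integral_const_mul]
  have hd : ∀ x ∈ uIcc a b, HasDerivAt (fun x => -Real.exp (-(q * (x - a)) + B * (b - x)))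
      ((q + B) * Real.exp (-(q * (x - a)) + B * (b - x))) x := fun x _ => by
    have h1 : HasDerivAt (fun x : ℝ => -(q * (x - a)) + B * (b - x)) (-(q * 1) + B * (-1)) x :=
      ((((hasDerivAt_id x).sub_const a).const_mul q).neg).add
        (((hasDerivAt_id x).const_sub b).const_mul B)
    exact h1.exp.neg.congr_deriv (by ring)
  rw [intervalIntegral.integral_eq_sub_of_hasDerivAt hd]
  · simp
  · apply Continuous.intervalIntegrable
    fun_prop

theorem exp_add_lintegral {q B : ℝ} (hq : 0 ≤ q) (hB : 0 ≤ B) {a b : ℝ} (hab : a ≤ b) :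
    ENNReal.ofReal (Real.exp (-(q * (b - a)))) + ENNReal.ofReal (q + B) *
        ∫⁻ x in Ioc a b, ENNReal.ofReal (Real.exp (-(q * (x - a)))) *
          ENNReal.ofReal (Real.exp (B * (b - x))) = ENNReal.ofReal (Real.exp (B * (b - a))) := by
  simp_rw [← ENNReal.ofReal_mul (Real.exp_pos _).le, ← Real.exp_add]
  rw [← ofReal_integral_eq_lintegral_ofReal, ← ENNReal.ofReal_mul (by positivity),
    ← ENNReal.ofReal_add (Real.exp_pos _).le, ← intervalIntegral.integral_of_le hab,
    exp_add_integral]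
  · refine mul_nonneg (by positivity) (integral_nonneg fun x => (Real.exp_pos _).le)
  · have : Continuous fun x : ℝ => Real.exp (-(q * (x - a)) + B * (b - x)) := by fun_prop
    exact (this.intervalIntegrable a b).1
  · exact Eventually.of_forall fun x => (Real.exp_pos _).le

variable {σ C O : Type} (J : JumpSystem σ C) (obs : σ → O) (lam : C → ℝ≥0)

/-- Conditioning on the first jump: either there is none, or a jump occurs at time v and is followed
by fewer than k jumps. -/
theorem sum_jumpInt_succ [MeasurableSpace O] (k : ℕ) (z : σ) (a b : ℝ) {G : (ℝ → O) → ENNReal}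
    (hG : Measurable G) :
    ∑ j ∈ Finset.range (k + 1), J.jumpInt obs lam j z a b G =
      ENNReal.ofReal (Real.exp (-(J.totalRate lam z * (b - a)))) * G (fun _ => obs z) +
      ∫⁻ v in Ioc a b, ENNReal.ofReal (Real.exp (-(J.totalRate lam z * (v - a)))) *
        ∑ c ∈ J.en z, lam c * ∑ j ∈ Finset.range k,
          J.jumpInt obs lam j (J.step c z) v b fun p => G (glue (obs z) v p) := by
  have hm : ∀ j c, Measurable fun v =>
      J.jumpInt obs lam j (J.step c z) v b fun p => G (glue (obs z) v p) := fun j c =>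
    J.measurable_jumpInt obs lam j b (J.step c z) (a := id)
      (G := fun v p => G (glue (obs z) v p)) measurable_id (hG.comp (measurable_glue (obs z)))
  have he : Measurable fun v : ℝ => ENNReal.ofReal (Real.exp (-(J.totalRate lam z * (v - a)))) := by
    fun_prop
  rw [Finset.sum_range_succ', add_comm]
  congr 1
  simp only [jumpInt, Finset.mul_sum]
  rw [lintegral_finsetSum _ fun c _ => ?_, Finset.sum_comm]
  · refine Finset.sum_congr rfl fun c _ => ?_
    rw [lintegral_finsetSum _ fun j _ => ?_]
    · refine Finset.sum_congr rfl fun j _ => ?_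
      rw [← lintegral_const_mul' _ _ ENNReal.coe_ne_top]
      refine lintegral_congr fun v => ?_
      ring
    · exact he.mul ((hm j c).const_mul _)
  · exact Finset.measurable_fun_sum _ fun j _ => he.mul ((hm j c).const_mul _)

theorem ofReal_totalRate (z : σ) : ENNReal.ofReal (J.totalRate lam z) = ∑ c ∈ J.en z, (lam c : ENNReal) := by
  rw [totalRate, ENNReal.ofReal_sum_of_nonneg fun _ _ => NNReal.coe_nonneg _]
  simp

variable {I : σ → Prop}

/-- If the total rate grows at most linearly, there is no explosion. -/
theorem one_le_tsum_jumpInt [MeasurableSpace O] (hI : ∀ z, I z → ∀ c ∈ J.en z, I (J.step c z)) {v : σ → ℝ}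
    {Λ L : ℝ} (hΛ : 0 < Λ) (hL : 0 < L) (hv : ∀ z, I z → 0 < v z)
    (hrate : ∀ z, I z → J.totalRate lam z ≤ Λ * v z)
    (hstep : ∀ z, I z → ∀ c ∈ J.en z, v (J.step c z) ≤ v z + L) {z : σ} (hz : I z) {a b : ℝ}
    (hab : a ≤ b) : 1 ≤ ∑' k, J.jumpInt obs lam k z a b fun _ => 1 := by
  -- The last term dominates the probability of at least k jumps during (a, b] and tends to zero as
  -- k grows.
  have key : ∀ k : ℕ, ∀ z, I z → ∀ a ≤ b, 1 ≤ ∑ j ∈ Finset.range k, J.jumpInt obs lam j z a b (fun _ => 1) +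
      ENNReal.ofReal (v z / (v z + k * L)) * ENNReal.ofReal (Real.exp (Λ * L * (b - a))) := by
    intro k
    induction k with
    | zero =>
      intro z hz a hab
      have := (hv z hz).ne'
      have h1 : (0 : ℝ) ≤ Λ * L * (b - a) := mul_nonneg (by positivity) (sub_nonneg.2 hab)
      simp only [Finset.range_zero, Finset.sum_empty, Nat.cast_zero, zero_mul, add_zero, zero_add,
        div_self this, ENNReal.ofReal_one, one_mul]
      rw [ENNReal.one_le_ofReal]
      exact Real.one_le_exp h1
    | succ k ih =>
      intro z hz a hab
      have hvz := hv z hz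
      set q := J.totalRate lam z with hq
      have hq0 : 0 ≤ q := J.totalRate_nonneg lam z
      rw [J.sum_jumpInt_succ obs lam k z a b measurable_const, mul_one, ← hq]
      set r : ℝ := (v z + L) / (v z + L + k * L) with hr
      have hr0 : 0 ≤ r := by positivity
      have h1 : (1 : ENNReal) = ENNReal.ofReal (Real.exp (-(q * (b - a)))) + ENNReal.ofReal q *
          ∫⁻ x in Ioc a b, ENNReal.ofReal (Real.exp (-(q * (x - a)))) := by
        have := exp_add_lintegral hq0 le_rfl hab
        simpa using this.symm
      have hcont : Continuous fun x : ℝ => ENNReal.ofReal (Real.exp (-(q * (x - a)))) :=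
        ENNReal.continuous_ofReal.comp (by fun_prop)
      have hcont' : Continuous fun x : ℝ => ENNReal.ofReal (Real.exp (Λ * L * (b - x))) :=
        ENNReal.continuous_ofReal.comp (by fun_prop)
      calc (1 : ENNReal) = _ := h1
        _ = ENNReal.ofReal (Real.exp (-(q * (b - a)))) +
          ∫⁻ x in Ioc a b, ENNReal.ofReal (Real.exp (-(q * (x - a)))) * ENNReal.ofReal q := by
            rw [lintegral_mul_const _ hcont.measurable, mul_comm (ENNReal.ofReal q)]
        _ ≤ ENNReal.ofReal (Real.exp (-(q * (b - a)))) +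
          ∫⁻ x in Ioc a b, (ENNReal.ofReal (Real.exp (-(q * (x - a)))) *
            (∑ c ∈ J.en z, lam c * ∑ j ∈ Finset.range k,
              J.jumpInt obs lam j (J.step c z) x b fun _ => 1) +
            ENNReal.ofReal q * ENNReal.ofReal r * (ENNReal.ofReal (Real.exp (-(q * (x - a)))) *
              ENNReal.ofReal (Real.exp (Λ * L * (b - x))))) := by
            refine add_le_add le_rfl (setLIntegral_mono' measurableSet_Ioc fun x hx => ?_)
            have h2 : ENNReal.ofReal q ≤ ∑ c ∈ J.en z, lam c * (∑ j ∈ Finset.range k,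
                J.jumpInt obs lam j (J.step c z) x b (fun _ => 1) +
                ENNReal.ofReal r * ENNReal.ofReal (Real.exp (Λ * L * (b - x)))) := by
              rw [hq, ofReal_totalRate]
              refine Finset.sum_le_sum fun c hc => ?_
              conv_lhs => rw [← mul_one (lam c : ENNReal)]
              refine mul_le_mul_right ((ih _ (hI z hz c hc) x hx.2).trans
                (add_le_add le_rfl (mul_le_mul_left (ENNReal.ofReal_le_ofReal ?_) _))) _
              have hvc := hv _ (hI z hz c hc)
              rw [hr, div_le_div_iff₀ (by positivity) (by positivity)]
              have := hstep z hz c hc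
              have hk : (0 : ℝ) ≤ k * L := by positivity
              nlinarith
            simp only [mul_add, Finset.sum_add_distrib] at h2
            rw [← Finset.sum_mul, ← ofReal_totalRate, ← hq] at h2
            refine (mul_le_mul_right h2 _).trans ?_
            rw [mul_add]
            refine add_le_add le_rfl (le_of_eq ?_)
            ring
        _ = ENNReal.ofReal (Real.exp (-(q * (b - a)))) +
          (∫⁻ x in Ioc a b, ENNReal.ofReal (Real.exp (-(q * (x - a)))) *
            (∑ c ∈ J.en z, lam c * ∑ j ∈ Finset.range k,
              J.jumpInt obs lam j (J.step c z) x b fun _ => 1)) +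
            ENNReal.ofReal q * ENNReal.ofReal r * ∫⁻ x in Ioc a b,
              (ENNReal.ofReal (Real.exp (-(q * (x - a)))) *
              ENNReal.ofReal (Real.exp (Λ * L * (b - x)))) := by
            rw [lintegral_add_right, lintegral_const_mul' _ _
              (ENNReal.mul_ne_top ENNReal.ofReal_ne_top ENNReal.ofReal_ne_top), add_assoc]
            exact (hcont.measurable.mul hcont'.measurable).const_mul _
        _ ≤ _ := by
            refine add_le_add le_rfl ?_
            have h3 := exp_add_lintegral hq0 (by positivity : 0 ≤ Λ * L) hab
            have h4 : ENNReal.ofReal (q + Λ * L) * ∫⁻ x in Ioc a b,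
                (ENNReal.ofReal (Real.exp (-(q * (x - a)))) *
                ENNReal.ofReal (Real.exp (Λ * L * (b - x)))) ≤
                ENNReal.ofReal (Real.exp (Λ * L * (b - a))) := h3 ▸ le_add_self
            have hpos : 0 < q + Λ * L := by positivity
            -- After clearing denominators this reads q (v + L) ≤ v (q + Λ L), that is, q ≤ Λ v, the
            -- linear growth of the rate.
            have h5 : ENNReal.ofReal q * ENNReal.ofReal r ≤
                ENNReal.ofReal (v z / (v z + (k + 1 : ℕ) * L)) * ENNReal.ofReal (q + Λ * L) := by
              rw [← ENNReal.ofReal_mul hq0, ← ENNReal.ofReal_mul (by positivity)]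
              refine ENNReal.ofReal_le_ofReal ?_
              rw [hr, mul_div_assoc', div_mul_eq_mul_div, div_le_div_iff₀ (by positivity) (by positivity)]
              have hqv := hrate z hz
              rw [← hq] at hqv
              have e1 : v z + ((k + 1 : ℕ) : ℝ) * L = v z + L + k * L := by push_cast; ring
              rw [e1]
              refine mul_le_mul_of_nonneg_right ?_ (by positivity)
              nlinarith
            calc _ ≤ ENNReal.ofReal (v z / (v z + (k + 1 : ℕ) * L)) * ENNReal.ofReal (q + Λ * L) * _ :=
                  mul_le_mul_left h5 _
              _ ≤ _ := by
                rw [mul_assoc]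
                exact mul_le_mul_right h4 _
  have hlim : Tendsto (fun k : ℕ => ∑' k, J.jumpInt obs lam k z a b (fun _ => 1) +
      ENNReal.ofReal (v z / (v z + k * L)) * ENNReal.ofReal (Real.exp (Λ * L * (b - a)))) atTop
      (𝓝 (∑' k, J.jumpInt obs lam k z a b (fun _ => 1) + 0)) := by
    refine tendsto_const_nhds.add ?_
    have : Tendsto (fun k : ℕ => v z / (v z + k * L)) atTop (𝓝 0) := by
      refine tendsto_const_nhds.div_atTop (tendsto_atTop_add_const_left _ _ ?_)
      exact tendsto_natCast_atTop_atTop.atTop_mul_const hL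
    have h2 := ENNReal.Tendsto.mul_const (b := ENNReal.ofReal (Real.exp (Λ * L * (b - a))))
      (ENNReal.tendsto_ofReal this) (Or.inr ENNReal.ofReal_ne_top)
    simpa using h2
  rw [add_zero] at hlim
  refine ge_of_tendsto' hlim fun k => (key k z hz a hab).trans (add_le_add ?_ le_rfl)
  exact ENNReal.sum_le_tsum _

/-- If the moves that decrease `Y` have rate at most `Λ Y`, it takes long until `Y = 0`. -/
theorem tsum_jumpInt_le [MeasurableSpace O] (hI : ∀ z, I z → ∀ c ∈ J.en z, I (J.step c z)) {Y : σ → ℕ}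
    {Λ θ : ℝ} {L : ℕ} (hΛ : 0 ≤ Λ) (hθ : 0 < θ) (hθ1 : θ ≤ 1)
    (hY : ∀ z, I z → ∀ c ∈ J.en z, Y (J.step c z) ≤ Y z)
    (hYL : ∀ z, I z → ∀ c ∈ J.en z, Y z ≤ Y (J.step c z) + L)
    (hrate : ∀ z, I z → ∑ c ∈ (J.en z).filter (fun c => Y (J.step c z) ≠ Y z), (lam c : ℝ) ≤ Λ * Y z)
    {A : Set O} (hA : MeasurableSet A) (hAY : ∀ z, I z → obs z ∈ A → Y z = 0) {z : σ} (hz : I z)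
    {a b : ℝ} (hab : a ≤ b) :
    ∑' k, J.jumpInt obs lam k z a b ({p | p b ∈ A}.indicator 1) ≤
      ENNReal.ofReal (θ ^ Y z) * ENNReal.ofReal (Real.exp (Λ * θ⁻¹ ^ L * Y z * (b - a))) := by
  have hGm : Measurable ({p : ℝ → O | p b ∈ A}.indicator (1 : (ℝ → O) → ENNReal)) :=
    measurable_one.indicator (measurable_pi_apply b hA)
  have key : ∀ k : ℕ, ∀ z, I z → ∀ a ≤ b,
      ∑ j ∈ Finset.range k, J.jumpInt obs lam j z a b ({p | p b ∈ A}.indicator 1) ≤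
      ENNReal.ofReal (θ ^ Y z) * ENNReal.ofReal (Real.exp (Λ * θ⁻¹ ^ L * Y z * (b - a))) := by
    intro k
    induction k with
    | zero => intro z hz a hab; simp
    | succ k ih =>
      intro z hz a hab
      rw [J.sum_jumpInt_succ obs lam k z a b hGm]
      set q := J.totalRate lam z with hq
      have hq0 : 0 ≤ q := J.totalRate_nonneg lam z
      -- Moves that decrease Y have total rate at most Λ Y, and each of them increases θ ^ Y at most
      -- by the factor θ⁻¹ ^ L; B is the resulting growth rate, frozen at the initial value of Y,
      -- which never increases.
      set B : ℝ := Λ * θ⁻¹ ^ L * Y z with hB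
      have hB0 : 0 ≤ B := by positivity
      have hcont : Continuous fun x : ℝ => ENNReal.ofReal (Real.exp (-(q * (x - a)))) :=
        ENNReal.continuous_ofReal.comp (by fun_prop)
      have hcont' : Continuous fun x : ℝ => ENNReal.ofReal (Real.exp (B * (b - x))) :=
        ENNReal.continuous_ofReal.comp (by fun_prop)
      rw [← exp_add_lintegral hq0 hB0 hab, mul_add]
      refine add_le_add ?_ ?_
      · rw [mul_comm]
        refine mul_le_mul_left ?_ _
        by_cases hzA : obs z ∈ A
        · rw [hAY z hz hzA]
          simp [hzA]
        · simp [hzA]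
      · rw [← mul_assoc, ← lintegral_const_mul' _ _
          (ENNReal.mul_ne_top ENNReal.ofReal_ne_top ENNReal.ofReal_ne_top)]
        refine setLIntegral_mono' measurableSet_Ioc fun x hx => ?_
        rw [mul_left_comm]
        refine mul_le_mul_right ?_ _
        have h1 : ∀ c ∈ J.en z, ∑ j ∈ Finset.range k, J.jumpInt obs lam j (J.step c z) x b
            (fun p => ({p | p b ∈ A}.indicator 1 (glue (obs z) x p) : ENNReal)) ≤
            ENNReal.ofReal (θ ^ Y (J.step c z)) * ENNReal.ofReal (Real.exp (B * (b - x))) := by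
          intro c hc
          have h2 : (fun p => ({p | p b ∈ A}.indicator 1 (glue (obs z) x p) : ENNReal)) =
              {p | p b ∈ A}.indicator 1 := by
            ext p
            have hxb : glue (obs z) x p b = p b := if_pos hx.2
            have hiff : glue (obs z) x p ∈ {p : ℝ → O | p b ∈ A} ↔ p ∈ {p : ℝ → O | p b ∈ A} := by
              rw [mem_ofPred_eq, mem_ofPred_eq, hxb]
            by_cases hp : p ∈ {p : ℝ → O | p b ∈ A}
            · rw [indicator_of_mem hp, indicator_of_mem (hiff.2 hp)]
              rfl
            · rw [indicator_of_notMem hp, indicator_of_notMem (mt hiff.1 hp)]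
          rw [h2]
          refine (ih _ (hI z hz c hc) x hx.2).trans (mul_le_mul_right (ENNReal.ofReal_le_ofReal ?_) _)
          refine Real.exp_le_exp.2 (mul_le_mul_of_nonneg_right ?_ (sub_nonneg.2 hx.2))
          refine mul_le_mul_of_nonneg_left ?_ (by positivity)
          exact_mod_cast hY z hz c hc
        refine (Finset.sum_le_sum fun c hc => mul_le_mul_right (h1 c hc) _).trans ?_
        simp_rw [← mul_assoc]
        rw [← Finset.sum_mul]
        refine mul_le_mul_left ?_ _
        rw [← ENNReal.ofReal_mul (by positivity)]
        have h3 : ∑ c ∈ J.en z, (lam c : ENNReal) * ENNReal.ofReal (θ ^ Y (J.step c z)) =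
            ENNReal.ofReal (∑ c ∈ J.en z, lam c * θ ^ Y (J.step c z)) := by
          rw [ENNReal.ofReal_sum_of_nonneg fun c _ => by positivity]
          refine Finset.sum_congr rfl fun c _ => ?_
          rw [ENNReal.ofReal_mul (NNReal.coe_nonneg _), ENNReal.ofReal_coe_nnreal]
        rw [h3]
        refine ENNReal.ofReal_le_ofReal ?_
        -- A move that changes Y decreases it by at most L; all other moves leave θ ^ Y unchanged.
        have h4 : ∀ c ∈ J.en z, lam c * θ ^ Y (J.step c z) ≤ lam c * θ ^ Y z +
            if Y (J.step c z) ≠ Y z then lam c * (θ ^ Y z * θ⁻¹ ^ L) else 0 := fun c hc => by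
          split_ifs with h5
          · have h6 : θ ^ Y (J.step c z) ≤ θ ^ Y z * θ⁻¹ ^ L := by
              rw [inv_pow, ← div_eq_mul_inv, le_div_iff₀ (by positivity), ← pow_add]
              exact pow_le_pow_of_le_one hθ.le hθ1 (hYL z hz c hc)
            have h7 : (lam c : ℝ) * θ ^ Y (J.step c z) ≤ lam c * (θ ^ Y z * θ⁻¹ ^ L) :=
              mul_le_mul_of_nonneg_left h6 (NNReal.coe_nonneg _)
            have h8 : 0 ≤ (lam c : ℝ) * θ ^ Y z := by positivity
            linarith
          · rw [not_not.1 h5, add_zero]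
        refine (Finset.sum_le_sum h4).trans ?_
        rw [Finset.sum_add_distrib, ← Finset.sum_mul, ← Finset.sum_filter, ← Finset.sum_mul]
        have h9 := mul_le_mul_of_nonneg_right (hrate z hz)
          (by positivity : 0 ≤ θ ^ Y z * θ⁻¹ ^ L)
        have h10 : ∑ c ∈ J.en z, (lam c : ℝ) = q := rfl
        rw [h10]
        calc _ ≤ q * θ ^ Y z + Λ * Y z * (θ ^ Y z * θ⁻¹ ^ L) := by gcongr
          _ = _ := by rw [hB]; ring
  exact ENNReal.tsum_le_of_sum_range_le fun k => key k z hz a hab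

/-- The jump system together with a memory. -/
def withMemory {δ : Type} (m : C → δ → δ) : JumpSystem (σ × δ) C where
  en z := J.en z.1
  step c z := (J.step c z.1, m c z.2)

theorem isRun_withMemory {δ : Type} (m : C → δ → δ) {T : C → Set ℝ} {z : σ × δ} {a b : ℝ}
    {l : List (C × ℝ)} : (J.withMemory m).IsRun T z a l b ↔ J.IsRun T z.1 a l b := by
  induction l generalizing z a with
  | nil => rfl
  | cons e l ih => simp only [IsRun, ih]; rfl

theorem final_withMemory {δ : Type} (m : C → δ → δ) (z : σ × δ) (l : List (C × ℝ)) :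
    (J.withMemory m).final z l = (J.final z.1 l, l.foldl (fun d e => m e.1 d) z.2) := by
  induction l generalizing z with
  | nil => rfl
  | cons e l ih => rw [final, ih]; rfl

variable {h : ℝ}

/-- Almost surely the run exists. -/
theorem ae_exists_run [Countable C] (hh : 0 < h) (hI : ∀ z, I z → ∀ c ∈ J.en z, I (J.step c z))
    {v : σ → ℝ} {Λ L : ℝ} (hΛ : 0 < Λ) (hL : 0 < L) (hv : ∀ z, I z → 0 < v z)
    (hrate : ∀ z, I z → J.totalRate lam z ≤ Λ * v z)
    (hstep : ∀ z, I z → ∀ c ∈ J.en z, v (J.step c z) ≤ v z + L) {z : σ} (hz : I z) {a b : ℝ}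
    (ha : 0 ≤ a) (hab : a ≤ b) : ∀ᵐ ω ∂law lam h, ∃ l, J.IsRun (rings h ω) z a l b := by
  let obs : σ → Unit := fun _ => ()
  obtain ⟨E, hE, hE'⟩ := J.exists_measurableSet_runEvent obs hh z hab MeasurableSet.univ
  have h1 := J.law_runEvent obs lam hh z ha hab MeasurableSet.univ
  have h2 := J.one_le_tsum_jumpInt obs lam hI hΛ hL hv hrate hstep hz hab
  rw [indicator_univ] at h1
  have h3 : law lam h E = 1 := by
    refine le_antisymm prob_le_one ?_
    have : law lam h (J.runEvent obs h z a b univ) = law lam h E := by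
      refine measure_congr ?_
      filter_upwards [ae_good lam (h := h)] with ω hω
      exact propext (hE' ω hω).symm
    rw [← this, h1]
    exact h2
  have h4 : ∀ᵐ ω ∂law lam h, ω ∈ E := by
    rw [← prob_compl_eq_zero_iff hE] at h3
    exact h3
  filter_upwards [h4, ae_good lam (h := h)] with ω hω hg
  obtain ⟨l, hl, -⟩ := (hE' ω hg).1 hω
  exact ⟨l, hl⟩

/-- The probability that all elements of a finite set are touched. -/
theorem law_touch_le {N : Type} [DecidableEq N] [Countable C] (hh : 0 < h) (rng : C → Finset N)
    (hI : ∀ z, I z → ∀ c ∈ J.en z, I (J.step c z)) {Λ θ : ℝ} {L : ℕ} (hΛ : 0 ≤ Λ) (hθ : 0 < θ)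
    (hθ1 : θ ≤ 1) (hL : ∀ c, (rng c).card ≤ L)
    (hrate : ∀ z, I z → ∀ u, ∑ c ∈ (J.en z).filter (fun c => u ∈ rng c), (lam c : ℝ) ≤ Λ)
    {z : σ} (hz : I z) {a b : ℝ} (ha : 0 ≤ a) (hab : a ≤ b) (F : Finset N) :
    law lam h {ω | ∃ l, J.IsRun (rings h ω) z a l b ∧ ∀ u ∈ F, ∃ e ∈ l, u ∈ rng e.1} ≤
      ENNReal.ofReal (θ ^ F.card) * ENNReal.ofReal (Real.exp (Λ * θ⁻¹ ^ L * F.card * (b - a))) := by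
  -- The memory holds the elements of F that have not been touched yet. The event is that it is
  -- empty at time b, and Y is its cardinality.
  let m : C → Finset N → Finset N := fun c D => D \ rng c
  let obs : σ × Finset N → Finset N := Prod.snd
  let _ : MeasurableSpace (Finset N) := ⊤
  have hset : {ω : ClockSpace C | ∃ l, J.IsRun (rings h ω) z a l b ∧ ∀ u ∈ F, ∃ e ∈ l, u ∈ rng e.1} =
      (J.withMemory m).runEvent obs h (z, F) a b {p | p b ∈ ({∅} : Set (Finset N))} := by
    have hfold : ∀ (l : List (C × ℝ)) (D : Finset N) u, u ∈ l.foldl (fun d e => m e.1 d) D ↔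
        u ∈ D ∧ ∀ e ∈ l, u ∉ rng e.1 := by
      intro l
      induction l with
      | nil => simp
      | cons e l ih =>
        intro D u
        rw [List.foldl_cons, ih]
        simp only [m, Finset.mem_sdiff, List.forall_mem_cons, and_assoc]
    ext ω
    simp only [runEvent, mem_ofPred_eq, isRun_withMemory, mem_singleton_iff, path]
    refine exists_congr fun l => and_congr_right fun hl => ?_
    rw [((J.isRun_withMemory m (z := (z, F))).2 hl).stateAt_end, final_withMemory,
      Finset.eq_empty_iff_forall_notMem]
    simp only [obs, hfold]
    constructor
    · rintro h1 u ⟨hu, h2⟩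
      obtain ⟨e, he, hue⟩ := h1 u hu
      exact h2 e he hue
    · intro h1 u hu
      by_contra hcon
      push Not at hcon
      exact h1 u ⟨hu, hcon⟩
  have hA : MeasurableSet ({∅} : Set (Finset N)) := trivial
  rw [hset, (J.withMemory m).law_runEvent obs lam hh (z, F) ha hab
    (A := {p | p b ∈ ({∅} : Set (Finset N))}) (measurable_pi_apply b hA)]
  refine (J.withMemory m).tsum_jumpInt_le obs lam (I := fun z => I z.1) (Y := fun z => z.2.card)
    (fun z hz c hc => hI z.1 hz c hc) hΛ hθ hθ1 (L := L) ?_ ?_ ?_ hA ?_ hz hab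
  · exact fun z _ c _ => Finset.card_le_card Finset.sdiff_subset
  · intro z _ c _
    have h1 := Finset.le_card_sdiff (rng c) z.2
    have h2 := hL c
    change z.2.card ≤ (z.2 \ rng c).card + L
    omega
  · intro z hz
    -- A move that shrinks the memory is charged to one of the remembered elements it touches, each
    -- of which is touched at rate at most Λ.
    have h1 : ∀ c, (if (((J.withMemory m).step c z).2).card ≠ z.2.card then (lam c : ℝ) else 0) ≤
        ∑ u ∈ z.2, if u ∈ rng c then (lam c : ℝ) else 0 := by
      intro c
      have hnn : ∀ u ∈ z.2, 0 ≤ if u ∈ rng c then (lam c : ℝ) else 0 := fun u _ => by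
        split_ifs
        exacts [NNReal.coe_nonneg _, le_rfl]
      split_ifs with hc
      · have hex : ∃ u ∈ z.2, u ∈ rng c := by
          by_contra hcon
          push Not at hcon
          refine hc ?_
          change (z.2 \ rng c).card = _
          rw [Finset.sdiff_eq_self_of_disjoint]
          exact Finset.disjoint_left.2 hcon
        obtain ⟨u, hu, huc⟩ := hex
        refine le_trans ?_ (Finset.single_le_sum hnn hu)
        rw [if_pos huc]
      · exact Finset.sum_nonneg hnn
    calc _ ≤ ∑ c ∈ J.en z.1, ∑ u ∈ z.2, (if u ∈ rng c then (lam c : ℝ) else 0) := by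
          rw [Finset.sum_filter]
          exact Finset.sum_le_sum fun c _ => h1 c
      _ = ∑ u ∈ z.2, ∑ c ∈ (J.en z.1).filter (fun c => u ∈ rng c), (lam c : ℝ) := by
          rw [Finset.sum_comm]
          simp_rw [Finset.sum_filter]
      _ ≤ ∑ u ∈ z.2, Λ := Finset.sum_le_sum fun u _ => hrate z.1 hz u
      _ = _ := by rw [Finset.sum_const, nsmul_eq_mul, mul_comm]
  · rintro z _ hz
    exact Finset.card_eq_zero.2 hz

end JumpSystem

/-! ### Projections and decompositions of jump systems -/

namespace JumpSystem

open scoped NNReal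

variable {σ σ' C C' O : Type} {J : JumpSystem σ C} {J' : JumpSystem σ' C'}

/-- A jump system that is projected onto another one has the same law. -/
theorem jumpInt_comp (obs : σ' → O) {lam : C → ℝ≥0} {lam' : C' → ℝ≥0} {I : σ → Prop}
    (hI : ∀ z, I z → ∀ c ∈ J.en z, I (J.step c z)) (f : σ → σ') (g : σ → C → C')
    (hg : ∀ z, I z → BijOn (g z) (J.en z) (J'.en (f z)))
    (hlam : ∀ z, I z → ∀ c ∈ J.en z, lam' (g z c) = lam c)
    (hstep : ∀ z, I z → ∀ c ∈ J.en z, f (J.step c z) = J'.step (g z c) (f z)) (k : ℕ) {z : σ}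
    (hz : I z) (a b : ℝ) (G : (ℝ → O) → ENNReal) :
    J.jumpInt (fun z => obs (f z)) lam k z a b G = J'.jumpInt obs lam' k (f z) a b G := by
  have hsum : ∀ {M : Type} [AddCommMonoid M] (z : σ), I z → ∀ (F : C' → M),
      ∑ c ∈ J.en z, F (g z c) = ∑ c ∈ J'.en (f z), F c := fun z hz F =>
    Finset.sum_nbij (g z) (fun c hc => (hg z hz).mapsTo hc) (hg z hz).injOn (hg z hz).surjOn
      fun _ _ => rfl
  have hrate : ∀ z, I z → J.totalRate lam z = J'.totalRate lam' (f z) := fun z hz => by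
    rw [totalRate, totalRate, ← hsum z hz]
    exact Finset.sum_congr rfl fun c hc => by rw [hlam z hz c hc]
  induction k generalizing z a G with
  | zero => rw [jumpInt, jumpInt, hrate z hz]
  | succ k ih =>
    rw [jumpInt, jumpInt, ← hsum z hz, hrate z hz]
    refine Finset.sum_congr rfl fun c hc => ?_
    rw [hlam z hz c hc]
    congr 1
    refine lintegral_congr fun v => ?_
    rw [ih (hI z hz c hc), hstep z hz c hc]

variable {J' : JumpSystem σ' C} {T T' : C → Set ℝ} {z : σ} {a b : ℝ} {l : List (C × ℝ)}

theorem IsRun.restrict_left {a' : ℝ} (h : J.IsRun T z a l b) (ha : a ≤ a') (hb : a' ≤ b)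
    (hv : ∀ c ∈ J.en z, ∀ s ∈ T c, ¬ (a < s ∧ s ≤ a')) : J.IsRun T z a' l b := by
  cases l with
  | nil => exact ⟨hb, fun c hc s hs hab => h.2 c hc s hs ⟨ha.trans_lt hab.1, hab.2⟩⟩
  | cons e l =>
    obtain ⟨h1, h2, h3, h4, h5, h6⟩ := h
    exact ⟨h1, h2, not_le.1 fun hle => hv _ h1 _ h2 ⟨h3, hle⟩, h4,
      fun c hc s hs hab => h5 c hc s hs ⟨ha.trans_lt hab.1, hab.2⟩, h6⟩

/-- If a system decomposes into components as long as only good moves are carried out, and if the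
runs of the components consist of good moves, then so does the run of the whole system. -/
theorem IsRun.forall_ok {ι : Type} [DecidableEq ι] {τ : ι → Type} {K : ∀ i, JumpSystem (τ i) C}
    {U : ι → C → Set ℝ} {Rel : σ → (∀ i, τ i) → Prop} {ok : C → Prop} (own : C → ι) (hT : NoSim T)
    (h1 : ∀ z y c s, Rel z y → c ∈ J.en z → s ∈ T c →
      c ∈ (K (own c)).en (y (own c)) ∧ s ∈ U (own c) c)
    (h2 : ∀ z y c, Rel z y → c ∈ J.en z → ok c →
      Rel (J.step c z) (Function.update y (own c) ((K (own c)).step c (y (own c)))))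
    (h3 : ∀ z y j c s, Rel z y → c ∈ (K j).en (y j) → s ∈ U j c →
      c ∈ J.en z ∧ s ∈ T c ∧ own c = j) {y : ∀ i, τ i} (hz : Rel z y)
    (h : J.IsRun T z a l b) {m : ι → List (C × ℝ)}
    (hm : ∀ i, (K i).IsRun (U i) (y i) a (m i) b) (hok : ∀ i, ∀ e ∈ m i, ok e.1) :
    ∀ e ∈ l, ok e.1 := by
  induction l generalizing z y a m with
  | nil => simp
  | cons e l ih =>
    obtain ⟨e1, e2, e3, e4, e5, e6⟩ := h
    obtain ⟨k1, k2⟩ := h1 _ _ _ _ hz e1 e2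
    -- The first move of the whole run belongs to one component, and its ring is also the first one
    -- to which that component responds; it is thus the first move of the run of the component and
    -- inherits its goodness.
    have hcons : ∃ m', m (own e.1) = e :: m' := by
      have hr := hm (own e.1)
      cases hme : m (own e.1) with
      | nil =>
        rw [hme] at hr
        exact absurd ⟨e3, e4⟩ (hr.2 _ k1 _ k2)
      | cons e' m' =>
        rw [hme] at hr
        obtain ⟨r1, r2, r3, r4, r5, r6⟩ := hr
        obtain ⟨q1, q2, q3⟩ := h3 _ _ _ _ _ hz r1 r2
        have ht : e'.2 = e.2 := by
          rcases lt_trichotomy e'.2 e.2 with hlt | heq | hlt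
          · exact absurd ⟨r3, hlt⟩ (e5 _ q1 _ q2)
          · exact heq
          · exact absurd ⟨e3, hlt⟩ (r5 _ k1 _ k2)
        exact ⟨m', by rw [Prod.ext (hT _ _ _ (ht ▸ q2) e2) ht]⟩
    obtain ⟨m', hm'⟩ := hcons
    have hoke : ok e.1 := hok (own e.1) e (by rw [hm']; simp)
    refine List.forall_mem_cons.2 ⟨hoke, ?_⟩
    refine ih (h2 _ _ _ hz e1 hoke) e6 (m := Function.update m (own e.1) m') (fun i => ?_) fun i => ?_
    · by_cases hi : i = own e.1
      · subst hi
        have := hm (own e.1)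
        rw [hm'] at this
        rw [Function.update_self, Function.update_self]
        exact this.2.2.2.2.2
      · rw [Function.update_of_ne hi, Function.update_of_ne hi]
        refine (hm i).restrict_left e3.le e4 fun c hc s hs hab => ?_
        obtain ⟨q1, q2, q3⟩ := h3 _ _ _ _ _ hz hc hs
        rcases hab.2.lt_or_eq with hlt | rfl
        · exact e5 c q1 s q2 ⟨hab.1, hlt⟩
        · exact hi (by rw [← q3, hT _ _ _ q2 e2])
    · by_cases hi : i = own e.1
      · subst hi
        rw [Function.update_self]
        exact fun e' he' => hok (own e.1) e' (by rw [hm']; simp [he'])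
      · rw [Function.update_of_ne hi]
        exact hok i

end JumpSystem

/-! ### Renaming the vertices of a spin graph -/

theorem Label.child_inj {b b' : Label} {k k' : ℕ} : b.child k = b'.child k' ↔ b = b' ∧ k = k' := by
  obtain ⟨r, l⟩ := b
  obtain ⟨r', l'⟩ := b'
  simp only [Label.child, Prod.mk.injEq, List.cons.injEq]
  tauto

namespace SpinGraph

variable {S W : Type}

theorem ext_of {γ γ' : SpinGraph S W} (h : ∀ l, γ.spin l = γ'.spin l)
    (h' : ∀ l m, γ.graph.Adj l m ↔ γ'.graph.Adj l m) : γ = γ' := by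
  obtain ⟨s, g, p⟩ := γ
  obtain ⟨s', g', p'⟩ := γ'
  obtain rfl : s = s' := funext h
  obtain rfl : g = g' := by ext l m; exact h' l m
  rfl

theorem mem_verts_of_adj {γ : SpinGraph S W} {u v : W} (h : γ.graph.Adj u v) :
    u ∈ γ.verts ∧ v ∈ γ.verts := ⟨γ.spin_ne_none _ _ h, γ.spin_ne_none _ _ h.symm⟩

open scoped Classical in
/-- The spin graph with the vertices renamed. -/
noncomputable def map (f : W → W) (γ : SpinGraph S W) : SpinGraph S W where
  spin m := if h : ∃ l, l ∈ γ.verts ∧ f l = m then γ.spin h.choose else none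
  graph :=
    { Adj := fun m m' => m ≠ m' ∧ ∃ l l', γ.graph.Adj l l' ∧ f l = m ∧ f l' = m'
      symm := ⟨fun _ _ ⟨h, l, l', h1, h2, h3⟩ => ⟨h.symm, l', l, h1.symm, h3, h2⟩⟩
      loopless := ⟨fun _ h => h.1 rfl⟩ }
  spin_ne_none u v h := by
    obtain ⟨-, l, l', h1, h2, -⟩ := h
    have hex : ∃ l, l ∈ γ.verts ∧ f l = u := ⟨l, (mem_verts_of_adj h1).1, h2⟩
    rw [dif_pos hex]
    exact hex.choose_spec.1

variable {f f' : W → W} {γ : SpinGraph S W} {V : Set W}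

theorem map_spin (hf : InjOn f V) (hV : γ.verts ⊆ V) {l : W} (hl : l ∈ V) :
    (γ.map f).spin (f l) = γ.spin l := by
  by_cases hex : ∃ l', l' ∈ γ.verts ∧ f l' = f l
  · have : (γ.map f).spin (f l) = γ.spin hex.choose := dif_pos hex
    rw [this, hf (hV hex.choose_spec.1) hl hex.choose_spec.2]
  · have : (γ.map f).spin (f l) = none := dif_neg hex
    rw [this]
    by_contra hne
    exact hex ⟨l, Ne.symm hne, rfl⟩

theorem map_spin_eq_none {m : W} (h : ∀ l ∈ γ.verts, f l ≠ m) : (γ.map f).spin m = none :=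
  dif_neg fun ⟨l, h1, h2⟩ => h l h1 h2

theorem mem_verts_map {m : W} : m ∈ (γ.map f).verts ↔ ∃ l ∈ γ.verts, f l = m := by
  constructor
  · intro h
    by_contra hcon
    push Not at hcon
    exact h (map_spin_eq_none hcon)
  · rintro hex
    have : (γ.map f).spin m = γ.spin hex.choose := dif_pos hex
    rw [verts, mem_ofPred_eq, this]
    exact hex.choose_spec.1

theorem map_adj (hf : InjOn f γ.verts) {m m' : W} :
    (γ.map f).graph.Adj m m' ↔ ∃ l l', γ.graph.Adj l l' ∧ f l = m ∧ f l' = m' := by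
  constructor
  · exact fun h => h.2
  · rintro ⟨l, l', h, rfl, rfl⟩
    have := mem_verts_of_adj h
    exact ⟨fun heq => h.ne (hf this.1 this.2 heq), l, l', h, rfl, rfl⟩

theorem map_adj_iff (hf : InjOn f V) (hV : γ.verts ⊆ V) {l l' : W} (hl : l ∈ V) (hl' : l' ∈ V) :
    (γ.map f).graph.Adj (f l) (f l') ↔ γ.graph.Adj l l' := by
  rw [map_adj (hf.mono hV)]
  constructor
  · rintro ⟨m, m', h, h1, h2⟩
    have := mem_verts_of_adj h
    rwa [← hf (hV this.1) hl h1, ← hf (hV this.2) hl' h2]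
  · exact fun h => ⟨l, l', h, rfl, rfl⟩

theorem map_congr (h : EqOn f f' γ.verts) : γ.map f = γ.map f' := by
  refine ext_of (fun m => ?_) fun m m' => ?_
  · have : (fun l => l ∈ γ.verts ∧ f l = m) = fun l => l ∈ γ.verts ∧ f' l = m := by
      ext l
      exact and_congr_right fun hl => by rw [h hl]
    classical
    exact congrArg (fun p : W → Prop => if h : ∃ l, p l then γ.spin h.choose else none) this
  · refine and_congr_right fun _ => exists_congr fun l => exists_congr fun l' =>
      and_congr_right fun hl => ?_
    rw [h (mem_verts_of_adj hl).1, h (mem_verts_of_adj hl).2]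

end SpinGraph

/-! ### Substitutions with prescribed names: renaming and restriction -/

namespace Rule

variable {S : Type} (ρ : Rule S) (new : Fin ρ.newSize → Label) (ψ : Fin (ρ.size + 1) → Label)

open scoped Classical in
/-- The name of the vertex `y` of `Γ'` after the substitution, if new vertices are named by `new`. -/
noncomputable def placeAt (y : Fin ρ.newSize) : Label :=
  if h : ∃ x, ρ.glue x = some y then ψ h.choose else new y

open scoped Classical in
/-- What becomes of an old vertex. -/
noncomputable def collapseAt (u : Label) : Option Label :=
  if h : ∃ x, ψ x = u then (ρ.glue h.choose).map (ρ.placeAt new ψ) else some u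

variable {new ψ}

theorem placeAt_mem (y : Fin ρ.newSize) : ρ.placeAt new ψ y ∈ range ψ ∪ range new := by
  unfold placeAt
  split_ifs with h
  · exact Or.inl ⟨_, rfl⟩
  · exact Or.inr ⟨_, rfl⟩

theorem collapseAt_eq_some {u w : Label} (h : ρ.collapseAt new ψ u = some w) :
    (u ∉ range ψ ∧ u = w) ∨ (u ∈ range ψ ∧ w ∈ range (ρ.placeAt new ψ)) := by
  unfold collapseAt at h
  split_ifs at h with hx
  · obtain ⟨y, -, hy⟩ := Option.map_eq_some_iff.1 h
    exact Or.inr ⟨hx, y, hy⟩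
  · exact Or.inl ⟨hx, Option.some.inj h⟩

theorem collapseAt_apply (hψ : Function.Injective ψ) (x : Fin (ρ.size + 1)) :
    ρ.collapseAt new ψ (ψ x) = (ρ.glue x).map (ρ.placeAt new ψ) := by
  have hex : ∃ x', ψ x' = ψ x := ⟨x, rfl⟩
  unfold collapseAt
  rw [dif_pos hex, hψ hex.choose_spec]

theorem collapseAt_of_notMem {u : Label} (h : u ∉ range ψ) : ρ.collapseAt new ψ u = some u :=
  dif_neg h

theorem placeAt_injective (hψ : Function.Injective ψ) (hnew : Function.Injective new)
    (hd : ∀ x y, ψ x ≠ new y) : Function.Injective (ρ.placeAt new ψ) := by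
  intro y y' h
  unfold placeAt at h
  split_ifs at h with h1 h2 h2
  · have := hψ h
    have e1 := h1.choose_spec
    rw [this, h2.choose_spec] at e1
    exact (Option.some.inj e1).symm
  · exact absurd h (hd _ _)
  · exact absurd h.symm (hd _ _)
  · exact hnew h

open scoped Classical in
/-- The substitution with the given names for the new vertices. -/
noncomputable def applyAt (new : Fin ρ.newSize → Label) (γ : SpinGraph S Label)
    (ψ : Fin (ρ.size + 1) → Label) : SpinGraph S Label where
  spin w :=
    if h : ∃ y, ρ.placeAt new ψ y = w then some (ρ.rhsSpin h.choose)
    else if ∃ x, ψ x = w then none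
    else γ.spin w
  graph := SimpleGraph.fromRel fun w z =>
    (∃ y y', ρ.rhs.Adj y y' ∧ ρ.placeAt new ψ y = w ∧ ρ.placeAt new ψ y' = z) ∨
    ∃ u v, γ.graph.Adj u v ∧ (¬ ∃ x x', ρ.lhs.Adj x x' ∧ ψ x = u ∧ ψ x' = v) ∧
      ρ.collapseAt new ψ u = some w ∧ ρ.collapseAt new ψ v = some z
  spin_ne_none := by
    have key : ∀ u w, γ.spin u ≠ none → ρ.collapseAt new ψ u = some w →
        (if h : ∃ y, ρ.placeAt new ψ y = w then some (ρ.rhsSpin h.choose)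
          else if ∃ x, ψ x = w then none else γ.spin w) ≠ none := by
      intro u w hu hc
      by_cases hy : ∃ y, ρ.placeAt new ψ y = w
      · rw [dif_pos hy]; simp
      · rw [dif_neg hy]
        rcases ρ.collapseAt_eq_some hc with ⟨h1, rfl⟩ | ⟨-, h2⟩
        · rw [if_neg (show ¬ ∃ x, ψ x = u from h1)]
          exact hu
        · exact absurd h2 hy
    intro w z h
    rw [SimpleGraph.fromRel_adj] at h
    rcases h.2 with (⟨y, y', -, hw, -⟩ | ⟨u, v, huv, -, hw, -⟩) |
        (⟨y, y', -, -, hw⟩ | ⟨u, v, huv, -, -, hw⟩)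
    · rw [dif_pos ⟨y, hw⟩]; simp
    · exact key u w (γ.spin_ne_none u v huv) hw
    · rw [dif_pos ⟨y', hw⟩]; simp
    · exact key v w (γ.spin_ne_none v u huv.symm) hw

theorem apply_eq_applyAt (γ : SpinGraph S Label) (ψ : Fin (ρ.size + 1) → Label) :
    ρ.apply γ ψ = ρ.applyAt (fun y => (ψ 0).child (γ.firstFree (ψ 0) + y)) γ ψ := rfl

variable {γ : SpinGraph S Label}

theorem applyAt_adj {w z : Label} : (ρ.applyAt new γ ψ).graph.Adj w z ↔ w ≠ z ∧
    ((∃ y y', ρ.rhs.Adj y y' ∧ ρ.placeAt new ψ y = w ∧ ρ.placeAt new ψ y' = z) ∨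
    ∃ u v, γ.graph.Adj u v ∧ (¬ ∃ x x', ρ.lhs.Adj x x' ∧ ψ x = u ∧ ψ x' = v) ∧
      ρ.collapseAt new ψ u = some w ∧ ρ.collapseAt new ψ v = some z) := by
  refine (SimpleGraph.fromRel_adj _ _ _).trans (and_congr_right fun _ => or_iff_left_of_imp ?_)
  rintro (⟨y, y', h1, h2, h3⟩ | ⟨u, v, h1, h2, h3, h4⟩)
  · exact Or.inl ⟨y', y, h1.symm, h3, h2⟩
  · exact Or.inr ⟨v, u, h1.symm, fun ⟨x, x', k1, k2, k3⟩ => h2 ⟨x', x, k1.symm, k3, k2⟩, h4, h3⟩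

theorem applyAt_spin_place (hp : Function.Injective (ρ.placeAt new ψ)) (y : Fin ρ.newSize) :
    (ρ.applyAt new γ ψ).spin (ρ.placeAt new ψ y) = some (ρ.rhsSpin y) := by
  have hex : ∃ y', ρ.placeAt new ψ y' = ρ.placeAt new ψ y := ⟨y, rfl⟩
  refine (dif_pos hex).trans ?_
  rw [hp hex.choose_spec]

theorem applyAt_spin_range {w : Label} (h : w ∉ range (ρ.placeAt new ψ)) (hw : w ∈ range ψ) :
    (ρ.applyAt new γ ψ).spin w = none :=
  (dif_neg h).trans (if_pos hw)

theorem applyAt_spin_of_notMem {w : Label} (h : w ∉ range (ρ.placeAt new ψ)) (hw : w ∉ range ψ) :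
    (ρ.applyAt new γ ψ).spin w = γ.spin w :=
  (dif_neg h).trans (if_neg hw)

theorem applyAt_spin_of_notMem' {w : Label} (h : w ∉ range new) (hw : w ∉ range ψ) :
    (ρ.applyAt new γ ψ).spin w = γ.spin w := by
  refine ρ.applyAt_spin_of_notMem ?_ hw
  rintro ⟨y, rfl⟩
  exact (ρ.placeAt_mem y).elim hw h

theorem applyAt_verts_subset : (ρ.applyAt new γ ψ).verts ⊆ (γ.verts ∪ range ψ) ∪ range new := by
  intro w hw
  by_contra hcon
  simp only [mem_union, not_or] at hcon
  rw [SpinGraph.verts, mem_ofPred_eq, ρ.applyAt_spin_of_notMem' hcon.2 hcon.1.2] at hw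
  exact hcon.1.1 hw

/-- The links after a substitution: new ones, or old ones with moved end points. -/
theorem applyAt_adj_cases {w z : Label} (h : (ρ.applyAt new γ ψ).graph.Adj w z) :
    (w ∈ range ψ ∪ range new ∧ z ∈ range ψ ∪ range new) ∨ ∃ u v, γ.graph.Adj u v ∧
      ((u ∉ range ψ ∧ u = w) ∨ (u ∈ range ψ ∧ w ∈ range ψ ∪ range new)) ∧
      ((v ∉ range ψ ∧ v = z) ∨ (v ∈ range ψ ∧ z ∈ range ψ ∪ range new)) := by
  have hsub : range (ρ.placeAt new ψ) ⊆ range ψ ∪ range new := by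
    rintro _ ⟨y, rfl⟩
    exact ρ.placeAt_mem y
  rcases (ρ.applyAt_adj.1 h).2 with ⟨y, y', -, rfl, rfl⟩ | ⟨u, v, huv, -, hu, hv⟩
  · exact Or.inl ⟨ρ.placeAt_mem y, ρ.placeAt_mem y'⟩
  · refine Or.inr ⟨u, v, huv, ?_, ?_⟩
    · exact (ρ.collapseAt_eq_some hu).imp_right fun h => ⟨h.1, hsub h.2⟩
    · exact (ρ.collapseAt_eq_some hv).imp_right fun h => ⟨h.1, hsub h.2⟩

/-- Substitution commutes with renaming. -/
theorem map_applyAt {f : Label → Label} {V : Set Label} (hf : InjOn f V) (hγ : γ.verts ⊆ V)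
    (hψV : range ψ ⊆ V) (hnewV : range new ⊆ V) (hψ : Function.Injective ψ)
    (hnew : Function.Injective new) (hd : ∀ x y, ψ x ≠ new y) :
    (ρ.applyAt new γ ψ).map f = ρ.applyAt (f ∘ new) (γ.map f) (f ∘ ψ) := by
  have hmemψ : ∀ x, ψ x ∈ V := fun x => hψV ⟨x, rfl⟩
  have hmemn : ∀ x, new x ∈ V := fun x => hnewV ⟨x, rfl⟩
  have hψ' : Function.Injective (f ∘ ψ) := fun x x' h => hψ (hf (hmemψ _) (hmemψ _) h)
  have hnew' : Function.Injective (f ∘ new) := fun x x' h => hnew (hf (hmemn _) (hmemn _) h)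
  have hd' : ∀ x y, (f ∘ ψ) x ≠ (f ∘ new) y := fun x y h => hd x y (hf (hmemψ _) (hmemn _) h)
  have hplace : ∀ y, ρ.placeAt (f ∘ new) (f ∘ ψ) y = f (ρ.placeAt new ψ y) := fun y => by
    unfold placeAt
    split_ifs <;> rfl
  have hplaceV : ∀ y, ρ.placeAt new ψ y ∈ V := fun y =>
    (ρ.placeAt_mem y).elim (fun h => hψV h) fun h => hnewV h
  have hψr : ∀ u ∈ V, f u ∈ range (f ∘ ψ) ↔ u ∈ range ψ := fun u hu =>
    ⟨fun ⟨x, hx⟩ => ⟨x, hf (hmemψ x) hu hx⟩, fun ⟨x, hx⟩ => ⟨x, congrArg f hx⟩⟩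
  have hpr : ∀ u ∈ V, f u ∈ range (ρ.placeAt (f ∘ new) (f ∘ ψ)) ↔ u ∈ range (ρ.placeAt new ψ) :=
    fun u hu => ⟨fun ⟨x, hx⟩ => ⟨x, hf (hplaceV x) hu ((hplace x).symm.trans hx)⟩,
      fun ⟨x, hx⟩ => ⟨x, (hplace x).trans (congrArg f hx)⟩⟩
  -- Injectivity on `V` is needed here: an old vertex outside of the matched subgraph must not be
  -- renamed to one inside.
  have hcol : ∀ u ∈ V, ρ.collapseAt (f ∘ new) (f ∘ ψ) (f u) = (ρ.collapseAt new ψ u).map f := by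
    intro u hu
    by_cases h : u ∈ range ψ
    · obtain ⟨x, rfl⟩ := h
      rw [ρ.collapseAt_apply hψ, Option.map_map]
      refine (ρ.collapseAt_apply hψ' x).trans ?_
      congr 1
      exact funext hplace
    · rw [ρ.collapseAt_of_notMem h, ρ.collapseAt_of_notMem (mt (hψr u hu).1 h)]
      rfl
  have hcolV : ∀ u ∈ V, ∀ w, ρ.collapseAt new ψ u = some w → w ∈ V := fun u hu w h => by
    rcases ρ.collapseAt_eq_some h with ⟨-, rfl⟩ | ⟨-, y, rfl⟩
    exacts [hu, hplaceV y]
  have hV : (ρ.applyAt new γ ψ).verts ⊆ V :=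
    ρ.applyAt_verts_subset.trans (union_subset (union_subset hγ hψV) hnewV)
  have hp := ρ.placeAt_injective hψ hnew hd
  have hp' := ρ.placeAt_injective hψ' hnew' hd'
  refine SpinGraph.ext_of (fun m => ?_) fun m m' => ?_
  · by_cases hm : m ∈ f '' V
    · obtain ⟨l, hl, rfl⟩ := hm
      rw [SpinGraph.map_spin hf hV hl]
      by_cases h1 : l ∈ range (ρ.placeAt new ψ)
      · obtain ⟨y, rfl⟩ := h1
        rw [ρ.applyAt_spin_place hp, ← hplace, ρ.applyAt_spin_place hp']
      · have h1' := mt (hpr l hl).1 h1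
        by_cases h2 : l ∈ range ψ
        · rw [ρ.applyAt_spin_range h1 h2, ρ.applyAt_spin_range h1' ((hψr l hl).2 h2)]
        · rw [ρ.applyAt_spin_of_notMem h1 h2, ρ.applyAt_spin_of_notMem h1' (mt (hψr l hl).1 h2),
            SpinGraph.map_spin hf hγ hl]
    · rw [SpinGraph.map_spin_eq_none fun l hl h => hm ⟨l, hV hl, h⟩, ρ.applyAt_spin_of_notMem,
        SpinGraph.map_spin_eq_none fun l hl h => hm ⟨l, hγ hl, h⟩]
      · rintro ⟨y, rfl⟩
        exact hm ⟨_, hplaceV y, (hplace y).symm⟩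
      · rintro ⟨x, rfl⟩
        exact hm ⟨_, hmemψ x, rfl⟩
  · rw [SpinGraph.map_adj (hf.mono hV)]
    constructor
    · rintro ⟨l, l', h, rfl, rfl⟩
      have hmem := SpinGraph.mem_verts_of_adj h
      rw [applyAt_adj] at h ⊢
      refine ⟨fun heq => h.1 (hf (hV hmem.1) (hV hmem.2) heq), ?_⟩
      rcases h.2 with ⟨y, y', h1, rfl, rfl⟩ | ⟨u, v, huv, h1, h2, h3⟩
      · exact Or.inl ⟨y, y', h1, hplace y, hplace y'⟩
      · have hu := SpinGraph.mem_verts_of_adj huv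
        refine Or.inr ⟨f u, f v, (SpinGraph.map_adj_iff hf hγ (hγ hu.1) (hγ hu.2)).2 huv, ?_, ?_, ?_⟩
        · rintro ⟨x, x', hx, e1, e2⟩
          exact h1 ⟨x, x', hx, hf (hmemψ x) (hγ hu.1) e1, hf (hmemψ x') (hγ hu.2) e2⟩
        · rw [hcol u (hγ hu.1), h2]; rfl
        · rw [hcol v (hγ hu.2), h3]; rfl
    · intro h
      rw [applyAt_adj] at h
      obtain ⟨hne, h⟩ := h
      rcases h with ⟨y, y', h1, rfl, rfl⟩ | ⟨u, v, huv, h1, h2, h3⟩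
      · refine ⟨ρ.placeAt new ψ y, ρ.placeAt new ψ y', ?_, (hplace y).symm, (hplace y').symm⟩
        rw [applyAt_adj]
        exact ⟨fun heq => h1.ne (hp heq), Or.inl ⟨y, y', h1, rfl, rfl⟩⟩
      · rw [SpinGraph.map_adj (hf.mono hγ)] at huv
        obtain ⟨l, l', hll, rfl, rfl⟩ := huv
        have hl := SpinGraph.mem_verts_of_adj hll
        rw [hcol l (hγ hl.1), Option.map_eq_some_iff] at h2
        rw [hcol l' (hγ hl.2), Option.map_eq_some_iff] at h3
        obtain ⟨w, hw, rfl⟩ := h2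
        obtain ⟨w', hw', rfl⟩ := h3
        refine ⟨w, w', ?_, rfl, rfl⟩
        rw [applyAt_adj]
        refine ⟨fun heq => hne (congrArg f heq), Or.inr ⟨l, l', hll, ?_, hw, hw'⟩⟩
        rintro ⟨x, x', hx, rfl, rfl⟩
        exact h1 ⟨x, x', hx, rfl, rfl⟩

/-- Substitution inside of `A` commutes with the restriction to `A`. -/
theorem restrict_applyAt_of_subset {A : Set Label} (hψ : range ψ ⊆ A) (hnew : range new ⊆ A) :
    (ρ.applyAt new γ ψ).restrict A = ρ.applyAt new (γ.restrict A) ψ := by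
  classical
  have hplace : ∀ y, ρ.placeAt new ψ y ∈ A := fun y =>
    (ρ.placeAt_mem y).elim (fun h => hψ h) fun h => hnew h
  have hcol : ∀ u w, ρ.collapseAt new ψ u = some w → w ∈ A → u ∈ A := fun u w h hw => by
    rcases ρ.collapseAt_eq_some h with ⟨-, rfl⟩ | ⟨h, -⟩
    exacts [hw, hψ h]
  have hcol' : ∀ u w, ρ.collapseAt new ψ u = some w → u ∈ A → w ∈ A := fun u w h hu => by
    rcases ρ.collapseAt_eq_some h with ⟨-, rfl⟩ | ⟨-, y, rfl⟩
    exacts [hu, hplace y]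
  refine SpinGraph.ext_of (fun m => ?_) fun m m' => ?_
  · by_cases hm : m ∈ A
    · refine (if_pos hm).trans ?_
      have : (γ.restrict A).spin m = γ.spin m := if_pos hm
      simp only [applyAt, this]
    · refine (if_neg hm).trans ?_
      rw [ρ.applyAt_spin_of_notMem' (fun h => hm (hnew h)) fun h => hm (hψ h)]
      exact (if_neg hm).symm
  · change (ρ.applyAt new γ ψ).graph.Adj m m' ∧ m ∈ A ∧ m' ∈ A ↔ _
    rw [applyAt_adj, applyAt_adj]
    constructor
    · rintro ⟨⟨h0, h⟩, hm, hm'⟩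
      refine ⟨h0, h.imp_right ?_⟩
      rintro ⟨u, v, h1, h2, h3, h4⟩
      exact ⟨u, v, ⟨h1, hcol _ _ h3 hm, hcol _ _ h4 hm'⟩, h2, h3, h4⟩
    · rintro ⟨h0, ⟨y, y', h1, rfl, rfl⟩ | ⟨u, v, h1, h2, h3, h4⟩⟩
      · exact ⟨⟨h0, Or.inl ⟨y, y', h1, rfl, rfl⟩⟩, hplace _, hplace _⟩
      · exact ⟨⟨h0, Or.inr ⟨u, v, h1.1, h2, h3, h4⟩⟩, hcol' _ _ h3 h1.2.1, hcol' _ _ h4 h1.2.2⟩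

/-- Substitution outside of `A` does not affect the restriction to `A`. -/
theorem restrict_applyAt_of_disjoint {A : Set Label} (hψ : Disjoint (range ψ) A)
    (hnew : Disjoint (range new) A) : (ρ.applyAt new γ ψ).restrict A = γ.restrict A := by
  classical
  have hplace : ∀ y, ρ.placeAt new ψ y ∉ A := fun y =>
    (ρ.placeAt_mem y).elim (fun h => disjoint_left.1 hψ h) fun h => disjoint_left.1 hnew h
  have hcol : ∀ u w, ρ.collapseAt new ψ u = some w → w ∈ A → u = w := fun u w h hw => by
    rcases ρ.collapseAt_eq_some h with ⟨-, rfl⟩ | ⟨-, y, rfl⟩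
    exacts [rfl, absurd hw (hplace y)]
  refine SpinGraph.ext_of (fun m => ?_) fun m m' => ?_
  · by_cases hm : m ∈ A
    · refine (if_pos hm).trans ?_
      rw [ρ.applyAt_spin_of_notMem' (fun h => disjoint_left.1 hnew h hm)
        fun h => disjoint_left.1 hψ h hm]
      exact (if_pos hm).symm
    · exact (if_neg hm).trans (if_neg hm).symm
  · change (ρ.applyAt new γ ψ).graph.Adj m m' ∧ m ∈ A ∧ m' ∈ A ↔ γ.graph.Adj m m' ∧ m ∈ A ∧ m' ∈ A
    rw [applyAt_adj]
    constructor
    · rintro ⟨⟨h0, ⟨y, y', h1, rfl, rfl⟩ | ⟨u, v, h1, h2, h3, h4⟩⟩, hm, hm'⟩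
      · exact absurd hm (hplace _)
      · obtain rfl := hcol _ _ h3 hm
        obtain rfl := hcol _ _ h4 hm'
        exact ⟨h1, hm, hm'⟩
    · rintro ⟨h1, hm, hm'⟩
      have hn : ∀ u ∈ A, u ∉ range ψ := fun u hu h => disjoint_left.1 hψ h hu
      refine ⟨⟨h1.ne, Or.inr ⟨m, m', h1, ?_, ρ.collapseAt_of_notMem (hn m hm),
        ρ.collapseAt_of_notMem (hn m' hm')⟩⟩, hm, hm'⟩
      rintro ⟨x, x', -, rfl, -⟩
      exact hn _ hm ⟨x, rfl⟩

end Rule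

/-! ### Evolution with canonical names that are never used twice -/

/-- A state in which every vertex has a name that is never used again after its deletion. The next
vertices created at `b` get the indices from `cnt b` on; `lab l` is the name in the sense of
`Marked` of the vertex `l`. -/
structure CState (S : Type) where
  graph : SpinGraph S Label
  touched : Set Label
  cnt : Label → ℕ
  lab : Label → Label

namespace SpinGraph

variable {S : Type} {γ : SpinGraph S Label}

theorem HasRoom.firstFree_spec (h : γ.HasRoom) (b : Label) {j : ℕ} (hj : γ.firstFree b ≤ j) :
    γ.spin (b.child j) = none := by
  have hne : {K : ℕ | ∀ j, K ≤ j → γ.spin (b.child j) = none}.Nonempty := by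
    obtain ⟨K, hK⟩ := (h b).bddAbove
    refine ⟨K + 1, fun j hj => ?_⟩
    by_contra hne
    have := hK hne
    omega
  exact Nat.sInf_mem hne j hj

end SpinGraph

namespace CState

variable {S : Type}

/-- The state with the actual names. -/
noncomputable def img (z : CState S) : Marked S := ⟨z.graph.map z.lab, z.lab '' z.touched⟩

/-- The initial state. -/
noncomputable def init (α : SpinGraph S ℕ) : CState S := ⟨α.embed, ∅, fun _ => 0, id⟩

/-- The name of the vertex `y` that is created by a substitution at `φ`. -/
def newName (z : CState S) {m k : ℕ} (φ : Fin (m + 1) → Label) (y : Fin k) : Label :=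
  (φ 0).child (z.cnt (φ 0) + y)

open scoped Classical in
/-- The state after a move. -/
noncomputable def step (G : Grammar S) (c : G.Move) (z : CState S) : CState S where
  graph := (G.rule c.1).applyAt (z.newName c.2) z.graph c.2
  touched := z.touched ∪ range c.2
  cnt b := if b = c.2 0 then z.cnt b + (G.rule c.1).newSize else z.cnt b
  lab l := if h : ∃ y : Fin (G.rule c.1).newSize, z.newName c.2 y = l then
    (z.lab (c.2 0)).child (z.img.graph.firstFree (z.lab (c.2 0)) + h.choose) else z.lab l

/-- The move is possible. -/
def CanMove (G : Grammar S) (c : G.Move) (z : CState S) : Prop :=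
  (G.rule c.1).IsMatch z.graph c.2

theorem newName_injective (z : CState S) {m k : ℕ} (φ : Fin (m + 1) → Label) :
    Function.Injective (z.newName φ : Fin k → Label) := fun y y' h => by
  have := (Label.child_inj.1 h).2
  exact Fin.ext (by omega)

/-- The invariants of the evolution. -/
structure Good (n : ℕ) (z : CState S) : Prop where
  fresh : ∀ b k, b.child k ∈ z.graph.verts ∪ z.touched → k < z.cnt b
  root : ∀ l, (z.lab l).1 = l.1
  len : ∀ l, (z.lab l).2.length = l.2.length
  inj : InjOn z.lab z.graph.verts
  fin : ∀ r, {l | l ∈ z.graph.verts ∧ l.1 = r}.Finite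
  degree : z.img.graph.DegreeLE n

variable {G : Grammar S} {n : ℕ} {z : CState S} {c : G.Move}

theorem CanMove.range_subset (h : CanMove G c z) : range c.2 ⊆ z.graph.verts := by
  rintro _ ⟨x, rfl⟩
  rw [SpinGraph.verts, mem_ofPred_eq, h.2.1 x]
  simp

theorem Good.newName_notMem (h : Good n z) {m k : ℕ} (φ : Fin (m + 1) → Label) (y : Fin k) :
    z.newName φ y ∉ z.graph.verts ∪ z.touched := fun hm => by
  have := h.fresh _ _ hm
  omega

theorem Good.ne_newName (h : Good n z) (hc : CanMove G c z) (x) (y : Fin (G.rule c.1).newSize) :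
    c.2 x ≠ z.newName c.2 y := fun heq =>
  h.newName_notMem c.2 y (Or.inl (heq ▸ hc.range_subset ⟨x, rfl⟩))

/-- All names reserved for vertices created at b have the root of b, names keep their roots under
`lab`, and only finitely many vertices exist over each root. -/
theorem Good.hasRoom (h : Good n z) : z.img.graph.HasRoom := by
  intro b
  refine Set.Finite.of_finite_image (f := fun k => b.child k) ?_ fun k _ k' _ hk =>
    (Label.child_inj.1 hk).2
  refine ((h.fin b.1).image z.lab).subset ?_
  rintro _ ⟨k, hk, rfl⟩
  obtain ⟨l, hl, hlb⟩ := SpinGraph.mem_verts_map.1 hk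
  refine ⟨l, ⟨hl, ?_⟩, hlb⟩
  rw [← h.root l, hlb]
  rfl

theorem step_lab_newName (z : CState S) (c : G.Move) (y : Fin (G.rule c.1).newSize) :
    (z.step G c).lab (z.newName c.2 y) =
      (z.lab (c.2 0)).child (z.img.graph.firstFree (z.lab (c.2 0)) + y) := by
  have hex : ∃ y' : Fin (G.rule c.1).newSize, z.newName c.2 y' = z.newName c.2 y := ⟨y, rfl⟩
  have := z.newName_injective c.2 hex.choose_spec
  refine (dif_pos hex).trans ?_
  rw [this]

theorem step_lab_of_notMem {l : Label} (h : ∀ y : Fin (G.rule c.1).newSize, z.newName c.2 y ≠ l) :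
    (z.step G c).lab l = z.lab l :=
  dif_neg fun ⟨y, hy⟩ => h y hy

theorem Good.step_lab (h : Good n z) {l : Label} (hl : l ∈ z.graph.verts ∪ z.touched) :
    (z.step G c).lab l = z.lab l :=
  step_lab_of_notMem fun y hy => h.newName_notMem c.2 y (hy ▸ hl)

/-- The actual names given to the new vertices start at `firstFree`, so they differ from those of
all existing vertices. The vertices about to be deleted are still included, since the actual name is
chosen before the substitution. -/
theorem Good.step_inj (h : Good n z) : InjOn (z.step G c).lab
    (z.graph.verts ∪ range (z.newName c.2 : Fin (G.rule c.1).newSize → Label)) := by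
  have hroom := h.hasRoom
  have hfree : ∀ l ∈ z.graph.verts, ∀ y : Fin (G.rule c.1).newSize,
      z.lab l ≠ (z.lab (c.2 0)).child (z.img.graph.firstFree (z.lab (c.2 0)) + y) := by
    intro l hl y heq
    have h1 : z.lab l ∈ z.img.graph.verts := SpinGraph.mem_verts_map.2 ⟨l, hl, rfl⟩
    rw [heq] at h1
    exact h1 (hroom.firstFree_spec _ (by omega))
  rintro l (hl | ⟨y, rfl⟩) l' (hl' | ⟨y', rfl⟩) heq
  · rw [h.step_lab (Or.inl hl), h.step_lab (Or.inl hl')] at heq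
    exact h.inj hl hl' heq
  · rw [h.step_lab (Or.inl hl), step_lab_newName] at heq
    exact absurd heq (hfree l hl y')
  · rw [h.step_lab (Or.inl hl'), step_lab_newName] at heq
    exact absurd heq.symm (hfree l' hl' y)
  · rw [step_lab_newName, step_lab_newName] at heq
    have := (Label.child_inj.1 heq).2
    rw [show y = y' from Fin.ext (by omega)]

theorem CanMove.img (h : Good n z) (hc : CanMove G c z) :
    G.CanMove ⟨c.1, z.lab ∘ c.2⟩ z.img := by
  have hV : ∀ x, c.2 x ∈ z.graph.verts := fun x => hc.range_subset ⟨x, rfl⟩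
  refine ⟨fun x x' hx => hc.1 (h.inj (hV x) (hV x') hx), fun x => ?_, fun x y hxy => ?_⟩
  · exact (SpinGraph.map_spin h.inj Subset.rfl (hV x)).trans (hc.2.1 x)
  · exact (SpinGraph.map_adj_iff h.inj Subset.rfl (hV x) (hV y)).2 (hc.2.2 x y hxy)

theorem step_verts_subset (hc : CanMove G c z) : (z.step G c).graph.verts ⊆
    z.graph.verts ∪ range (z.newName c.2 : Fin (G.rule c.1).newSize → Label) := by
  refine (G.rule c.1).applyAt_verts_subset.trans ?_
  rw [union_eq_self_of_subset_right hc.range_subset]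

/-- Substitution commutes with a renaming that is injective on the old and new vertices, and `lab`
sends the new canonical names to exactly those names that the substitution with actual names would
choose. -/
theorem Good.img_step (h : Good n z) (hc : CanMove G c z) :
    (z.step G c).img = G.step ⟨c.1, z.lab ∘ c.2⟩ z.img := by
  have h1 : z.graph.map (z.step G c).lab = z.graph.map z.lab :=
    SpinGraph.map_congr fun l hl => h.step_lab (Or.inl hl)
  have h2 : (z.step G c).lab ∘ c.2 = z.lab ∘ c.2 :=
    funext fun x => h.step_lab (Or.inl (hc.range_subset ⟨x, rfl⟩))
  refine Marked.ext ?_ ?_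
  · refine ((G.rule c.1).map_applyAt (h.step_inj) subset_union_left
      (hc.range_subset.trans subset_union_left) subset_union_right hc.1 (z.newName_injective c.2)
      (h.ne_newName hc)).trans ?_
    rw [h1, h2]
    refine Eq.trans ?_ ((G.rule c.1).apply_eq_applyAt _ _).symm
    congr 1
    funext y
    exact step_lab_newName z c y
  · change (z.step G c).lab '' (z.touched ∪ range c.2) = z.lab '' z.touched ∪ range (z.lab ∘ c.2)
    rw [image_union, ← range_comp, h2]
    congr 1
    exact image_congr fun l hl => h.step_lab (Or.inr hl)

theorem newName_eq_child {b : Label} {k m p : ℕ} {φ : Fin (m + 1) → Label} {y : Fin p}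
    (h : z.newName φ y = b.child k) : b = φ 0 ∧ k = z.cnt (φ 0) + y :=
  let h := Label.child_inj.1 h
  ⟨h.1.symm, h.2.symm⟩

theorem le_step_cnt (z : CState S) (c : G.Move) (b : Label) : z.cnt b ≤ (z.step G c).cnt b := by
  simp only [step]
  split_ifs <;> omega

theorem Good.step (hn : ∀ i (γ : SpinGraph S Label) ψ, γ.HasRoom → γ.DegreeLE n →
    (G.rule i).IsMatch γ ψ → ((G.rule i).apply γ ψ).DegreeLE n) (h : Good n z)
    (hc : CanMove G c z) : Good n (z.step G c) where
  fresh b k hbk := by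
    have hsub : b.child k ∈ (z.graph.verts ∪ z.touched) ∪
        range (z.newName c.2 : Fin (G.rule c.1).newSize → Label) := by
      rcases hbk with hbk | hbk | hbk
      · exact (step_verts_subset hc hbk).imp Or.inl id
      · exact Or.inl (Or.inr hbk)
      · exact Or.inl (Or.inl (hc.range_subset hbk))
    rcases hsub with hbk | ⟨y, hy⟩
    · exact (h.fresh b k hbk).trans_le (le_step_cnt z c b)
    · obtain ⟨rfl, rfl⟩ := newName_eq_child hy
      simp [CState.step]
  root l := by
    by_cases hl : ∃ y : Fin (G.rule c.1).newSize, z.newName c.2 y = l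
    · obtain ⟨y, rfl⟩ := hl
      rw [step_lab_newName]
      exact h.root (c.2 0)
    · push Not at hl
      rw [step_lab_of_notMem hl, h.root]
  len l := by
    by_cases hl : ∃ y : Fin (G.rule c.1).newSize, z.newName c.2 y = l
    · obtain ⟨y, rfl⟩ := hl
      rw [step_lab_newName]
      simp [Label.child, newName, h.len (c.2 0)]
    · push Not at hl
      rw [step_lab_of_notMem hl, h.len]
  inj := (h.step_inj).mono (step_verts_subset hc)
  fin r := by
    refine ((h.fin r).union (finite_range (z.newName c.2 : Fin (G.rule c.1).newSize → Label))).subset ?_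
    rintro l ⟨hl, hr⟩
    exact (step_verts_subset hc hl).imp (fun h => ⟨h, hr⟩) id
  degree := by
    -- The degree bound is preserved for states with room for new names, hence it is applied to the
    -- state with actual names.
    rw [h.img_step hc]
    exact hn _ _ _ h.hasRoom h.degree (hc.img h)

theorem mem_verts_embed {α : SpinGraph S ℕ} {l : Label} :
    l ∈ α.embed.verts ↔ l.2 = [] ∧ l.1 ∈ α.verts := by
  simp only [SpinGraph.verts, SpinGraph.embed, mem_ofPred_eq]
  split_ifs with h <;> simp [h]

theorem map_id (γ : SpinGraph S Label) : γ.map id = γ := by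
  refine SpinGraph.ext_of (fun l => ?_) fun l m => ?_
  · exact SpinGraph.map_spin (f := id) (injOn_id univ) (subset_univ _) (mem_univ l)
  · exact SpinGraph.map_adj_iff (f := id) (injOn_id _) (subset_univ _) (mem_univ l) (mem_univ m)

theorem img_init (α : SpinGraph S ℕ) : (init α).img = Marked.init α :=
  Marked.ext (map_id _) (image_empty _)

theorem Good.init {α : SpinGraph S ℕ} (hα : α.DegreeLE n) : Good n (CState.init α) where
  fresh b k h := by
    rcases h with h | h
    · have := (mem_verts_embed.1 h).1
      simp [Label.child] at this
    · exact absurd h (notMem_empty _)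
  root l := rfl
  len l := rfl
  inj := injOn_id _
  fin r := by
    refine (finite_singleton ((r, []) : Label)).subset ?_
    rintro ⟨a, l⟩ ⟨hl, rfl⟩
    exact Prod.ext rfl (mem_verts_embed.1 hl).1
  degree := by
    rw [img_init]
    intro l
    refine le_trans ?_ (hα l.1)
    have hinj : InjOn Prod.fst (α.embed.graph.neighborSet l) := fun m hm m' hm' heq =>
      Prod.ext heq (hm.2.1.trans hm'.2.1.symm)
    refine hinj.encard_image.symm.trans_le (encard_le_encard ?_)
    rintro _ ⟨m, hm, rfl⟩
    exact hm.2.2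

/-- Renaming preserves the root and the generation of a name, so initial vertices keep their names
and no other vertex acquires such a name. -/
theorem Good.touchedSet (h : Good n z) : z.img.touchedSet = {v | ((v, []) : Label) ∈ z.touched} := by
  ext v
  constructor
  · rintro ⟨l, hl, hlv⟩
    have h1 : l = (v, []) := by
      refine Prod.ext ?_ ?_
      · rw [← h.root l, hlv]
      · have := h.len l
        rw [hlv] at this
        exact List.length_eq_zero_iff.1 this.symm
    rwa [h1] at hl
  · intro hv
    refine ⟨(v, []), hv, Prod.ext (h.root _) ?_⟩
    exact List.length_eq_zero_iff.1 (h.len (v, []))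

/-- The degrees with respect to the canonical names. -/
theorem Good.graph_degree (h : Good n z) : z.graph.DegreeLE n := by
  intro l
  by_cases hl : l ∈ z.graph.verts
  · refine le_trans ?_ (h.degree (z.lab l))
    have hsub : z.graph.graph.neighborSet l ⊆ z.graph.verts := fun m hm =>
      (SpinGraph.mem_verts_of_adj hm).2
    rw [← (h.inj.mono hsub).encard_image]
    refine encard_le_encard ?_
    rintro _ ⟨m, hm, rfl⟩
    exact (SpinGraph.map_adj_iff h.inj Subset.rfl hl (hsub hm)).2 hm
  · have : z.graph.graph.neighborSet l = ∅ := by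
      ext m
      simp only [SimpleGraph.mem_neighborSet, mem_empty_iff_false, iff_false]
      exact fun hm => hl (SpinGraph.mem_verts_of_adj hm).1
    rw [this]
    simp

end CState

/-! ### The law of the finite chain as the law of a run -/

namespace Grammar

open scoped NNReal

variable {S : Type} (G : Grammar S)

/-- The rate of a move. -/
noncomputable def moveRate (c : G.Move) : ℝ≥0 := ⟨G.rate c.1, (G.rate_pos c.1).le⟩

open scoped Classical in
/-- The jump system on the states with canonical names. -/
noncomputable def canonical : JumpSystem (CState S) G.Move where
  en z := if h : {c | z.CanMove G c}.Finite then h.toFinset else ∅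
  step c z := z.step G c

open scoped Classical in
/-- The jump system on the states with actual names. -/
noncomputable def actual : JumpSystem (Marked S) G.Move where
  en x := if h : {c | G.CanMove c x}.Finite then h.toFinset else ∅
  step := G.step

variable {G} {n : ℕ}

theorem finite_isMatch {γ : SpinGraph S Label} (h : γ.verts.Finite) :
    {c : G.Move | (G.rule c.1).IsMatch γ c.2}.Finite := by
  have h1 : ∀ i, {ψ : Fin ((G.rule i).size + 1) → Label | ∀ x, ψ x ∈ γ.verts}.Finite := fun i =>
    Set.Finite.pi' fun _ => h
  refine (Set.finite_iUnion fun i => (h1 i).image (Sigma.mk i)).subset ?_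
  rintro ⟨i, ψ⟩ hc
  refine mem_iUnion.2 ⟨i, ψ, fun x => ?_, rfl⟩
  rw [SpinGraph.verts, mem_ofPred_eq, hc.2.1 x]
  simp

theorem canMove_of_mem_en {z : CState S} {c : G.Move} (hc : c ∈ G.canonical.en z) :
    z.CanMove G c := by
  simp only [canonical] at hc
  split_ifs at hc with h
  · exact h.mem_toFinset.1 hc
  · simp at hc

theorem mem_en_canonical {z : CState S} (h : z.graph.verts.Finite) {c : G.Move} :
    c ∈ G.canonical.en z ↔ z.CanMove G c := by
  have hf : {c | z.CanMove G c}.Finite := finite_isMatch h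
  simp only [canonical]
  rw [dif_pos hf, hf.mem_toFinset]
  rfl

theorem mem_en_actual {x : Marked S} (h : x.graph.verts.Finite) {c : G.Move} :
    c ∈ G.actual.en x ↔ G.CanMove c x := by
  have hf : {c | G.CanMove c x}.Finite := finite_isMatch h
  simp only [actual]
  rw [dif_pos hf, hf.mem_toFinset]
  rfl

theorem canMove_of_mem_en_actual {x : Marked S} {c : G.Move} (hc : c ∈ G.actual.en x) :
    G.CanMove c x := by
  simp only [actual] at hc
  split_ifs at hc with h
  · exact h.mem_toFinset.1 hc
  · simp at hc

theorem finite_verts_step {x : Marked S} {c : G.Move} (h : x.graph.verts.Finite) :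
    (G.step c x).graph.verts.Finite :=
  ((h.union (finite_range _)).union (finite_range _)).subset
    ((G.rule c.1).apply_eq_applyAt x.graph c.2 ▸ (G.rule c.1).applyAt_verts_subset)

/-- The degree bound `n` is preserved by the substitutions. -/
def Preserves (G : Grammar S) (n : ℕ) : Prop :=
  ∀ i (γ : SpinGraph S Label) ψ, γ.HasRoom → γ.DegreeLE n →
    (G.rule i).IsMatch γ ψ → ((G.rule i).apply γ ψ).DegreeLE n

/-- The invariants of the evolution of finite graphs. -/
def Inv (n : ℕ) (z : CState S) : Prop := z.Good n ∧ z.graph.verts.Finite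

theorem Inv.step (hn : G.Preserves n) {z : CState S} (h : Inv n z) {c : G.Move}
    (hc : c ∈ G.canonical.en z) : Inv n (G.canonical.step c z) := by
  have hc := canMove_of_mem_en hc
  exact ⟨h.1.step hn hc, (h.2.union (finite_range _)).subset (CState.step_verts_subset hc)⟩

/-- Moves correspond to each other because `lab` is injective on the existing vertices and every
vertex of the actual state comes from one of them. -/
theorem Inv.bijOn {z : CState S} (h : Inv n z) :
    BijOn (fun c : G.Move => (⟨c.1, z.lab ∘ c.2⟩ : G.Move)) (G.canonical.en z)
      (G.actual.en z.img) := by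
  have hfin : z.img.graph.verts.Finite := by
    refine (h.2.image z.lab).subset fun m hm => ?_
    obtain ⟨l, hl, rfl⟩ := SpinGraph.mem_verts_map.1 hm
    exact ⟨l, hl, rfl⟩
  refine ⟨fun c hc => ?_, ?_, ?_⟩
  · exact (mem_en_actual hfin).2 (((mem_en_canonical h.2).1 hc).img h.1)
  · rintro ⟨i, φ⟩ hc ⟨i', φ'⟩ hc' heq
    obtain ⟨rfl, heq⟩ := Sigma.mk.inj heq
    have heq := eq_of_heq heq
    have h1 := ((mem_en_canonical h.2).1 hc).range_subset
    have h2 := ((mem_en_canonical h.2).1 hc').range_subset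
    congr 1
    funext x
    exact h.1.inj (h1 ⟨x, rfl⟩) (h2 ⟨x, rfl⟩) (congrFun heq x)
  · rintro ⟨i, ψ⟩ hc
    have hc := (mem_en_actual hfin).1 hc
    have hex : ∀ x, ∃ l ∈ z.graph.verts, z.lab l = ψ x := fun x => by
      refine SpinGraph.mem_verts_map.1 ?_
      change z.img.graph.spin (ψ x) ≠ none
      rw [hc.2.1 x]
      simp
    choose φ hφ hφψ using hex
    obtain rfl : z.lab ∘ φ = ψ := funext hφψ
    refine ⟨⟨i, φ⟩, (mem_en_canonical h.2).2 ⟨?_, fun x => ?_, fun x y hxy => ?_⟩, rfl⟩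
    · exact fun x y hxy => hc.1 (congrArg z.lab hxy)
    · exact (SpinGraph.map_spin h.1.inj Subset.rfl (hφ x)).symm.trans (hc.2.1 x)
    · exact (SpinGraph.map_adj_iff h.1.inj Subset.rfl (hφ x) (hφ y)).1 (hc.2.2 x y hxy)

/-- The evolution with actual names is a projection of the one with canonical names: possible moves
correspond bijectively with equal rates, and the steps commute with the projection. -/
theorem jumpInt_canonical (hn : G.Preserves n) {z : CState S} (h : Inv n z) (k : ℕ) (a b : ℝ)
    (F : (ℝ → Marked S) → ENNReal) : G.canonical.jumpInt CState.img G.moveRate k z a b F =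
      G.actual.jumpInt id G.moveRate k z.img a b F :=
  JumpSystem.jumpInt_comp (J := G.canonical) (J' := G.actual) (fun x => x) (I := Inv n)
    (fun _ hz _ hc => hz.step hn hc) CState.img (fun z c => ⟨c.1, z.lab ∘ c.2⟩)
    (fun _ hz => hz.bijOn) (fun _ _ _ _ => rfl)
    (fun _ hz _ hc => hz.1.img_step (canMove_of_mem_en hc)) k h a b F

theorem totalRate_actual {x : Marked S} (h : x.graph.verts.Finite) :
    G.actual.totalRate G.moveRate x = G.totalRate x := by
  have hf : ∀ i, {ψ | (G.rule i).IsMatch x.graph ψ}.Finite := fun i =>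
    (finite_isMatch (G := G) h).preimage sigma_mk_injective.injOn
  have he : G.actual.en x = Finset.univ.sigma fun i => (hf i).toFinset := by
    ext c
    rw [mem_en_actual h]
    simp [CanMove]
  rw [JumpSystem.totalRate, he, Finset.sum_sigma, Grammar.totalRate]
  refine Finset.sum_congr rfl fun i _ => ?_
  have hs : ∀ s ∈ (hf i).toFinset, ((G.moveRate ⟨i, s⟩ : ℝ≥0) : ℝ) = G.rate i := fun _ _ => rfl
  rw [Finset.sum_congr rfl hs, Finset.sum_const, nsmul_eq_mul, ncard_eq_toFinset_card _ (hf i), mul_comm]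

theorem after_zero (x : Marked S) {k : ℕ} (w : Fin k → G.Move) : G.after x w 0 = x := rfl

theorem after_cons (x : Marked S) {k : ℕ} (c : G.Move) (w : Fin k → G.Move) (j : ℕ) :
    G.after x (Fin.cons c w : Fin (k + 1) → G.Move) (j + 1) = G.after (G.step c x) w j := by
  simp [after, List.ofFn_succ]

theorem admissible_cons (x : Marked S) {k : ℕ} (c : G.Move) (w : Fin k → G.Move) :
    G.Admissible x (Fin.cons c w : Fin (k + 1) → G.Move) ↔
      G.CanMove c x ∧ G.Admissible (G.step c x) w := by
  rw [Admissible, Fin.forall_fin_succ]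
  refine and_congr Iff.rfl (forall_congr' fun j => ?_)
  rw [Fin.val_succ, after_cons, Fin.cons_succ]

/-- The times of the jumps, in increasing order. -/
def jumpTimes (k : ℕ) (a b : ℝ) : Set (Fin k → ℝ) := {τ | StrictMono τ ∧ ∀ j, τ j ∈ Ioo a b}

theorem cons_mem_jumpTimes {k : ℕ} {a b v : ℝ} {τ : Fin k → ℝ} :
    (Fin.cons v τ : Fin (k + 1) → ℝ) ∈ jumpTimes (k + 1) a b ↔ v ∈ Ioo a b ∧ τ ∈ jumpTimes k v b := by
  simp only [jumpTimes, mem_ofPred_eq, Fin.forall_fin_succ, Fin.cons_zero, Fin.cons_succ]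
  constructor
  · rintro ⟨h1, h2, h3⟩
    refine ⟨h2, fun i j hij => ?_, fun j => ⟨?_, (h3 j).2⟩⟩
    · have := h1 (Fin.succ_lt_succ_iff.2 hij)
      simpa using this
    · have := h1 (Fin.succ_pos j)
      simpa using this
  · rintro ⟨h1, h2, h3⟩
    refine ⟨fun i j hij => ?_, h1, fun j => ⟨h1.1.trans (h3 j).1, (h3 j).2⟩⟩
    induction j using Fin.cases with
    | zero => exact absurd hij (Fin.not_lt_zero i)
    | succ j =>
      induction i using Fin.cases with
      | zero => exact (h3 j).1
      | succ i => exact h2 (Fin.succ_lt_succ_iff.1 hij)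

theorem measurableSet_jumpTimes {k : ℕ} {Θ : Type} [MeasurableSpace Θ] {a : Θ → ℝ} {b : ℝ}
    {τ : Θ → Fin k → ℝ} (ha : Measurable a) (hτ : Measurable τ) :
    MeasurableSet {θ | τ θ ∈ jumpTimes k (a θ) b} := by
  have hj : ∀ j, Measurable fun θ => τ θ j := fun j => (measurable_pi_apply j).comp hτ
  have : {θ | τ θ ∈ jumpTimes k (a θ) b} = (⋂ i, ⋂ j, ⋂ _ : i < j, {θ | τ θ i < τ θ j}) ∩
      ⋂ j, ({θ | a θ < τ θ j} ∩ {θ | τ θ j < b}) := by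
    ext θ
    simp only [jumpTimes, mem_ofPred_eq, mem_inter_iff, mem_iInter, StrictMono, mem_Ioo]
  rw [this]
  refine (MeasurableSet.iInter fun i => MeasurableSet.iInter fun j => MeasurableSet.iInter fun _ =>
    measurableSet_lt (hj i) (hj j)).inter (MeasurableSet.iInter fun j =>
    (measurableSet_lt ha (hj j)).inter (measurableSet_lt (hj j) measurable_const))

/-- The density of the jumps during a time interval that starts at `a`. -/
noncomputable def densityFrom (G : Grammar S) (x : Marked S) (a b : ℝ) {k : ℕ} (w : Fin k → G.Move)
    (τ : Fin k → ℝ) : ENNReal :=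
  let T : Fin (k + 2) → ℝ := Fin.cons a (Fin.snoc τ b : Fin (k + 1) → ℝ)
  ENNReal.ofReal ((∏ j, G.rate (w j).1) *
    Real.exp (-∑ j : Fin (k + 1), G.totalRate (G.after x w j) * (T j.succ - T j.castSucc)))

theorem densityFrom_cons (x : Marked S) (a b v : ℝ) {k : ℕ} (c : G.Move) (w : Fin k → G.Move)
    (τ : Fin k → ℝ) : G.densityFrom x a b (Fin.cons c w : Fin (k + 1) → G.Move) (Fin.cons v τ) =
      G.moveRate c * (ENNReal.ofReal (Real.exp (-(G.totalRate x * (v - a)))) *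
        G.densityFrom (G.step c x) v b w τ) := by
  have hc : (G.moveRate c : ENNReal) = ENNReal.ofReal (G.rate c.1) := by
    rw [← ENNReal.ofReal_coe_nnreal]; rfl
  unfold densityFrom
  dsimp only
  rw [Fin.prod_univ_succ, Fin.sum_univ_succ, hc,
    ← ENNReal.ofReal_mul (Real.exp_pos _).le, ← ENNReal.ofReal_mul (G.rate_pos _).le]
  congr 1
  simp only [Fin.cons_zero, Fin.cons_succ, Fin.val_zero, after_zero, Fin.val_succ, after_cons,
    Fin.castSucc_zero, neg_add, Real.exp_add]
  have h1 : (Fin.snoc (Fin.cons v τ : Fin (k + 1) → ℝ) b : Fin (k + 2) → ℝ) =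
      Fin.cons v (Fin.snoc τ b : Fin (k + 1) → ℝ) := (Fin.cons_snoc_eq_snoc_cons v τ b).symm
  rw [h1]
  simp only [Fin.cons_zero]
  rw [show ∀ p q r s : ℝ, p * q * (r * s) = p * (r * (q * s)) from fun p q r s => by ring]
  rfl

theorem measurable_densityFrom {k : ℕ} (x : Marked S) (w : Fin k → G.Move) (b : ℝ) {Θ : Type}
    [MeasurableSpace Θ] {a : Θ → ℝ} {τ : Θ → Fin k → ℝ} (ha : Measurable a) (hτ : Measurable τ) :
    Measurable fun θ => G.densityFrom x (a θ) b w (τ θ) := by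
  have hT : ∀ j, Measurable fun θ =>
      (Fin.cons (a θ) (Fin.snoc (τ θ) b : Fin (k + 1) → ℝ) : Fin (k + 2) → ℝ) j := by
    intro j
    induction j using Fin.cases with
    | zero => simpa using ha
    | succ j =>
      induction j using Fin.lastCases with
      | last => simp
      | cast j =>
        simp only [Fin.cons_succ, Fin.snoc_castSucc]
        exact (measurable_pi_apply j).comp hτ
  unfold densityFrom
  refine ENNReal.measurable_ofReal.comp (Measurable.const_mul (Real.measurable_exp.comp
    (Measurable.neg (Finset.measurable_fun_sum _ fun j _ =>
      Measurable.const_mul ((hT _).sub (hT _)) _))) _)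

theorem measurable_pathOf {k : ℕ} (x : Marked S) (w : Fin k → G.Move) :
    Measurable fun τ => G.pathOf x w τ := by
  refine measurable_pi_iff.2 fun s => ?_
  have h1 : Measurable fun τ : Fin k → ℝ => {j | τ j ≤ s}.ncard := by
    have : (fun τ : Fin k → ℝ => {j | τ j ≤ s}.ncard) =
        fun τ => ∑ j, if τ j ≤ s then 1 else 0 := by
      funext τ
      rw [Finset.sum_boole, ncard_eq_toFinset_card']
      simp
    rw [this]
    exact Finset.measurable_fun_sum _ fun j _ =>
      Measurable.ite (measurable_pi_apply j measurableSet_Iic) measurable_const measurable_const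
  exact (measurable_from_top (f := fun j => G.after x w j)).comp h1

theorem pathOf_cons (x : Marked S) {b v : ℝ} {k : ℕ} (c : G.Move) (w : Fin k → G.Move)
    {τ : Fin k → ℝ} (hτ : τ ∈ jumpTimes k v b) :
    G.pathOf x (Fin.cons c w : Fin (k + 1) → G.Move) (Fin.cons v τ) =
      JumpSystem.glue x v (G.pathOf (G.step c x) w τ) := by
  funext s
  unfold pathOf JumpSystem.glue
  split_ifs with hs
  · have : {j : Fin (k + 1) | (Fin.cons v τ : Fin (k + 1) → ℝ) j ≤ s} =
        insert 0 (Fin.succ '' {j | τ j ≤ s}) := by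
      ext j
      induction j using Fin.cases with
      | zero => simp [hs]
      | succ j => simp
    rw [this, ncard_insert_of_notMem (by simp), ncard_image_of_injective _ (Fin.succ_injective k),
      after_cons]
  · have : {j : Fin (k + 1) | (Fin.cons v τ : Fin (k + 1) → ℝ) j ≤ s} = ∅ := by
      ext j
      simp only [mem_ofPred_eq, mem_empty_iff_false, iff_false]
      induction j using Fin.cases with
      | zero => simpa using hs
      | succ j =>
        rw [Fin.cons_succ]
        exact fun hle => hs ((hτ.2 j).1.le.trans hle)
    rw [this, ncard_empty, after_zero]

/-- The integral over the trajectories with the moves `w`. -/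
noncomputable def wordInt (G : Grammar S) (x : Marked S) (a b : ℝ) {k : ℕ} (w : Fin k → G.Move)
    (F : (ℝ → Marked S) → ENNReal) : ENNReal :=
  ∫⁻ τ : Fin k → ℝ, (jumpTimes k a b).indicator
    (fun τ => G.densityFrom x a b w τ * F (G.pathOf x w τ)) τ

theorem measurable_wordInt_integrand {k : ℕ} (x : Marked S) (w : Fin k → G.Move) (b : ℝ) {Θ : Type}
    [MeasurableSpace Θ] {a : Θ → ℝ} {τ : Θ → Fin k → ℝ} {F : Θ → (ℝ → Marked S) → ENNReal}
    (ha : Measurable a) (hτ : Measurable τ) (hF : Measurable (Function.uncurry F)) :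
    Measurable fun θ => (jumpTimes k (a θ) b).indicator
      (fun τ => G.densityFrom x (a θ) b w τ * F θ (G.pathOf x w τ)) (τ θ) := by
  simp only [Set.indicator]
  refine Measurable.ite (measurableSet_jumpTimes ha hτ) ?_ measurable_const
  exact (measurable_densityFrom x w b ha hτ).mul
    (hF.comp (measurable_id.prodMk ((measurable_pathOf x w).comp hτ)))

/-- Splitting off the first jump time by Fubini; density and trajectory factorize accordingly. This
is the recursion that defines `JumpSystem.jumpInt`. -/
theorem wordInt_cons (x : Marked S) (a b : ℝ) {k : ℕ} (c : G.Move) (w : Fin k → G.Move)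
    {F : (ℝ → Marked S) → ENNReal} (hF : Measurable F) :
    G.wordInt x a b (Fin.cons c w : Fin (k + 1) → G.Move) F = G.moveRate c *
      ∫⁻ v in Ioc a b, ENNReal.ofReal (Real.exp (-(G.totalRate x * (v - a)))) *
        G.wordInt (G.step c x) v b w fun p => F (JumpSystem.glue x v p) := by
  have hmp := (volume_preserving_piFinSuccAbove (fun _ : Fin (k + 1) => ℝ) 0).symm
  let Φ : (Fin (k + 1) → ℝ) → ENNReal := fun τ => (jumpTimes (k + 1) a b).indicator
      (fun τ => G.densityFrom x a b (Fin.cons c w : Fin (k + 1) → G.Move) τ *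
        F (G.pathOf x (Fin.cons c w : Fin (k + 1) → G.Move) τ)) τ
  have hm : Measurable Φ :=
    measurable_wordInt_integrand x _ b (Θ := Fin (k + 1) → ℝ) (a := fun _ => a)
      (τ := id) (F := fun _ => F) measurable_const measurable_id (hF.comp measurable_snd)
  have hcons : ∀ (v : ℝ) (τ : Fin k → ℝ),
      (MeasurableEquiv.piFinSuccAbove (fun _ : Fin (k + 1) => ℝ) 0).symm (v, τ) = Fin.cons v τ := by
    intro v τ
    ext j
    simp [MeasurableEquiv.piFinSuccAbove]
  have h1 : ∫⁻ τ, Φ τ = ∫⁻ v : ℝ, ∫⁻ τ : Fin k → ℝ, Φ (Fin.cons v τ) := by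
    rw [← hmp.lintegral_comp hm, Measure.volume_eq_prod]
    refine (lintegral_prod _ (hm.comp hmp.measurable).aemeasurable).trans ?_
    exact lintegral_congr fun v => lintegral_congr fun τ => congrArg Φ (hcons v τ)
  refine h1.trans ?_
  -- The jump times of a word lie in the open interval, those of `JumpSystem.jumpInt` in the
  -- half-open one; the end point is a null set.
  rw [← restrict_Ioo_eq_restrict_Ioc, ← lintegral_const_mul' _ _ ENNReal.coe_ne_top,
    ← lintegral_indicator measurableSet_Ioo]
  refine lintegral_congr fun v => ?_
  by_cases hv : v ∈ Ioo a b
  · rw [indicator_of_mem hv, wordInt, ← lintegral_const_mul' _ _ ENNReal.ofReal_ne_top,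
      ← lintegral_const_mul' _ _ ENNReal.coe_ne_top]
    refine lintegral_congr fun τ => ?_
    by_cases hτ : τ ∈ jumpTimes k v b
    · refine (indicator_of_mem (cons_mem_jumpTimes.2 ⟨hv, hτ⟩) _).trans ?_
      rw [indicator_of_mem hτ, densityFrom_cons, pathOf_cons x c w hτ]
      ring
    · refine (indicator_of_notMem (fun h => hτ (cons_mem_jumpTimes.1 h).2) _).trans ?_
      rw [indicator_of_notMem hτ]
      simp
  · rw [indicator_of_notMem hv]
    refine (lintegral_congr fun τ => ?_).trans lintegral_zero
    exact indicator_of_notMem (fun h => hv (cons_mem_jumpTimes.1 h).1) _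

open scoped Classical in
-- Summing over the first letter and then over the remaining word reproduces the recursion for the
-- number of jumps. Words that begin with an impossible move are not admissible, so only the enabled
-- moves remain.
theorem tsum_wordInt {x : Marked S} (hx : x.graph.verts.Finite) (k : ℕ) {a b : ℝ}
    {F : (ℝ → Marked S) → ENNReal} (hF : Measurable F) :
    ∑' w : Fin k → G.Move, (if G.Admissible x w then G.wordInt x a b w F else 0) =
      G.actual.jumpInt id G.moveRate k x a b F := by
  induction k generalizing x a F with
  | zero =>
    rw [tsum_eq_single default fun w hw => absurd (Subsingleton.elim w default) hw,
      if_pos (show G.Admissible x default from fun j => j.elim0), wordInt, JumpSystem.jumpInt, totalRate_actual hx]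
    have h1 : ∀ τ : Fin 0 → ℝ, (jumpTimes 0 a b).indicator
        (fun τ => G.densityFrom x a b default τ * F (G.pathOf x default τ)) τ =
        ENNReal.ofReal (Real.exp (-(G.totalRate x * (b - a)))) * F fun _ => x := by
      intro τ
      rw [indicator_of_mem (show τ ∈ jumpTimes 0 a b from ⟨fun j => j.elim0, fun j => j.elim0⟩)]
      congr 1
      · simp [densityFrom, after]
        rfl
      · congr 1
        funext s
        simp [pathOf, after]
    simp_rw [h1]
    rw [lintegral_const, volume_pi, Measure.pi_of_empty]
    simp
  | succ k ih =>
    rw [← (Fin.consEquiv fun _ : Fin (k + 1) => G.Move).tsum_eq, ENNReal.tsum_prod', JumpSystem.jumpInt,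
      tsum_eq_sum (s := G.actual.en x)]
    · refine Finset.sum_congr rfl fun c hc => ?_
      have hc := canMove_of_mem_en_actual hc
      have h1 : ∀ w : Fin k → G.Move, (if G.Admissible x (Fin.cons c w : Fin (k + 1) → G.Move) then
          G.wordInt x a b (Fin.cons c w : Fin (k + 1) → G.Move) F else 0) = G.moveRate c *
          ∫⁻ v in Ioc a b, ENNReal.ofReal (Real.exp (-(G.totalRate x * (v - a)))) *
            (if G.Admissible (G.step c x) w then
              G.wordInt (G.step c x) v b w (fun p => F (JumpSystem.glue x v p)) else 0) := by
        intro w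
        by_cases hw : G.Admissible (G.step c x) w
        · simp only [if_pos hw, if_pos ((admissible_cons x c w).2 ⟨hc, hw⟩), wordInt_cons x a b c w hF]
        · simp only [if_neg hw, if_neg fun h => hw ((admissible_cons x c w).1 h).2, mul_zero,
            lintegral_zero]
      have h2 : ∀ w : Fin k → G.Move, Measurable fun v =>
          G.wordInt (G.step c x) v b w fun p => F (JumpSystem.glue x v p) := by
        intro w
        refine Measurable.lintegral_prod_right' (f := fun q : ℝ × (Fin k → ℝ) =>
          (jumpTimes k q.1 b).indicator (fun τ => G.densityFrom (G.step c x) q.1 b w τ *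
            F (JumpSystem.glue x q.1 (G.pathOf (G.step c x) w τ))) q.2) ?_
        refine measurable_wordInt_integrand (G.step c x) w b (Θ := ℝ × (Fin k → ℝ))
          (a := fun q => q.1) (τ := fun q => q.2) (F := fun q p => F (JumpSystem.glue x q.1 p))
          measurable_fst measurable_snd ?_
        exact hF.comp ((JumpSystem.measurable_glue x).comp
          ((measurable_fst.comp measurable_fst).prodMk measurable_snd))
      have hce : ∀ w : Fin k → G.Move,
        (Fin.consEquiv fun _ : Fin (k + 1) => G.Move) (c, w) = Fin.cons c w := fun _ => rfl
      simp only [hce, h1]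
      rw [ENNReal.tsum_mul_left, ← lintegral_tsum]
      · congr 1
        refine lintegral_congr fun v => ?_
        rw [ENNReal.tsum_mul_left, totalRate_actual hx]
        congr 1
        exact ih (finite_verts_step hx) (hF.comp
          ((JumpSystem.measurable_glue x).comp (measurable_const.prodMk measurable_id)))
      · intro w
        refine (Measurable.mul (by fun_prop) ?_).aemeasurable
        split_ifs
        exacts [h2 w, measurable_const]
    · intro c hc
      rw [mem_en_actual hx] at hc
      refine ENNReal.tsum_eq_zero.2 fun w => ?_
      exact if_neg fun h => hc ((admissible_cons x c w).1 h).1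

/-- The law of the chain as a sum over the number of jumps. -/
theorem chainLaw_apply {x : Marked S} (hx : x.graph.verts.Finite) (t : ℝ)
    {A : Set (ℝ → Marked S)} (hA : MeasurableSet A) :
    G.chainLaw x t A = ∑' k, G.actual.jumpInt id G.moveRate k x 0 t (A.indicator 1) := by
  classical
  rw [chainLaw, Measure.sum_apply _ hA, ENNReal.tsum_sigma']
  refine tsum_congr fun k => ?_
  rw [← tsum_wordInt hx k (measurable_one.indicator hA)]
  refine tsum_congr fun w => ?_
  by_cases hw : G.Admissible x w
  · have hD : MeasurableSet (jumpTimes k 0 t) :=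
      measurableSet_jumpTimes (Θ := Fin k → ℝ) (a := fun _ => 0) (τ := id) measurable_const measurable_id
    have hd : Measurable fun τ => G.pathDensity x t w τ :=
      measurable_densityFrom x w t (Θ := Fin k → ℝ) (a := fun _ => 0) (τ := id) measurable_const
        measurable_id
    have hpre := measurable_pathOf x w hA
    rw [if_pos hw, if_pos hw, Measure.map_apply (measurable_pathOf x w) hA, withDensity_apply _ hpre,
      Measure.restrict_restrict hpre, wordInt]
    refine Eq.trans (lintegral_indicator (hpre.inter hD) _).symm ?_
    refine lintegral_congr fun τ => ?_
    by_cases h1 : τ ∈ jumpTimes k 0 t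
    · rw [indicator_of_mem h1]
      by_cases h2 : G.pathOf x w τ ∈ A
      · rw [indicator_of_mem (show τ ∈ _ ∩ jumpTimes k 0 t from ⟨h2, h1⟩), indicator_of_mem h2,
          Pi.one_apply, mul_one]
        rfl
      · rw [indicator_of_notMem fun h => h2 h.1, indicator_of_notMem h2, mul_zero]
    · rw [indicator_of_notMem h1, indicator_of_notMem fun h => h1 h.2]
  · rw [if_neg hw, if_neg hw]
    rfl

/-- The chain is the image of the evolution with canonical names. -/
theorem chainLaw_init (hn : G.Preserves n) {α : SpinGraph S ℕ} (hα : α.DegreeLE n)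
    (hfin : α.verts.Finite) {h t : ℝ} (hh : 0 < h) (ht : 0 ≤ t) {A : Set (ℝ → Marked S)}
    (hA : MeasurableSet A) : G.chainLaw (Marked.init α) t A =
      ClockSpace.law G.moveRate h (G.canonical.runEvent CState.img h (CState.init α) 0 t A) := by
  have hfin' : α.embed.verts.Finite := by
    refine (hfin.image fun v => ((v, []) : Label)).subset fun l hl => ?_
    have := CState.mem_verts_embed.1 hl
    exact ⟨l.1, this.2, Prod.ext rfl this.1.symm⟩
  rw [chainLaw_apply (x := Marked.init α) hfin' t hA,
    JumpSystem.law_runEvent _ _ _ hh _ le_rfl ht hA]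
  refine tsum_congr fun k => ?_
  rw [jumpInt_canonical hn (z := CState.init α) ⟨CState.Good.init hα, hfin'⟩, CState.img_init]

end Grammar

/-! ### Bounded degrees: balls and touch rates -/

namespace SpinGraph

variable {S W : Type} {γ : SpinGraph S W} {n : ℕ}

/-- The vertices at distance at most `r` from `v`. -/
def ball (γ : SpinGraph S W) (v : W) (r : ℕ) : Set W := {w | γ.graph.edist v w ≤ r}

theorem ball_succ_subset (γ : SpinGraph S W) (v : W) (r : ℕ) :
    γ.ball v (r + 1) ⊆ ⋃ u ∈ insert v (γ.graph.neighborSet v), γ.ball u r := by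
  intro w hw
  have hne : γ.graph.edist v w ≠ ⊤ := fun h => by
    rw [ball, mem_ofPred_eq, h] at hw
    exact absurd hw (by simp)
  obtain ⟨p, hp⟩ := SimpleGraph.exists_walk_of_edist_ne_top hne
  rw [ball, mem_ofPred_eq, ← hp] at hw
  have hle : p.length ≤ r + 1 := by exact_mod_cast hw
  cases p with
  | nil => exact mem_iUnion₂.2 ⟨v, mem_insert _ _, by simp [ball]⟩
  | cons h q =>
    refine mem_iUnion₂.2 ⟨_, mem_insert_of_mem _ h, (SimpleGraph.edist_le q).trans ?_⟩
    rw [SimpleGraph.Walk.length_cons] at hle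
    exact_mod_cast (by omega : q.length ≤ r)

theorem DegreeLE.finite_neighborSet (h : γ.DegreeLE n) (v : W) : (γ.graph.neighborSet v).Finite :=
  Set.finite_of_encard_le_coe (h v)

theorem DegreeLE.ball (h : γ.DegreeLE n) (r : ℕ) (v : W) :
    (γ.ball v r).Finite ∧ (γ.ball v r).ncard ≤ (n + 1) ^ r := by
  classical
  induction r generalizing v with
  | zero =>
    have : γ.ball v 0 = {v} := by
      ext w
      simp [SpinGraph.ball, SimpleGraph.edist_eq_zero_iff, eq_comm (a := v)]
    rw [this]
    simp
  | succ r ih =>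
    have hN := h.finite_neighborSet v
    have hI : (insert v (γ.graph.neighborSet v)).Finite := hN.insert v
    have hfin : (⋃ u ∈ insert v (γ.graph.neighborSet v), γ.ball u r).Finite :=
      hI.biUnion fun u _ => (ih u).1
    refine ⟨hfin.subset (γ.ball_succ_subset v r), (ncard_le_ncard (γ.ball_succ_subset v r) hfin).trans ?_⟩
    have hcard : hI.toFinset.card ≤ n + 1 := by
      rw [← ncard_eq_toFinset_card _ hI]
      refine (ncard_insert_le _ _).trans (Nat.succ_le_succ ?_)
      have := h v
      rw [← hN.cast_ncard_eq] at this
      exact_mod_cast this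
    have hsub : (⋃ u ∈ insert v (γ.graph.neighborSet v), γ.ball u r) =
        ((hI.toFinset.biUnion fun u => (ih u).1.toFinset : Finset W) : Set W) := by
      ext w
      simp
    rw [hsub, ncard_coe_finset]
    refine (Finset.card_biUnion_le_card_mul _ _ ((n + 1) ^ r) fun u _ => ?_).trans ?_
    · rw [← ncard_eq_toFinset_card _ (ih u).1]
      exact (ih u).2
    · rw [pow_succ, mul_comm]
      exact Nat.mul_le_mul_left _ hcard

end SpinGraph

namespace Grammar

open scoped NNReal

variable {S : Type} {G : Grammar S} {n R : ℕ}

/-- An embedding of the left hand side maps walks to walks, so it does not increase distances. -/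
theorem edist_le_of_isMatch (hlocal : G.IsLocal) (hrange : G.RangeLE R) {γ : SpinGraph S Label}
    {c : G.Move} (hc : (G.rule c.1).IsMatch γ c.2) (x y) : γ.graph.edist (c.2 x) (c.2 y) ≤ R := by
  obtain ⟨p, hp⟩ := ((hlocal c.1).preconnected x y).exists_walk_length_eq_dist
  let f : (G.rule c.1).lhs →g γ.graph := ⟨c.2, fun h => hc.2.2 _ _ h⟩
  refine (SimpleGraph.edist_le (p.map f)).trans ?_
  rw [SimpleGraph.Walk.length_map, hp]
  exact_mod_cast hrange c.1 x y

/-- The vertices touched by a move. -/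
def moveRange (c : G.Move) : Finset Label := Finset.univ.image c.2

theorem mem_moveRange {c : G.Move} {u : Label} : u ∈ moveRange c ↔ u ∈ range c.2 := by
  simp [moveRange]

/-- A bound for the number of vertices in a substitution rule. -/
noncomputable def maxSize (G : Grammar S) : ℕ := ∑ i, ((G.rule i).size + 1 + (G.rule i).newSize) + 1

theorem size_le_maxSize (i : Fin G.numRules) :
    (G.rule i).size + 1 + (G.rule i).newSize ≤ G.maxSize := by
  have := Finset.single_le_sum (f := fun i => (G.rule i).size + 1 + (G.rule i).newSize)
    (fun _ _ => Nat.zero_le _) (Finset.mem_univ i)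
  unfold maxSize
  omega

theorem card_moveRange_le (c : G.Move) : (moveRange c).card ≤ G.maxSize := by
  refine Finset.card_image_le.trans ?_
  have := size_le_maxSize c.1
  rw [Finset.card_univ, Fintype.card_fin]
  omega

/-- A bound for the rate at which a given vertex is touched. -/
noncomputable def touchRate (G : Grammar S) (n R : ℕ) : ℝ :=
  ∑ i, G.rate i * (((n + 1) ^ R) ^ ((G.rule i).size + 1) : ℕ) + 1

theorem touchRate_pos : 0 < G.touchRate n R := by
  have : 0 ≤ ∑ i, G.rate i * ((((n + 1) ^ R) ^ ((G.rule i).size + 1) : ℕ) : ℝ) :=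
    Finset.sum_nonneg fun i _ => mul_nonneg (G.rate_pos i).le (Nat.cast_nonneg _)
  unfold touchRate
  linarith

/-- A move that touches u has all its vertices in the ball of radius R around u, and such a ball has
at most (n + 1) ^ R elements; this bounds the number of matches of each rule. -/
theorem sum_touching_le (hlocal : G.IsLocal) (hrange : G.RangeLE R) {z : CState S} (h : Inv n z)
    (u : Label) : ∑ c ∈ (G.canonical.en z).filter (fun c => u ∈ moveRange c), (G.moveRate c : ℝ) ≤
      G.touchRate n R := by
  classical
  have hb := h.1.graph_degree.ball R u
  set b := hb.1.toFinset with hbdef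
  have hbcard : b.card ≤ (n + 1) ^ R := by
    rw [hbdef, ← ncard_eq_toFinset_card _ hb.1]
    exact hb.2
  have hsub : (G.canonical.en z).filter (fun c => u ∈ moveRange c) ⊆
      Finset.univ.sigma fun i => Fintype.piFinset fun _ : Fin ((G.rule i).size + 1) => b := by
    rintro c hc
    rw [Finset.mem_filter, mem_moveRange] at hc
    obtain ⟨hc, x, rfl⟩ := hc
    rw [Finset.mem_sigma, Fintype.mem_piFinset]
    refine ⟨Finset.mem_univ _, fun y => ?_⟩
    rw [hbdef, Finite.mem_toFinset]
    exact edist_le_of_isMatch hlocal hrange (canMove_of_mem_en hc) x y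
  refine (Finset.sum_le_sum_of_subset_of_nonneg hsub fun _ _ _ => NNReal.coe_nonneg _).trans ?_
  rw [Finset.sum_sigma]
  unfold touchRate
  refine le_trans (Finset.sum_le_sum fun i _ => ?_) (le_add_of_nonneg_right zero_le_one)
  have hs : ∀ s ∈ Fintype.piFinset fun _ : Fin ((G.rule i).size + 1) => b,
      ((G.moveRate ⟨i, s⟩ : ℝ≥0) : ℝ) = G.rate i := fun _ _ => rfl
  rw [Finset.sum_congr rfl hs, Finset.sum_const, nsmul_eq_mul, mul_comm, Fintype.card_piFinset,
    Finset.prod_const, Finset.card_univ, Fintype.card_fin]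
  refine mul_le_mul_of_nonneg_left ?_ (G.rate_pos i).le
  exact_mod_cast Nat.pow_le_pow_left hbcard _

/-- Every move touches at least one vertex, so the total rate is at most the sum of the touch rates
of all vertices. Linear growth in the number of vertices is what excludes explosion. -/
theorem totalRate_le (hlocal : G.IsLocal) (hrange : G.RangeLE R) {z : CState S} (h : Inv n z) :
    G.canonical.totalRate G.moveRate z ≤ G.touchRate n R * (z.graph.verts.ncard + 1 : ℝ) := by
  classical
  have h1 : ∀ c ∈ G.canonical.en z, (G.moveRate c : ℝ) ≤
      ∑ u ∈ h.2.toFinset, if u ∈ moveRange c then (G.moveRate c : ℝ) else 0 := by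
    intro c hc
    have hmem : c.2 0 ∈ h.2.toFinset :=
      h.2.mem_toFinset.2 ((canMove_of_mem_en hc).range_subset ⟨0, rfl⟩)
    refine le_trans ?_ (Finset.single_le_sum (fun u _ => ?_) hmem)
    · rw [if_pos (mem_moveRange.2 ⟨0, rfl⟩)]
    · split_ifs
      exacts [NNReal.coe_nonneg _, le_rfl]
  refine (Finset.sum_le_sum h1).trans ?_
  rw [Finset.sum_comm]
  simp_rw [← Finset.sum_filter]
  refine (Finset.sum_le_sum fun u _ => sum_touching_le hlocal hrange h u).trans ?_
  rw [Finset.sum_const, nsmul_eq_mul, ← ncard_eq_toFinset_card _ h.2, mul_comm]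
  exact mul_le_mul_of_nonneg_left (by linarith) touchRate_pos.le

theorem ncard_verts_step {z : CState S} (h : z.graph.verts.Finite) {c : G.Move}
    (hc : c ∈ G.canonical.en z) :
    ((G.canonical.step c z).graph.verts.ncard + 1 : ℝ) ≤ z.graph.verts.ncard + 1 + G.maxSize := by
  have h1 : (G.canonical.step c z).graph.verts.ncard ≤ z.graph.verts.ncard + G.maxSize := by
    refine (ncard_le_ncard (CState.step_verts_subset (canMove_of_mem_en hc))
      (h.union (finite_range _))).trans ((ncard_union_le _ _).trans (Nat.add_le_add_left ?_ _))
    rw [← image_univ]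
    refine (ncard_image_le finite_univ).trans ?_
    rw [ncard_univ, Nat.card_eq_fintype_card, Fintype.card_fin]
    have := size_le_maxSize c.1
    omega
  have h2 : ((G.canonical.step c z).graph.verts.ncard : ℝ) ≤ z.graph.verts.ncard + G.maxSize := by
    exact_mod_cast h1
  linarith

theorem ae_exists_run (hn : G.Preserves n) (hlocal : G.IsLocal) (hrange : G.RangeLE R) {h : ℝ}
    (hh : 0 < h) {z : CState S} (hz : Inv n z) {a b : ℝ} (ha : 0 ≤ a) (hab : a ≤ b) :
    ∀ᵐ ω ∂ClockSpace.law G.moveRate h, ∃ l, G.canonical.IsRun (ClockSpace.rings h ω) z a l b :=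
  G.canonical.ae_exists_run G.moveRate hh (I := Inv n) (fun _ hz _ hc => hz.step hn hc)
    (v := fun z => z.graph.verts.ncard + 1) (Λ := G.touchRate n R) (L := G.maxSize) touchRate_pos
    (by unfold maxSize; positivity) (fun _ _ => by positivity)
    (fun _ hz => totalRate_le hlocal hrange hz) (fun _ hz _ hc => ncard_verts_step hz.2 hc) hz ha hab

/-- During short time intervals it is unlikely that many given vertices are touched. -/
theorem exists_law_touch_le (hn : G.Preserves n) (hlocal : G.IsLocal) (hrange : G.RangeLE R) {κ : ℝ}
    (hκ : 0 < κ) : ∃ h₀ : ℝ, 0 < h₀ ∧ ∀ h, 0 < h → ∀ z : CState S, Inv n z → ∀ a b, 0 ≤ a → a ≤ b →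
      b - a ≤ h₀ → ∀ F : Finset Label, ClockSpace.law G.moveRate h
        {ω | ∃ l, G.canonical.IsRun (ClockSpace.rings h ω) z a l b ∧
          ∀ u ∈ F, ∃ e ∈ l, u ∈ range e.1.2} ≤ ENNReal.ofReal (κ ^ F.card) := by
  -- The factor e is kept in reserve for the exponential term of `JumpSystem.law_touch_le`, whose
  -- exponent will be at most |F|.
  set θ : ℝ := min 1 (κ / Real.exp 1) with hθ
  have hθ0 : 0 < θ := lt_min one_pos (by positivity)
  have hθκ : θ * Real.exp 1 ≤ κ := by
    have : θ ≤ κ / Real.exp 1 := min_le_right _ _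
    rwa [le_div_iff₀ (Real.exp_pos 1)] at this
  have hB : 0 < G.touchRate n R * θ⁻¹ ^ G.maxSize := mul_pos touchRate_pos (by positivity)
  -- With this length of the interval the exponent is at most |F|, so the bound becomes (θ e) ^ |F|.
  refine ⟨(G.touchRate n R * θ⁻¹ ^ G.maxSize)⁻¹, inv_pos.2 hB, fun h hh z hz a b ha hab hba F => ?_⟩
  have h1 := G.canonical.law_touch_le G.moveRate hh moveRange (I := Inv n)
    (fun _ hz _ hc => hz.step hn hc) touchRate_pos.le hθ0 (min_le_left _ _) card_moveRange_le
    (fun _ hz u => sum_touching_le hlocal hrange hz u) hz ha hab F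
  simp only [mem_moveRange] at h1
  refine h1.trans ?_
  rw [← ENNReal.ofReal_mul (by positivity)]
  refine ENNReal.ofReal_le_ofReal ?_
  have h2 : G.touchRate n R * θ⁻¹ ^ G.maxSize * F.card * (b - a) ≤ F.card * 1 := by
    have : G.touchRate n R * θ⁻¹ ^ G.maxSize * (b - a) ≤ 1 := by
      calc _ ≤ G.touchRate n R * θ⁻¹ ^ G.maxSize * (G.touchRate n R * θ⁻¹ ^ G.maxSize)⁻¹ :=
            mul_le_mul_of_nonneg_left hba hB.le
        _ = 1 := mul_inv_cancel₀ hB.ne'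
    have hF : (0 : ℝ) ≤ F.card := Nat.cast_nonneg _
    nlinarith
  calc _ ≤ θ ^ F.card * Real.exp (F.card * 1) := by gcongr
    _ = (θ * Real.exp 1) ^ F.card := by rw [Real.exp_nat_mul, mul_pow]
    _ ≤ κ ^ F.card := by gcongr

end Grammar

/-! ### Parts of a state and autonomous evolution inside of a set of names -/

theorem Rule.isMatch_restrict {S : Type} {ρ : Rule S} {γ : SpinGraph S Label} {Q : Set Label}
    {ψ : Fin (ρ.size + 1) → Label} :
    ρ.IsMatch (γ.restrict Q) ψ ↔ ρ.IsMatch γ ψ ∧ range ψ ⊆ Q := by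
  have hspin : ∀ l ∈ Q, (γ.restrict Q).spin l = γ.spin l := fun l hl => if_pos hl
  constructor
  · rintro ⟨h1, h2, h3⟩
    have hQ : range ψ ⊆ Q := by
      rintro _ ⟨x, rfl⟩
      by_contra hx
      have : (γ.restrict Q).spin (ψ x) = none := if_neg hx
      rw [h2 x] at this
      exact absurd this (by simp)
    exact ⟨⟨h1, fun x => (hspin _ (hQ ⟨x, rfl⟩)).symm.trans (h2 x), fun x y h => (h3 x y h).1⟩, hQ⟩
  · rintro ⟨⟨h1, h2, h3⟩, hQ⟩
    exact ⟨h1, fun x => (hspin _ (hQ ⟨x, rfl⟩)).trans (h2 x),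
      fun x y h => ⟨h3 x y h, hQ ⟨x, rfl⟩, hQ ⟨y, rfl⟩⟩⟩

theorem SpinGraph.mem_verts_restrict {S W : Type} {γ : SpinGraph S W} {Q : Set W} {l : W} :
    l ∈ (γ.restrict Q).verts ↔ l ∈ γ.verts ∧ l ∈ Q := by
  simp only [SpinGraph.verts, SpinGraph.restrict, mem_ofPred_eq]
  split_ifs with h <;> simp [h]

theorem SpinGraph.restrict_spin {S W : Type} {γ : SpinGraph S W} {Q : Set W} {l : W} (hl : l ∈ Q) :
    (γ.restrict Q).spin l = γ.spin l := if_pos hl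

theorem SpinGraph.restrict_adj {S W : Type} {γ : SpinGraph S W} {Q : Set W} {l m : W} :
    (γ.restrict Q).graph.Adj l m ↔ γ.graph.Adj l m ∧ l ∈ Q ∧ m ∈ Q := Iff.rfl

namespace CState

variable {S : Type} {G : Grammar S} {n : ℕ} {Q : Set Label} {A : Set ℕ} {z y : CState S}

/-- `y` is the part of the state `z` on the names in `Q`; the actual names are compared only over
`A`. -/
structure AgreeOn (Q : Set Label) (A : Set ℕ) (z y : CState S) : Prop where
  graph : y.graph = z.graph.restrict Q
  touched : y.touched = z.touched ∩ Q
  cnt : ∀ l ∈ Q, y.cnt l = z.cnt l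
  lab : ∀ l ∈ labelsOver A, y.lab l = z.lab l

theorem AgreeOn.mem_verts (h : AgreeOn Q A z y) {l : Label} :
    l ∈ y.graph.verts ↔ l ∈ z.graph.verts ∧ l ∈ Q := by
  rw [h.graph, SpinGraph.mem_verts_restrict]

/-- Since renaming preserves roots, the vertices with an actual name over A are precisely those with
a canonical name over A, and there both the states and the renamings agree. -/
theorem AgreeOn.img_spin (h : AgreeOn Q A z y) (hA : labelsOver A ⊆ Q) (hz : z.Good n)
    (hy : y.Good n) {m : Label} (hm : m.1 ∈ A) : y.img.graph.spin m = z.img.graph.spin m := by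
  have hover : ∀ l, z.lab l = m → l ∈ labelsOver A := fun l hl => by
    change l.1 ∈ A
    rw [← hz.root l, hl]
    exact hm
  by_cases hex : ∃ l ∈ z.graph.verts, z.lab l = m
  · obtain ⟨l, hl, rfl⟩ := hex
    have hl' := hover l rfl
    have h1 : z.img.graph.spin (z.lab l) = z.graph.spin l := SpinGraph.map_spin hz.inj Subset.rfl hl
    have h2 : y.img.graph.spin (y.lab l) = y.graph.spin l :=
      SpinGraph.map_spin hy.inj Subset.rfl (h.mem_verts.2 ⟨hl, hA hl'⟩)
    rw [h1, ← h.lab l hl', h2, h.graph, SpinGraph.restrict_spin (hA hl')]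
  · have h1 : z.img.graph.spin m = none :=
      SpinGraph.map_spin_eq_none fun l hl hlm => hex ⟨l, hl, hlm⟩
    have h2 : y.img.graph.spin m = none := by
      refine SpinGraph.map_spin_eq_none fun l hl hlm => ?_
      have hlA : l ∈ labelsOver A := by
        change l.1 ∈ A
        rw [← hy.root l, hlm]
        exact hm
      exact hex ⟨l, (h.mem_verts.1 hl).1, (h.lab l hlA).symm.trans hlm⟩
    rw [h1, h2]

theorem firstFree_congr {γ γ' : SpinGraph S Label} {b : Label}
    (h : ∀ k, γ.spin (b.child k) = γ'.spin (b.child k)) : γ.firstFree b = γ'.firstFree b := by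
  unfold SpinGraph.firstFree
  simp only [h]

theorem AgreeOn.canMove_iff (h : AgreeOn Q A z y) {c : G.Move} :
    CanMove G c y ↔ CanMove G c z ∧ range c.2 ⊆ Q := by
  unfold CanMove
  rw [h.graph, Rule.isMatch_restrict]

/-- A move inside of `Q` acts in the same way on both states. -/
theorem AgreeOn.step_inside (h : AgreeOn Q A z y) (hA : labelsOver A ⊆ Q) (hz : z.Good n)
    (hy : y.Good n) {c : G.Move} (hcQ : range c.2 ⊆ Q)
    (hnew : ∀ k, z.cnt (c.2 0) ≤ k → (c.2 0).child k ∈ Q) :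
    AgreeOn Q A (z.step G c) (y.step G c) := by
  have h0 : c.2 0 ∈ Q := hcQ ⟨0, rfl⟩
  have hnn : (y.newName c.2 : Fin (G.rule c.1).newSize → Label) = z.newName c.2 := by
    funext i
    rw [newName, newName, h.cnt _ h0]
  have hnewQ : range (z.newName c.2 : Fin (G.rule c.1).newSize → Label) ⊆ Q := by
    rintro _ ⟨i, rfl⟩
    exact hnew _ (Nat.le_add_right _ _)
  refine ⟨?_, ?_, fun l hl => ?_, fun l hl => ?_⟩
  · simp only [step]
    rw [hnn, h.graph, (G.rule c.1).restrict_applyAt_of_subset hcQ hnewQ]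
  · simp only [step]
    rw [h.touched, union_inter_distrib_right, inter_eq_self_of_subset_left hcQ]
  · simp only [step]
    rw [h.cnt l hl]
  · by_cases hl' : ∃ i : Fin (G.rule c.1).newSize, z.newName c.2 i = l
    · obtain ⟨i, rfl⟩ := hl'
      have hr : (c.2 0).1 ∈ A := hl
      have h1 := step_lab_newName y c i
      rw [hnn] at h1
      rw [h1, step_lab_newName, h.lab (c.2 0) hr]
      congr 2
      -- The first free actual name depends only on vertices over the root of the place of the move.
      -- This is why actual names are compared over a set `A` of roots and not on all of `Q`.
      refine firstFree_congr fun k => h.img_spin hA hz hy ?_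
      change (z.lab (c.2 0)).1 ∈ A
      rw [hz.root]
      exact hr
    · push Not at hl'
      rw [step_lab_of_notMem hl', step_lab_of_notMem (by rw [hnn]; exact hl'), h.lab l hl]

/-- A move outside of `Q` does not affect the part of the state in `Q`. -/
theorem AgreeOn.step_outside (h : AgreeOn Q A z y) (hA : labelsOver A ⊆ Q) {c : G.Move}
    (hcQ : Disjoint (range c.2) Q) (hnew : ∀ k, z.cnt (c.2 0) ≤ k → (c.2 0).child k ∉ Q) :
    AgreeOn Q A (z.step G c) y := by
  have hnewQ : Disjoint (range (z.newName c.2 : Fin (G.rule c.1).newSize → Label)) Q := by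
    refine disjoint_left.2 ?_
    rintro _ ⟨i, rfl⟩
    exact hnew _ (Nat.le_add_right _ _)
  refine ⟨?_, ?_, fun l hl => ?_, fun l hl => ?_⟩
  · simp only [step]
    rw [h.graph, (G.rule c.1).restrict_applyAt_of_disjoint hcQ hnewQ]
  · simp only [step]
    rw [h.touched, union_inter_distrib_right, disjoint_iff_inter_eq_empty.1 hcQ, union_empty]
  · simp only [step]
    rw [if_neg, h.cnt l hl]
    rintro rfl
    exact disjoint_left.1 hcQ ⟨0, rfl⟩ hl
  · rw [step_lab_of_notMem, h.lab l hl]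
    rintro i rfl
    exact disjoint_left.1 hnewQ ⟨i, rfl⟩ (hA hl)

/-- The part of a state on the names in `Q`. -/
noncomputable def restrict (z : CState S) (Q : Set Label) : CState S :=
  ⟨z.graph.restrict Q, z.touched ∩ Q, z.cnt, z.lab⟩

theorem agreeOn_restrict (z : CState S) (Q : Set Label) (A : Set ℕ) : AgreeOn Q A z (z.restrict Q) :=
  ⟨rfl, rfl, fun _ _ => rfl, fun _ _ => rfl⟩

theorem Good.restrict (h : z.Good n) (Q : Set Label) : (z.restrict Q).Good n where
  fresh b k hbk := h.fresh b k (hbk.imp (fun h => (SpinGraph.mem_verts_restrict.1 h).1) And.left)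
  root := h.root
  len := h.len
  inj := h.inj.mono fun l hl => (SpinGraph.mem_verts_restrict.1 hl).1
  fin r := (h.fin r).subset fun l hl => ⟨(SpinGraph.mem_verts_restrict.1 hl.1).1, hl.2⟩
  degree m := by
    refine (encard_le_encard ?_).trans (h.degree m)
    rintro m' ⟨hne, l, l', hll, h1, h2⟩
    exact ⟨hne, l, l', hll.1, h1, h2⟩

theorem inv_restrict (h : Grammar.Inv n z) (Q : Set Label) : Grammar.Inv n (z.restrict Q) :=
  ⟨h.1.restrict Q, h.2.subset fun _ hl => (SpinGraph.mem_verts_restrict.1 hl).1⟩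

/-- The actual states agree over `A`. -/
theorem AgreeOn.restrict_img (h : AgreeOn (labelsOver A) A z y) (hz : z.Good n) (hy : y.Good n) :
    z.img.restrict A = y.img := by
  have hover : ∀ l, z.lab l ∈ labelsOver A ↔ l ∈ labelsOver A := fun l => by
    simp only [labelsOver, mem_ofPred_eq, hz.root]
  refine Marked.ext (SpinGraph.ext_of (fun m => ?_) fun m m' => ?_) ?_
  · by_cases hm : m ∈ labelsOver A
    · exact (SpinGraph.restrict_spin hm).trans (h.img_spin Subset.rfl hz hy hm).symm
    · refine Eq.trans (if_neg hm) (SpinGraph.map_spin_eq_none fun l hl hlm => hm ?_).symm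
      have := (h.mem_verts.1 hl).2
      rw [← hlm]
      change (y.lab l).1 ∈ A
      rw [hy.root]
      exact this
  · refine SpinGraph.restrict_adj.trans ?_
    refine (and_congr_left fun _ => SpinGraph.map_adj hz.inj).trans
      (Iff.trans ?_ (SpinGraph.map_adj hy.inj).symm)
    constructor
    · rintro ⟨⟨l, l', hll, rfl, rfl⟩, hm, hm'⟩
      have h1 := (hover l).1 hm
      have h2 := (hover l').1 hm'
      refine ⟨l, l', ?_, h.lab l h1, h.lab l' h2⟩
      rw [h.graph]
      exact ⟨hll, h1, h2⟩
    · rintro ⟨l, l', hll, rfl, rfl⟩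
      rw [h.graph] at hll
      obtain ⟨hll, h1, h2⟩ := hll
      rw [h.lab l h1, h.lab l' h2]
      exact ⟨⟨l, l', hll, rfl, rfl⟩, (hover l).2 h1, (hover l').2 h2⟩
  · ext m
    change m ∈ z.lab '' z.touched ∩ labelsOver A ↔ m ∈ y.lab '' y.touched
    rw [h.touched]
    constructor
    · rintro ⟨⟨l, hl, rfl⟩, hm⟩
      have h1 := (hover l).1 hm
      exact ⟨l, ⟨hl, h1⟩, h.lab l h1⟩
    · rintro ⟨l, ⟨hl, h1⟩, rfl⟩
      rw [h.lab l h1]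
      exact ⟨⟨l, hl, rfl⟩, (hover l).2 h1⟩

end CState

namespace Grammar

open CState

variable {S : Type} {G : Grammar S} {n : ℕ}

theorem Inv.en_iff {z : CState S} (h : Inv n z) {c : G.Move} :
    c ∈ G.canonical.en z ↔ CState.CanMove G c z := mem_en_canonical h.2

theorem inv_stateAt (hn : G.Preserves n) {T : G.Move → Set ℝ} {z : CState S} {a b : ℝ}
    {l : List (G.Move × ℝ)} (h : G.canonical.IsRun T z a l b) (hz : Inv n z) (s : ℝ) :
    Inv n (G.canonical.stateAt z l s) := by
  induction l generalizing z a with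
  | nil => exact hz
  | cons e l ih =>
    rw [JumpSystem.stateAt]
    split_ifs
    · exact ih h.2.2.2.2.2 (hz.step hn h.1)
    · exact hz

theorem inv_final (hn : G.Preserves n) {T : G.Move → Set ℝ} {z : CState S} {a b : ℝ}
    {l : List (G.Move × ℝ)} (h : G.canonical.IsRun T z a l b) (hz : Inv n z) :
    Inv n (G.canonical.final z l) :=
  h.final_induction (fun _ _ hc hz => hz.step hn hc) hz

theorem touched_final {z : CState S} {l : List (G.Move × ℝ)} :
    (G.canonical.final z l).touched = z.touched ∪ {u | ∃ e ∈ l, u ∈ range e.1.2} := by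
  induction l generalizing z with
  | nil => simp [JumpSystem.final]
  | cons e l ih =>
    rw [JumpSystem.final, ih]
    ext u
    simp only [canonical, CState.step, mem_union, mem_ofPred_eq, List.mem_cons, exists_eq_or_imp,
      or_assoc]

/-- If a connected left hand side meets `Q` and its complement, there is a link leaving `Q`. -/
theorem exists_cross (hlocal : G.IsLocal) {γ : SpinGraph S Label} {c : G.Move}
    (hc : (G.rule c.1).IsMatch γ c.2) {Q : Set Label} {x y} (hx : c.2 x ∈ Q) (hy : c.2 y ∉ Q) :
    ∃ x' y', c.2 x' ∈ Q ∧ c.2 y' ∉ Q ∧ γ.graph.Adj (c.2 x') (c.2 y') := by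
  obtain ⟨p⟩ := (hlocal c.1).preconnected x y
  induction p with
  | nil => exact absurd hx hy
  | @cons u v w hadj p ih =>
    by_cases hv : c.2 v ∈ Q
    · exact ih hv hy
    · exact ⟨u, v, hx, hv, hc.2.2 _ _ hadj⟩

open scoped Classical in
/-- If no touched vertex is linked across the boundary of `Q`, the evolution inside of `Q` is
autonomous. `X` contains the vertices of `Q` with links leaving `Q`. -/
theorem run_restrict (hn : G.Preserves n) (hlocal : G.IsLocal) {T : G.Move → Set ℝ}
    (hT : JumpSystem.NoSim T) {z y : CState S} (hz : Inv n z) (hy : Inv n y) {Q X : Set Label}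
    {A : Set ℕ} (hA : labelsOver A ⊆ Q)
    (hzy : AgreeOn Q A z y) (hQ : ∀ u k, z.cnt u ≤ k → (u.child k ∈ Q ↔ u ∈ Q))
    (hX : ∀ u ∈ Q, ∀ v ∉ Q, z.graph.graph.Adj u v → u ∈ X) {a b : ℝ} {l : List (G.Move × ℝ)}
    (hl : G.canonical.IsRun T z a l b) (hXl : ∀ e ∈ l, Disjoint (range e.1.2) X) :
    G.canonical.IsRun T y a (l.filter fun e => range e.1.2 ⊆ Q) b ∧
      ∀ s, AgreeOn Q A (G.canonical.stateAt z l s)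
          (G.canonical.stateAt y (l.filter fun e => range e.1.2 ⊆ Q) s) ∧
        ∀ u ∈ Q, ∀ v ∉ Q, (G.canonical.stateAt z l s).graph.graph.Adj u v → u ∈ X := by
  -- The monotonicity of the counters is part of the invariant because `hQ` speaks of the names that
  -- are unused initially; it then covers everything that is created later.
  let Rel : CState S → CState S → Prop := fun z' y' => Inv n z' ∧ Inv n y' ∧ AgreeOn Q A z' y' ∧
    (∀ u, z.cnt u ≤ z'.cnt u) ∧ ∀ u ∈ Q, ∀ v ∉ Q, z'.graph.graph.Adj u v → u ∈ X
  -- A connected left hand side that meets both `Q` and its complement would use a link leaving `Q`,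
  -- whose end point in `Q` lies in `X` and would be touched.
  have hcross : ∀ {z' y'} {c : G.Move}, Rel z' y' → c ∈ G.canonical.en z' → Disjoint (range c.2) X →
      range c.2 ⊆ Q ∨ Disjoint (range c.2) Q := by
    intro z' y' c hR hc hok
    by_contra hcon
    rw [not_or, not_subset, not_disjoint_iff] at hcon
    obtain ⟨⟨_, ⟨y, rfl⟩, hy⟩, ⟨_, ⟨x, rfl⟩, hx⟩⟩ := hcon
    obtain ⟨x', y', h1, h2, h3⟩ := exists_cross hlocal (canMove_of_mem_en hc) hx hy
    exact disjoint_left.1 hok ⟨x', rfl⟩ (hR.2.2.2.2 _ h1 _ h2 h3)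
  -- New links stay on the side of the move, and a link that is moved by the substitution cannot
  -- have left `Q` at a touched vertex; thus links across the boundary keep their end point in `X`.
  have hinv : ∀ {z' y'} {c : G.Move}, Rel z' y' → c ∈ G.canonical.en z' → Disjoint (range c.2) X →
      ∀ u ∈ Q, ∀ v ∉ Q, (z'.step G c).graph.graph.Adj u v → u ∈ X := by
    intro z' y' c hR hc hok u hu v hv huv
    have hnew : ∀ i : Fin (G.rule c.1).newSize, z'.newName c.2 i ∈ Q ↔ c.2 0 ∈ Q := fun i =>
      hQ _ _ ((hR.2.2.2.1 _).trans (Nat.le_add_right _ _))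
    rcases hcross hR hc hok with hin | hout
    · have hmem : ∀ w ∈ range c.2 ∪ range (z'.newName c.2 : Fin (G.rule c.1).newSize → Label),
          w ∈ Q := by
        rintro w (hw | ⟨i, rfl⟩)
        exacts [hin hw, (hnew i).2 (hin ⟨0, rfl⟩)]
      rcases (G.rule c.1).applyAt_adj_cases huv with ⟨-, h2⟩ | ⟨u', v', h1, h2, h3⟩
      · exact absurd (hmem _ h2) hv
      · rcases h3 with ⟨-, rfl⟩ | ⟨-, h3⟩
        · rcases h2 with ⟨-, rfl⟩ | ⟨h2, -⟩
          · exact hR.2.2.2.2 _ hu _ hv h1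
          · exact absurd (hR.2.2.2.2 _ (hin h2) _ hv h1) (disjoint_left.1 hok h2)
        · exact absurd (hmem _ h3) hv
    · have hmem : ∀ w ∈ range c.2 ∪ range (z'.newName c.2 : Fin (G.rule c.1).newSize → Label),
          w ∉ Q := by
        rintro w (hw | ⟨i, rfl⟩)
        exacts [disjoint_left.1 hout hw, fun h => disjoint_left.1 hout ⟨0, rfl⟩ ((hnew i).1 h)]
      rcases (G.rule c.1).applyAt_adj_cases huv with ⟨h2, -⟩ | ⟨u', v', h1, h2, h3⟩
      · exact absurd hu (hmem _ h2)
      · rcases h2 with ⟨-, rfl⟩ | ⟨-, h2⟩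
        · have hv' : v' ∉ Q := by
            rcases h3 with ⟨-, rfl⟩ | ⟨h3, -⟩
            exacts [hv, disjoint_left.1 hout h3]
          exact hR.2.2.2.2 _ hu _ hv' h1
        · exact absurd hu (hmem _ h2)
  have hcnt : ∀ {z' y'} (c : G.Move), Rel z' y' → ∀ u, z.cnt u ≤ (z'.step G c).cnt u :=
    fun c hR u => (hR.2.2.2.1 u).trans (le_step_cnt _ c u)
  have := hl.sim (J' := G.canonical) (T' := T) hT (Rel := Rel) (vis := fun c => range c.2 ⊆ Q)
    (ok := fun c => Disjoint (range c.2) X) ?_ ?_ ?_ (fun _ _ _ h => h) (z' := y)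
    ⟨hz, hy, hzy, fun _ => le_rfl, hX⟩ hXl
  · exact ⟨this.1, fun s => ⟨(this.2 s).2.2.1, (this.2 s).2.2.2.2⟩⟩
  · intro z' y' c hR hc hok hvis
    have hcy : c ∈ G.canonical.en y' :=
      (hR.2.1.en_iff).2 (hR.2.2.1.canMove_iff.2 ⟨canMove_of_mem_en hc, hvis⟩)
    refine ⟨hcy, hR.1.step hn hc, hR.2.1.step hn hcy, ?_, hcnt c hR, hinv hR hc hok⟩
    exact hR.2.2.1.step_inside hA hR.1.1 hR.2.1.1 hvis fun k hk =>
      (hQ _ _ ((hR.2.2.2.1 _).trans hk)).2 (hvis ⟨0, rfl⟩)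
  · intro z' y' c hR hc hok hvis
    have hout := (hcross hR hc hok).resolve_left hvis
    refine ⟨hR.1.step hn hc, hR.2.1, ?_, hcnt c hR, hinv hR hc hok⟩
    exact hR.2.2.1.step_outside hA hout fun k hk h =>
      disjoint_left.1 hout ⟨0, rfl⟩ ((hQ _ _ ((hR.2.2.2.1 _).trans hk)).1 h)
  · intro z' y' c s hR hc hs
    have := hR.2.2.1.canMove_iff.1 (canMove_of_mem_en hc)
    exact ⟨(hR.1.en_iff).2 this.1, hs, this.2⟩

end Grammar

/-! ### Independence of the evolutions near separated sets -/

namespace SpinGraph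

variable {S : Type} (α : SpinGraph S ℕ) {D : Set ℕ} {R j : ℕ}

/-- The vertices at distance at most `j` from `D`. -/
def hull (D : Set ℕ) (j : ℕ) : Set ℕ := {v | ∃ u ∈ D, α.graph.edist u v ≤ j}

variable {α}

theorem hull_zero : α.hull D 0 = D := by
  ext v
  simp [hull, SimpleGraph.edist_eq_zero_iff]

theorem hull_mono {i : ℕ} (h : i ≤ j) : α.hull D i ⊆ α.hull D j := fun _ ⟨u, hu, hv⟩ =>
  ⟨u, hu, hv.trans (by exact_mod_cast h)⟩

theorem subset_hull : D ⊆ α.hull D j := fun v hv => ⟨v, hv, by simp⟩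

theorem hull_eq : α.hull D R = D ∪ α.boundary R D := by
  ext v
  constructor
  · rintro ⟨u, hu, hv⟩
    by_cases hvD : v ∈ D
    exacts [Or.inl hvD, Or.inr ⟨hvD, u, hu, hv⟩]
  · rintro (hv | ⟨-, u, hu, hv⟩)
    exacts [subset_hull hv, ⟨u, hu, hv⟩]

theorem hull_adj {u v : ℕ} (h : α.graph.Adj u v) (hu : u ∈ α.hull D j) : v ∈ α.hull D (j + 1) := by
  obtain ⟨w, hw, hwu⟩ := hu
  refine ⟨w, hw, (SimpleGraph.edist_triangle (v := u)).trans ?_⟩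
  push_cast
  refine add_le_add hwu ?_
  rw [SimpleGraph.edist_eq_one_iff_adj.2 h]

theorem embed_restrict (B : Set ℕ) : (α.restrict B).embed = α.embed.restrict (labelsOver B) := by
  refine ext_of (fun l => ?_) fun l m => ?_
  · by_cases hl : l ∈ labelsOver B
    · rw [restrict_spin hl]
      have : (α.restrict B).spin l.1 = α.spin l.1 := if_pos hl
      simp only [embed, this]
    · have : (α.restrict B).spin l.1 = none := if_neg hl
      refine Eq.trans ?_ (if_neg hl).symm
      simp only [embed, this, ite_self]
  · change (_ ∧ _ ∧ _ ∧ _ ∧ _) ↔ ((_ ∧ _ ∧ _) ∧ _ ∧ _)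
    simp only [labelsOver, mem_ofPred_eq]
    tauto

theorem DegreeLE.restrict {W : Type} {β : SpinGraph S W} {n : ℕ} (h : β.DegreeLE n) (B : Set W) :
    (β.restrict B).DegreeLE n := fun v =>
  (encard_le_encard fun _ hw => hw.1).trans (h v)

theorem restrict_restrict {W : Type} (β : SpinGraph S W) (A B : Set W) :
    (β.restrict B).restrict A = β.restrict (B ∩ A) := by
  classical
  refine ext_of (fun l => ?_) fun l m => ?_
  · by_cases hA : l ∈ A
    · rw [restrict_spin hA]
      by_cases hB : l ∈ B
      · rw [restrict_spin hB, restrict_spin (show l ∈ B ∩ A from ⟨hB, hA⟩)]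
      · exact (if_neg hB).trans (if_neg fun h => hB h.1).symm
    · exact (if_neg hA).trans (if_neg fun h => hA h.2).symm
  · simp only [restrict_adj, mem_inter_iff]
    tauto

end SpinGraph

namespace Grammar

open CState ClockSpace

variable {S : Type} {G : Grammar S} {n R : ℕ} {α : SpinGraph S ℕ}

theorem inv_init (hα : α.DegreeLE n) {B : Set ℕ} (hB : B.Finite) :
    Inv n (CState.init (α.restrict B)) := by
  refine ⟨CState.Good.init (hα.restrict B), (hB.image fun v => ((v, []) : Label)).subset fun l hl => ?_⟩
  have := CState.mem_verts_embed.1 hl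
  exact ⟨l.1, (SpinGraph.mem_verts_restrict.1 this.2).2, Prod.ext rfl this.1.symm⟩

theorem agreeOn_init {A B C : Set ℕ} (h : B ∩ A = C) : AgreeOn (labelsOver A) A
    (CState.init (α.restrict B)) (CState.init (α.restrict C)) := by
  refine ⟨?_, (empty_inter _).symm, fun _ _ => rfl, fun _ _ => rfl⟩
  subst h
  change (α.restrict (B ∩ A)).embed = (α.restrict B).embed.restrict (labelsOver A)
  rw [← SpinGraph.embed_restrict, SpinGraph.restrict_restrict]

/-- The distances to the sets `D i` increase by at most one along links, up to distance `R`, and no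
vertex at distance between `1` and `R` has been created during the evolution. -/
structure Layers {ι : Type} (α : SpinGraph S ℕ) (R : ℕ) (D : ι → Set ℕ) (z : CState S) : Prop where
  layer : ∀ i, ∀ j < R, ∀ u v, z.graph.graph.Adj u v → u.1 ∈ α.hull (D i) j →
    v.1 ∈ α.hull (D i) (j + 1)
  old : ∀ i, ∀ l ∈ z.graph.verts, l.1 ∈ α.boundary R (D i) → l.2 = []

/-- The move touches no initial vertex at distance between `1` and `R` from the sets `D i`. -/
def OkMove {ι : Type} (α : SpinGraph S ℕ) (R : ℕ) (D : ι → Set ℕ) (c : G.Move) : Prop :=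
  ∀ i x, (c.2 x).2 = [] → (c.2 x).1 ∉ α.boundary R (D i)

section

variable {ι : Type} {D : ι → Set ℕ} {z y : CState S} {c : G.Move}

/-- Two vertices of a left hand side are joined inside it by a walk of length at most R, and along
each link the distance to D i, measured in the initial graph between roots, grows by at most one. -/
theorem Layers.mem_hull (hlocal : G.IsLocal) (hrange : G.RangeLE R) (h : Layers α R D z)
    (hc : CState.CanMove G c z) {i : ι} {x} (hx : (c.2 x).1 ∈ D i) (y) :
    (c.2 y).1 ∈ α.hull (D i) R := by
  have key : ∀ {u v} (p : (G.rule c.1).lhs.Walk u v) (j : ℕ), (c.2 u).1 ∈ α.hull (D i) j →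
      j + p.length ≤ R → (c.2 v).1 ∈ α.hull (D i) (j + p.length) := by
    intro u v p
    induction p with
    | nil => exact fun j hj _ => hj
    | cons hadj p ih =>
      intro j hj hle
      rw [SimpleGraph.Walk.length_cons] at hle ⊢
      have := ih (j + 1) (h.layer i j (by omega) _ _ (hc.2.2 _ _ hadj) hj) (by omega)
      rwa [show j + 1 + p.length = j + (p.length + 1) by omega] at this
  obtain ⟨p, hp⟩ := ((hlocal c.1).preconnected x y).exists_walk_length_eq_dist
  have hle : 0 + p.length ≤ R := by
    rw [zero_add, hp]
    exact hrange c.1 x y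
  exact SpinGraph.hull_mono hle (key p 0 (by rwa [SpinGraph.hull_zero]) hle)

/-- A move that meets D i stays in its R-neighbourhood. It cannot use a vertex over the boundary,
since such a vertex is an initial one and these are not touched by admissible moves. -/
theorem Layers.cases (hlocal : G.IsLocal) (hrange : G.RangeLE R) (h : Layers α R D z)
    (hc : CState.CanMove G c z) (hok : OkMove α R D c) (i : ι) :
    (∀ x, (c.2 x).1 ∈ D i) ∨ ∀ x, (c.2 x).1 ∉ α.hull (D i) R := by
  have hb : ∀ x, (c.2 x).1 ∉ α.boundary R (D i) := fun x hx =>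
    hok i x (h.old i _ (hc.range_subset ⟨x, rfl⟩) hx) hx
  by_cases hex : ∃ x, (c.2 x).1 ∈ D i
  · obtain ⟨x, hx⟩ := hex
    refine Or.inl fun y => ?_
    have := h.mem_hull hlocal hrange hc hx y
    rw [SpinGraph.hull_eq] at this
    exact this.resolve_right (hb y)
  · push Not at hex
    refine Or.inr fun x hx => ?_
    rw [SpinGraph.hull_eq] at hx
    exact hx.elim (hex x) (hb x)

/-- An admissible move acts either entirely over D i or entirely outside of its R-neighbourhood. In
both cases its vertices and the created ones lie in the same zone, so no link can jump over a layer
and nothing is created over the boundary. -/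
theorem Layers.step (hlocal : G.IsLocal) (hrange : G.RangeLE R) (h : Layers α R D z)
    (hc : CState.CanMove G c z) (hok : OkMove α R D c) : Layers α R D (z.step G c) where
  layer i j hj u v huv hu := by
    rcases h.cases hlocal hrange hc hok i with hin | hout
    · have hmem : ∀ w ∈ range c.2 ∪ range (z.newName c.2 : Fin (G.rule c.1).newSize → Label),
          w.1 ∈ D i := by
        rintro _ (⟨x, rfl⟩ | ⟨y, rfl⟩)
        exacts [hin x, hin 0]
      rcases (G.rule c.1).applyAt_adj_cases huv with ⟨-, h2⟩ | ⟨u', v', h1, h2, h3⟩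
      · exact SpinGraph.subset_hull (hmem _ h2)
      · rcases h3 with ⟨-, rfl⟩ | ⟨-, h3⟩
        · refine h.layer i j hj _ _ h1 ?_
          rcases h2 with ⟨-, rfl⟩ | ⟨h2, -⟩
          exacts [hu, SpinGraph.subset_hull (hmem _ (Or.inl h2))]
        · exact SpinGraph.subset_hull (hmem _ h3)
    · have hmem : ∀ w ∈ range c.2 ∪ range (z.newName c.2 : Fin (G.rule c.1).newSize → Label),
          w.1 ∉ α.hull (D i) R := by
        rintro _ (⟨x, rfl⟩ | ⟨y, rfl⟩)
        exacts [hout x, hout 0]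
      have hu' := SpinGraph.hull_mono hj.le hu
      rcases (G.rule c.1).applyAt_adj_cases huv with ⟨h2, -⟩ | ⟨u', v', h1, h2, h3⟩
      · exact absurd hu' (hmem _ h2)
      · rcases h2 with ⟨-, rfl⟩ | ⟨-, h2⟩
        · have hv' := h.layer i j hj _ _ h1 hu
          rcases h3 with ⟨-, rfl⟩ | ⟨h3, -⟩
          · exact hv'
          · exact absurd (SpinGraph.hull_mono hj hv') (hmem _ (Or.inl h3))
        · exact absurd hu' (hmem _ h2)
  old i l hl hlb := by
    rcases step_verts_subset hc hl with hl | ⟨y, rfl⟩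
    · exact h.old i l hl hlb
    · rcases h.cases hlocal hrange hc hok i with hin | hout
      · exact absurd (hin 0) hlb.1
      · refine absurd ?_ (hout 0)
        rw [SpinGraph.hull_eq]
        exact Or.inr hlb

theorem layers_init (B : Set ℕ) : Layers α R D (CState.init (α.restrict B)) where
  layer _ _ _ _ _ huv hu := SpinGraph.hull_adj huv.2.2.1 hu
  old _ _ hl _ := (CState.mem_verts_embed.1 hl).1

/-- The regions whose evolutions are independent: the neighbourhoods of the sets `D i`, and the
complement of these sets. -/
def region (α : SpinGraph S ℕ) (R : ℕ) (D : ι → Set ℕ) : Option ι → Set ℕ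
  | none => (⋃ i, D i)ᶜ
  | some i => α.hull (D i) R

/-- The moves in the neighbourhood of `E` that meet `E`. -/
def clusterMoves (G : Grammar S) (α : SpinGraph S ℕ) (R : ℕ) (E : Set ℕ) : Set G.Move :=
  {c | range c.2 ⊆ labelsOver (α.hull E R) ∧ ∃ x, (c.2 x).1 ∈ E}

/-- The moves of the regions. -/
def regionMoves (G : Grammar S) (α : SpinGraph S ℕ) (R : ℕ) (D : ι → Set ℕ) : Option ι → Set G.Move
  | none => {c | ∀ x i, (c.2 x).1 ∉ D i}
  | some i => G.clusterMoves α R (D i)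

/-- `y` is the part of the state `z` in the region `j`. -/
def RegionRel (n : ℕ) (α : SpinGraph S ℕ) (R : ℕ) (D : ι → Set ℕ) (j : Option ι) (z y : CState S) :
    Prop :=
  Inv n z ∧ Inv n y ∧ Layers α R D z ∧ AgreeOn (labelsOver (region α R D j)) (region α R D j) z y

theorem range_subset_of_mem_regionMoves {j : Option ι} (h : c ∈ G.regionMoves α R D j) :
    range c.2 ⊆ labelsOver (region α R D j) := by
  cases j with
  | none =>
    rintro _ ⟨x, rfl⟩
    change (c.2 x).1 ∈ (⋃ i, D i)ᶜ
    rw [mem_compl_iff, mem_iUnion, not_exists]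
    exact h x
  | some i => exact h.1

theorem disjoint_of_notMem_regionMoves (hlocal : G.IsLocal) (hrange : G.RangeLE R)
    (hz : Layers α R D z) (hc : CState.CanMove G c z) (hok : OkMove α R D c) {j : Option ι}
    (h : c ∉ G.regionMoves α R D j) : ∀ x, (c.2 x).1 ∉ region α R D j := by
  cases j with
  | none =>
    simp only [regionMoves, mem_ofPred_eq, not_forall, not_not] at h
    obtain ⟨x, i, hx⟩ := h
    rcases hz.cases hlocal hrange hc hok i with hin | hout
    · exact fun y hy => hy (mem_iUnion.2 ⟨i, hin y⟩)
    · exact absurd (SpinGraph.subset_hull hx) (hout x)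
  | some i =>
    rcases hz.cases hlocal hrange hc hok i with hin | hout
    · refine absurd ⟨?_, 0, hin 0⟩ h
      rintro _ ⟨x, rfl⟩
      exact SpinGraph.subset_hull (hin x)
    · exact hout

theorem RegionRel.step_mem (hn : G.Preserves n) (hlocal : G.IsLocal) (hrange : G.RangeLE R)
    {j : Option ι} (h : RegionRel n α R D j z y) (hc : c ∈ G.canonical.en z) (hok : OkMove α R D c)
    (hj : c ∈ G.regionMoves α R D j) : c ∈ G.canonical.en y ∧
      RegionRel n α R D j (G.canonical.step c z) (G.canonical.step c y) := by
  have hsub := range_subset_of_mem_regionMoves hj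
  have hcz := canMove_of_mem_en hc
  have hcy : c ∈ G.canonical.en y := h.2.1.en_iff.2 (h.2.2.2.canMove_iff.2 ⟨hcz, hsub⟩)
  exact ⟨hcy, h.1.step hn hc, h.2.1.step hn hcy, h.2.2.1.step hlocal hrange hcz hok,
    h.2.2.2.step_inside Subset.rfl h.1.1 h.2.1.1 hsub fun k _ =>
      (show (c.2 0).1 ∈ region α R D j from hsub ⟨0, rfl⟩)⟩

theorem RegionRel.step_notMem (hn : G.Preserves n) (hlocal : G.IsLocal) (hrange : G.RangeLE R)
    {j : Option ι} (h : RegionRel n α R D j z y) (hc : c ∈ G.canonical.en z) (hok : OkMove α R D c)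
    (hj : c ∉ G.regionMoves α R D j) : RegionRel n α R D j (G.canonical.step c z) y := by
  have hcz := canMove_of_mem_en hc
  have hd := disjoint_of_notMem_regionMoves hlocal hrange h.2.2.1 hcz hok hj
  refine ⟨h.1.step hn hc, h.2.1, h.2.2.1.step hlocal hrange hcz hok,
    h.2.2.2.step_outside Subset.rfl (disjoint_left.2 ?_) fun k _ => hd 0⟩
  rintro _ ⟨x, rfl⟩
  exact hd x

theorem RegionRel.mem_en {j : Option ι} (h : RegionRel n α R D j z y) (hc : c ∈ G.canonical.en y) :
    c ∈ G.canonical.en z :=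
  h.1.en_iff.2 (h.2.2.2.canMove_iff.1 (canMove_of_mem_en hc)).1

open scoped Classical in
/-- The region to which a move belongs. -/
noncomputable def ownRegion (D : ι → Set ℕ) (c : G.Move) : Option ι :=
  if h : ∃ i x, (c.2 x).1 ∈ D i then some h.choose else none

/-- A move of the region of D i lies in the neighbourhood of D i and hence misses every other set of
the family. In particular the move sets of different regions are disjoint, although the regions
themselves overlap in the boundaries. -/
theorem ownRegion_eq (hD : ∀ i i', i ≠ i' → Disjoint (D i) (α.hull (D i') R)) {j : Option ι}
    (h : c ∈ G.regionMoves α R D j) : ownRegion D c = j := by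
  cases j with
  | none =>
    refine dif_neg ?_
    rintro ⟨i, x, hx⟩
    exact h x i hx
  | some i =>
    obtain ⟨hsub, x, hx⟩ := h
    have hex : ∃ i x, (c.2 x).1 ∈ D i := ⟨i, x, hx⟩
    refine (dif_pos hex).trans ?_
    obtain ⟨x', hx'⟩ := hex.choose_spec
    congr 1
    by_contra hne
    exact disjoint_left.1 (hD _ _ hne) hx' (hsub ⟨x', rfl⟩)

theorem mem_regionMoves_ownRegion (hlocal : G.IsLocal) (hrange : G.RangeLE R)
    (hz : Layers α R D z) (hc : CState.CanMove G c z) :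
    c ∈ G.regionMoves α R D (ownRegion D c) := by
  by_cases hex : ∃ i x, (c.2 x).1 ∈ D i
  · have : ownRegion D c = some hex.choose := dif_pos hex
    rw [this]
    obtain ⟨x, hx⟩ := hex.choose_spec
    refine ⟨?_, x, hx⟩
    rintro _ ⟨y, rfl⟩
    exact hz.mem_hull hlocal hrange hc hx y
  · have : ownRegion D c = none := dif_neg hex
    rw [this]
    push Not at hex
    exact fun x i => hex i x

/-- The rings of the clocks of a set of moves. -/
def ringsOf (K : Set G.Move) (T : G.Move → Set ℝ) (c : G.Move) : Set ℝ := {s | c ∈ K ∧ s ∈ T c}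

theorem noSim_ringsOf {K : Set G.Move} {T : G.Move → Set ℝ} (hT : JumpSystem.NoSim T) :
    JumpSystem.NoSim (ringsOf K T) := fun _ _ _ h h' => hT _ _ _ h.2 h'.2

theorem rings_silence (h : ℝ) (K : Set G.Move) (ω : ClockSpace G.Move) :
    rings h (silence (K ×ˢ univ) ω) = ringsOf K (rings h ω) := by
  funext c
  ext s
  rw [mem_rings_silence]
  simp only [mem_prod, mem_univ, and_true, ringsOf, mem_ofPred_eq, rings, exists_and_left]

variable {T : G.Move → Set ℝ} {a b : ℝ} {l : List (G.Move × ℝ)}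

/-- As long as no boundary vertex is touched, moves of the region act identically on the whole state
and on its part, and the other moves take place outside of the region. -/
theorem exists_run_region (hn : G.Preserves n) (hlocal : G.IsLocal) (hrange : G.RangeLE R)
    (hT : JumpSystem.NoSim T) (hl : G.canonical.IsRun T z a l b) (hok : ∀ e ∈ l, OkMove α R D e.1)
    {j : Option ι} (h : RegionRel n α R D j z y) :
    ∃ m, G.canonical.IsRun (ringsOf (G.regionMoves α R D j) T) y a m b ∧
      ∀ s, RegionRel n α R D j (G.canonical.stateAt z l s) (G.canonical.stateAt y m s) := by
  refine ⟨_, hl.sim (J' := G.canonical) (T' := ringsOf (G.regionMoves α R D j) T) hT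
    (Rel := RegionRel n α R D j) (vis := fun c => c ∈ G.regionMoves α R D j)
    (ok := OkMove α R D) ?_ ?_ ?_ ?_ h hok⟩
  · exact fun _ _ _ hR hc hok hvis => hR.step_mem hn hlocal hrange hc hok hvis
  · exact fun _ _ _ hR hc hok hvis => hR.step_notMem hn hlocal hrange hc hok hvis
  · exact fun _ _ _ _ hR hc hs => ⟨hR.mem_en hc, hs.2, hs.1⟩
  · exact fun _ _ hv hs => ⟨hv, hs⟩

/-- Converse to `exists_run_region`: if the regions, run separately with their own clocks, leave the
boundaries untouched, then so does the whole evolution. Otherwise its first offending move would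
already occur in the run of the region owning it. -/
theorem forall_okMove (hn : G.Preserves n) (hlocal : G.IsLocal) (hrange : G.RangeLE R)
    (hD : ∀ i i', i ≠ i' → Disjoint (D i) (α.hull (D i') R)) (hT : JumpSystem.NoSim T)
    (hl : G.canonical.IsRun T z a l b) {y : Option ι → CState S}
    (h : ∀ j, RegionRel n α R D j z (y j)) {m : Option ι → List (G.Move × ℝ)}
    (hm : ∀ j, G.canonical.IsRun (ringsOf (G.regionMoves α R D j) T) (y j) a (m j) b)
    (hok : ∀ j, ∀ e ∈ m j, OkMove α R D e.1) : ∀ e ∈ l, OkMove α R D e.1 := by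
  classical
  refine hl.forall_ok (K := fun _ => G.canonical) (U := fun j => ringsOf (G.regionMoves α R D j) T)
    (Rel := fun z y => ∀ j, RegionRel n α R D j z (y j)) (ownRegion D) hT ?_ ?_ ?_ h hm hok
  · intro z y c s hR hc hs
    have hcz := canMove_of_mem_en hc
    have hmem := mem_regionMoves_ownRegion hlocal hrange (hR none).2.2.1 hcz
    refine ⟨(hR _).2.1.en_iff.2 ((hR (ownRegion D c)).2.2.2.canMove_iff.2
      ⟨hcz, range_subset_of_mem_regionMoves hmem⟩), hmem, hs⟩
  · intro z y c hR hc hok j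
    by_cases hj : j = ownRegion D c
    · subst hj
      rw [Function.update_self]
      exact ((hR _).step_mem hn hlocal hrange hc hok (mem_regionMoves_ownRegion hlocal hrange
        (hR none).2.2.1 (canMove_of_mem_en hc))).2
    · rw [Function.update_of_ne hj]
      exact (hR j).step_notMem hn hlocal hrange hc hok fun hmem => hj (ownRegion_eq hD hmem).symm
  · exact fun z y j c s hR hc hs => ⟨(hR j).mem_en hc, hs.2, ownRegion_eq hD hs.1⟩

end

/-- `E` is touched up to time `t`, and no vertex in its neighbourhood is. -/
def Isolated (α : SpinGraph S ℕ) (R : ℕ) (t : ℝ) (E : Set ℕ) (p : ℝ → Marked S) : Prop :=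
  E ⊆ (p t).touchedSet ∧ Disjoint (α.boundary R E) (p t).touchedSet

/-- The event that the evolution near `E`, driven by the moves that meet `E`, touches all vertices
of `E`, no other ones, and follows a trajectory in `U`. -/
def clusterEvent (G : Grammar S) (α : SpinGraph S ℕ) (R : ℕ) (h t : ℝ) (E : Set ℕ)
    (U : Set (ℝ → Marked S)) : Set (ClockSpace G.Move) :=
  silence (G.clusterMoves α R E ×ˢ univ) ⁻¹' G.canonical.runEvent img h
    (CState.init (α.restrict (α.hull E R))) 0 t {p | Isolated α R t E p ∧ p ∈ U}

/-- The event that the evolution in `B` outside of the sets `D i` does not touch their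
neighbourhoods. -/
def restEvent (G : Grammar S) (α : SpinGraph S ℕ) (R : ℕ) (h t : ℝ) {ι : Type} (D : ι → Set ℕ)
    (B : Set ℕ) : Set (ClockSpace G.Move) :=
  silence (G.regionMoves α R D none ×ˢ univ) ⁻¹' G.canonical.runEvent img h
    (CState.init (α.restrict (B ∩ region α R D none))) 0 t
    {p | ∀ i, Disjoint (α.boundary R (D i)) (p t).touchedSet}

theorem measurableSet_touched (t : ℝ) (u : Label) :
    MeasurableSet {p : ℝ → Marked S | u ∈ (p t).touched} := by
  have h1 : MeasurableSet[Marked.starSigma univ] {x : Marked S | u ∈ x.touched} :=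
    MeasurableSpace.measurableSet_generateFrom (Or.inr ⟨u, mem_univ _, rfl⟩)
  exact (measurable_pi_apply (X := fun _ : ℝ => Marked S) t) h1

theorem measurableSet_disjoint_touchedSet (t : ℝ) (E : Set ℕ) :
    MeasurableSet {p : ℝ → Marked S | Disjoint E (p t).touchedSet} := by
  have : {p : ℝ → Marked S | Disjoint E (p t).touchedSet} =
      ⋂ v ∈ E, {p | ((v, []) : Label) ∈ (p t).touched}ᶜ := by
    ext p
    simp only [disjoint_left, Marked.touchedSet, mem_ofPred_eq, mem_iInter, mem_compl_iff]
  rw [this]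
  exact MeasurableSet.biInter (to_countable E) fun v _ => (measurableSet_touched t _).compl

theorem measurableSet_isolated (t : ℝ) (E : Set ℕ) :
    MeasurableSet {p : ℝ → Marked S | Isolated α R t E p} := by
  have : {p : ℝ → Marked S | E ⊆ (p t).touchedSet} = ⋂ v ∈ E, {p | ((v, []) : Label) ∈ (p t).touched} := by
    ext p
    simp only [subset_def, Marked.touchedSet, mem_ofPred_eq, mem_iInter]
  have h0 : MeasurableSet {p : ℝ → Marked S | E ⊆ (p t).touchedSet} := by
    rw [this]
    exact MeasurableSet.biInter (to_countable E) fun v _ => measurableSet_touched t _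
  exact h0.inter (measurableSet_disjoint_touchedSet t _)

/-- The events of silenced clocks are independent. -/
theorem law_iInter_silence {J : Type} [Fintype J] {h t : ℝ} (hh : 0 < h) (ht : 0 ≤ t)
    {K : J → Set G.Move} (hK : ∀ i j, i ≠ j → Disjoint (K i) (K j)) (z : J → CState S)
    {A : J → Set (ℝ → Marked S)} (hA : ∀ j, MeasurableSet (A j)) :
    law G.moveRate h
        (⋂ j, silence (K j ×ˢ univ) ⁻¹' G.canonical.runEvent img h (z j) 0 t (A j)) =
      ∏ j, law G.moveRate h
        (silence (K j ×ˢ univ) ⁻¹' G.canonical.runEvent img h (z j) 0 t (A j)) := by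
  choose E hE hE' using fun j => G.canonical.exists_measurableSet_runEvent img hh (z j) ht (hA j)
  have h1 : ∀ᵐ ω ∂law G.moveRate h, ∀ j, (ω ∈ silence (K j ×ˢ univ) ⁻¹' E j ↔
      ω ∈ silence (K j ×ˢ univ) ⁻¹' G.canonical.runEvent img h (z j) 0 t (A j)) := by
    filter_upwards [ae_good G.moveRate (h := h)] with ω hω j
    exact hE' j _ (hω.silence _)
  have h2 := law_iInter G.moveRate h Finset.univ (K := fun j => K j ×ˢ (univ : Set ℕ))
    (E := fun j => silence (K j ×ˢ univ) ⁻¹' E j)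
    (fun i _ j _ hij => disjoint_left.2 fun p hp hp' => disjoint_left.1 (hK i j hij) hp.1 hp'.1)
    (fun j => measurable_silence _ (hE j)) fun j => DependsOn.preimage_silence _ _
  simp only [Finset.mem_univ, iInter_true] at h2
  convert h2 using 1
  · refine measure_congr (Filter.eventuallyEq_set.2 ?_)
    filter_upwards [h1] with ω hω
    simp only [mem_iInter]
    exact forall_congr' fun j => (hω j).symm
  · refine Finset.prod_congr rfl fun j _ => measure_congr ?_
    filter_upwards [h1] with ω hω
    exact propext (hω j).symm

theorem mem_touchedSet_img {z : CState S} (hz : z.Good n) {v : ℕ} :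
    v ∈ z.img.touchedSet ↔ ((v, []) : Label) ∈ z.touched := by
  rw [hz.touchedSet]
  rfl

theorem okMove_of_disjoint {ι : Type} {D : ι → Set ℕ} (hn : G.Preserves n) {T : G.Move → Set ℝ}
    {z : CState S} {a b : ℝ} {l : List (G.Move × ℝ)} (hz : Inv n z)
    (hl : G.canonical.IsRun T z a l b)
    (h : ∀ i, Disjoint (α.boundary R (D i)) (G.canonical.stateAt z l b).img.touchedSet) :
    ∀ e ∈ l, OkMove α R D e.1 := by
  intro e he i x hx hb
  refine disjoint_left.1 (h i) hb ?_
  rw [mem_touchedSet_img (inv_stateAt hn hl hz b).1, hl.stateAt_end, touched_final]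
  exact Or.inr ⟨e, he, x, Prod.ext rfl hx⟩

/-- The evolutions near distinct clusters and the rest are independent. -/
theorem law_isolated (hn : G.Preserves n) (hlocal : G.IsLocal) (hrange : G.RangeLE R)
    (hα : α.DegreeLE n) {h t : ℝ} (hh : 0 < h) (ht : 0 ≤ t) {ι : Type} [Fintype ι] {D : ι → Set ℕ}
    (hD : ∀ i i', i ≠ i' → Disjoint (D i) (α.hull (D i') R)) {B : Set ℕ} (hB : B.Finite)
    (hDB : ∀ i, α.hull (D i) R ⊆ B) {U : ι → Set (ℝ → Marked S)} (hU : ∀ i, MeasurableSet (U i)) :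
    law G.moveRate h (G.canonical.runEvent img h (CState.init (α.restrict B)) 0 t
      {p | ∀ i, Isolated α R t (D i) p ∧ (fun s => (p s).restrict (α.hull (D i) R)) ∈ U i}) =
    law G.moveRate h (G.restEvent α R h t D B) *
      ∏ i, law G.moveRate h (G.clusterEvent α R h t (D i) (U i)) := by
  set z₀ := CState.init (α.restrict B) with hz₀
  let y₀ : Option ι → CState S := fun j => CState.init (α.restrict (B ∩ region α R D j))
  have hy₀ : ∀ i, y₀ (some i) = CState.init (α.restrict (α.hull (D i) R)) := fun i => by
    simp only [y₀, region, inter_eq_self_of_subset_right (hDB i)]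
  have hrel : ∀ j, RegionRel n α R D j z₀ (y₀ j) := fun j =>
    ⟨inv_init hα hB, inv_init hα (hB.inter_of_left _), layers_init B, agreeOn_init rfl⟩
  -- The boundaries are contained both in the neighbourhoods and in the complement of the sets; that
  -- they remain untouched has to be required in every region.
  let A : Option ι → Set (ℝ → Marked S) := fun j => j.elim
    {p | ∀ i, Disjoint (α.boundary R (D i)) (p t).touchedSet}
    fun i => {p | Isolated α R t (D i) p ∧ p ∈ U i}
  have hA : ∀ j, MeasurableSet (A j) := by
    rintro (- | i)
    · have : A none = ⋂ i, {p | Disjoint (α.boundary R (D i)) (p t).touchedSet} := by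
        ext p
        simp only [A, Option.elim_none, mem_ofPred_eq, mem_iInter]
      rw [this]
      exact MeasurableSet.iInter fun i => measurableSet_disjoint_touchedSet t _
    · exact (measurableSet_isolated t _).inter (hU i)
  have hK : ∀ i j, i ≠ j → Disjoint (G.regionMoves α R D i) (G.regionMoves α R D j) :=
    fun i j hij => disjoint_left.2 fun c hc hc' =>
      hij ((ownRegion_eq hD hc).symm.trans (ownRegion_eq hD hc'))
  -- The regions are driven by disjoint sets of clocks. It remains to see that the event for the
  -- whole evolution is almost surely the intersection of the events of the regions.
  have hfac := law_iInter_silence hh ht hK y₀ hA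
  rw [Fintype.prod_option] at hfac
  have hsome : ∀ i, silence (G.regionMoves α R D (some i) ×ˢ univ) ⁻¹'
      G.canonical.runEvent img h (y₀ (some i)) 0 t (A (some i)) =
      G.clusterEvent α R h t (D i) (U i) := fun i => by
    rw [hy₀]
    rfl
  simp_rw [hsome] at hfac
  refine Eq.trans (measure_congr (Filter.eventuallyEq_set.2 ?_)) hfac
  filter_upwards [ae_good G.moveRate (h := h), ae_exists_run hn hlocal hrange hh
    (inv_init (α := α) hα hB) le_rfl ht] with ω hω hex
  rw [mem_iInter]
  obtain ⟨l, hl⟩ := hex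
  have hsil : ∀ j, ω ∈ silence (G.regionMoves α R D j ×ˢ univ) ⁻¹'
      G.canonical.runEvent img h (y₀ j) 0 t (A j) ↔ ∃ m,
      G.canonical.IsRun (ringsOf (G.regionMoves α R D j) (rings h ω)) (y₀ j) 0 m t ∧
      G.canonical.path img (y₀ j) m ∈ A j := fun j => by
    rw [mem_preimage, JumpSystem.runEvent, mem_ofPred_eq, rings_silence]
  have htouch : ∀ {j z y}, RegionRel n α R D j z y → ∀ v ∈ region α R D j,
      (v ∈ z.img.touchedSet ↔ v ∈ y.img.touchedSet) := by
    intro j z y hR v hv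
    rw [mem_touchedSet_img hR.1.1, mem_touchedSet_img hR.2.1.1, hR.2.2.2.touched]
    exact (and_iff_left (show ((v, []) : Label) ∈ labelsOver _ from hv)).symm
  have hbd : ∀ i, α.boundary R (D i) ⊆ region α R D (some i) := fun i v hv => by
    change v ∈ α.hull (D i) R
    rw [SpinGraph.hull_eq]
    exact Or.inr hv
  -- The boundary of one set is disjoint from all sets of the family by the separation hypothesis.
  have hbd' : ∀ i, α.boundary R (D i) ⊆ region α R D none := fun i v hv hmem => by
    obtain ⟨i', hi'⟩ := mem_iUnion.1 hmem
    by_cases hii : i' = i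
    · subst hii; exact hv.1 hi'
    · exact disjoint_left.1 (hD i' i hii) hi' (hbd i hv)
  have hiso : ∀ {i z y}, RegionRel n α R D (some i) z y → ((D i ⊆ z.img.touchedSet ∧
      Disjoint (α.boundary R (D i)) z.img.touchedSet) ↔ (D i ⊆ y.img.touchedSet ∧
      Disjoint (α.boundary R (D i)) y.img.touchedSet)) := by
    intro i z y hR
    refine and_congr (forall₂_congr fun v hv => htouch hR v (SpinGraph.subset_hull hv)) ?_
    rw [disjoint_left, disjoint_left]
    exact forall₂_congr fun v hv => not_congr (htouch hR v (hbd i hv))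
  constructor
  · rintro ⟨l', hl', hl'A⟩
    obtain rfl := hl'.unique hω.1 hl
    have hok := okMove_of_disjoint (α := α) (R := R) (D := D) hn (inv_init hα hB) hl'
      fun i => (hl'A i).1.2
    intro j
    rw [hsil]
    obtain ⟨m, hm, hmr⟩ := exists_run_region hn hlocal hrange hω.1 hl' hok (hrel j)
    refine ⟨m, hm, ?_⟩
    cases j with
    | none =>
      intro i
      refine disjoint_left.2 fun v hv hvt => disjoint_left.1 (hl'A i).1.2 hv ?_
      exact (htouch (hmr t) v (hbd' i hv)).2 hvt
    | some i =>
      refine ⟨(hiso (hmr t)).1 (hl'A i).1, ?_⟩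
      have : G.canonical.path img (y₀ (some i)) m =
          fun s => (G.canonical.path img z₀ l' s).restrict (α.hull (D i) R) := by
        funext s
        exact ((hmr s).2.2.2.restrict_img (hmr s).1.1 (hmr s).2.1.1).symm
      rw [this]
      exact (hl'A i).2
  · intro hall
    have hall' := fun j => (hsil j).1 (hall j)
    choose m hm hmA using hall'
    have hok := forall_okMove hn hlocal hrange hD hω.1 hl hrel hm fun j e he => ?_
    · refine ⟨l, hl, fun i => ?_⟩
      obtain ⟨m', hm', hmr⟩ := exists_run_region hn hlocal hrange hω.1 hl hok (hrel (some i))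
      obtain rfl := hm'.unique (noSim_ringsOf hω.1) (hm (some i))
      have hi := hmA (some i)
      refine ⟨(hiso (hmr t)).2 hi.1, ?_⟩
      have : G.canonical.path img (y₀ (some i)) (m (some i)) =
          fun s => (G.canonical.path img z₀ l s).restrict (α.hull (D i) R) := by
        funext s
        exact ((hmr s).2.2.2.restrict_img (hmr s).1.1 (hmr s).2.1.1).symm
      rw [← this]
      exact hi.2
    · cases j with
      | none => exact okMove_of_disjoint hn (hrel none).2.1 (hm none) (hmA none) e he
      | some i =>
        have hmem : e.1 ∈ G.regionMoves α R D (some i) := by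
          have : ∀ {m : List (G.Move × ℝ)} {z a}, G.canonical.IsRun
              (ringsOf (G.regionMoves α R D (some i)) (rings h ω)) z a m t →
              ∀ e ∈ m, e.1 ∈ G.regionMoves α R D (some i) := by
            intro m
            induction m with
            | nil => simp
            | cons e m ih =>
              intro z a hr
              exact List.forall_mem_cons.2 ⟨hr.2.1.1, ih hr.2.2.2.2.2⟩
          exact this (hm (some i)) e he
        -- A move of the region of D i touches only vertices over D i or its boundary. Vertices over
        -- D i are in no boundary of the family, and the boundary of D i is untouched by the event
        -- of this region.
        have h1 := okMove_of_disjoint (α := α) (R := R) (D := fun _ : Unit => D i) hn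
          (hrel (some i)).2.1 (hm (some i)) (fun _ => (hmA (some i)).1.2) e he
        intro i' x hx hb
        have h2 : (e.1.2 x).1 ∈ α.hull (D i) R := hmem.1 ⟨x, rfl⟩
        rw [SpinGraph.hull_eq] at h2
        rcases h2 with h2 | h2
        · by_cases hii : i = i'
          · subst hii; exact hb.1 h2
          · exact disjoint_left.1 (hD i i' hii) h2 (hbd i' hb)
        · exact h1 () x hx h2

end Grammar

/-! ### Identification of the cluster law -/

namespace SpinGraph

variable {S : Type} {α : SpinGraph S ℕ} {n : ℕ}

theorem DegreeLE.finite_hull (hα : α.DegreeLE n) {D : Set ℕ} (hD : D.Finite) (j : ℕ) :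
    (α.hull D j).Finite := by
  refine (hD.biUnion fun v _ => (hα.ball j v).1).subset ?_
  rintro v ⟨u, hu, hv⟩
  exact mem_iUnion₂.2 ⟨u, hu, hv⟩

end SpinGraph

namespace Grammar

open CState ClockSpace

variable {S : Type} {G : Grammar S} {n R : ℕ} {α : SpinGraph S ℕ}

/-- The evolution in `A` stays in `A`. -/
theorem restrict_path (hn : G.Preserves n) {A : Set ℕ} {z : CState S} (hz : Inv n z)
    (hA : AgreeOn (labelsOver A) A z z) {T : G.Move → Set ℝ} {a b : ℝ} {l : List (G.Move × ℝ)}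
    (hl : G.canonical.IsRun T z a l b) (s : ℝ) :
    (G.canonical.path img z l s).restrict A = G.canonical.path img z l s := by
  have key : ∀ {l : List (G.Move × ℝ)} {z : CState S} {a : ℝ}, Inv n z →
      AgreeOn (labelsOver A) A z z → G.canonical.IsRun T z a l b →
      Inv n (G.canonical.stateAt z l s) ∧
      AgreeOn (labelsOver A) A (G.canonical.stateAt z l s) (G.canonical.stateAt z l s) := by
    intro l
    induction l with
    | nil => exact fun hz hA _ => ⟨hz, hA⟩
    | cons e l ih =>
      intro z a hz hA hl
      rw [JumpSystem.stateAt]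
      split_ifs
      · refine ih (hz.step hn hl.1) ?_ hl.2.2.2.2.2
        have hsub := (hA.canMove_iff.1 (canMove_of_mem_en hl.1)).2
        exact hA.step_inside Subset.rfl hz.1 hz.1 hsub fun k _ =>
          (show (e.1.2 0).1 ∈ A from hsub ⟨0, rfl⟩)
      · exact ⟨hz, hA⟩
  have := key hz hA hl
  exact this.2.restrict_img this.1.1 this.1.1

/-- With positive probability none of the finitely many clocks that are enabled initially rings
before t; then nothing happens in the complement. -/
theorem law_restEvent_ne_zero (hα : α.DegreeLE n) {h t : ℝ} (hh : 0 < h) (ht : 0 ≤ t) {ι : Type}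
    (D : ι → Set ℕ) {B : Set ℕ} (hB : B.Finite) :
    law G.moveRate h (G.restEvent α R h t D B) ≠ 0 := by
  classical
  set z := CState.init (α.restrict (B ∩ region α R D none)) with hz
  have hinv : Inv n z := inv_init hα (hB.inter_of_left _)
  obtain ⟨P, hP⟩ := exists_nat_ge (t / h)
  rw [div_le_iff₀ hh] at hP
  let V : G.Move → Set ℝ := fun c => if c ∈ G.canonical.en z then Ioc 0 t else ∅
  have hVpos : ∀ c ∈ G.canonical.en z, V c = Ioc 0 t := fun c hc => if_pos hc
  have hVneg : ∀ c, c ∉ G.canonical.en z → V c = ∅ := fun c hc => if_neg hc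
  have hV : ∀ c, MeasurableSet (V c) ∧ V c ⊆ Ioc 0 (P * h) := fun c => by
    by_cases hc : c ∈ G.canonical.en z
    · rw [hVpos c hc]
      exact ⟨measurableSet_Ioc, Ioc_subset_Ioc_right hP⟩
    · rw [hVneg c hc]
      exact ⟨MeasurableSet.empty, empty_subset _⟩
  have hvoid := law_void G.moveRate hh.le P (G.canonical.en z) (fun c => (hV c).1) hVneg
    fun c => (hV c).2
  intro h0
  have hle : law G.moveRate h {ω | ∀ c, ringSum h P c ω ((V c).indicator 1) = 0} ≤
      law G.moveRate h (G.restEvent α R h t D B) := by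
    refine measure_mono fun ω hω => ?_
    refine ⟨[], ⟨ht, fun c hc s hs hab => ?_⟩, fun i => ?_⟩
    · rw [rings_silence] at hs
      have hsV : s ∈ V c := by
        rw [hVpos c hc]
        exact hab
      have := (ringSum_eq_zero_iff hh P c ω _).1 (hω c) s hs.2 ((hV c).2 hsV).2
      rw [indicator_of_mem hsV] at this
      exact one_ne_zero this
    · have : (G.canonical.path img z [] t).touchedSet = ∅ := by
        change z.img.touchedSet = ∅
        rw [hz, CState.img_init]
        rfl
      rw [this]
      exact disjoint_empty _
  rw [h0, hvoid] at hle
  exact (ENNReal.ofReal_pos.2 (Real.exp_pos _)).not_ge hle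

/-- The evolution near `D` has the law of the chain on `D` and its boundary under the condition that
precisely the vertices of `D` are touched. -/
theorem law_clusterEvent (hn : G.Preserves n) (hlocal : G.IsLocal) (hrange : G.RangeLE R)
    (hα : α.DegreeLE n) {h t : ℝ} (hh : 0 < h) (ht : 0 ≤ t) {D : Set ℕ} (hD : D.Finite)
    {U : Set (ℝ → Marked S)} (hU : MeasurableSet U) :
    law G.moveRate h (G.clusterEvent α R h t D U) =
      law G.moveRate h (G.clusterEvent α R h t D univ) * G.clusterLaw α R t D U := by
  set B := α.hull D R with hBdef
  have hB : B.Finite := hα.finite_hull hD R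
  set z := CState.init (α.restrict B) with hz
  have hinv : Inv n z := inv_init hα hB
  have hfin : (α.restrict B).verts.Finite :=
    hB.subset fun v hv => (SpinGraph.mem_verts_restrict.1 hv).2
  set r := law G.moveRate h (G.restEvent α R h t (fun _ : Unit => D) B) with hr
  have hr0 : r ≠ 0 := law_restEvent_ne_zero hα hh ht _ hB
  have hself : AgreeOn (labelsOver B) B z z := agreeOn_init (inter_self B)
  -- The factorization is applied to the single set D inside of the graph on D and its boundary. The
  -- factor r of the surroundings does not depend on U and cancels in the conditional probability.
  have key : ∀ U : Set (ℝ → Marked S), MeasurableSet U →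
      G.chainLaw (Marked.init (α.restrict B)) t ({p | Isolated α R t D p} ∩ U) =
        r * law G.moveRate h (G.clusterEvent α R h t D U) := by
    intro U hU
    have h1 := law_isolated hn hlocal hrange hα hh ht (D := fun _ : Unit => D)
      (fun i i' hi => absurd (Subsingleton.elim i i') hi) hB (fun _ => Subset.rfl) (fun _ => hU)
    rw [Fintype.prod_unique] at h1
    rw [← h1, chainLaw_init hn (hα.restrict B) hfin hh ht ((measurableSet_isolated t D).inter hU)]
    congr 1
    ext ω
    refine exists_congr fun l => and_congr_right fun hl => ?_
    have hpath : (fun s => (G.canonical.path img z l s).restrict B) = G.canonical.path img z l :=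
      funext fun s => restrict_path hn hinv hself hl s
    have hmem : (fun s => (G.canonical.path img z l s).restrict B) ∈ U ↔
        G.canonical.path img z l ∈ U := by rw [hpath]
    exact ⟨fun hp _ => ⟨hp.1, hmem.2 hp.2⟩, fun hp => ⟨(hp ()).1, hmem.1 (hp ()).2⟩⟩
  have hcond : G.clusterLaw α R t D U =
      (r * law G.moveRate h (G.clusterEvent α R h t D univ))⁻¹ *
        (r * law G.moveRate h (G.clusterEvent α R h t D U)) := by
    rw [← key U hU, ← key univ MeasurableSet.univ, inter_univ, clusterLaw, ← SpinGraph.hull_eq]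
    exact ProbabilityTheory.cond_apply (measurableSet_isolated t D) _ _
  have hle : law G.moveRate h (G.clusterEvent α R h t D U) ≤
      law G.moveRate h (G.clusterEvent α R h t D univ) :=
    measure_mono fun ω ⟨l, hl, hp⟩ => ⟨l, hl, hp.1, mem_univ _⟩
  -- If D cannot become a cluster, both sides vanish and the value of the conditional law is
  -- irrelevant.
  by_cases h0 : law G.moveRate h (G.clusterEvent α R h t D univ) = 0
  · rw [h0, zero_mul]
    exact le_antisymm (h0 ▸ hle) zero_le
  · have hrt : r ≠ ⊤ := measure_ne_top _ _
    rw [hcond, ENNReal.mul_inv (Or.inl hr0) (Or.inl hrt)]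
    set x := law G.moveRate h (G.clusterEvent α R h t D univ)
    set y := law G.moveRate h (G.clusterEvent α R h t D U)
    calc y = (x * x⁻¹) * ((r⁻¹ * r) * y) := by
          rw [ENNReal.mul_inv_cancel h0 (measure_ne_top _ _), ENNReal.inv_mul_cancel hr0 hrt, one_mul,
            one_mul]
      _ = x * (r⁻¹ * x⁻¹ * (r * y)) := by ring

end Grammar

/-! ### Counting self-avoiding paths -/

namespace SimpleGraph

variable {V : Type} {H : SimpleGraph V}

/-- In a graph of bounded degree the self-avoiding paths from a vertex are covered by few sets. -/
theorem exists_path_family {N : ℕ} (hN : ∀ v, (H.neighborSet v).encard ≤ N) (k : ℕ) (u : V) :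
    ∃ Φ : Finset (Finset V), Φ.card ≤ N ^ k ∧ (∀ F ∈ Φ, F.card = k + 1) ∧
      ∀ v (p : H.Walk u v), p.IsPath → k ≤ p.length → ∃ F ∈ Φ, ∀ w ∈ F, w ∈ p.support := by
  classical
  induction k generalizing u with
  | zero => exact ⟨{{u}}, by simp, by simp, fun v p _ _ => ⟨{u}, by simp, by simp⟩⟩
  | succ k ih =>
    choose Φ h1 h2 h3 using ih
    have hfin : (H.neighborSet u).Finite := Set.finite_of_encard_le_coe (hN u)
    -- A set for the neighbour w may already contain u; such sets have too few elements and do not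
    -- come from paths that start at u, so they are discarded.
    refine ⟨(hfin.toFinset.biUnion fun w => (Φ w).image (insert u)).filter fun F => F.card = k + 2,
      ?_, fun F hF => (Finset.mem_filter.1 hF).2, ?_⟩
    · refine (Finset.card_filter_le _ _).trans ((Finset.card_biUnion_le_card_mul _ _ (N ^ k)
        fun w _ => Finset.card_image_le.trans (h1 w)).trans ?_)
      rw [pow_succ, mul_comm]
      refine Nat.mul_le_mul_left _ ?_
      rw [← ncard_eq_toFinset_card _ hfin]
      have := hN u
      rw [← hfin.cast_ncard_eq] at this
      exact_mod_cast this
    · intro v p hp hle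
      cases p with
      | nil => simp at hle
      | @cons _ w _ hadj q =>
        rw [Walk.cons_isPath_iff] at hp
        rw [Walk.length_cons] at hle
        obtain ⟨F, hF, hFq⟩ := h3 w v q hp.1 (by omega)
        refine ⟨insert u F, Finset.mem_filter.2 ⟨Finset.mem_biUnion.2 ⟨w, ?_, ?_⟩, ?_⟩, ?_⟩
        · exact hfin.mem_toFinset.2 hadj
        · exact Finset.mem_image_of_mem _ hF
        · rw [Finset.card_insert_of_notMem fun hu => hp.2 (hFq u hu), h2 w F hF]
        · intro x hx
          rw [Walk.support_cons]
          rcases Finset.mem_insert.1 hx with rfl | hx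
          · exact List.mem_cons_self
          · exact List.mem_cons_of_mem _ (hFq x hx)

end SimpleGraph

/-! ### Propagation of discrepancies along touched paths -/

namespace CState

variable {S : Type}

/-- The two states coincide on the names over `A`. -/
structure Agree (A : Set ℕ) (z z' : CState S) : Prop where
  spin : ∀ l ∈ labelsOver A, z.graph.spin l = z'.graph.spin l
  adj : ∀ l ∈ labelsOver A, ∀ m, z.graph.graph.Adj l m ↔ z'.graph.graph.Adj l m
  touched : ∀ l ∈ labelsOver A, l ∈ z.touched ↔ l ∈ z'.touched
  cnt : ∀ l ∈ labelsOver A, z.cnt l = z'.cnt l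
  lab : ∀ l ∈ labelsOver A, z.lab l = z'.lab l

variable {A B : Set ℕ} {z z' z'' : CState S}

theorem Agree.mono (hAB : A ⊆ B) (h : Agree B z z') : Agree A z z' :=
  ⟨fun l hl => h.spin l (hAB hl), fun l hl m => h.adj l (hAB hl) m,
    fun l hl => h.touched l (hAB hl), fun l hl => h.cnt l (hAB hl), fun l hl => h.lab l (hAB hl)⟩

/-- Two states that both have the part `y` on the names in `Q` agree where no links leave `Q`. -/
theorem AgreeOn.agree {Q : Set Label} {y : CState S} (h : AgreeOn Q A z y) (h' : AgreeOn Q A z' y)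
    (hA : labelsOver A ⊆ Q) (hz : ∀ u ∈ labelsOver A, ∀ v, z.graph.graph.Adj u v → v ∈ Q)
    (hz' : ∀ u ∈ labelsOver A, ∀ v, z'.graph.graph.Adj u v → v ∈ Q) : Agree A z z' where
  spin l hl := by
    rw [← SpinGraph.restrict_spin (hA hl), ← h.graph, h'.graph, SpinGraph.restrict_spin (hA hl)]
  adj l hl m := by
    have h1 : z.graph.graph.Adj l m ↔ y.graph.graph.Adj l m := by
      rw [h.graph]
      exact ⟨fun hm => ⟨hm, hA hl, hz l hl m hm⟩, fun hm => hm.1⟩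
    have h2 : z'.graph.graph.Adj l m ↔ y.graph.graph.Adj l m := by
      rw [h'.graph]
      exact ⟨fun hm => ⟨hm, hA hl, hz' l hl m hm⟩, fun hm => hm.1⟩
    exact h1.trans h2.symm
  touched l hl := by
    have h1 : l ∈ y.touched ↔ l ∈ z.touched := by rw [h.touched]; exact and_iff_left (hA hl)
    have h2 : l ∈ y.touched ↔ l ∈ z'.touched := by rw [h'.touched]; exact and_iff_left (hA hl)
    exact h1.symm.trans h2
  cnt l hl := (h.cnt l (hA hl)).symm.trans (h'.cnt l (hA hl))
  lab l hl := (h.lab l hl).symm.trans (h'.lab l hl)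

theorem Agree.agreeOn_restrict {Q : Set Label} (h : Agree B z z') (hQ : Q ⊆ labelsOver B)
    (hA : labelsOver A ⊆ Q) : AgreeOn Q A z' (z.restrict Q) where
  graph := by
    refine SpinGraph.ext_of (fun l => ?_) fun l m => and_congr_left fun hl => h.adj l (hQ hl.1) m
    by_cases hl : l ∈ Q
    · exact (SpinGraph.restrict_spin hl).trans ((h.spin l (hQ hl)).trans
        (SpinGraph.restrict_spin hl).symm)
    · exact (if_neg hl).trans (if_neg hl).symm
  touched := by
    ext l
    exact and_congr_left fun hl => h.touched l (hQ hl)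
  cnt l hl := h.cnt l (hQ hl)
  lab l hl := h.lab l (hQ (hA hl))

/-- The set `P` together with all descendants that do not exist yet. -/
inductive Descendants (cnt : Label → ℕ) (P : Set Label) : Label → Prop
  | base {v : Label} : v ∈ P → Descendants cnt P v
  | child {b : Label} {k : ℕ} : cnt b ≤ k → Descendants cnt P b → Descendants cnt P (b.child k)

/-- The vertices from which the complement of `A` can be reached through vertices in `V`. -/
def leak (z : CState S) (A : Set ℕ) (V : Set Label) : Set Label :=
  {v | v.1 ∉ A ∨ ∃ (w : Label) (p : z.graph.graph.Walk v w), (∀ x ∈ p.support, x ∈ V) ∧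
    ∃ x, z.graph.graph.Adj w x ∧ x.1 ∉ A}

variable {V : Set Label} {n : ℕ}

theorem leak_of_adj {u v : Label} (hu : u ∈ V) (h : z.graph.graph.Adj u v) (hv : v ∈ z.leak A V) :
    u ∈ z.leak A V := by
  rcases hv with hv | ⟨w, p, hp, hx⟩
  · refine Or.inr ⟨u, SimpleGraph.Walk.nil, fun x hx => ?_, v, h, hv⟩
    rw [SimpleGraph.Walk.support_nil, List.mem_singleton] at hx
    exact hx ▸ hu
  · refine Or.inr ⟨w, SimpleGraph.Walk.cons h p, fun x hx => ?_, hx⟩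
    rw [SimpleGraph.Walk.support_cons] at hx
    rcases List.mem_cons.1 hx with rfl | hx
    exacts [hu, hp x hx]

/-- Unless v itself lies outside of A, it is an end point of a link and therefore a vertex. -/
theorem notMem_of_leak {v : Label} (hv : v ∈ z.leak A V) (hz : v ∉ z.graph.verts) : v.1 ∉ A := by
  rcases hv with hv | ⟨w, p, -, x, hx, -⟩
  · exact hv
  · cases p with
    | nil => exact absurd (SpinGraph.mem_verts_of_adj hx).1 hz
    | cons h _ => exact absurd (SpinGraph.mem_verts_of_adj h).1 hz

/-- The additional names in `Descendants` have indices not yet used, so they belong to no existing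
vertex. -/
theorem Good.leak_of_descendants (h : z.Good n) {v : Label} (hz : v ∈ z.graph.verts)
    (hv : Descendants z.cnt (z.leak A V) v) : v ∈ z.leak A V := by
  cases hv with
  | base hv => exact hv
  | child hk _ => exact absurd (h.fresh _ _ (Or.inl hz)) (by omega)

/-- A future child is put on the side of its parent. It cannot be in the leak set for a reason of
its own: not being a vertex, it would have to lie outside of A together with its parent. -/
theorem Good.descendants_child_iff (h : z.Good n) {u : Label} {k : ℕ} (hk : z.cnt u ≤ k) :
    Descendants z.cnt (z.leak A V) (u.child k) ↔ Descendants z.cnt (z.leak A V) u := by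
  refine ⟨fun hd => ?_, Descendants.child hk⟩
  generalize hv : u.child k = v at hd
  cases hd with
  | base hl =>
    refine Descendants.base (Or.inl ?_)
    have := notMem_of_leak hl fun hz => by
      have := h.fresh u k (Or.inl (hv ▸ hz))
      omega
    rw [← hv] at this
    exact this
  | child hk' hd =>
    obtain ⟨rfl, -⟩ := Label.child_inj.1 hv
    exact hd

end CState

namespace Grammar

open CState

variable {S : Type} {G : Grammar S} {n : ℕ}

/-- If the vertices that are touched do not contain long paths that start near `A 0`, the states
that agree on `A (k + 1)` continue to agree on `A 0`. -/
theorem agree_stateAt (hn : G.Preserves n) (hlocal : G.IsLocal) {T : G.Move → Set ℝ}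
    (hT : JumpSystem.NoSim T) {z z' : CState S} (hz : Inv n z) (hz' : Inv n z') {A : ℕ → Set ℕ}
    (hA : Monotone A) {k : ℕ} (hzz : Agree (A (k + 1)) z z')
    (hchain : ∀ i < k + 1, ∀ u v, z.graph.graph.Adj u v → u.1 ∈ A i → v.1 ∈ A (i + 1)) {a b : ℝ}
    {l l' : List (G.Move × ℝ)} (hl : G.canonical.IsRun T z a l b)
    (hl' : G.canonical.IsRun T z' a l' b)
    (hesc : ∀ u w (p : z.graph.graph.Walk u w), u.1 ∈ A 1 → p.IsPath → k ≤ p.length →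
      ¬ ∀ x ∈ p.support, (∃ e ∈ l, x ∈ range e.1.2) ∨ ∃ e ∈ l', x ∈ range e.1.2) (s : ℝ) :
    Agree (A 0) (G.canonical.stateAt z l s) (G.canonical.stateAt z' l' s) := by
  classical
  set V : Set Label := {x | (∃ e ∈ l, x ∈ range e.1.2) ∨ ∃ e ∈ l', x ∈ range e.1.2} with hV
  have hindex : ∀ {u w} (p : z.graph.graph.Walk u w) (i : ℕ), u.1 ∈ A i → i + p.length ≤ k + 1 →
      w.1 ∈ A (i + p.length) := by
    intro u w p
    induction p with
    | nil => exact fun i hi _ => hi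
    | cons h p ih =>
      intro i hi hle
      rw [SimpleGraph.Walk.length_cons] at hle ⊢
      have := ih (i + 1) (hchain i (by omega) _ _ h hi) (by omega)
      rwa [show i + 1 + p.length = i + (p.length + 1) by omega] at this
  -- A path from A 1 to a vertex with a link leaving A (k + 1) has at least k links, since each link
  -- leads at most from one set of the chain to the next; `hesc` excludes such a path of touched
  -- vertices.
  have hleak : ∀ v, v.1 ∈ A 1 → v ∉ z.leak (A (k + 1)) V := by
    rintro v hv (hv' | ⟨w, p, hp, x, hwx, hx⟩)
    · exact hv' (hA (by omega) hv)
    · refine hesc v w p.bypass hv p.bypass_isPath ?_ fun x hx => hp x (p.support_bypass_subset_support hx)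
      by_contra hlt
      have h1 := hindex p.bypass 1 hv (by omega)
      exact hx (hA (by omega) (hchain _ (by omega) _ _ hwx h1))
  have hdesc : ∀ v, Descendants z.cnt (z.leak (A (k + 1)) V) v → v.1 ∉ A 1 := by
    intro v hv
    induction hv with
    | base h => exact fun h' => hleak _ h' h
    | child _ _ ih => exact ih
  -- The protected region: all names except the leak set, from which touched paths lead out of A (k
  -- + 1), and its future descendants.
  set Q : Set Label := {v | ¬ Descendants z.cnt (z.leak (A (k + 1)) V) v} with hQdef
  have hAQ : labelsOver (A 0) ⊆ Q := fun v hv hd => hdesc v hd (hA zero_le_one hv)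
  have hQA : Q ⊆ labelsOver (A (k + 1)) := fun v hv => by
    by_contra hcon
    exact hv (.base (Or.inl hcon))
  set X : Set Label := {u | u ∈ Q ∧ ∃ v ∉ Q, z.graph.graph.Adj u v} with hX
  -- A touched vertex with a link to the leak set would belong to the leak set itself. The inner
  -- boundary of `Q` is therefore untouched in both evolutions.
  have hXV : ∀ u ∈ X, u ∉ V := by
    rintro u ⟨hu, v, hv, huv⟩ huV
    refine hu (.base (leak_of_adj huV huv ?_))
    exact hz.1.leak_of_descendants (SpinGraph.mem_verts_of_adj huv).2 (not_not.1 hv)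
  have hXA : ∀ u ∈ labelsOver (A 0), u ∉ X := by
    rintro u hu ⟨-, v, hv, huv⟩
    exact hdesc v (not_not.1 hv) (hchain 0 (by omega) u v huv hu)
  have hQc : ∀ u k, z.cnt u ≤ k → (u.child k ∈ Q ↔ u ∈ Q) := fun u k hk =>
    not_congr (hz.1.descendants_child_iff hk)
  have hQc' : ∀ u j, z'.cnt u ≤ j → (u.child j ∈ Q ↔ u ∈ Q) := fun u j hk => by
    by_cases hu : u ∈ labelsOver (A (k + 1))
    · exact hQc u _ ((hzz.cnt u hu).trans_le hk)
    · exact iff_of_false (fun h => hu (@hQA (u.child j) h)) fun h => hu (hQA h)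
  obtain ⟨h1, h1'⟩ := run_restrict hn hlocal hT hz (inv_restrict hz Q) (X := X) hAQ
    (z.agreeOn_restrict Q (A 0)) hQc (fun u hu v hv huv => ⟨hu, v, hv, huv⟩) hl
    fun e he => disjoint_right.2 fun u hu hue => hXV u hu (Or.inl ⟨e, he, hue⟩)
  obtain ⟨h2, h2'⟩ := run_restrict hn hlocal hT hz' (inv_restrict hz Q) (X := X) hAQ
    (hzz.agreeOn_restrict hQA hAQ) hQc'
    (fun u hu v hv huv => ⟨hu, v, hv, (hzz.adj u (hQA hu) v).2 huv⟩) hl'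
    fun e he => disjoint_right.2 fun u hu hue => hXV u hu (Or.inr ⟨e, he, hue⟩)
  -- Inside of `Q` both evolutions are runs with the same clocks from the same initial part, hence
  -- they coincide.
  have hfil := h1.unique hT h2
  refine (h1' s).1.agree (y := _) (hfil ▸ (h2' s).1) hAQ ?_ ?_
  · intro u hu v huv
    by_contra hv
    exact hXA u hu ((h1' s).2 u (hAQ hu) v hv huv)
  · intro u hu v huv
    by_contra hv
    exact hXA u hu ((h2' s).2 u (hAQ hu) v hv huv)

end Grammar

/-! ### The Markov property at the end points of the time slabs -/

namespace JumpSystem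

open ClockSpace
open scoped NNReal

variable {σ C : Type} (J : JumpSystem σ C) {h : ℝ}

/-- The event that a run exists whose sequence of moves belongs to `P`. -/
def movesEvent (h : ℝ) (z : σ) (a b : ℝ) (P : Set (List C)) : Set (ClockSpace C) :=
  {ω | ∃ l, J.IsRun (rings h ω) z a l b ∧ l.map Prod.fst ∈ P}

theorem final_eq_foldl (z : σ) (l : List (C × ℝ)) :
    J.final z l = (l.map Prod.fst).foldl (fun z c => J.step c z) z := by
  induction l generalizing z with
  | nil => rfl
  | cons e l ih => exact ih _

/-- A run on (a, b] hears only the rings in that interval, so silencing all slabs that do not meet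
it changes nothing. Recording the list of moves as a memory makes the event measurable. -/
theorem exists_measurableSet_movesEvent [Countable C] (hh : 0 < h) (z : σ) {a b : ℝ} (hab : a ≤ b)
    (P : Set (List C)) {K : Set ℕ} (hK : ∀ s, a < s → s ≤ b → ∀ p, s ∈ slab h p → p ∈ K) :
    ∃ E, MeasurableSet E ∧ DependsOn (univ ×ˢ K) E ∧
      ∀ ω, Good h ω → (ω ∈ E ↔ ω ∈ J.movesEvent h z a b P) := by
  let m : C → List C → List C := fun c d => d ++ [c]
  let obs : σ × List C → List C := Prod.snd
  let _ : MeasurableSpace (List C) := ⊤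
  have hP : MeasurableSet P := trivial
  obtain ⟨E, hE, hE'⟩ := (J.withMemory m).exists_measurableSet_runEvent obs hh (z, []) hab
    (A := {p | p b ∈ P}) (measurable_pi_apply b hP)
  have hfold : ∀ (l : List (C × ℝ)) (d : List C),
      l.foldl (fun d e => m e.1 d) d = d ++ l.map Prod.fst := by
    intro l
    induction l with
    | nil => simp
    | cons e l ih => intro d; rw [List.foldl_cons, ih]; simp [m]
  refine ⟨silence (univ ×ˢ K) ⁻¹' E, measurable_silence _ hE, DependsOn.preimage_silence _ _,
    fun ω hω => ?_⟩
  rw [mem_preimage, hE' _ (hω.silence _)]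
  refine exists_congr fun l => ?_
  rw [isRun_withMemory]
  have hring : ∀ c s, a < s → s ≤ b →
      (s ∈ rings h (silence (univ ×ˢ K) ω) c ↔ s ∈ rings h ω c) := by
    intro c s has hsb
    rw [mem_rings_silence]
    constructor
    · rintro ⟨p, -, hp⟩
      exact ⟨p, hp⟩
    · rintro ⟨p, l, hl, h1, h2⟩
      exact ⟨p, ⟨mem_univ _, hK s has hsb p h2⟩, l, hl, h1, h2⟩
  have hrun : J.IsRun (rings h (silence (univ ×ˢ K) ω)) z a l b ↔ J.IsRun (rings h ω) z a l b :=
    ⟨IsRun.congr hring, IsRun.congr fun c s h1 h2 => (hring c s h1 h2).symm⟩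
  have hobs : ∀ l, J.IsRun (rings h (silence (univ ×ˢ K) ω)) z a l b →
      (J.withMemory m).path obs (z, []) l b = l.map Prod.fst := by
    intro l hl
    rw [path, ((J.isRun_withMemory m (z := (z, []))).2 hl).stateAt_end, final_withMemory]
    simp only [obs, hfold, List.nil_append]
  constructor
  · rintro ⟨h1, h2⟩
    refine ⟨hrun.1 h1, ?_⟩
    rw [← hobs l h1]
    exact h2
  · rintro ⟨h1, h2⟩
    refine ⟨hrun.2 h1, ?_⟩
    rw [mem_ofPred_eq, hobs l (hrun.2 h1)]
    exact h2

theorem slab_before {j p : ℕ} (hh : 0 < h) {s : ℝ} (hs : s ≤ j * h) (hp : s ∈ slab h p) : p < j := by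
  have h1 : (p : ℝ) * h < j * h := hp.1.trans_le hs
  exact_mod_cast lt_of_mul_lt_mul_right h1 hh.le

theorem slab_eq {j p : ℕ} (hh : 0 < h) {s : ℝ} (hs : j * h < s) (hs' : s ≤ (j + 1) * h)
    (hp : s ∈ slab h p) : p = j := by
  have h1 : p < j + 1 := slab_before hh (j := j + 1) (by push_cast; exact hs') hp
  have h2 : (j : ℝ) * h < (p + 1) * h := hs.trans_le hp.2
  have h3 : (j : ℝ) < ((p + 1 : ℕ) : ℝ) := by
    push_cast
    exact lt_of_mul_lt_mul_right h2 hh.le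
  have h4 : j < p + 1 := by exact_mod_cast h3
  omega

theorem tsum_law_le_one [Countable C] (lam : C → ℝ≥0) {ι : Type} [Countable ι]
    {E : ι → Set (ClockSpace C)} (hE : ∀ i, MeasurableSet (E i))
    (hd : ∀ ω, Good h ω → ∀ i i', ω ∈ E i → ω ∈ E i' → i = i') :
    ∑' i, law lam h (E i) ≤ 1 := by
  rw [← measure_iUnion₀ ?_ fun i => (hE i).nullMeasurableSet]
  · exact prob_le_one
  · intro i i' hi
    refine measure_mono_null ?_ (ae_good lam (h := h))
    exact fun ω hω hg => hi (hd ω hg i i' hω.1 hω.2)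

theorem map_fst_unique {z : σ} {a b : ℝ} {ω : ClockSpace C} (hω : Good h ω) {w w' : List C}
    (hw : ω ∈ J.movesEvent h z a b {w}) (hw' : ω ∈ J.movesEvent h z a b {w'}) : w = w' := by
  obtain ⟨l, hl, rfl⟩ := hw
  obtain ⟨l', hl', rfl⟩ := hw'
  rw [hl.unique hω.1 hl']

/-- An event about the slab `j` that is unlikely for all states at its beginning is unlikely. -/
theorem law_slab_le [Countable C] (lam : C → ℝ≥0) (hh : 0 < h) (j : ℕ) {I : σ → Prop}
    (hI : ∀ z, I z → ∀ c ∈ J.en z, I (J.step c z)) {z₀ z₀' : σ} (hz : I z₀) (hz' : I z₀')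
    {ε : ENNReal} {Bad : σ → σ → Set (ClockSpace C)}
    (hBad : ∀ z z', I z → I z' → ∃ E, MeasurableSet E ∧ DependsOn (univ ×ˢ {j}) E ∧
      (∀ ω, Good h ω → ω ∈ Bad z z' → ω ∈ E) ∧ law lam h E ≤ ε) :
    law lam h {ω | ∃ l l', J.IsRun (rings h ω) z₀ 0 l (j * h) ∧
      J.IsRun (rings h ω) z₀' 0 l' (j * h) ∧ ω ∈ Bad (J.final z₀ l) (J.final z₀' l')} ≤ ε := by
  classical
  have hj : (0 : ℝ) ≤ j * h := by positivity
  have hK : ∀ s, (0 : ℝ) < s → s ≤ j * h → ∀ p, s ∈ slab h p → p ∈ Iio j :=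
    fun s _ hs p hp => slab_before hh hs hp
  choose E hE hEd hE' using fun w => J.exists_measurableSet_movesEvent hh z₀ hj {w} hK
  choose F hF hFd hF' using fun w => J.exists_measurableSet_movesEvent hh z₀' hj {w} hK
  let fin : σ → List C → σ := fun z w => w.foldl (fun z c => J.step c z) z
  -- The lists of moves are countably many and determine the states at the beginning of the slab.
  -- Lists that lead to states violating the invariant are irrelevant and get the empty event.
  have hB : ∀ q : List C × List C, ∃ D, MeasurableSet D ∧ DependsOn (univ ×ˢ {j}) D ∧
      (I (fin z₀ q.1) → I (fin z₀' q.2) → ∀ ω, Good h ω →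
        ω ∈ Bad (fin z₀ q.1) (fin z₀' q.2) → ω ∈ D) ∧ law lam h D ≤ ε := by
    intro q
    by_cases hq : I (fin z₀ q.1) ∧ I (fin z₀' q.2)
    · obtain ⟨D, h1, h2, h3, h4⟩ := hBad _ _ hq.1 hq.2
      exact ⟨D, h1, h2, fun _ _ => h3, h4⟩
    · exact ⟨∅, MeasurableSet.empty, fun _ => Iff.rfl, fun h1 h2 => absurd ⟨h1, h2⟩ hq, by simp⟩
  choose D hD hDd hD' hDε using hB
  have hsub : ∀ᵐ ω ∂law lam h, ω ∈ {ω | ∃ l l', J.IsRun (rings h ω) z₀ 0 l (j * h) ∧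
      J.IsRun (rings h ω) z₀' 0 l' (j * h) ∧ ω ∈ Bad (J.final z₀ l) (J.final z₀' l')} →
      ω ∈ ⋃ q : List C × List C, (E q.1 ∩ F q.2) ∩ D q := by
    filter_upwards [ae_good lam (h := h)] with ω hω
    rintro ⟨l, l', hl, hl', hb⟩
    refine mem_iUnion.2 ⟨(l.map Prod.fst, l'.map Prod.fst), ⟨(hE' _ ω hω).2 ⟨l, hl, rfl⟩,
      (hF' _ ω hω).2 ⟨l', hl', rfl⟩⟩, ?_⟩
    rw [final_eq_foldl, final_eq_foldl] at hb
    refine hD' _ ?_ ?_ ω hω hb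
    · have := hl.final_induction (fun z c hc h => hI z h c hc) hz
      rwa [final_eq_foldl] at this
    · have := hl'.final_induction (fun z c hc h => hI z h c hc) hz'
      rwa [final_eq_foldl] at this
  refine (measure_mono_ae hsub).trans ((measure_iUnion_le _).trans ?_)
  have hdisj : Disjoint ((univ : Set C) ×ˢ Iio j) (univ ×ˢ {j}) :=
    disjoint_left.2 fun p hp hp' => absurd hp.2 (by rw [hp'.2]; exact lt_irrefl j)
  have hone := tsum_law_le_one lam (h := h) (E := fun q : List C × List C => E q.1 ∩ F q.2)
    (fun q => (hE _).inter (hF _)) fun ω hω q q' hq hq' => Prod.ext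
      (J.map_fst_unique hω ((hE' _ ω hω).1 hq.1) ((hE' _ ω hω).1 hq'.1))
      (J.map_fst_unique hω ((hF' _ ω hω).1 hq.2) ((hF' _ ω hω).1 hq'.2))
  -- The past depends on the slabs before j and the bad event only on the slab j, so the
  -- probabilities multiply; the events of the past are almost surely disjoint, and their
  -- probabilities sum to at most one.
  calc ∑' q : List C × List C, law lam h ((E q.1 ∩ F q.2) ∩ D q)
      ≤ ∑' q : List C × List C, law lam h (E q.1 ∩ F q.2) * ε := by
        refine ENNReal.tsum_le_tsum fun q => ?_
        rw [law_inter lam h hdisj ((hE _).inter (hF _)) (hD q)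
          (fun ω => and_congr (hEd _ ω) (hFd _ ω)) (hDd q)]
        gcongr
        exact hDε q
    _ = (∑' q : List C × List C, law lam h (E q.1 ∩ F q.2)) * ε := ENNReal.tsum_mul_right
    _ ≤ 1 * ε := by gcongr
    _ = ε := one_mul ε

/-- The final state of a run belongs to a finite set with probability close to one. -/
theorem exists_finset_final [Countable C] (lam : C → ℝ≥0) (hh : 0 < h) (z : σ) {b : ℝ} (hb : 0 ≤ b)
    {ε : ENNReal} (hε : ε ≠ 0) : ∃ D : Finset (List C),
      law lam h {ω | ∃ l, J.IsRun (rings h ω) z 0 l b ∧ l.map Prod.fst ∉ D} ≤ ε := by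
  choose E hE hEd hE' using fun w => J.exists_measurableSet_movesEvent hh z hb {w} (K := univ)
    fun _ _ _ _ _ => mem_univ _
  have hone := tsum_law_le_one lam (h := h) hE fun ω hω w w' hw hw' =>
    J.map_fst_unique hω ((hE' _ ω hω).1 hw) ((hE' _ ω hω).1 hw')
  have htend := ENNReal.tendsto_tsum_compl_atTop_zero (f := fun w => law lam h (E w))
    (ne_top_of_le_ne_top ENNReal.one_ne_top hone)
  obtain ⟨D, hD⟩ := (htend.eventually_le_const (pos_iff_ne_zero.2 hε)).exists
  refine ⟨D, le_trans ?_ hD⟩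
  refine (measure_mono_ae (t := ⋃ w : {w // w ∉ D}, E w) ?_).trans (measure_iUnion_le _)
  filter_upwards [ae_good lam (h := h)] with ω hω
  rintro ⟨l, hl, hlD⟩
  exact mem_iUnion.2 ⟨⟨_, hlD⟩, (hE' _ ω hω).2 ⟨l, hl, rfl⟩⟩

end JumpSystem

/-! ### Coupled evolutions in finite sets and escape along long paths -/

namespace Grammar

open CState ClockSpace

variable {S : Type} {G : Grammar S} {n R : ℕ} {α : SpinGraph S ℕ} {h : ℝ}

/-- The initial state of the evolution in a finite set. -/
noncomputable def start (α : SpinGraph S ℕ) (B : Finset ℕ) : CState S :=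
  CState.init (α.restrict (B : Set ℕ))

open scoped Classical in
/-- The state at time `s` of the evolution in `B`. -/
noncomputable def state (G : Grammar S) (h : ℝ) (α : SpinGraph S ℕ) (B : Finset ℕ)
    (ω : ClockSpace G.Move) (s : ℝ) : CState S :=
  if hex : ∃ l, G.canonical.IsRun (rings h ω) (start α B) 0 l s then
    G.canonical.final (start α B) hex.choose else start α B

/-- No two clocks ring at the same time, and the evolutions in finite sets exist at all times. -/
structure Regular (G : Grammar S) (h : ℝ) (α : SpinGraph S ℕ) (ω : ClockSpace G.Move) : Prop where
  good : Good h ω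
  run : ∀ B : Finset ℕ, ∀ b, 0 ≤ b → ∃ l, G.canonical.IsRun (rings h ω) (start α B) 0 l b

theorem inv_start (hα : α.DegreeLE n) (B : Finset ℕ) : Inv n (start α B) :=
  inv_init hα B.finite_toSet

theorem ae_regular (hn : G.Preserves n) (hlocal : G.IsLocal) (hrange : G.RangeLE R)
    (hα : α.DegreeLE n) (hh : 0 < h) : ∀ᵐ ω ∂law G.moveRate h, G.Regular h α ω := by
  have h1 : ∀ᵐ ω ∂law G.moveRate h, ∀ (B : Finset ℕ) (b : ℕ), ∃ l,
      G.canonical.IsRun (rings h ω) (start α B) 0 l b :=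
    ae_all_iff.2 fun B => ae_all_iff.2 fun b =>
      ae_exists_run hn hlocal hrange hh (inv_start hα B) le_rfl (Nat.cast_nonneg b)
  filter_upwards [h1, ae_good G.moveRate (h := h)] with ω h1 h2
  refine ⟨h2, fun B b hb => ?_⟩
  obtain ⟨N, hN⟩ := exists_nat_ge b
  obtain ⟨l, hl⟩ := h1 B N
  obtain ⟨l₁, l₂, -, h3, -⟩ := hl.split hb hN
  exact ⟨l₁, h3⟩

variable {ω : ClockSpace G.Move} {B : Finset ℕ}

theorem state_eq (hω : Good h ω) {l : List (G.Move × ℝ)} {b s : ℝ}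
    (hl : G.canonical.IsRun (rings h ω) (start α B) 0 l b) (hs : 0 ≤ s) (hsb : s ≤ b) :
    G.state h α B ω s = G.canonical.stateAt (start α B) l s := by
  obtain ⟨l', hl', he⟩ := hl.exists_stateAt hs hsb
  have hex : ∃ l, G.canonical.IsRun (rings h ω) (start α B) 0 l s := ⟨l', hl'⟩
  rw [he]
  refine (dif_pos hex).trans ?_
  rw [hex.choose_spec.unique hω.1 hl']

theorem inv_state (hn : G.Preserves n) (hα : α.DegreeLE n) (B : Finset ℕ) (ω : ClockSpace G.Move)
    (s : ℝ) : Inv n (G.state h α B ω s) := by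
  unfold state
  split_ifs with hex
  · exact inv_final hn hex.choose_spec (inv_start hα B)
  · exact inv_start hα B

/-- Created vertices inherit the root of a vertex of the move, so no new roots appear. -/
theorem verts_final_subset {A : Set ℕ} {T : G.Move → Set ℝ} {z : CState S} {a b : ℝ}
    {l : List (G.Move × ℝ)} (hl : G.canonical.IsRun T z a l b)
    (hz : z.graph.verts ⊆ labelsOver A) : (G.canonical.final z l).graph.verts ⊆ labelsOver A := by
  refine hl.final_induction (P := fun z => z.graph.verts ⊆ labelsOver A) (fun z c hc hz => ?_) hz
  have hc := canMove_of_mem_en hc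
  refine (step_verts_subset hc).trans (union_subset hz ?_)
  rintro _ ⟨y, rfl⟩
  exact (show (c.2 0).1 ∈ A from hz (hc.range_subset ⟨0, rfl⟩))

theorem verts_state_subset (B : Finset ℕ) (ω : ClockSpace G.Move) (s : ℝ) :
    (G.state h α B ω s).graph.verts ⊆ labelsOver (B : Set ℕ) := by
  have h0 : (start α B).graph.verts ⊆ labelsOver (B : Set ℕ) := fun l hl =>
    (SpinGraph.mem_verts_restrict.1 (mem_verts_embed.1 hl).2).2
  unfold state
  split_ifs with hex
  · exact verts_final_subset hex.choose_spec h0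
  · exact h0

theorem Regular.exists_slab (hω : G.Regular h α ω) (B : Finset ℕ) {a b : ℝ} (ha : 0 ≤ a)
    (hab : a ≤ b) : ∃ l l', G.canonical.IsRun (rings h ω) (start α B) 0 l a ∧
      G.state h α B ω a = G.canonical.final (start α B) l ∧
      G.canonical.IsRun (rings h ω) (G.canonical.final (start α B) l) a l' b ∧
      ∀ s, a ≤ s → s ≤ b → G.state h α B ω s =
        G.canonical.stateAt (G.canonical.final (start α B) l) l' s := by
  obtain ⟨l, hl⟩ := hω.run B b (ha.trans hab)
  obtain ⟨l₁, l₂, rfl, h1, h2⟩ := hl.split ha hab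
  have hs : ∀ s, a ≤ s → s ≤ b → G.state h α B ω s =
      G.canonical.stateAt (G.canonical.final (start α B) l₁) l₂ s := fun s has hsb => by
    rw [state_eq hω.good hl (ha.trans has) hsb,
      JumpSystem.stateAt_append_of_le fun e he => (h1.time_mem e he).2.trans has]
  refine ⟨l₁, l₂, h1, ?_, h2, hs⟩
  rw [hs a le_rfl hab, h2.stateAt_start]

/-- The event that the vertices touched in the `j`-th time slab by one of two evolutions contain a
long path starting in `F₀`. -/
def escapeEvent (G : Grammar S) (h : ℝ) (j k : ℕ) (F₀ : Finset Label) (z z' : CState S) :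
    Set (ClockSpace G.Move) :=
  {ω | ∃ l l', G.canonical.IsRun (rings h ω) z (j * h) l ((j + 1) * h) ∧
    G.canonical.IsRun (rings h ω) z' (j * h) l' ((j + 1) * h) ∧
    ∃ u ∈ F₀, ∃ (w : Label) (p : z.graph.graph.Walk u w), p.IsPath ∧ k ≤ p.length ∧
      ∀ x ∈ p.support, (∃ e ∈ l, x ∈ range e.1.2) ∨ ∃ e ∈ l', x ∈ range e.1.2}

/-- In a time interval of the length of a slab it is unlikely that many given vertices are
touched. -/
def TouchBound (G : Grammar S) (n : ℕ) (h κ : ℝ) : Prop :=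
  ∀ z : CState S, Inv n z → ∀ a b, 0 ≤ a → a ≤ b → b - a ≤ h → ∀ F : Finset Label,
    law G.moveRate h {ω | ∃ l, G.canonical.IsRun (rings h ω) z a l b ∧
      ∀ u ∈ F, ∃ e ∈ l, u ∈ range e.1.2} ≤ ENNReal.ofReal (κ ^ F.card)

/-- Union bound. A path of length 2 m + 1 has 2 (m + 1) vertices, so one of the two evolutions
touches at least m + 1 of them. There are at most (n + 1) ^ (2 m + 1) candidates for the vertex set
of the path from each starting point, and 4 ^ (m + 1) subsets of it. -/
theorem exists_escape_bound {κ : ℝ} (hκ : 0 < κ) (hκ1 : κ ≤ 1) (hh : 0 < h)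
    (htouch : G.TouchBound n h κ) (j m : ℕ) (F₀ : Finset Label) {z z' : CState S} (hz : Inv n z)
    (hz' : Inv n z') : ∃ E, MeasurableSet E ∧ DependsOn (univ ×ˢ {j}) E ∧
      (∀ ω, Good h ω → ω ∈ G.escapeEvent h j (2 * m + 1) F₀ z z' → ω ∈ E) ∧
      law G.moveRate h E ≤ F₀.card * ENNReal.ofReal ((4 * (n + 1) ^ 2 * κ) ^ (m + 1)) := by
  classical
  have hab : (j : ℝ) * h ≤ (j + 1) * h := by nlinarith
  have ha : (0 : ℝ) ≤ j * h := by positivity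
  have hK : ∀ s, (j : ℝ) * h < s → s ≤ (j + 1) * h → ∀ p, p ∈ {p | s ∈ slab h p} → p ∈ ({j} : Set ℕ) :=
    fun s hs hs' p hp => JumpSystem.slab_eq hh hs hs' hp
  let P : Finset Label → Set (List G.Move) := fun F => {w | ∀ u ∈ F, ∃ c ∈ w, u ∈ range c.2}
  have hP : ∀ (F : Finset Label) (l : List (G.Move × ℝ)),
      l.map Prod.fst ∈ P F ↔ ∀ u ∈ F, ∃ e ∈ l, u ∈ range e.1.2 := fun F l => by
    simp only [P, mem_ofPred_eq, List.mem_map, exists_exists_and_eq_and]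
  have hbound : ∀ z : CState S, Inv n z → ∀ F : Finset Label, ∃ E, MeasurableSet E ∧
      DependsOn (univ ×ˢ {j}) E ∧ (∀ ω, Good h ω → ∀ l,
        G.canonical.IsRun (rings h ω) z (j * h) l ((j + 1) * h) →
        (∀ u ∈ F, ∃ e ∈ l, u ∈ range e.1.2) → ω ∈ E) ∧
      law G.moveRate h E ≤ ENNReal.ofReal (κ ^ F.card) := by
    intro z hz F
    obtain ⟨E, hE, hEd, hE'⟩ := G.canonical.exists_measurableSet_movesEvent hh z hab (P F) hK
    refine ⟨E, hE, hEd, fun ω hω l hl hF => (hE' ω hω).2 ⟨l, hl, (hP F l).2 hF⟩, ?_⟩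
    refine le_trans (measure_mono_ae ?_) (htouch z hz _ _ ha hab (by linarith) F)
    filter_upwards [ae_good G.moveRate (h := h)] with ω hω hE
    obtain ⟨l, hl, hlP⟩ := (hE' ω hω).1 hE
    exact ⟨l, hl, (hP F l).1 hlP⟩
  choose E hE hEd hE' hEκ using hbound z hz
  choose E₂ hE₂ hEd₂ hE₂' hEκ₂ using hbound z' hz'
  have hdeg : ∀ v, (z.graph.graph.neighborSet v).encard ≤ ((n + 1 : ℕ) : ℕ∞) := fun v =>
    (hz.1.graph_degree v).trans (by exact_mod_cast Nat.le_succ n)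
  choose Φ hΦ1 hΦ2 hΦ3 using SimpleGraph.exists_path_family hdeg (2 * m + 1)
  -- H stands for the vertices of the path touched by the first evolution. Whichever of H and its
  -- complement in F is guaranteed to be large is charged to the corresponding evolution, so that no
  -- joint estimate is needed.
  let D : Finset Label → Finset Label → Set (ClockSpace G.Move) := fun F H =>
    if m + 1 ≤ H.card then E H else E₂ (F \ H)
  have hD : ∀ F H, MeasurableSet (D F H) ∧ DependsOn (univ ×ˢ {j}) (D F H) := fun F H => by
    simp only [D]
    split_ifs
    exacts [⟨hE _, hEd _⟩, ⟨hE₂ _, hEd₂ _⟩]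
  have hDκ : ∀ u, ∀ F ∈ Φ u, ∀ H ∈ F.powerset,
      law G.moveRate h (D F H) ≤ ENNReal.ofReal (κ ^ (m + 1)) := by
    intro u F hF H hH
    simp only [D]
    split_ifs with hc
    · exact (hEκ H).trans (ENNReal.ofReal_le_ofReal (pow_le_pow_of_le_one hκ.le hκ1 hc))
    · refine (hEκ₂ _).trans (ENNReal.ofReal_le_ofReal (pow_le_pow_of_le_one hκ.le hκ1 ?_))
      rw [Finset.card_sdiff_of_subset (Finset.mem_powerset.1 hH), hΦ2 u F hF]
      omega
  refine ⟨⋃ u ∈ F₀, ⋃ F ∈ Φ u, ⋃ H ∈ F.powerset, D F H, ?_, ?_, ?_, ?_⟩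
  · exact Finset.measurableSet_biUnion _ fun u _ => Finset.measurableSet_biUnion _ fun F _ =>
      Finset.measurableSet_biUnion _ fun H _ => (hD F H).1
  · intro ω
    simp only [mem_iUnion]
    refine exists_congr fun u => exists_congr fun _ => exists_congr fun F => exists_congr fun _ =>
      exists_congr fun H => exists_congr fun _ => (hD F H).2 ω
  · rintro ω hω ⟨l, l', hl, hl', u, hu, w, p, hp, hlen, hsupp⟩
    obtain ⟨F, hF, hFp⟩ := hΦ3 u w p hp hlen
    let H : Finset Label := F.filter fun x => ∃ e ∈ l, x ∈ range e.1.2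
    refine mem_biUnion hu (mem_biUnion hF (mem_biUnion (x := H)
      (Finset.mem_powerset.2 (Finset.filter_subset _ _)) ?_))
    simp only [D]
    split_ifs with hc
    · exact hE' H ω hω l hl fun x hx => (Finset.mem_filter.1 hx).2
    · refine hE₂' _ ω hω l' hl' fun x hx => ?_
      rw [Finset.mem_sdiff, Finset.mem_filter, not_and] at hx
      exact (hsupp x (hFp x hx.1)).resolve_left (hx.2 hx.1)
  · set c := ENNReal.ofReal (κ ^ (m + 1)) with hc
    have h1 : ∀ u, ∀ F ∈ Φ u, law G.moveRate h (⋃ H ∈ F.powerset, D F H) ≤ (4 ^ (m + 1) : ℕ) * c := by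
      intro u F hF
      refine (measure_biUnion_finset_le _ _).trans ((Finset.sum_le_sum (hDκ u F hF)).trans ?_)
      rw [Finset.sum_const, Finset.card_powerset, hΦ2 u F hF, nsmul_eq_mul,
        show 2 * m + 1 + 1 = 2 * (m + 1) by ring, pow_mul, show 2 ^ 2 = 4 from rfl]
    have h2 : ∀ u, law G.moveRate h (⋃ F ∈ Φ u, ⋃ H ∈ F.powerset, D F H) ≤
        ((n + 1) ^ (2 * (m + 1)) : ℕ) * ((4 ^ (m + 1) : ℕ) * c) := by
      intro u
      refine (measure_biUnion_finset_le _ _).trans ((Finset.sum_le_sum (h1 u)).trans ?_)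
      rw [Finset.sum_const, nsmul_eq_mul]
      gcongr
      refine (hΦ1 u).trans (Nat.pow_le_pow_right (by omega) (by omega))
    refine (measure_biUnion_finset_le _ _).trans ((Finset.sum_le_sum fun u _ => h2 u).trans ?_)
    rw [Finset.sum_const, nsmul_eq_mul]
    gcongr
    rw [hc, ← ENNReal.ofReal_natCast, ← ENNReal.ofReal_natCast, ← ENNReal.ofReal_mul (by positivity),
      ← ENNReal.ofReal_mul (by positivity)]
    refine ENNReal.ofReal_le_ofReal (le_of_eq ?_)
    push_cast
    rw [mul_pow, mul_pow, ← pow_mul]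
    ring

end Grammar

/-! ### Evolutions in large finite sets agree locally -/

namespace Grammar

open CState ClockSpace

variable {S : Type} {G : Grammar S} {n R : ℕ} {α : SpinGraph S ℕ} {h : ℝ}

/-- The event that the evolutions in `B` and `B'` do not agree on `A` up to time `t`. -/
def disagreeEvent (G : Grammar S) (h : ℝ) (α : SpinGraph S ℕ) (A : Set ℕ) (B B' : Finset ℕ) (t : ℝ) :
    Set (ClockSpace G.Move) :=
  {ω | ∃ s, 0 ≤ s ∧ s ≤ t ∧ ¬ CState.Agree A (G.state h α B ω s) (G.state h α B' ω s)}

/-- Agreement includes the links to arbitrary vertices, which is why the sets must also contain the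
neighbours of A. -/
theorem agree_start {A : Set ℕ} {B B' : Finset ℕ} (hB : α.hull A 1 ⊆ B) (hB' : α.hull A 1 ⊆ B') :
    CState.Agree A (start α B) (start α B') := by
  have hspin : ∀ (B : Finset ℕ), α.hull A 1 ⊆ B → ∀ l ∈ labelsOver A,
      (start α B).graph.spin l = α.embed.spin l := fun B hB l hl => by
    change (α.restrict (B : Set ℕ)).embed.spin l = _
    rw [SpinGraph.embed_restrict]
    exact SpinGraph.restrict_spin (hB (SpinGraph.subset_hull hl))
  have hadj : ∀ (B : Finset ℕ), α.hull A 1 ⊆ B → ∀ l ∈ labelsOver A, ∀ m,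
      (start α B).graph.graph.Adj l m ↔ α.embed.graph.Adj l m := fun B hB l hl m => by
    change (α.restrict (B : Set ℕ)).embed.graph.Adj l m ↔ _
    rw [SpinGraph.embed_restrict]
    refine ⟨fun hm => hm.1, fun hm => ⟨hm, hB (SpinGraph.subset_hull hl), hB ?_⟩⟩
    refine SpinGraph.hull_adj (j := 0) hm.2.2 ?_
    rw [SpinGraph.hull_zero]
    exact hl
  exact ⟨fun l hl => (hspin B hB l hl).trans (hspin B' hB' l hl).symm,
    fun l hl m => (hadj B hB l hl m).trans (hadj B' hB' l hl m).symm,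
    fun _ _ => Iff.rfl, fun _ _ => rfl, fun _ _ => rfl⟩

/-- The constants for which the evolutions in finite sets converge. -/
structure Rates (G : Grammar S) (n : ℕ) (h κ : ℝ) : Prop where
  preserves : G.Preserves n
  isLocal : G.IsLocal
  pos : 0 < h
  pos' : 0 < κ
  le_one : κ ≤ 1
  small : 4 * (n + 1) ^ 2 * κ < 1
  touch : G.TouchBound n h κ

theorem tendsto_escape {κ : ℝ} (hG : G.Rates n h κ) (C : ENNReal) (hC : C ≠ ⊤) :
    Tendsto (fun m : ℕ => C * ENNReal.ofReal ((4 * (n + 1) ^ 2 * κ) ^ (m + 1))) atTop (𝓝 0) := by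
  have hpos := hG.pos'
  have h1 := (tendsto_pow_atTop_nhds_zero_of_lt_one (by positivity) hG.small).comp
    (tendsto_add_atTop_nat 1)
  have h2 := ENNReal.tendsto_ofReal h1
  rw [ENNReal.ofReal_zero] at h2
  have h3 := ENNReal.Tendsto.const_mul h2 (Or.inr hC)
  rwa [mul_zero] at h3

/-- The evolutions in large finite sets agree on a given finite set with high probability. -/
theorem exists_disagree_le {κ : ℝ} (hG : G.Rates n h κ) (hrange : G.RangeLE R) (hα : α.DegreeLE n)
    (j : ℕ) (A₀ : Finset ℕ) {ε : ENNReal} (hε : ε ≠ 0) :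
    ∃ A₁ : Finset ℕ, A₀ ⊆ A₁ ∧ ∀ B B' : Finset ℕ, A₁ ⊆ B → A₁ ⊆ B' →
      law G.moveRate h (G.disagreeEvent h α A₀ B B' (j * h)) ≤ ε := by
  have hreg := ae_regular hG.preserves hG.isLocal hrange hα hG.pos
  induction j generalizing A₀ ε with
  | zero =>
    have hfin : (α.hull (A₀ : Set ℕ) 1).Finite := hα.finite_hull A₀.finite_toSet 1
    refine ⟨hfin.toFinset, fun v hv => hfin.mem_toFinset.2 (SpinGraph.subset_hull hv),
      fun B B' hB hB' => ?_⟩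
    refine le_of_eq_of_le (measure_mono_null ?_ hreg) zero_le
    rintro ω ⟨s, hs0, hs, hne⟩ hω
    refine hne ?_
    obtain rfl : s = 0 := le_antisymm (by simpa using hs) hs0
    have hst : ∀ B, G.state h α B ω 0 = start α B := fun B => by
      obtain ⟨l, hl⟩ := hω.run B 0 le_rfl
      rw [state_eq hω.good hl le_rfl le_rfl, hl.stateAt_start]
    rw [hst, hst]
    exact agree_start (fun v hv => hB (hfin.mem_toFinset.2 hv))
      fun v hv => hB' (hfin.mem_toFinset.2 hv)
  | succ j ih =>
    have hj : (0 : ℝ) ≤ j * h := mul_nonneg (Nat.cast_nonneg j) hG.pos.le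
    have hjj : (j : ℝ) * h ≤ (j + 1) * h := by have := hG.pos; nlinarith
    have hε4 : ε / 4 ≠ 0 := by simp [hε]
    obtain ⟨δ, hδ0, hδ⟩ := ENNReal.exists_pos_sum_of_countable hε4 ℕ
    choose next hnext hnext' using fun (i : ℕ) (A : Finset ℕ) =>
      ih A (ε := δ i) (by exact_mod_cast (hδ0 i).ne')
    -- The chain replaces distances in the random graph at time j h: up to small probability the
    -- evolutions in any two sets containing A (i + 1) agree on A i, and the errors are summable.
    obtain ⟨A, rfl, hAsucc⟩ : ∃ A : ℕ → Finset ℕ, A 0 = A₀ ∧ ∀ i, A (i + 1) = next i (A i) :=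
      ⟨fun i => Nat.rec A₀ (fun i A => next i A) i, rfl, fun _ => rfl⟩
    have hAmono : Monotone A := monotone_nat_of_le_succ fun i => by
      rw [hAsucc]
      exact hnext i (A i)
    obtain ⟨D, hD⟩ := G.canonical.exists_finset_final G.moveRate hG.pos (start α (A 2)) hj hε4
    classical
    -- The list of moves in A 2 belongs, up to small probability, to the finite set `D`; hence the
    -- names present at time j h come from a deterministic finite set. The invariant is included
    -- because an arbitrary list need not be a run leading to a finite graph.
    have hDfin : {u : Label | ∃ w ∈ D, u ∈ (w.foldl (fun z c => G.canonical.step c z)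
        (start α (A 2))).graph.verts ∧
        Inv n (w.foldl (fun z c => G.canonical.step c z) (start α (A 2)))}.Finite := by
      refine (D.finite_toSet.biUnion (t := fun w => {u : Label | u ∈ (w.foldl
        (fun z c => G.canonical.step c z) (start α (A 2))).graph.verts ∧
        Inv n (w.foldl (fun z c => G.canonical.step c z) (start α (A 2)))}) fun w _ => ?_).subset ?_
      · by_cases hw : Inv n (w.foldl (fun z c => G.canonical.step c z) (start α (A 2)))
        · exact hw.2.subset fun u hu => hu.1
        · exact finite_empty.subset fun u hu => hw hu.2
      · rintro u ⟨w, hw, hu⟩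
        exact mem_iUnion₂.2 ⟨w, hw, hu⟩
    set F₀ := hDfin.toFinset with hF₀
    -- The length of the path is chosen only now: it depends on the number of possible starting
    -- points, which involves A 2 but no later set of the chain.
    obtain ⟨m, hm⟩ := ((tendsto_escape hG F₀.card (ENNReal.natCast_ne_top _)).eventually_le_const
      (pos_iff_ne_zero.2 hε4)).exists
    set k := 2 * m + 1 with hk
    obtain ⟨A', hA', hA''⟩ := ih (A (k + 1)) hε4
    refine ⟨A' ∪ A (k + 2), fun v hv => Finset.mem_union_right _
        ((hAmono (Nat.zero_le (k + 2)) : A 0 ⊆ A (k + 2)) hv), fun B B' hB hB' => ?_⟩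
    have hAB : ∀ i < k + 1, A (i + 1) ⊆ B := fun i hi v hv =>
      hB (Finset.mem_union_right _
        ((hAmono (show i + 1 ≤ k + 2 by omega) : A (i + 1) ⊆ A (k + 2)) hv))
    let E₁ := G.disagreeEvent h α (A (k + 1)) B B' (j * h)
    let D₂ : ℕ → Set (ClockSpace G.Move) := fun i =>
      G.disagreeEvent h α (A i : Set ℕ) B (A (i + 1)) (j * h)
    let E₂ : Set (ClockSpace G.Move) := ⋃ i : ℕ, if i < k + 1 then D₂ i else ∅
    let E₃ := {ω : ClockSpace G.Move | ∃ l, G.canonical.IsRun (rings h ω) (start α (A 2)) 0 l (j * h) ∧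
      l.map Prod.fst ∉ D}
    let E₄ := {ω : ClockSpace G.Move | ∃ l l',
      G.canonical.IsRun (rings h ω) (start α B) 0 l (j * h) ∧
      G.canonical.IsRun (rings h ω) (start α B') 0 l' (j * h) ∧
      ω ∈ G.escapeEvent h j k F₀ (G.canonical.final (start α B) l)
        (G.canonical.final (start α B') l')}
    have h1 : law G.moveRate h E₁ ≤ ε / 4 := hA'' B B' (Finset.union_subset_left hB)
      (Finset.union_subset_left hB')
    have h2 : law G.moveRate h E₂ ≤ ε / 4 := by
      refine (measure_iUnion_le _).trans (le_trans (ENNReal.tsum_le_tsum fun i => ?_) hδ.le)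
      split_ifs with hi
      · exact hnext' i (A i) B (A (i + 1)) (hAsucc i ▸ hAB i hi) (hAsucc i ▸ Subset.rfl)
      · simp
    have h4 : law G.moveRate h E₄ ≤ ε / 4 := by
      refine G.canonical.law_slab_le G.moveRate hG.pos j (I := Inv n)
        (fun _ hz _ hc => hz.step hG.preserves hc) (inv_start hα B) (inv_start hα B')
        (Bad := fun z z' => G.escapeEvent h j k F₀ z z') fun z z' hz hz' => ?_
      obtain ⟨E, hE1, hE2, hE3, hE4⟩ :=
        exists_escape_bound hG.pos' hG.le_one hG.pos hG.touch j m F₀ hz hz'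
      exact ⟨E, hE1, hE2, hE3, hE4.trans hm⟩
    have hsub : ∀ᵐ ω ∂law G.moveRate h, ω ∈ G.disagreeEvent h α (A 0) B B' ((j + 1 : ℕ) * h) →
        ω ∈ (E₁ ∪ E₂) ∪ (E₃ ∪ E₄) := by
      filter_upwards [hreg] with ω hω hdis
      by_contra hcon
      simp only [mem_union, not_or] at hcon
      obtain ⟨⟨hc1, hc2⟩, hc3, hc4⟩ := hcon
      have hag1 : ∀ s, 0 ≤ s → s ≤ j * h →
          CState.Agree (A (k + 1)) (G.state h α B ω s) (G.state h α B' ω s) := by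
        intro s hs0 hs
        by_contra hne
        exact hc1 ⟨s, hs0, hs, hne⟩
      have hag2 : ∀ i < k + 1,
          CState.Agree (A i) (G.state h α B ω (j * h)) (G.state h α (A (i + 1)) ω (j * h)) := by
        intro i hi
        by_contra hne
        refine hc2 (mem_iUnion.2 ⟨i, ?_⟩)
        rw [if_pos hi]
        exact ⟨_, hj, le_rfl, hne⟩
      obtain ⟨s, hs0, hs, hne⟩ := hdis
      rcases le_total s (j * h) with hsj | hsj
      · exact hne ((hag1 s hs0 hsj).mono (by exact_mod_cast hAmono (Nat.zero_le _)))
      · push_cast at hs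
        obtain ⟨l, l', hl, hfin, hl', hst⟩ := hω.exists_slab B hj hjj
        obtain ⟨m₁, m', hm₁, hmfin, hm', hmst⟩ := hω.exists_slab B' hj hjj
        have hagj := hag1 _ hj le_rfl
        rw [hst s hsj hs, hmst s hsj hs] at hne
        rw [hfin, hmfin] at hagj
        rw [hfin] at hag2
        refine hne (agree_stateAt hG.preserves hG.isLocal hω.good.1
          (inv_final hG.preserves hl (inv_start hα B))
          (inv_final hG.preserves hm₁ (inv_start hα B')) (A := fun i => (A i : Set ℕ))
          (fun i i' hi => by exact_mod_cast hAmono hi) hagj ?_ hl' hm' ?_ s)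
        -- The evolution in B agrees on A i with the one in A (i + 1), all of whose vertices lie
        -- over A (i + 1). A link starting over A i therefore ends over A (i + 1).
        · intro i hi u v huv hu
          exact verts_state_subset (A (i + 1)) ω (j * h)
            (SpinGraph.mem_verts_of_adj (((hag2 i hi).adj u hu v).1 huv)).2
        -- The starting point of the path lies over A 1, where the evolution in B agrees with the
        -- one in A 2, so it belongs to the finite set `F₀` and the escape event occurs.
        · intro u w p hu hp hlen hsupp
          refine hc4 ⟨l, m₁, hl, hm₁, l', m', hl', hm', u, ?_, w, p, hp, hlen, hsupp⟩
          obtain ⟨q, hq⟩ := hω.run (A 2) _ hj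
          have hq' : q.map Prod.fst ∈ D := by
            by_contra hqD
            exact hc3 ⟨q, hq, hqD⟩
          have hstq : G.state h α (A 2) ω (j * h) = G.canonical.final (start α (A 2)) q := by
            rw [state_eq hω.good hq hj le_rfl, hq.stateAt_end]
          rw [hF₀, hDfin.mem_toFinset]
          refine ⟨_, hq', ?_⟩
          rw [← JumpSystem.final_eq_foldl]
          refine ⟨?_, inv_final hG.preserves hq (inv_start hα _)⟩
          rw [← hstq]
          have hu1 : u ∈ (G.canonical.final (start α B) l).graph.verts := by
            cases p with
            | nil => simp [hk] at hlen
            | cons hadj _ => exact (SpinGraph.mem_verts_of_adj hadj).1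
          change (G.state h α (A 2) ω (j * h)).graph.spin u ≠ none
          rw [← (hag2 1 (by omega)).spin u hu]
          exact hu1
    refine (measure_mono_ae hsub).trans ?_
    calc _ ≤ (law G.moveRate h E₁ + law G.moveRate h E₂) +
          (law G.moveRate h E₃ + law G.moveRate h E₄) :=
        (measure_union_le _ _).trans (add_le_add (measure_union_le _ _) (measure_union_le _ _))
      _ ≤ (ε / 4 + ε / 4) + (ε / 4 + ε / 4) := by gcongr
      _ = ε := by
        have : ε / 4 + ε / 4 = ε / 2 := by
          rw [← ENNReal.add_div, ENNReal.div_eq_div_iff (by norm_num) (by norm_num) (by norm_num)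
            (by norm_num)]
          ring
        rw [this, ENNReal.add_halves]

end Grammar

/-! ### Local limits of states and almost sure stabilization -/

namespace Marked

variable {S : Type} {l : Label} {x y w : Marked S}

theorem SameAt.refl (l : Label) (x : Marked S) : SameAt l x x := ⟨rfl, rfl, Iff.rfl⟩

theorem SameAt.symm (h : SameAt l x y) : SameAt l y x := ⟨h.1.symm, h.2.1.symm, h.2.2.symm⟩

theorem SameAt.trans (h : SameAt l x y) (h' : SameAt l y w) : SameAt l x w :=
  ⟨h.1.trans h'.1, h.2.1.trans h'.2.1, h.2.2.trans h'.2.2⟩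

theorem SameAt.adj (h : SameAt l x y) (m : Label) :
    x.graph.graph.Adj l m ↔ y.graph.graph.Adj l m := by
  change m ∈ x.graph.graph.neighborSet l ↔ m ∈ y.graph.graph.neighborSet l
  rw [h.2.1]

theorem eq_of_sameAt (h : ∀ l, SameAt l x y) : x = y :=
  Marked.ext (SpinGraph.ext_of (fun l => (h l).1) fun l m => (h l).adj m)
    (Set.ext fun l => (h l).2.2)

open scoped Classical in
/-- The limit of a sequence of states. -/
noncomputable def limit (x : ℕ → Marked S) : Marked S where
  graph :=
    let spin : Label → Option S := fun l =>
      if h : ∃ a, ∀ᶠ k in atTop, (x k).graph.spin l = a then h.choose else none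
    { spin := spin
      graph :=
        { Adj := fun l m => (∀ᶠ k in atTop, (x k).graph.graph.Adj l m) ∧ spin l ≠ none ∧ spin m ≠ none
          symm := ⟨fun _ _ h => ⟨h.1.mono fun _ h => h.symm, h.2.2, h.2.1⟩⟩
          loopless := ⟨fun _ h => (h.1.exists.choose_spec).ne rfl⟩ }
      spin_ne_none := fun _ _ h => h.2.1 }
  touched := {l | ∀ᶠ k in atTop, l ∈ (x k).touched}

theorem limit_spin {x : ℕ → Marked S} {K : ℕ} (h : ∀ k ≥ K, SameAt l (x k) (x K)) :
    (limit x).graph.spin l = (x K).graph.spin l := by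
  have h1 : ∀ᶠ k in atTop, (x k).graph.spin l = (x K).graph.spin l :=
    eventually_atTop.2 ⟨K, fun k hk => (h k hk).1⟩
  have hex : ∃ a, ∀ᶠ k in atTop, (x k).graph.spin l = a := ⟨_, h1⟩
  refine (dif_pos hex).trans ?_
  obtain ⟨k, h2, h3⟩ := (hex.choose_spec.and h1).exists
  rw [← h2, h3]

/-- Stabilization is required at all names, not only at l, because a link of the limit requires the
spins at both of its end points to have nonempty limits. -/
theorem sameAt_limit {x : ℕ → Marked S} (hx : ∀ l, ∃ K, ∀ k ≥ K, SameAt l (x k) (x K)) {K : ℕ}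
    (h : ∀ k ≥ K, SameAt l (x k) (x K)) : SameAt l (limit x) (x K) := by
  refine ⟨limit_spin h, ?_, ?_⟩
  · ext m
    constructor
    · rintro ⟨h1, -⟩
      obtain ⟨k, hk, hkK⟩ := (h1.and (eventually_ge_atTop K)).exists
      exact ((h k hkK).adj m).1 hk
    · intro hm
      have hm' : ∀ k ≥ K, (x k).graph.graph.Adj l m := fun k hk => ((h k hk).adj m).2 hm
      refine ⟨eventually_atTop.2 ⟨K, hm'⟩, ?_, ?_⟩
      · refine fun h0 => (x K).graph.spin_ne_none l m hm ?_
        rw [← limit_spin h]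
        exact h0
      · obtain ⟨K', hK'⟩ := hx m
        refine fun h0 => (x (max K K')).graph.spin_ne_none m l (hm' _ (le_max_left _ _)).symm ?_
        rw [(hK' _ (le_max_right K K')).1, ← limit_spin hK']
        exact h0
  · constructor
    · intro h1
      obtain ⟨k, hk, hkK⟩ := (Eventually.and h1 (eventually_ge_atTop K)).exists
      exact (h k hkK).2.2.1 hk
    · exact fun h1 => eventually_atTop.2 ⟨K, fun k hk => (h k hk).2.2.2 h1⟩

end Marked

namespace CState

variable {S : Type} {A B : Set ℕ} {n : ℕ} {z z' z'' : CState S}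

/-- The actual names and the actual states agree over `A`. -/
def ImgAgree (A : Set ℕ) (z z' : CState S) : Prop :=
  ∀ l ∈ labelsOver A, z.lab l = z'.lab l ∧ Marked.SameAt l z.img z'.img

theorem ImgAgree.symm (h : ImgAgree A z z') : ImgAgree A z' z :=
  fun l hl => ⟨(h l hl).1.symm, (h l hl).2.symm⟩

theorem ImgAgree.trans (h : ImgAgree A z z') (h' : ImgAgree A z' z'') : ImgAgree A z z'' :=
  fun l hl => ⟨(h l hl).1.trans (h' l hl).1, (h l hl).2.trans (h' l hl).2⟩

theorem ImgAgree.mono (hAB : A ⊆ B) (h : ImgAgree B z z') : ImgAgree A z z' :=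
  fun l hl => h l (hAB hl)

theorem Good.mem_labelsOver (h : z.Good n) {l m : Label} (hl : z.lab l = m) (hm : m ∈ labelsOver A) :
    l ∈ labelsOver A := by
  change l.1 ∈ A
  rw [← h.root l, hl]
  exact hm

/-- The actual names of the neighbours enter the comparison, so the renamings have to agree at the
other ends of the links as well; hence the hypothesis that links starting over A end over B. -/
theorem Agree.imgAgree (h : Agree B z z') (hAB : A ⊆ B) (hz : z.Good n) (hz' : z'.Good n)
    (hadj : ∀ u ∈ labelsOver A, ∀ v, z.graph.graph.Adj u v → v ∈ labelsOver B) :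
    ImgAgree A z z' := by
  intro m hm
  refine ⟨h.lab m (hAB hm), ?_, ?_, ?_⟩
  · by_cases hex : ∃ l ∈ z.graph.verts, z.lab l = m
    · obtain ⟨l, hl, rfl⟩ := hex
      have hlA : l ∈ labelsOver B := hAB (hz.mem_labelsOver rfl hm)
      have h1 : z.img.graph.spin (z.lab l) = z.graph.spin l :=
        SpinGraph.map_spin hz.inj Subset.rfl hl
      have hl' : l ∈ z'.graph.verts := by
        change z'.graph.spin l ≠ none
        rw [← h.spin l hlA]
        exact hl
      have h2 : z'.img.graph.spin (z'.lab l) = z'.graph.spin l :=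
        SpinGraph.map_spin hz'.inj Subset.rfl hl'
      rw [h1, h.lab l hlA, h2, h.spin l hlA]
    · have h1 : z.img.graph.spin m = none :=
        SpinGraph.map_spin_eq_none fun l hl hlm => hex ⟨l, hl, hlm⟩
      have h2 : z'.img.graph.spin m = none := by
        refine SpinGraph.map_spin_eq_none fun l hl hlm => ?_
        have hlA : l ∈ labelsOver B := hAB (hz'.mem_labelsOver hlm hm)
        refine hex ⟨l, ?_, (h.lab l hlA).trans hlm⟩
        change z.graph.spin l ≠ none
        rw [h.spin l hlA]
        exact hl
      rw [h1, h2]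
  · ext m'
    refine (SpinGraph.map_adj hz.inj).trans (Iff.trans ?_ (SpinGraph.map_adj hz'.inj).symm)
    constructor
    · rintro ⟨l, l', hll, rfl, rfl⟩
      have hl := hz.mem_labelsOver rfl hm
      exact ⟨l, l', (h.adj l (hAB hl) l').1 hll, (h.lab l (hAB hl)).symm,
        (h.lab l' (hadj l hl l' hll)).symm⟩
    · rintro ⟨l, l', hll, rfl, rfl⟩
      have hl := hz'.mem_labelsOver rfl hm
      have hll' := (h.adj l (hAB hl) l').2 hll
      exact ⟨l, l', hll', h.lab l (hAB hl), h.lab l' (hadj l hl l' hll')⟩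
  · constructor
    · rintro ⟨l, hl, rfl⟩
      have hl' := hAB (hz.mem_labelsOver rfl hm)
      exact ⟨l, (h.touched l hl').1 hl, (h.lab l hl').symm⟩
    · rintro ⟨l, hl, rfl⟩
      have hl' := hAB (hz'.mem_labelsOver rfl hm)
      exact ⟨l, (h.touched l hl').2 hl, h.lab l hl'⟩

end CState

namespace Grammar

open CState ClockSpace

variable {S : Type} {G : Grammar S} {n R : ℕ} {α : SpinGraph S ℕ} {h κ : ℝ}

/-- The event that the actual states in `B` and `B'` do not agree on `A` up to time `t`. -/
def imgDisagree (G : Grammar S) (h : ℝ) (α : SpinGraph S ℕ) (A : Set ℕ) (B B' : Finset ℕ) (t : ℝ) :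
    Set (ClockSpace G.Move) :=
  {ω | ∃ s, 0 ≤ s ∧ s ≤ t ∧ ¬ ImgAgree A (G.state h α B ω s) (G.state h α B' ω s)}

/-- An intermediate set `A₁` confines the links: where the evolution in B agrees with the one in
`A₁`, links starting over A₀ end over `A₁`, and there the evolutions in B and B' agree. -/
theorem exists_imgDisagree_le (hG : G.Rates n h κ) (hrange : G.RangeLE R) (hα : α.DegreeLE n)
    (j : ℕ) (A₀ : Finset ℕ) {ε : ENNReal} (hε : ε ≠ 0) : ∃ A₁ : Finset ℕ,
      ∀ B B' : Finset ℕ, A₁ ⊆ B → A₁ ⊆ B' →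
        law G.moveRate h (G.imgDisagree h α A₀ B B' (j * h)) ≤ ε := by
  have hε2 : ε / 2 ≠ 0 := by simp [hε]
  obtain ⟨A₁, h01, h1⟩ := exists_disagree_le hG hrange hα j A₀ hε2
  obtain ⟨A₂, h12, h2⟩ := exists_disagree_le hG hrange hα j A₁ hε2
  refine ⟨A₂, fun B B' hB hB' => ?_⟩
  have hsub : G.imgDisagree h α A₀ B B' (j * h) ⊆
      G.disagreeEvent h α A₀ B A₁ (j * h) ∪ G.disagreeEvent h α A₁ B B' (j * h) := by
    rintro ω ⟨s, hs0, hs, hne⟩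
    by_contra hcon
    simp only [mem_union, disagreeEvent, mem_ofPred_eq, not_or, not_exists, not_and, not_not] at hcon
    refine hne ((hcon.2 s hs0 hs).imgAgree (by exact_mod_cast h01)
      (inv_state hG.preserves hα B ω s).1 (inv_state hG.preserves hα B' ω s).1 fun u hu v huv => ?_)
    exact verts_state_subset A₁ ω s
      (SpinGraph.mem_verts_of_adj (((hcon.1 s hs0 hs).adj u hu v).1 huv)).2
  refine (measure_mono hsub).trans ((measure_union_le _ _).trans ?_)
  calc _ ≤ ε / 2 + ε / 2 := add_le_add (h1 B A₁ (h12.trans hB) Subset.rfl) (h2 B B' hB hB')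
    _ = ε := ENNReal.add_halves ε

/-- The evolutions in the sets `B k` stabilize. -/
def Stable (G : Grammar S) (h : ℝ) (α : SpinGraph S ℕ) (B : ℕ → Finset ℕ) (ω : ClockSpace G.Move) :
    Prop :=
  ∀ (A : Finset ℕ) (t : ℝ), ∃ K, ∀ k ≥ K, ∀ s, 0 ≤ s → s ≤ t →
    ImgAgree A (G.state h α (B k) ω s) (G.state h α (B K) ω s)

/-- Borel-Cantelli: the set B k is so large that the evolutions in B k and B (k + 1) disagree on the
first k vertices up to time k h with probability at most 2⁻ᵏ. -/
theorem exists_stable (hG : G.Rates n h κ) (hrange : G.RangeLE R) (hα : α.DegreeLE n) :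
    ∃ B : ℕ → Finset ℕ, (∀ v, ∀ᶠ k in atTop, v ∈ B k) ∧
      ∀ᵐ ω ∂law G.moveRate h, G.Stable h α B ω := by
  have hpow : ∀ k : ℕ, ((2 : ENNReal)⁻¹) ^ k ≠ 0 := fun k => by simp
  choose N hN using fun k : ℕ => exists_imgDisagree_le hG hrange hα k (Finset.range k) (hpow k)
  let B : ℕ → Finset ℕ := fun k => (Finset.range (k + 1)).biUnion N ∪ Finset.range k
  have hNB : ∀ k i, k ≤ i → N k ⊆ B i := fun k i hi v hv => Finset.mem_union_left _
    (Finset.mem_biUnion.2 ⟨k, Finset.mem_range.2 (by omega), hv⟩)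
  refine ⟨B, fun v => ?_, ?_⟩
  · filter_upwards [eventually_gt_atTop v] with k hk
    exact Finset.mem_union_right _ (Finset.mem_range.2 hk)
  have hsum : ∑' k : ℕ, law G.moveRate h (G.imgDisagree h α (Finset.range k) (B k) (B (k + 1))
      (k * h)) ≠ ⊤ := by
    refine ne_top_of_le_ne_top ?_ (ENNReal.tsum_le_tsum fun k =>
      hN k (B k) (B (k + 1)) (hNB k k le_rfl) (hNB k (k + 1) (by omega)))
    rw [ENNReal.tsum_geometric]
    simp
  filter_upwards [ae_eventually_notMem hsum] with ω hω A t
  obtain ⟨K₁, hK₁⟩ := eventually_atTop.1 hω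
  obtain ⟨K₂, hK₂⟩ := A.exists_nat_subset_range
  obtain ⟨K₃, hK₃⟩ := exists_nat_ge (t / h)
  rw [div_le_iff₀ hG.pos] at hK₃
  refine ⟨max K₁ (max K₂ K₃), fun k hk => ?_⟩
  induction k, hk using Nat.le_induction with
  | base => exact fun s _ _ l _ => ⟨rfl, Marked.SameAt.refl _ _⟩
  | succ k hk ih =>
    intro s hs0 hs
    refine ImgAgree.trans ?_ (ih s hs0 hs)
    have h1 := hK₁ k ((le_max_left _ _).trans hk)
    have h2 : K₂ ≤ k := (le_max_left _ _).trans ((le_max_right _ _).trans hk)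
    have h3 : K₃ ≤ k := (le_max_right _ _).trans ((le_max_right _ _).trans hk)
    have h3' : (K₃ : ℝ) ≤ k := by exact_mod_cast h3
    simp only [imgDisagree, mem_ofPred_eq, not_exists, not_and, not_not] at h1
    refine (ImgAgree.mono ?_ (h1 s hs0 (hs.trans (hK₃.trans ?_)))).symm
    · intro v hv
      exact Finset.mem_coe.2 (Finset.range_mono h2 (hK₂ hv))
    · exact mul_le_mul_of_nonneg_right h3' hG.pos.le

/-- The limit of the evolutions in the sets `B k`. -/
noncomputable def limitState (G : Grammar S) (h : ℝ) (α : SpinGraph S ℕ) (B : ℕ → Finset ℕ) (s : ℝ)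
    (ω : ClockSpace G.Move) : Marked S :=
  Marked.limit fun k => (G.state h α (B k) ω s).img

theorem Stable.sameAt {B : ℕ → Finset ℕ} {ω : ClockSpace G.Move} (hω : G.Stable h α B ω)
    (A : Finset ℕ) (t : ℝ) : ∃ K, ∀ k ≥ K, ∀ s, 0 ≤ s → s ≤ t → ∀ l ∈ labelsOver (A : Set ℕ),
      Marked.SameAt l (G.limitState h α B s ω) (G.state h α (B k) ω s).img := by
  obtain ⟨K, hK⟩ := hω A t
  refine ⟨K, fun k hk s hs0 hs l hl => ?_⟩
  refine Marked.SameAt.trans ?_ ((hK k hk s hs0 hs l hl).2.symm)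
  refine Marked.sameAt_limit (x := fun k => (G.state h α (B k) ω s).img) (fun m => ?_)
    fun k hk => (hK k hk s hs0 hs l hl).2
  obtain ⟨K', hK'⟩ := hω {m.1} s
  exact ⟨K', fun k hk => (hK' k hk s hs0 le_rfl m
    (by simp [labelsOver])).2⟩

/-- The limit is close to the evolutions in large finite sets. -/
theorem exists_limit_le (hG : G.Rates n h κ) (hrange : G.RangeLE R) (hα : α.DegreeLE n)
    {B : ℕ → Finset ℕ} (hB : ∀ v, ∀ᶠ k in atTop, v ∈ B k)
    (hst : ∀ᵐ ω ∂law G.moveRate h, G.Stable h α B ω) (t : ℝ) (A₀ : Finset ℕ) {ε : ENNReal}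
    (hε : ε ≠ 0) : ∃ A₁ : Finset ℕ, ∀ C : Finset ℕ, A₁ ⊆ C → law G.moveRate h
      {ω | ∃ s, 0 ≤ s ∧ s ≤ t ∧ ∃ l ∈ labelsOver (A₀ : Set ℕ),
        ¬ Marked.SameAt l (G.limitState h α B s ω) (G.state h α C ω s).img} ≤ ε := by
  obtain ⟨j, hj⟩ := exists_nat_ge (t / h)
  rw [div_le_iff₀ hG.pos] at hj
  obtain ⟨A₁, hA₁⟩ := exists_imgDisagree_le hG hrange hα j A₀ hε
  refine ⟨A₁, fun C hC => ?_⟩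
  have hev : ∀ᶠ k in atTop, A₁ ⊆ B k := (eventually_all_finset A₁).2 fun v _ => hB v
  obtain ⟨K₀, hK₀⟩ := eventually_atTop.1 hev
  -- If the limit differs from the evolution in C, then so do all B k with large k. These events
  -- increase, so continuity from below allows a bound for a single large k to be used.
  let E : ℕ → Set (ClockSpace G.Move) := fun K => ⋂ k ≥ K, G.imgDisagree h α A₀ (B k) C (j * h)
  have hE : Monotone E := fun K K' hK => biInter_mono (fun k hk => le_trans hK hk) fun _ _ => Subset.rfl
  refine (measure_mono_ae (t := ⋃ K, E K) ?_).trans ?_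
  · filter_upwards [hst] with ω hω
    rintro ⟨s, hs0, hs, l, hl, hne⟩
    obtain ⟨K, hK⟩ := hω.sameAt A₀ t
    refine mem_iUnion.2 ⟨K, mem_iInter₂.2 fun k hk => ⟨s, hs0, hs.trans hj, fun hag => ?_⟩⟩
    exact hne ((hK k hk s hs0 hs l hl).trans (hag l hl).2)
  · rw [hE.measure_iUnion]
    refine iSup_le fun K => (measure_mono (t := G.imgDisagree h α A₀ (B (max K K₀)) C (j * h)) ?_).trans
      (hA₁ _ _ (hK₀ _ (le_max_right _ _)) hC)
    exact iInter₂_subset _ (le_max_left K K₀)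

end Grammar

/-! ### The limit process and its dynamics -/

namespace Grammar

open CState ClockSpace Marked

variable {S : Type} {G : Grammar S} {n R : ℕ} {α : SpinGraph S ℕ} {h κ : ℝ}

/-- A substitution inside of A, including its choice of new names, depends only on the state over A;
moved links arise from links with an end point over A. -/
theorem sameAt_step {x y : Marked S} {c : G.Move} {A : Set ℕ}
    (hxy : ∀ l ∈ labelsOver A, SameAt l x y) (hc : range c.2 ⊆ labelsOver A) :
    ∀ l ∈ labelsOver A, SameAt l (G.step c x) (G.step c y) := by
  classical
  have hff : x.graph.firstFree (c.2 0) = y.graph.firstFree (c.2 0) :=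
    CState.firstFree_congr fun k => (hxy ((c.2 0).child k)
      (show (c.2 0).1 ∈ A from hc ⟨0, rfl⟩)).1
  have hadj : ∀ {x y : Marked S}, (∀ l ∈ labelsOver A, SameAt l x y) →
      x.graph.firstFree (c.2 0) = y.graph.firstFree (c.2 0) → ∀ l ∈ labelsOver A, ∀ m,
      (G.step c x).graph.graph.Adj l m → (G.step c y).graph.graph.Adj l m := by
    intro x y hxy hff l hl m hm
    change ((G.rule c.1).apply y.graph c.2).graph.Adj l m
    replace hm : ((G.rule c.1).apply x.graph c.2).graph.Adj l m := hm
    rw [Rule.apply_eq_applyAt, Rule.applyAt_adj] at hm ⊢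
    rw [← hff]
    refine ⟨hm.1, hm.2.imp_right ?_⟩
    rintro ⟨u, v, huv, h1, h2, h3⟩
    have hu : u ∈ labelsOver A := by
      rcases (G.rule c.1).collapseAt_eq_some h2 with ⟨-, rfl⟩ | ⟨hu, -⟩
      exacts [hl, hc hu]
    exact ⟨u, v, ((hxy u hu).adj v).1 huv, h1, h2, h3⟩
  intro l hl
  refine ⟨?_, Set.ext fun m => ⟨hadj hxy hff l hl m,
    hadj (fun l hl => (hxy l hl).symm) hff.symm l hl m⟩, ?_⟩
  · change ((G.rule c.1).apply x.graph c.2).spin l = ((G.rule c.1).apply y.graph c.2).spin l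
    rw [Rule.apply_eq_applyAt, Rule.apply_eq_applyAt, hff]
    simp only [Rule.applyAt, (hxy l hl).1]
  · change l ∈ x.touched ∪ range c.2 ↔ l ∈ y.touched ∪ range c.2
    exact or_congr_left (hxy l hl).2.2

variable {B : ℕ → Finset ℕ} {ω : ClockSpace G.Move}

/-- On bounded time intervals the limit coincides at each fixed name with the evolution in B k for
large k, uniformly in time; one-sided limits are thus inherited. The jumps of all these evolutions
at time s have a common cause, the only clock that rings at s. -/
theorem isTrajectory_limitState (hn : G.Preserves n) (hα : α.DegreeLE n) (hreg : G.Regular h α ω)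
    (hω : G.Stable h α B ω) : G.IsTrajectory fun s => G.limitState h α B s ω := by
  constructor
  · intro s hs l
    obtain ⟨K, hK⟩ := hω.sameAt {l.1} (s + 1)
    obtain ⟨r, hr⟩ := hreg.run (B K) (s + 1) (by linarith)
    have hl : l ∈ labelsOver (({l.1} : Finset ℕ) : Set ℕ) := by simp [labelsOver]
    filter_upwards [JumpSystem.eventually_stateAt_right (J := G.canonical) (start α (B K)) r s,
      Ioo_mem_nhdsGT (show s < s + 1 by linarith)] with s' h1 h2
    have h3 := hK K le_rfl s' (hs.trans h2.1.le) h2.2.le l hl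
    rw [state_eq hreg.good hr (hs.trans h2.1.le) h2.2.le, h1,
      ← state_eq hreg.good hr hs (by linarith)] at h3
    exact h3.trans (hK K le_rfl s hs (by linarith) l hl).symm
  · intro s hs
    choose r hr using fun k => hreg.run (B k) s hs.le
    let y : ℕ → CState S := fun k => G.canonical.stateBefore (start α (B k)) (r k) s
    have hleft : ∀ k, ∀ᶠ s' in 𝓝[<] s, 0 ≤ s' ∧ s' ≤ s ∧ G.state h α (B k) ω s' = y k := fun k => by
      filter_upwards [JumpSystem.eventually_stateAt_left (J := G.canonical) (start α (B k)) (r k) s,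
        Ioo_mem_nhdsLT hs] with s' h1 h2
      exact ⟨h2.1.le, h2.2.le, by rw [state_eq hreg.good (hr k) h2.1.le h2.2.le, h1]⟩
    have hinv : ∀ k, Inv n (y k) := fun k => by
      obtain ⟨s', h1⟩ := (hleft k).exists
      rw [← h1.2.2]
      exact inv_state hn hα _ _ _
    have hyag : ∀ A : Finset ℕ, ∃ K, ∀ k ≥ K, ImgAgree A (y k) (y K) := fun A => by
      obtain ⟨K, hK⟩ := hω A s
      refine ⟨K, fun k hk => ?_⟩
      obtain ⟨s', h1, h2⟩ := ((hleft k).and (hleft K)).exists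
      have := hK k hk s' h1.1 h1.2.1
      rwa [h1.2.2, h2.2.2] at this
    set y' : Marked S := Marked.limit fun k => (y k).img with hy'
    have hylim : ∀ A : Finset ℕ, ∃ K, (∀ k ≥ K, ∀ u ∈ labelsOver (A : Set ℕ),
        (y k).lab u = (y K).lab u) ∧ ∀ k ≥ K, ∀ l ∈ labelsOver (A : Set ℕ),
        SameAt l y' (y k).img ∧ SameAt l (G.limitState h α B s ω) (G.state h α (B k) ω s).img := by
      intro A
      obtain ⟨K₁, hK₁⟩ := hyag A
      obtain ⟨K₂, hK₂⟩ := hω.sameAt A s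
      have hmax : ∀ k ≥ max K₁ K₂, ∀ l ∈ labelsOver (A : Set ℕ), SameAt l y' (y k).img := by
        intro k hk l hl
        refine (Marked.sameAt_limit (x := fun k => (y k).img) (fun m => ?_)
          fun k hk => (hK₁ k hk l hl).2).trans (hK₁ k ((le_max_left _ _).trans hk) l hl).2.symm
        obtain ⟨K', hK'⟩ := hyag {m.1}
        exact ⟨K', fun k hk => (hK' k hk m (by simp [labelsOver])).2⟩
      exact ⟨max K₁ K₂, fun k hk u hu => (hK₁ k ((le_max_left _ _).trans hk) u hu).1.trans
        (hK₁ _ (le_max_left _ _) u hu).1.symm, fun k hk l hl =>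
        ⟨hmax k hk l hl, hK₂ k ((le_max_right _ _).trans hk) s hs.le le_rfl l hl⟩⟩
    refine ⟨y', fun l => ?_, ?_⟩
    · obtain ⟨K₁, -, hK₁⟩ := hylim {l.1}
      obtain ⟨K₂, hK₂⟩ := hω.sameAt {l.1} s
      have hl : l ∈ labelsOver (({l.1} : Finset ℕ) : Set ℕ) := by simp [labelsOver]
      filter_upwards [hleft (max K₁ K₂)] with s' h1
      have h2 := hK₂ _ (le_max_right K₁ K₂) s' h1.1 h1.2.1 l hl
      rw [h1.2.2] at h2
      exact h2.trans (hK₁ _ (le_max_left _ _) l hl).1.symm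
    -- Either infinitely many finite evolutions stand still at time s, and then so does the limit,
    -- or all but finitely many of them jump.
    by_cases hfreq : ∃ᶠ k in atTop, G.state h α (B k) ω s = y k
    · refine Or.inl (eq_of_sameAt fun l => ?_)
      obtain ⟨K, -, hK⟩ := hylim {l.1}
      obtain ⟨k, hk, hkK⟩ := (hfreq.and_eventually (eventually_ge_atTop K)).exists
      obtain ⟨h1, h2⟩ := hK k hkK l (by simp [labelsOver])
      rw [hk] at h2
      exact h2.trans h1.symm
    right
    rw [not_frequently] at hfreq
    have hmove : ∀ᶠ k in atTop, ∃ c ∈ G.canonical.en (y k), s ∈ rings h ω c ∧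
        G.state h α (B k) ω s = (y k).step G c := by
      filter_upwards [hfreq] with k hk
      have hst := state_eq hreg.good (hr k) hs.le le_rfl
      rcases (hr k).stateAt_cases hs le_rfl with h1 | ⟨c, h1, h2, h3⟩
      · exact absurd (hst.trans h1.1) hk
      · exact ⟨c, h1, h2, hst.trans h3⟩
    obtain ⟨K₁, hK₁⟩ := eventually_atTop.1 hmove
    -- Since no two clocks ring at time s, the canonical move c is the same for all large k.
    obtain ⟨c, -, hcs, -⟩ := hK₁ K₁ le_rfl
    have hc : ∀ k ≥ K₁, CState.CanMove G c (y k) ∧ G.state h α (B k) ω s = (y k).step G c := by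
      intro k hk
      obtain ⟨c', h1, h2, h3⟩ := hK₁ k hk
      obtain rfl := hreg.good.1 c' c s h2 hcs
      exact ⟨canMove_of_mem_en h1, h3⟩
    let A : Finset ℕ := Finset.univ.image fun x => (c.2 x).1
    have hA : ∀ x, c.2 x ∈ labelsOver (A : Set ℕ) := fun x =>
      Finset.mem_coe.2 (Finset.mem_image_of_mem (fun x => (c.2 x).1) (Finset.mem_univ x))
    obtain ⟨K₂, hK₂, hK₂'⟩ := hylim A
    -- The move of the limit process with actual names; the actual names of its finitely many
    -- vertices are the same for all large k.
    let m : G.Move := ⟨c.1, (y K₂).lab ∘ c.2⟩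
    have hlab : ∀ k ≥ K₂, (y k).lab ∘ c.2 = (y K₂).lab ∘ c.2 := fun k hk =>
      funext fun x => hK₂ k hk _ (hA x)
    have hm : ∀ k ≥ K₁, k ≥ K₂ → G.CanMove m (y k).img ∧
        (G.state h α (B k) ω s).img = G.step m (y k).img := by
      intro k hk hk'
      have h1 := (hc k hk).1.img (hinv k).1
      have h2 := (hinv k).1.img_step (hc k hk).1
      rw [hlab k hk'] at h1 h2
      rw [(hc k hk).2]
      exact ⟨h1, h2⟩
    have hmA : ∀ x, m.2 x ∈ labelsOver (A : Set ℕ) := fun x => by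
      change ((y K₂).lab (c.2 x)).1 ∈ (A : Set ℕ)
      rw [(hinv K₂).1.root]
      exact hA x
    refine ⟨m, ?_, eq_of_sameAt fun l => ?_⟩
    · obtain ⟨h1, h2, h3⟩ := (hm (max K₁ K₂) (le_max_left _ _) (le_max_right _ _)).1
      have h4 := fun x => (hK₂' (max K₁ K₂) (le_max_right _ _) _ (hmA x)).1
      exact ⟨h1, fun x => (h4 x).1.trans (h2 x), fun x x' hxx => ((h4 x).adj _).2 (h3 x x' hxx)⟩
    · obtain ⟨K₃, -, hK₃⟩ := hylim (insert l.1 A)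
      let k := max (max K₁ K₂) K₃
      have hk1 : K₁ ≤ k := (le_max_left _ _).trans (le_max_left _ _)
      have hk2 : K₂ ≤ k := (le_max_right _ _).trans (le_max_left _ _)
      have hk3 : K₃ ≤ k := le_max_right _ _
      have hl : l ∈ labelsOver ((insert l.1 A : Finset ℕ) : Set ℕ) := by simp [labelsOver]
      have h1 := (hK₃ k hk3 l hl).2
      rw [(hm k hk1 hk2).2] at h1
      refine h1.trans (sameAt_step (fun l hl => (hK₃ k hk3 l hl).1.symm) ?_ l hl)
      rintro _ ⟨x, rfl⟩
      exact (Finset.coe_subset.2 (Finset.subset_insert l.1 A) :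
        (A : Set ℕ) ⊆ ((insert l.1 A : Finset ℕ) : Set ℕ)) (hmA x)

/-- A set of trajectories that depends only on the names in `W` and the times in `[0, t]`. -/
def Local (W : Set Label) (t : ℝ) (A : Set (ℝ → Marked S)) : Prop :=
  ∀ x y : ℝ → Marked S, (∀ s, 0 ≤ s → s ≤ t → ∀ l ∈ W, SameAt l (x s) (y s)) → (x ∈ A ↔ y ∈ A)

/-- The local sets form a σ-algebra that contains the generators. -/
theorem local_of_measurableSet {W : Set Label} {t : ℝ} {A : Set (ℝ → Marked S)}
    (hA : MeasurableSet[pathSigma W t] A) : Local W t A := by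
  let m : MeasurableSpace (ℝ → Marked S) :=
    { MeasurableSet' := Local W t
      measurableSet_empty := fun _ _ _ => Iff.rfl
      measurableSet_compl := fun A hA x y hxy => not_congr (hA x y hxy)
      measurableSet_iUnion := fun f hf x y hxy => by
        simp only [mem_iUnion]
        exact exists_congr fun i => hf i x y hxy }
  have hle : pathSigma W t ≤ m := by
    refine iSup₂_le fun s hs => ?_
    rw [MeasurableSpace.comap_generateFrom]
    refine MeasurableSpace.generateFrom_le ?_
    rintro _ ⟨E, hE, rfl⟩ x y hxy
    rcases hE with (⟨l, hl, a, rfl⟩ | ⟨l, hl, a, rfl⟩) | ⟨l, hl, rfl⟩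
    · have := (hxy s hs.1 hs.2 l hl).1
      simp only [mem_preimage, mem_ofPred_eq, this]
    · exact (hxy s hs.1 hs.2 l hl).adj a
    · exact (hxy s hs.1 hs.2 l hl).2.2
  exact hle A hA

theorem measurableSet_of_pathSigma {W : Set Label} {t : ℝ} {A : Set (ℝ → Marked S)}
    (hA : MeasurableSet[pathSigma W t] A) : MeasurableSet A := by
  refine (show pathSigma W t ≤ MeasurableSpace.pi from iSup₂_le fun s _ => ?_) A hA
  refine le_trans (MeasurableSpace.comap_mono (MeasurableSpace.generateFrom_mono ?_))
    (le_iSup (fun s => MeasurableSpace.comap (fun x : ℝ → Marked S => x s) (starSigma univ)) s)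
  rintro E ((⟨l, -, a, rfl⟩ | ⟨l, -, a, rfl⟩) | ⟨l, -, rfl⟩)
  · exact Or.inl (Or.inl ⟨l, mem_univ _, a, rfl⟩)
  · exact Or.inl (Or.inr ⟨l, mem_univ _, a, rfl⟩)
  · exact Or.inr ⟨l, mem_univ _, rfl⟩

/-- The event that a run exists, expressed through the states at all times. -/
theorem Regular.mem_runEvent_iff (hω : G.Regular h α ω) {C : Finset ℕ} {t : ℝ} (ht : 0 ≤ t)
    {A : Set (ℝ → Marked S)} (hA : Local univ t A) :
    ω ∈ G.canonical.runEvent img h (start α C) 0 t A ↔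
      (fun s => (G.state h α C ω s).img) ∈ A := by
  obtain ⟨l, hl⟩ := hω.run C t ht
  have hpath : G.canonical.path img (start α C) l ∈ A ↔
      (fun s => (G.state h α C ω s).img) ∈ A := by
    refine hA _ _ fun s hs0 hs m _ => ?_
    rw [state_eq hω.good hl hs0 hs]
    exact SameAt.refl _ _
  rw [← hpath]
  constructor
  · rintro ⟨l', hl', h'⟩
    rwa [hl'.unique hω.good.1 hl] at h'
  · exact fun h' => ⟨l, hl, h'⟩

theorem law_runEvent_eq_state (hG : G.Rates n h κ) (hrange : G.RangeLE R) (hα : α.DegreeLE n)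
    (C : Finset ℕ) {t : ℝ} (ht : 0 ≤ t) {A : Set (ℝ → Marked S)} (hA : Local univ t A) :
    law G.moveRate h (G.canonical.runEvent img h (start α C) 0 t A) =
      law G.moveRate h {ω | (fun s => (G.state h α C ω s).img) ∈ A} := by
  refine measure_congr (Filter.eventuallyEq_set.2 ?_)
  filter_upwards [ae_regular hG.preserves hG.isLocal hrange hα hG.pos] with ω hω
  exact hω.mem_runEvent_iff ht hA

theorem nullMeasurableSet_state (hG : G.Rates n h κ) (hrange : G.RangeLE R) (hα : α.DegreeLE n)
    (C : Finset ℕ) {s : ℝ} (hs : 0 ≤ s) {A : Set (Marked S)} (hA : MeasurableSet A) :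
    NullMeasurableSet {ω | (G.state h α C ω s).img ∈ A} (law G.moveRate h) := by
  obtain ⟨E, hE, hE'⟩ := G.canonical.exists_measurableSet_runEvent img hG.pos (start α C) hs
    (A := {p | p s ∈ A}) (measurable_pi_apply s hA)
  refine hE.nullMeasurableSet.congr (Filter.eventuallyEq_set.2 ?_)
  filter_upwards [ae_regular hG.preserves hG.isLocal hrange hα hG.pos] with ω hω
  rw [hE' ω hω.good]
  refine hω.mem_runEvent_iff hs fun x y hxy => ?_
  have : x s = y s := eq_of_sameAt fun l => hxy s hs le_rfl l (mem_univ _)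
  simp only [mem_ofPred_eq, this]

/-- The states of the finite evolutions are defined by a choice of the run and are measurable only
up to null sets; therefore the probability space is the completion. -/
theorem measurable_limitState (hG : G.Rates n h κ) (hrange : G.RangeLE R) (hα : α.DegreeLE n)
    (hst : ∀ᵐ ω ∂law G.moveRate h, G.Stable h α B ω) {s : ℝ} (hs : 0 ≤ s) :
    Measurable (fun ω : NullMeasurableSpace (ClockSpace G.Move) (law G.moveRate h) =>
      G.limitState h α B s ω) := by
  have key : ∀ (E : Set (Marked S)) (l : Label), MeasurableSet E →
      (∀ x y, SameAt l x y → (x ∈ E ↔ y ∈ E)) →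
      NullMeasurableSet {ω | G.limitState h α B s ω ∈ E} (law G.moveRate h) := by
    intro E l hE hinv
    -- By stabilization at the name l, the event for the limit is almost surely the event that it
    -- occurs in the evolutions in B k for all large k.
    have hnull : NullMeasurableSet (⋃ K : ℕ, ⋂ k ≥ K, {ω | (G.state h α (B k) ω s).img ∈ E})
        (law G.moveRate h) := NullMeasurableSet.iUnion fun K => NullMeasurableSet.biInter
          (to_countable _) fun k _ => nullMeasurableSet_state hG hrange hα (B k) hs hE
    refine hnull.congr (Filter.eventuallyEq_set.2 ?_)
    filter_upwards [hst] with ω hω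
    obtain ⟨K, hK⟩ := hω.sameAt {l.1} s
    have hK' : ∀ k ≥ K, (G.limitState h α B s ω ∈ E ↔ (G.state h α (B k) ω s).img ∈ E) :=
      fun k hk => hinv _ _ (hK k hk s hs le_rfl l (by simp [labelsOver]))
    simp only [mem_iUnion, mem_iInter]
    constructor
    · rintro ⟨K', h1⟩
      exact (hK' _ (le_max_left K K')).2 (h1 _ (le_max_right K K'))
    · exact fun h1 => ⟨K, fun k hk => (hK' k hk).1 h1⟩
  refine measurable_generateFrom fun E hE => ?_
  have hE' : MeasurableSet E := MeasurableSpace.measurableSet_generateFrom hE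
  rcases hE with (⟨l, -, a, rfl⟩ | ⟨l, -, a, rfl⟩) | ⟨l, -, rfl⟩
  · exact key _ l hE' fun x y hxy => by simp only [mem_ofPred_eq, hxy.1]
  · exact key _ l hE' fun x y hxy => hxy.adj a
  · exact key _ l hE' fun x y hxy => hxy.2.2

theorem isDynamics_limitState (hG : G.Rates n h κ) (hrange : G.RangeLE R) (hα : α.DegreeLE n)
    (hB : ∀ v, ∀ᶠ k in atTop, v ∈ B k) (hst : ∀ᵐ ω ∂law G.moveRate h, G.Stable h α B ω) :
    G.IsDynamics n α (law G.moveRate h).completion (G.limitState h α B) where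
  prob := ⟨measure_univ (μ := law G.moveRate h)⟩
  measurable s hs := measurable_limitState hG hrange hα hst hs
  start := by
    have hreg := ae_regular hG.preserves hG.isLocal hrange hα hG.pos
    change ∀ᵐ ω ∂law G.moveRate h, G.limitState h α B 0 ω = Marked.init α
    filter_upwards [hst, hreg] with ω hω hr
    refine eq_of_sameAt fun l => ?_
    obtain ⟨K, hK⟩ := hω.sameAt {l.1} 0
    have hfin : (α.hull {l.1} 1).Finite := hα.finite_hull (finite_singleton _) 1
    have hev : ∀ᶠ k in atTop, hfin.toFinset ⊆ B k :=
      (eventually_all_finset hfin.toFinset).2 fun v _ => hB v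
    obtain ⟨k, hk, hkK⟩ := (hev.and (eventually_ge_atTop K)).exists
    have hl : l ∈ labelsOver (({l.1} : Finset ℕ) : Set ℕ) := by simp [labelsOver]
    refine (hK k hkK 0 le_rfl le_rfl l hl).trans ?_
    obtain ⟨r, hr0⟩ := hr.run (B k) 0 le_rfl
    rw [state_eq hr.good hr0 le_rfl le_rfl, hr0.stateAt_start]
    change SameAt l (CState.init (α.restrict (B k : Set ℕ))).img (Marked.init α)
    rw [CState.img_init]
    have hsub : ∀ v ∈ α.hull {l.1} 1, v ∈ B k := fun v hv => hk (hfin.mem_toFinset.2 hv)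
    have hl0 : l ∈ labelsOver (B k : Set ℕ) := hsub _ (SpinGraph.subset_hull rfl)
    change (α.restrict (B k : Set ℕ)).embed.spin l = _ ∧ _ ∧ _
    simp only [Marked.init]
    rw [SpinGraph.embed_restrict]
    refine ⟨SpinGraph.restrict_spin hl0, Set.ext fun m => ⟨fun hm => hm.1, fun hm => ⟨hm, hl0, ?_⟩⟩,
      trivial⟩
    refine hsub _ (SpinGraph.hull_adj (j := 0) hm.2.2 ?_)
    rw [SpinGraph.hull_zero]
    rfl
  trajectory := by
    have hreg := ae_regular hG.preserves hG.isLocal hrange hα hG.pos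
    change ∀ᵐ ω ∂law G.moveRate h, G.IsTrajectory fun s => G.limitState h α B s ω
    filter_upwards [hst, hreg] with ω hω hr
    exact isTrajectory_limitState hG.preserves hα hr hω
  degree := by
    change ∀ᵐ ω ∂law G.moveRate h, ∀ s, 0 ≤ s → (G.limitState h α B s ω).graph.DegreeLE n
    filter_upwards [hst] with ω hω s hs l
    obtain ⟨K, hK⟩ := hω.sameAt {l.1} s
    rw [(hK K le_rfl s hs le_rfl l (by simp [labelsOver])).2.1]
    exact (inv_state hG.preserves hα (B K) ω s).1.degree l

end Grammar

/-! ### Geometry of clusters -/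

namespace SpinGraph

variable {S : Type} {α : SpinGraph S ℕ} {R n : ℕ} {E D D' : Set ℕ}

/-- A walk in D through touched vertices cannot leave D', because the boundary of D' is untouched.
-/
theorem IsCluster.subset (h : α.IsCluster R E D) (h' : α.IsCluster R E D') {u : ℕ} (hu : u ∈ D)
    (hu' : u ∈ D') : D ⊆ D' := by
  have key : ∀ {a b : D} (_ : ((α.rangeGraph R).induce D).Walk a b), (a : ℕ) ∈ D' → (b : ℕ) ∈ D' := by
    intro a b p
    induction p with
    | nil => exact id
    | @cons a c b hadj _ ih =>
      intro ha
      refine ih ?_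
      by_contra hc
      exact disjoint_left.1 h'.2.2 ⟨hc, a, ha, hadj.2⟩ (h.2.1 c.2)
  intro v hv
  obtain ⟨p⟩ := h.1.preconnected ⟨u, hu⟩ ⟨v, hv⟩
  exact key p hu'

/-- Distinct clusters of the same set are disjoint, and a vertex of D in the boundary of D' would be
both touched and untouched. This is the separation required by `Grammar.law_isolated`. -/
theorem IsCluster.disjoint_hull (h : α.IsCluster R E D) (h' : α.IsCluster R E D') (hne : D ≠ D') :
    Disjoint D (α.hull D' R) := by
  rw [hull_eq]
  refine disjoint_left.2 fun u hu hu' => ?_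
  rcases hu' with hu' | hu'
  · exact hne ((h.subset h' hu hu').antisymm (h'.subset h hu' hu))
  · exact disjoint_left.1 h'.2.2 hu' (h.2.1 hu)

theorem edist_le_of_walk {u v : ℕ} (p : (α.rangeGraph R).Walk u v) :
    α.graph.edist u v ≤ (R * p.length : ℕ) := by
  induction p with
  | nil => simp
  | @cons u w v hadj p ih =>
    refine (SimpleGraph.edist_triangle (v := w)).trans ((add_le_add hadj.2 ih).trans ?_)
    rw [SimpleGraph.Walk.length_cons]
    push_cast
    rw [mul_add, mul_one, add_comm]

theorem DegreeLE.encard_rangeGraph (hα : α.DegreeLE n) (v : ℕ) :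
    ((α.rangeGraph R).neighborSet v).encard ≤ ((n + 1) ^ R : ℕ) := by
  have hb := hα.ball R v
  refine (encard_le_encard (t := α.ball v R) fun w hw => hw.2).trans ?_
  rw [← hb.1.cast_ncard_eq]
  exact_mod_cast hb.2

/-- An infinite cluster contains long paths from each of its vertices. -/
theorem IsCluster.exists_path (h : α.IsCluster R E D) (hα : α.DegreeLE n) (hD : D.Infinite) {v : ℕ}
    (hv : v ∈ D) (k : ℕ) : ∃ (w : ℕ) (p : (α.rangeGraph R).Walk v w), p.IsPath ∧ k ≤ p.length ∧
      ∀ x ∈ p.support, x ∈ E := by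
  classical
  -- One step in `rangeGraph` covers a distance of at most R, so a walk to a vertex at distance
  -- larger than R k has more than k steps.
  obtain ⟨w, hw, hwk⟩ := hD.exists_notMem_finite (hα.ball (R * k) v).1
  obtain ⟨q⟩ := h.1.preconnected ⟨v, hv⟩ ⟨w, hw⟩
  let f := (SimpleGraph.Embedding.induce (G := α.rangeGraph R) D).toHom
  have hf : Function.Injective f := Subtype.val_injective
  let p : (α.rangeGraph R).Walk v w := q.bypass.map f
  refine ⟨w, p, q.bypass_isPath.map hf, ?_, fun x hx => ?_⟩
  · by_contra hlt
    refine hwk ((edist_le_of_walk p).trans ?_)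
    exact_mod_cast Nat.mul_le_mul_left R (by omega)
  · replace hx : x ∈ (q.bypass.map f).support := hx
    rw [SimpleGraph.Walk.support_map, List.mem_map] at hx
    obtain ⟨y, -, rfl⟩ := hx
    exact h.2.1 y.2

end SpinGraph

/-! ### Thermodynamic limit, cluster property and finiteness of clusters -/

namespace Grammar

open CState ClockSpace Marked

variable {S : Type} {G : Grammar S} {n R : ℕ} {α : SpinGraph S ℕ} {h κ t : ℝ}

theorem Local.mono {W W' : Set Label} {A : Set (ℝ → Marked S)} (hW : W ⊆ W') (hA : Local W t A) :
    Local W' t A := fun x y hxy => hA x y fun s h0 h1 l hl => hxy s h0 h1 l (hW hl)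

variable {B : ℕ → Finset ℕ}

/-- Probabilities of local events converge. -/
theorem tendsto_law_state (hG : G.Rates n h κ) (hrange : G.RangeLE R) (hα : α.DegreeLE n)
    (hB : ∀ v, ∀ᶠ k in atTop, v ∈ B k) (hst : ∀ᵐ ω ∂law G.moveRate h, G.Stable h α B ω)
    {C : ℕ → Finset ℕ} (hC : ∀ v, ∀ᶠ k in atTop, v ∈ C k) {A₀ : Finset ℕ}
    {A : Set (ℝ → Marked S)} (hA : Local (labelsOver (A₀ : Set ℕ)) t A) :
    Tendsto (fun k => law G.moveRate h {ω | (fun s => (G.state h α (C k) ω s).img) ∈ A}) atTop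
      (𝓝 (law G.moveRate h {ω | (fun s => G.limitState h α B s ω) ∈ A})) := by
  refine (ENNReal.tendsto_nhds (measure_ne_top _ _)).2 fun ε hε => ?_
  obtain ⟨A₁, hA₁⟩ := exists_limit_le hG hrange hα hB hst t A₀ hε.ne'
  filter_upwards [(eventually_all_finset A₁).2 fun v _ => hC v] with k hk
  have hle := hA₁ (C k) hk
  set N := {ω : ClockSpace G.Move | ∃ s, 0 ≤ s ∧ s ≤ t ∧ ∃ l ∈ labelsOver (A₀ : Set ℕ),
        ¬ Marked.SameAt l (G.limitState h α B s ω) (G.state h α (C k) ω s).img} with hN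
  have hiff : ∀ ω ∉ N, ((fun s => G.limitState h α B s ω) ∈ A ↔
      (fun s => (G.state h α (C k) ω s).img) ∈ A) := by
    intro ω hω
    refine hA _ _ fun s hs0 hs l hl => ?_
    by_contra hne
    exact hω ⟨s, hs0, hs, l, hl, hne⟩
  constructor
  · rw [tsub_le_iff_right]
    refine (measure_mono (t := {ω | (fun s => (G.state h α (C k) ω s).img) ∈ A} ∪ N)
      fun ω hω => ?_).trans ((measure_union_le _ _).trans (by gcongr))
    by_cases hn : ω ∈ N
    exacts [Or.inr hn, Or.inl ((hiff ω hn).1 hω)]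
  · refine (measure_mono (t := {ω | (fun s => G.limitState h α B s ω) ∈ A} ∪ N)
      fun ω hω => ?_).trans ((measure_union_le _ _).trans (by gcongr))
    by_cases hn : ω ∈ N
    exacts [Or.inr hn, Or.inl ((hiff ω hn).2 hω)]

/-- The chain on O_N(o) is the evolution in a finite set, and connectedness makes these sets exhaust
the vertices; the convergence of local probabilities applies. -/
theorem isThermodynamicLimit_limitState (hG : G.Rates n h κ) (hrange : G.RangeLE R)
    (hα : α.DegreeLE n) (hconn : α.IsConnected) (hB : ∀ v, ∀ᶠ k in atTop, v ∈ B k)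
    (hst : ∀ᵐ ω ∂law G.moveRate h, G.Stable h α B ω) {o : ℕ} (ho : o ∈ α.verts) :
    G.IsThermodynamicLimit α o (law G.moveRate h).completion (G.limitState h α B) := by
  classical
  intro t ht W A hA
  have hball := fun N => (hα.ball N o).1
  -- Numbers that are not vertices are added, without changing the induced subgraph, in order that
  -- the sets exhaust all of ℕ.
  let C : ℕ → Finset ℕ := fun N =>
    (hball N).toFinset ∪ (Finset.range N).filter fun v => v ∉ α.verts
  have hC : ∀ v, ∀ᶠ N in atTop, v ∈ C N := by
    intro v
    by_cases hv : v ∈ α.verts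
    · obtain ⟨p⟩ := hconn.2 o ho v hv
      filter_upwards [eventually_ge_atTop p.length] with N hN
      refine Finset.mem_union_left _ ((hball N).mem_toFinset.2 ?_)
      exact (SimpleGraph.edist_le p).trans (by exact_mod_cast hN)
    · filter_upwards [eventually_gt_atTop v] with N hN
      exact Finset.mem_union_right _ (Finset.mem_filter.2 ⟨Finset.mem_range.2 hN, hv⟩)
  have hmem : ∀ N, ∀ v ∈ α.verts, (v ∈ (C N : Set ℕ) ↔ v ∈ α.ball o N) := by
    intro N v hv
    simp only [C, Finset.mem_coe, Finset.mem_union, Finset.mem_filter, Finite.mem_toFinset, hv,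
      not_true, and_false, or_false]
  have hnbhd : ∀ N, α.nbhd o N = α.restrict (C N : Set ℕ) := by
    intro N
    refine SpinGraph.ext_of (fun v => ?_) fun u v => and_congr_right fun huv => ?_
    · by_cases hv : v ∈ α.verts
      · by_cases hvN : v ∈ α.ball o N
        · exact (if_pos hvN).trans (if_pos ((hmem N v hv).2 hvN)).symm
        · exact (if_neg hvN).trans (if_neg fun h => hvN ((hmem N v hv).1 h)).symm
      · have h0 : α.spin v = none := not_not.1 hv
        simp only [SpinGraph.nbhd, SpinGraph.restrict, h0, ite_self]
    · have huv' := SpinGraph.mem_verts_of_adj huv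
      exact and_congr (hmem N u huv'.1).symm (hmem N v huv'.2).symm
  have hloc : Local (labelsOver ((W.image Prod.fst : Finset ℕ) : Set ℕ)) t A :=
    (local_of_measurableSet hA).mono fun l hl =>
      Finset.mem_coe.2 (Finset.mem_image_of_mem Prod.fst (Finset.mem_coe.1 hl))
  have hlim := tendsto_law_state hG hrange hα hB hst hC hloc
  refine (tendsto_congr fun N => ?_).2 hlim
  rw [hnbhd, chainLaw_init hG.preserves (hα.restrict _)
    ((C N).finite_toSet.subset fun v hv => (SpinGraph.mem_verts_restrict.1 hv).2) hG.pos ht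
    (measurableSet_of_pathSigma hA)]
  exact law_runEvent_eq_state hG hrange hα (C N) ht (hloc.mono (subset_univ _))

theorem restrict_eq_of_sameAt {x y : Marked S} {A : Set ℕ}
    (h : ∀ l ∈ labelsOver A, SameAt l x y) : x.restrict A = y.restrict A := by
  refine Marked.ext (SpinGraph.ext_of (fun l => ?_) fun l m => and_congr_left fun hlm =>
    (h l hlm.1).adj m) (Set.ext fun l => and_congr_left fun hl => (h l hl).2.2)
  by_cases hl : l ∈ labelsOver A
  · exact (SpinGraph.restrict_spin hl).trans ((h l hl).1.trans (SpinGraph.restrict_spin hl).symm)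
  · exact (if_neg hl).trans (if_neg hl).symm

theorem local_isolated (ht : 0 ≤ t) (D : Set ℕ) {U : Set (ℝ → Marked S)} (hU : Local univ t U) :
    Local (labelsOver (α.hull D R)) t
      {p | Isolated α R t D p ∧ (fun s => (p s).restrict (α.hull D R)) ∈ U} := by
  intro x y hxy
  have htouch : ∀ v ∈ α.hull D R, (v ∈ (x t).touchedSet ↔ v ∈ (y t).touchedSet) := fun v hv =>
    (hxy t ht le_rfl (v, []) hv).2.2
  refine and_congr (and_congr (forall₂_congr fun v hv => htouch v (SpinGraph.subset_hull hv)) ?_) ?_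
  · rw [disjoint_left, disjoint_left]
    refine forall₂_congr fun v hv => not_congr (htouch v ?_)
    rw [SpinGraph.hull_eq]
    exact Or.inr hv
  · refine hU _ _ fun s hs0 hs l _ => ?_
    simp only [restrict_eq_of_sameAt (hxy s hs0 hs)]
    exact SameAt.refl _ _

theorem clusterLaw_le_one (D : Set ℕ) (U : Set (ℝ → Marked S)) : G.clusterLaw α R t D U ≤ 1 := by
  have hm : MeasurableSet {x : ℝ → Marked S | D ⊆ (x t).touchedSet ∧
      Disjoint (α.boundary R D) (x t).touchedSet} := measurableSet_isolated t D
  rw [clusterLaw, ProbabilityTheory.cond_apply hm]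
  exact (mul_le_mul_right (measure_mono inter_subset_left) _).trans (ENNReal.inv_mul_le_one _)

/-- For the evolutions in finite sets the factorization holds with the factor of the surroundings;
comparing it with the case in which every U i is everything eliminates this factor. Both sides are
probabilities of local events, so the identity passes to the limit. -/
theorem law_isolated_limit (hG : G.Rates n h κ) (hrange : G.RangeLE R) (hα : α.DegreeLE n)
    (hB : ∀ v, ∀ᶠ k in atTop, v ∈ B k) (hst : ∀ᵐ ω ∂law G.moveRate h, G.Stable h α B ω)
    (ht : 0 ≤ t) {k : ℕ} {D : Fin k → Set ℕ} (hfin : ∀ i, (D i).Finite)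
    (hD : ∀ i i', i ≠ i' → Disjoint (D i) (α.hull (D i') R)) {U : Fin k → Set (ℝ → Marked S)}
    (hU : ∀ i, MeasurableSet[pathSigma univ t] (U i)) :
    law G.moveRate h {ω | ∀ i, Isolated α R t (D i) (fun s => G.limitState h α B s ω) ∧
      (fun s => (G.limitState h α B s ω).restrict (α.hull (D i) R)) ∈ U i} =
    law G.moveRate h {ω | ∀ i, Isolated α R t (D i) (fun s => G.limitState h α B s ω)} *
      ∏ i, G.clusterLaw α R t (D i) (U i) := by
  have hA : (⋃ i, α.hull (D i) R).Finite := finite_iUnion fun i => hα.finite_hull (hfin i) R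
  set A₀ := hA.toFinset with hA₀
  have hsub : ∀ i, α.hull (D i) R ⊆ (A₀ : Set ℕ) := fun i v hv =>
    Finset.mem_coe.2 (hA.mem_toFinset.2 (mem_iUnion.2 ⟨i, hv⟩))
  have hloc : ∀ U : Fin k → Set (ℝ → Marked S), (∀ i, MeasurableSet[pathSigma univ t] (U i)) →
      Local (labelsOver (A₀ : Set ℕ)) t {p | ∀ i, Isolated α R t (D i) p ∧
        (fun s => (p s).restrict (α.hull (D i) R)) ∈ U i} := fun U hU x y hxy =>
    forall_congr' fun i => local_isolated ht (D i) (local_of_measurableSet (hU i)) x y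
      fun s h0 h1 l hl => hxy s h0 h1 l (hsub i hl)
  have hlim := fun U hU => tendsto_law_state hG hrange hα hB hst hB (hloc U hU)
  have hev : ∀ᶠ j in atTop, A₀ ⊆ B j := (eventually_all_finset A₀).2 fun v _ => hB v
  have hval : ∀ U : Fin k → Set (ℝ → Marked S), (∀ i, MeasurableSet[pathSigma univ t] (U i)) →
      ∀ᶠ j in atTop, law G.moveRate h {ω | (fun s => (G.state h α (B j) ω s).img) ∈
        {p | ∀ i, Isolated α R t (D i) p ∧ (fun s => (p s).restrict (α.hull (D i) R)) ∈ U i}} =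
      law G.moveRate h (G.restEvent α R h t D (B j)) *
        ∏ i, law G.moveRate h (G.clusterEvent α R h t (D i) (U i)) := by
    intro U hU
    filter_upwards [hev] with j hj
    refine (law_runEvent_eq_state hG hrange hα (B j) ht
      ((hloc U hU).mono (subset_univ _))).symm.trans ?_
    exact law_isolated hG.preserves hG.isLocal hrange hα hG.pos ht hD (B j).finite_toSet
      (fun i v hv => hj (hsub i hv)) fun i => measurableSet_of_pathSigma (hU i)
  have h1 := hlim U hU
  have h2 := hlim (fun _ => univ) fun _ => MeasurableSet.univ
  have hne : ∏ i, G.clusterLaw α R t (D i) (U i) ≠ ⊤ :=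
    ENNReal.prod_ne_top fun i _ => ne_top_of_le_ne_top ENNReal.one_ne_top (clusterLaw_le_one _ _)
  have h3 := ENNReal.Tendsto.mul_const h2 (Or.inr hne)
  have h4 := tendsto_nhds_unique (h1.congr' ?_) h3
  · simp only [mem_ofPred_eq, mem_univ, and_true] at h4
    exact h4
  · filter_upwards [hval U hU, hval (fun _ => univ) fun _ => MeasurableSet.univ] with j hj hj'
    refine hj.trans (Eq.trans ?_ (congrArg (· * _) hj').symm)
    rw [mul_assoc, ← Finset.prod_mul_distrib]
    congr 1
    exact Finset.prod_congr rfl fun i _ => law_clusterEvent hG.preserves hG.isLocal hrange hα hG.pos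
      ht (hfin i) (measurableSet_of_pathSigma (hU i))

theorem law_touched_limit_le (hG : G.Rates n h κ) (hrange : G.RangeLE R) (hα : α.DegreeLE n)
    (hB : ∀ v, ∀ᶠ k in atTop, v ∈ B k) (hst : ∀ᵐ ω ∂law G.moveRate h, G.Stable h α B ω)
    (ht : 0 ≤ t) (hth : t ≤ h) (F : Finset ℕ) :
    law G.moveRate h {ω | ∀ v ∈ F, v ∈ (G.limitState h α B t ω).touchedSet} ≤
      ENNReal.ofReal (κ ^ F.card) := by
  classical
  have hloc : Local (labelsOver (F : Set ℕ)) t {p : ℝ → Marked S | ∀ v ∈ F, v ∈ (p t).touchedSet} :=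
    fun x y hxy => forall₂_congr fun v hv => (hxy t ht le_rfl (v, []) hv).2.2
  refine le_of_tendsto' (tendsto_law_state hG hrange hα hB hst hB hloc) fun k => ?_
  let F' : Finset Label := F.image fun v => (v, [])
  have hF' : F'.card = F.card :=
    Finset.card_image_of_injective _ fun v w hvw => (Prod.mk.inj hvw).1
  rw [← hF']
  refine le_trans (measure_mono_ae ?_)
    (hG.touch (start α (B k)) (inv_start hα (B k)) 0 t le_rfl ht (by linarith) F')
  filter_upwards [ae_regular hG.preserves hG.isLocal hrange hα hG.pos] with ω hω hmem
  obtain ⟨l, hl⟩ := hω.run (B k) t ht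
  refine ⟨l, hl, fun u hu => ?_⟩
  obtain ⟨v, hv, rfl⟩ := Finset.mem_image.1 hu
  have h1 := (mem_touchedSet_img (inv_state hG.preserves hα (B k) ω t).1).1 (hmem v hv)
  rw [state_eq hω.good hl ht le_rfl, hl.stateAt_end, touched_final] at h1
  exact h1.resolve_left (notMem_empty _)

/-- Peierls argument: at most ((n + 1) ^ R) ^ k sets of k + 1 vertices cover all paths of length at
least k from v, and each is entirely touched with probability at most κ ^ (k + 1). An infinite
cluster would contain such a path for every k. -/
theorem ae_finite_clusters (hG : G.Rates n h κ) (hrange : G.RangeLE R) (hα : α.DegreeLE n)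
    (hB : ∀ v, ∀ᶠ k in atTop, v ∈ B k) (hst : ∀ᵐ ω ∂law G.moveRate h, G.Stable h α B ω)
    (hκR : (n + 1) ^ R * κ ≤ 1 / 2) (ht : 0 ≤ t) (hth : t ≤ h) :
    ∀ᵐ ω ∂law G.moveRate h, ∀ D, α.IsCluster R (G.limitState h α B t ω).touchedSet D → D.Finite := by
  choose Φ hΦ1 hΦ2 hΦ3 using fun k v => SimpleGraph.exists_path_family
    (hα.encard_rangeGraph (R := R)) k v
  have hκ := hG.pos'
  have hnull : ∀ v, ∀ᵐ ω ∂law G.moveRate h, ¬ ∀ k, ∃ F ∈ Φ k v, ∀ w ∈ F,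
      w ∈ (G.limitState h α B t ω).touchedSet := by
    intro v
    have hk : ∀ k, law G.moveRate h {ω | ¬ ¬ ∀ k, ∃ F ∈ Φ k v, ∀ w ∈ F,
        w ∈ (G.limitState h α B t ω).touchedSet} ≤ ENNReal.ofReal ((1 / 2) ^ k) := by
      intro k
      refine (measure_mono (t := ⋃ F ∈ Φ k v, {ω | ∀ w ∈ F,
        w ∈ (G.limitState h α B t ω).touchedSet}) fun ω hω => ?_).trans
        ((measure_biUnion_finset_le _ _).trans ((Finset.sum_le_sum fun F hF =>
        law_touched_limit_le hG hrange hα hB hst ht hth F).trans ?_))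
      · obtain ⟨F, hF, hFw⟩ := not_not.1 hω k
        exact mem_biUnion hF hFw
      · rw [Finset.sum_congr rfl fun F hF => by rw [hΦ2 k v F hF], Finset.sum_const, nsmul_eq_mul,
          ← ENNReal.ofReal_natCast, ← ENNReal.ofReal_mul (by positivity)]
        refine ENNReal.ofReal_le_ofReal ?_
        have h1 : ((Φ k v).card : ℝ) ≤ ((n + 1) ^ R) ^ k := by exact_mod_cast hΦ1 k v
        calc ((Φ k v).card : ℝ) * κ ^ (k + 1) ≤ ((n + 1) ^ R) ^ k * κ ^ k := by
              refine mul_le_mul h1 ?_ (by positivity) (by positivity)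
              exact pow_le_pow_of_le_one hκ.le hG.le_one (Nat.le_succ k)
          _ = ((n + 1) ^ R * κ) ^ k := (mul_pow _ _ _).symm
          _ ≤ (1 / 2) ^ k := by gcongr
    have h0 : Tendsto (fun k : ℕ => ENNReal.ofReal ((1 / 2 : ℝ) ^ k)) atTop (𝓝 0) := by
      have := ENNReal.tendsto_ofReal
        (tendsto_pow_atTop_nhds_zero_of_lt_one (r := (1 / 2 : ℝ)) (by norm_num) (by norm_num))
      rwa [ENNReal.ofReal_zero] at this
    exact le_antisymm (ge_of_tendsto' h0 hk) zero_le
  filter_upwards [ae_all_iff.2 hnull] with ω hω D hD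
  by_contra hinf
  obtain ⟨v, hv⟩ := (Set.not_finite.1 hinf).nonempty
  refine hω v fun k => ?_
  obtain ⟨w, p, hp, hlen, hsupp⟩ := hD.exists_path hα hinf hv k
  obtain ⟨F, hF, hFp⟩ := hΦ3 k v w p hp hlen
  exact ⟨F, hF, fun x hx => hsupp x (hFp x hx)⟩

theorem clusterProperty_limitState (hG : G.Rates n h κ) (hrange : G.RangeLE R) (hα : α.DegreeLE n)
    (hB : ∀ v, ∀ᶠ k in atTop, v ∈ B k) (hst : ∀ᵐ ω ∂law G.moveRate h, G.Stable h α B ω)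
    (hκR : (n + 1) ^ R * κ ≤ 1 / 2) (ht : 0 ≤ t) (hth : t ≤ h) :
    G.ClusterProperty α R t (law G.moveRate h).completion (G.limitState h α B) := by
  refine ⟨ae_finite_clusters hG hrange hα hB hst hκR ht hth, fun k D hDinj U hU => ?_⟩
  change law G.moveRate h _ = law G.moveRate h _ * _
  -- If the sets can be clusters simultaneously, they are connected and separated, and being a
  -- cluster just means being isolated. Otherwise both events are empty; this also covers
  -- overlapping or adjacent sets, for which the factorization is not available.
  by_cases hex : ∃ E, ∀ i, α.IsCluster R E (D i)
  · obtain ⟨E, hE⟩ := hex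
    have hiff : ∀ (i) (p : ℝ → Marked S), α.IsCluster R (p t).touchedSet (D i) ↔
        Isolated α R t (D i) p := fun i p => and_iff_right (hE i).1
    have := law_isolated_limit hG hrange hα hB hst ht (D := fun i => (D i : Set ℕ))
      (fun i => (D i).finite_toSet) (fun i i' hne => (hE i).disjoint_hull (hE i') fun heq =>
        hne (hDinj (Finset.coe_injective heq))) hU
    simp only [SpinGraph.hull_eq] at this
    refine Eq.trans ?_ (this.trans ?_)
    · congr 1
      ext ω
      exact forall_congr' fun i => and_congr_left fun _ => hiff i fun s => G.limitState h α B s ω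
    · congr 2
      ext ω
      exact forall_congr' fun i => (hiff i fun s => G.limitState h α B s ω).symm
  · have h1 : {ω : ClockSpace G.Move | ∀ i, α.IsCluster R (G.limitState h α B t ω).touchedSet (D i)} = ∅ :=
      eq_empty_of_forall_notMem fun ω hω => hex ⟨_, hω⟩
    have h2 : {ω : ClockSpace G.Move | ∀ i, α.IsCluster R (G.limitState h α B t ω).touchedSet (D i) ∧
        (fun s => (G.limitState h α B s ω).restrict ((D i : Set ℕ) ∪ α.boundary R (D i))) ∈ U i} = ∅ :=
      eq_empty_of_forall_notMem fun ω hω => hex ⟨_, fun i => (hω i).1⟩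
    refine (congrArg (law G.moveRate h) h2).trans
      (Eq.trans ?_ (congrArg (fun s => law G.moveRate h s * _) h1).symm)
    simp only [measure_empty, zero_mul]

end Grammar

/-! ### Choice of the constants -/

theorem mainTheorem2 {S : Type} [Countable S] (G : Grammar S) (R : ℕ) (hR : 1 ≤ R)
    (hlocal : G.IsLocal) (hrange : G.RangeLE R) (hbounded : G.LocallyBounded) :
    ∃ n₀ : ℕ, ∀ n, n₀ ≤ n → ∃ t₀ : ℝ, 0 < t₀ ∧
      ∀ α : SpinGraph S ℕ, α.IsConnected → α.DegreeLE n →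
        ∃ (Ω : Type) (_ : MeasurableSpace Ω) (P : Measure Ω) (X : ℝ → Ω → Marked S),
          G.IsDynamics n α P X ∧
          (∀ o ∈ α.verts, G.IsThermodynamicLimit α o P X) ∧
          ∀ t, 0 ≤ t → t < t₀ → G.ClusterProperty α R t P X := by
  obtain ⟨n₀, hn₀⟩ := hbounded
  refine ⟨n₀, fun n hn => ?_⟩
  have hpres : G.Preserves n := hn₀ n hn
  have hM : (1 : ℝ) ≤ n + 1 := by
    have : (0 : ℝ) ≤ n := Nat.cast_nonneg n
    linarith
  have hM2 : (1 : ℝ) ≤ (n + 1) ^ 2 := one_le_pow₀ hM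
  have hMR : (1 : ℝ) ≤ (n + 1) ^ R := one_le_pow₀ hM
  -- Small enough both for the escape estimate, where 4 (n + 1) ^ 2 κ < 1 is needed, and for the
  -- finiteness of the clusters, where (n + 1) ^ R κ ≤ 1 / 2 is needed.
  set κ : ℝ := (8 * (n + 1) ^ 2 * (n + 1) ^ R)⁻¹ with hκ
  have hden : (8 : ℝ) ≤ 8 * (n + 1) ^ 2 * (n + 1) ^ R := by nlinarith
  have hκ0 : 0 < κ := inv_pos.2 (by linarith)
  obtain ⟨h, hh, htouch⟩ := Grammar.exists_law_touch_le hpres hlocal hrange hκ0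
  have hG : G.Rates n h κ :=
    { preserves := hpres
      isLocal := hlocal
      pos := hh
      pos' := hκ0
      le_one := inv_le_one_of_one_le₀ (by linarith)
      small := by
        rw [hκ, ← div_eq_mul_inv, div_lt_one (by linarith)]
        nlinarith
      touch := fun z hz a b ha hab hba F => htouch h hh z hz a b ha hab hba F }
  have hκR : (n + 1) ^ R * κ ≤ 1 / 2 := by
    rw [hκ, ← div_eq_mul_inv, div_le_div_iff₀ (by linarith) (by norm_num)]
    nlinarith
  -- The length of a time slab serves as t₀. The construction itself reaches all times by iterating
  -- over the slabs, whereas the finiteness of clusters uses the touch estimate on a single slab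
  -- only.
  refine ⟨h, hh, fun α hconn hα => ?_⟩
  obtain ⟨B, hB, hst⟩ := Grammar.exists_stable hG hrange hα
  exact ⟨NullMeasurableSpace (ClockSpace G.Move) (ClockSpace.law G.moveRate h), inferInstance,
    (ClockSpace.law G.moveRate h).completion, G.limitState h α B,
    Grammar.isDynamics_limitState hG hrange hα hB hst,
    fun o ho => Grammar.isThermodynamicLimit_limitState hG hrange hα hconn hB hst ho,
    fun t ht hth => Grammar.clusterProperty_limitState hG hrange hα hB hst hκR ht hth.le⟩
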